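/- An instance of metric hard uniform capacitated $k$-median consists of finite sets $F$ of facilities and $C$ of clients, integers $k,U\ge 0$, and costs $c\ge 0$ forming a pseudometric on $F\sqcup C$. A solution is a set $S\subseteq F$ with an assignment $\varphi:C\to S$ that sends at most $U$ clients to each facility; its cost is $\sum_{j\in C}c(\varphi(j),j)$. The cost of a set $S$ is the cost of a cheapest such assignment, and $\mathrm{OPT}$ is the smallest cost of a solution with $|S|\le k$. For $p,q\in\mathbb N$, the $(p,q)$-local search starts from an arbitrary set of $\min(\lfloor 8k/3\rfloor,|F|)$ facilities with an optimal assignment. As long as possible it replaces the current set $S$ by some $(S\setminus B)\cup A$, where $B\subseteq S$, $A\subseteq F\setminus S$ and $|A|=|B|\le p$, with an optimal assignment, provided that this strictly decreases the cost, and by at least a $1/q$ fraction of the current cost. Where no such step exists, the search stops and $S$ is called $(p,q)$-locally optimal. **Theorem.** There are an absolute constant $d$ and a polynomial $Q$ in two variables with coefficients in $\mathbb N$ such that for every real $\varepsilon>0$ there is an integer $p$ with $2<p\le d\lceil 1/\varepsilon\rceil$ for which the following holds, with $q=Q(|F|+|C|,\lceil 1/\varepsilon\rceil)$. 1. For every instance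 with real costs, every $(p,q)$-locally optimal set of exactly $\min(\lfloor 8k/3\rfloor,|F|)$ facilities, with an optimal assignment, has cost at most $(3+\varepsilon)$ times the cost of every solution that opens at most $k$ facilities. 2. There is a random access machine program (unit-cost addition, truncated subtraction, tests for zero, indirect addressing) which, on every instance with costs in $\mathbb N$ that has a solution opening at most $k$ facilities, halts and outputs a result of the $(p,q)$-local search: a set of at most $\frac83 k$ facilities with a feasible assignment of cost at most $(3+\varepsilon)\,\mathrm{OPT}$. Its running time is at most $a_\varepsilon N^{d\lceil 1/\varepsilon\rceil}$, where $a_\varepsilon$ depends only on $\varepsilon$ and $N$ is $|F|+|C|$ plus the binary length of the input. In particular, for each fixed $\varepsilon$ this is a polynomial-time local search heuristic that approximates hard uniform capacitated $k$-median within a factor $3+\varepsilon$, violating the cardinality bound by a factor of at most $8/3$. -/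

import Mathlib

namespace CapMedian

/-! ### Instances, solutions and cost -/

/-- An instance of metric hard uniform capacitated `k`-median with costs in `R`: facilities
`Fin F`, clients `Fin C`, cardinality bound `k`, common capacity `U`, and a (pseudo)metric `c` on
the disjoint union of facilities and clients. -/
structure Instance (R : Type) [CommSemiring R] [LinearOrder R] where
  F : ℕ
  C : ℕ
  k : ℕ
  U : ℕ
  c : Fin F ⊕ Fin C → Fin F ⊕ Fin C → R
  c_nonneg : ∀ x y, 0 ≤ c x y
  c_self : ∀ x, c x x = 0
  c_symm : ∀ x y, c x y = c y x
  c_triangle : ∀ x y z, c x z ≤ c x y + c y z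

variable {R : Type} [CommSemiring R] [LinearOrder R]

/-- `φ` assigns every client to a facility of `S`, respecting the capacities
(every facility is available at most once). -/
def Instance.IsAssignment (I : Instance R) (S : Finset (Fin I.F)) (φ : Fin I.C → Fin I.F) : Prop :=
  (∀ j, φ j ∈ S) ∧ ∀ i, (Finset.univ.filter (fun j => φ j = i)).card ≤ I.U

/-- Total service cost of an assignment. -/
def Instance.cost (I : Instance R) (φ : Fin I.C → Fin I.F) : R :=
  ∑ j, I.c (Sum.inl (φ j)) (Sum.inr j)

/-- `φ` is a cheapest assignment of the clients to the open facilities `S`, so that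
`I.cost φ` is the cost of `S`. -/
def Instance.IsOptAssignment (I : Instance R) (S : Finset (Fin I.F)) (φ : Fin I.C → Fin I.F) :
    Prop :=
  I.IsAssignment S φ ∧ ∀ ψ, I.IsAssignment S ψ → I.cost φ ≤ I.cost ψ

/-- Some set of at most `k` facilities can serve all clients. -/
def Instance.Feasible (I : Instance R) : Prop :=
  ∃ O ψ, O.card ≤ I.k ∧ I.IsAssignment O ψ

/-- The assignment `φ` costs at most `ρ` times any solution that opens at most `k` facilities. -/
def Instance.WithinFactor (I : Instance R) (toReal : R → ℝ) (ρ : ℝ) (φ : Fin I.C → Fin I.F) :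
    Prop :=
  ∀ O ψ, O.card ≤ I.k → I.IsAssignment O ψ → toReal (I.cost φ) ≤ ρ * toReal (I.cost ψ)

/-! ### Local search with multi-swaps -/

/-- `T` arises from `S` by closing a set `B` of open facilities and opening a set `A` of closed
ones, where `A` and `B` have the same size, at most `p`. -/
def MultiSwap {n : ℕ} (p : ℕ) (S T : Finset (Fin n)) : Prop :=
  ∃ A B : Finset (Fin n), B ⊆ S ∧ Disjoint A S ∧ A.card = B.card ∧ B.card ≤ p ∧ T = (S \ B) ∪ A

/-- A state of the local search: open facilities and an assignment. -/
abbrev Instance.State (I : Instance R) : Type := Finset (Fin I.F) × (Fin I.C → Fin I.F)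

/-- A starting state: an arbitrary set of `⌊8k/3⌋` facilities (all facilities if there are fewer),
with an optimal assignment. -/
def Instance.IsStart (I : Instance R) (s : I.State) : Prop :=
  s.1.card = min (8 * I.k / 3) I.F ∧ I.IsOptAssignment s.1 s.2

/-- A local search step: a multi-swap of size at most `p`, followed by an optimal reassignment,
that strictly decreases the cost, by at least a fraction `1 / q` of the current cost. -/
def Instance.Step (I : Instance R) (p q : ℕ) (s t : I.State) : Prop :=
  MultiSwap p s.1 t.1 ∧ I.IsOptAssignment t.1 t.2 ∧ I.cost t.2 < I.cost s.2 ∧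
    (q : R) * I.cost t.2 + I.cost s.2 ≤ (q : R) * I.cost s.2

/-- The search stops at `s`. -/
def Instance.IsLocalOpt (I : Instance R) (p q : ℕ) (s : I.State) : Prop :=
  I.IsOptAssignment s.1 s.2 ∧ ∀ t, ¬ I.Step p q s t

/-- `s` is a possible result of the local search. -/
def Instance.IsSearchResult (I : Instance R) (p q : ℕ) (s : I.State) : Prop :=
  ∃ s₀, I.IsStart s₀ ∧ Relation.ReflTransGen (I.Step p q) s₀ s ∧ I.IsLocalOpt p q s

/-! ### Random access machine -/

/-- Programs of a random access machine with registers `0, 1, 2, …` (addressed directly) and a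
memory (addressed through registers), all cells holding natural numbers. The only arithmetic is
addition and truncated subtraction, so that in one step numbers grow by at most one bit. Hence
polynomial time with unit costs is the usual polynomial time. -/
inductive Prog : Type
  | const (x n : ℕ)
  | add (x y z : ℕ)
  | sub (x y z : ℕ)
  | load (x y : ℕ)
  | store (x y : ℕ)
  | seq (P Q : Prog)
  | ite (x : ℕ) (P Q : Prog)
  | while (x : ℕ) (P : Prog)

/-- Configurations: contents of the registers and of the memory. -/
structure Config where
  reg : ℕ → ℕ
  mem : ℕ → ℕ

/-- Write `v` to register `x`. -/
def Config.setReg (σ : Config) (x v : ℕ) : Config := ⟨Function.update σ.reg x v, σ.mem⟩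

/-- Write `v` to memory cell `a`. -/
def Config.setMem (σ : Config) (a v : ℕ) : Config := ⟨σ.reg, Function.update σ.mem a v⟩

/-- `Exec P σ t τ`: started in `σ`, the program `P` halts in `τ` after exactly `t` steps
(every instruction and every test of a register is one step). -/
inductive Exec : Prog → Config → ℕ → Config → Prop
  | const (x n : ℕ) (σ : Config) : Exec (.const x n) σ 1 (σ.setReg x n)
  | add (x y z : ℕ) (σ : Config) : Exec (.add x y z) σ 1 (σ.setReg x (σ.reg y + σ.reg z))
  | sub (x y z : ℕ) (σ : Config) : Exec (.sub x y z) σ 1 (σ.setReg x (σ.reg y - σ.reg z))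
  | load (x y : ℕ) (σ : Config) : Exec (.load x y) σ 1 (σ.setReg x (σ.mem (σ.reg y)))
  | store (x y : ℕ) (σ : Config) : Exec (.store x y) σ 1 (σ.setMem (σ.reg x) (σ.reg y))
  | seq {P Q : Prog} {σ τ υ : Config} {t u : ℕ} :
      Exec P σ t τ → Exec Q τ u υ → Exec (.seq P Q) σ (t + u) υ
  | ite_true {x : ℕ} {P Q : Prog} {σ τ : Config} {t : ℕ} :
      σ.reg x ≠ 0 → Exec P σ t τ → Exec (.ite x P Q) σ (t + 1) τ
  | ite_false {x : ℕ} {P Q : Prog} {σ τ : Config} {t : ℕ} :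
      σ.reg x = 0 → Exec Q σ t τ → Exec (.ite x P Q) σ (t + 1) τ
  | while_true {x : ℕ} {P : Prog} {σ τ υ : Config} {t u : ℕ} :
      σ.reg x ≠ 0 → Exec P σ t τ → Exec (.while x P) τ u υ →
      Exec (.while x P) σ (t + u + 1) υ
  | while_false {x : ℕ} {P : Prog} {σ : Config} :
      σ.reg x = 0 → Exec (.while x P) σ 1 σ

/-! ### Input and output -/

/-- The input words: the numbers of facilities and clients, `k`, `U`, and the matrix of connection
costs, row by row. -/
def Instance.input (I : Instance ℕ) : List ℕ :=
  [I.F, I.C, I.k, I.U] ++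
    (List.finRange I.F).flatMap fun i => (List.finRange I.C).map fun j => I.c (.inl i) (.inr j)

/-- Size of the input: number of facilities and clients (which are given as explicit sets),
plus the lengths of all input words in binary. -/
def Instance.size (I : Instance ℕ) : ℕ :=
  I.F + I.C + (I.input.map fun w => w.size + 1).sum

/-- The initial configuration: the input is in memory, every other cell is `0`. -/
def Instance.initial (I : Instance ℕ) : Config := ⟨fun _ => 0, fun a => I.input.getD a 0⟩

/-- The final configuration `τ` holds the assignment of the clients in memory cells
`0, …, C - 1` and the characteristic vector of the open facilities in the next `F` cells. -/
def Instance.Outputs (I : Instance ℕ) (τ : Config) (s : I.State) : Prop :=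
  (∀ j : Fin I.C, τ.mem j = (s.2 j : ℕ)) ∧
    ∀ i : Fin I.F, τ.mem (I.C + i) = if i ∈ s.1 then 1 else 0

end CapMedian

set_option linter.unusedSectionVars false
set_option linter.constructorNameAsVariable false

/-! ### Fractional transport that avoids the diagonal. -/

namespace CapMedian

/-! Approximation. Let `S` with assignment `φ` be locally optimal and let `O` with `ψ` be a solution
with at most `k` facilities. If `O \ S` has at most `p` elements, one multi-swap produces a superset
of `O`, and the stopping rule compares the two costs directly. Otherwise only single swaps are used:
they are averaged with weights `ω s o` for closing `s ∈ S \ O` and opening `o ∈ O \ S`, such that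
every `o` is opened with total weight 1.

Measure loads in units of the capacity. A facility with load `n` is closed with total weight at most
about `w(n) = max(0, 1 - 5n/3)`. Write `w(n) = 1 - loadShare(n) · n`: every facility has a unit
budget, and its load is charged at a rate of at most `5/3`. Since `|S|` is at least `8k/3 - 2/3`,
these weights sum to at least `|O \ S| - 2/3` plus the sum of the surpluses `5/3 - ∑ loadShare · x`
of the facilities of `O \ S`, where `x` tells how much of the demand of `o` each facility of `S \ O`
serves (`Bundling.card_add_surplus_le`). This count is where the factor `8/3` enters.

Clients are first merged into alternating paths (`Bundling`) from a facility of `φ` to one of `ψ`.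
When no two can be merged, a facility at which a nontrivial path arrives is not left by any path, so
a path ending in `S` can simply be completed. When `s` is closed for `o`, the paths ending at `o` go
to `o`, those from `s` that end in `S` are completed, and those from `s` that end at another `o'`
outside `S` are spread over the other facilities by a plan `π` chosen separately for each `o'`
(`IsLocalPlan`). The plan respects capacities once all `o'` are taken together, and in the weighted
average it sends at most `x s'` to each `s'`. The fractional result is rounded by Birkhoff's
theorem.

Such plans exist except that for each `o'` there may be conflicts: one facility, or two of medium
load, that cannot be closed by the plan (`exists_localPlan`). A facility in conflict with exactly
one `o` is used only in swaps that open this `o`; one in conflict with several is not used. The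
surplus of `o` pays for the weight that is lost in this way (`exists_swap_weights`).

Optimality of `φ` makes each term of rerouting costs nonnegative, and an averaging argument bounds
the weighted rerouting cost for `o'` by twice what its paths pay in `ψ`
(`IsLocalPlan.sum_change_le`). Opening contributes one more copy of the optimal cost, so the local
cost is about three times the optimal one. The rounding loss `2/3` in the count and the slack `1/q`
of the stopping rule are absorbed by `ε`, since `|O \ S|` is large compared with `1/ε`.

Algorithm. A small language in which every loop runs exactly `|F| + |C| + 1` times is compiled to
the machine, so that the running time of a command is polynomial with its nesting depth as exponent.
Cheapest assignments come from a primal-dual method that inserts the clients one by one and keeps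
prices as a certificate of optimality. Multi-swaps are enumerated by `2p` nested loops, each of
which toggles one facility. An unbounded loop repeats the improvement step. Each step lowers the
cost by the factor `1 - 1/q`, so the logarithm of the cost, which is at most the input size, bounds
the number of steps. -/

open Finset in
/-- Transport between labelled sources and targets that avoids equal labels: tight case. -/
theorem exists_offdiag_transport_of_tight {ι : Type*} [Fintype ι] [DecidableEq ι] (a τ : ι → ℝ)
    (ha : ∀ i, 0 ≤ a i) (hτ : ∀ i, 0 ≤ τ i) (hs : ∑ i, a i = ∑ i, τ i) (k : ι)
    (hk : a k + τ k = ∑ i, τ i) :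
    ∃ z : ι → ι → ℝ, (∀ i j, 0 ≤ z i j) ∧ (∀ i, z i i = 0) ∧ (∀ i, ∑ j, z i j = a i) ∧
      ∀ j, ∑ i, z i j = τ j := by
  have h1 : ∑ i ∈ univ.erase k, τ i = a k := by
    have := Finset.add_sum_erase univ τ (mem_univ k); linarith
  have h2 : ∑ i ∈ univ.erase k, a i = τ k := by
    have := Finset.add_sum_erase univ a (mem_univ k); linarith
  -- Label `k` supplies all the other targets and all the other sources ship to `k`. Tightness at
  -- `k` says precisely that both totals fit.
  refine ⟨fun i j => if i = k then (if j = k then 0 else τ j) else if j = k then a i else 0,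
    ?_, ?_, ?_, ?_⟩
  · intro i j; dsimp only; split_ifs <;> simp [ha, hτ]
  · intro i; dsimp only; split_ifs <;> simp_all
  · intro i
    by_cases hi : i = k
    · subst hi
      simp only [if_true]
      rw [← h1, ← Finset.add_sum_erase univ _ (mem_univ i)]
      simp only [if_true, zero_add]
      exact sum_congr rfl fun j hj => by simp [(mem_erase.1 hj).1]
    · simp [hi]
  · intro j
    by_cases hj : j = k
    · subst hj
      simp only [if_true]
      rw [← h2, ← Finset.add_sum_erase univ _ (mem_univ j)]
      simp only [if_true, zero_add]
      exact sum_congr rfl fun i hi => by simp [(mem_erase.1 hi).1]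
    · simp [hj]

open Finset in
-- The condition `a i + τ i ≤ ∑ τ` is necessary, since the supply of `i` must fit into the other
-- targets. For sufficiency, ship greedily from a source `i` to a target `k ≠ i`. Either a third
-- label becomes tight, and the tight case finishes, or a source or a target is exhausted and the
-- supports shrink. Labels `i` and `k` keep their condition because the total drops by the shipped
-- amount as well.
theorem exists_offdiag_transport_of_eq {ι : Type*} [Fintype ι] [DecidableEq ι] (N : ℕ) :
    ∀ (a τ : ι → ℝ), (∀ i, 0 ≤ a i) → (∀ i, 0 ≤ τ i) → ∑ i, a i = ∑ i, τ i →
    (∀ i, a i + τ i ≤ ∑ j, τ j) →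
    #{i | a i ≠ 0} + #{i | τ i ≠ 0} ≤ N →
    ∃ z : ι → ι → ℝ, (∀ i j, 0 ≤ z i j) ∧ (∀ i, z i i = 0) ∧ (∀ i, ∑ j, z i j = a i) ∧
      ∀ j, ∑ i, z i j = τ j := by
  induction N with
  | zero =>
    intro a τ ha hτ hs hd hN
    have h1 : ∀ i, a i = 0 := by
      intro i; by_contra h
      have : 0 < #{i | a i ≠ 0} := card_pos.2 ⟨i, by simp [h]⟩
      omega
    have h2 : ∀ i, τ i = 0 := by
      intro i; by_contra h
      have : 0 < #{i | τ i ≠ 0} := card_pos.2 ⟨i, by simp [h]⟩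
      omega
    exact ⟨fun _ _ => 0, by simp, by simp, by simp [h1], by simp [h2]⟩
  | succ N ih =>
    intro a τ ha hτ hs hd hN
    by_cases htight : ∃ k, a k + τ k = ∑ i, τ i
    · obtain ⟨k, hk⟩ := htight
      exact exists_offdiag_transport_of_tight a τ ha hτ hs k hk
    push Not at htight
    have hlt : ∀ i, a i + τ i < ∑ j, τ j := fun i => lt_of_le_of_ne (hd i) (htight i)
    by_cases hz : ∀ i, a i = 0
    · have : ∀ i, τ i = 0 := by
        have h0 : ∑ i, τ i = 0 := by rw [← hs]; simp [hz]
        intro i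
        exact (sum_eq_zero_iff_of_nonneg (fun i _ => hτ i)).1 h0 i (mem_univ i)
      exact ⟨fun _ _ => 0, by simp, by simp, by simp [hz], by simp [this]⟩
    push Not at hz
    obtain ⟨i, hi⟩ := hz
    have hai : 0 < a i := lt_of_le_of_ne (ha i) (Ne.symm hi)
    obtain ⟨k, hki, hk⟩ : ∃ k, k ≠ i ∧ 0 < τ k := by
      by_contra hcon
      push Not at hcon
      have : ∑ j, τ j = τ i := by
        refine sum_eq_single i (fun j _ hj => le_antisymm (hcon j hj) (hτ j)) (by simp)
      have := hlt i
      linarith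
    -- the amount that can be shipped
    obtain ⟨m, hm1, hm2⟩ : ∃ m : ι, True ∧ ∀ l, l ≠ i → l ≠ k → m ≠ i ∧ m ≠ k ∧ a m + τ m ≥ a l + τ l := by
      by_cases hne : ((univ.erase i).erase k).Nonempty
      · obtain ⟨m, hm, hmax⟩ := exists_max_image _ (fun l => a l + τ l) hne
        refine ⟨m, trivial, fun l h1 h2 => ⟨?_, ?_, hmax l (by simp [h1, h2])⟩⟩
        · simp at hm; exact hm.2
        · simp at hm; exact hm.1
      · refine ⟨i, trivial, fun l h1 h2 => (hne ⟨l, by simp [h1, h2]⟩).elim⟩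
    have hstep : ∀ e : ℝ, 0 < e → e ≤ a i → e ≤ τ k →
        (∀ l, l ≠ i → l ≠ k → a l + τ l + e ≤ ∑ j, τ j) →
        (∃ z : ι → ι → ℝ, (∀ i j, 0 ≤ z i j) ∧ (∀ i, z i i = 0) ∧
          (∀ j, ∑ l, z j l = Function.update a i (a i - e) j) ∧
          ∀ j, ∑ l, z l j = Function.update τ k (τ k - e) j) →
        ∃ z : ι → ι → ℝ, (∀ i j, 0 ≤ z i j) ∧ (∀ i, z i i = 0) ∧ (∀ i, ∑ j, z i j = a i) ∧
          ∀ j, ∑ i, z i j = τ j := by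
      rintro e he - - - ⟨z, h0, h1, h2, h3⟩
      refine ⟨fun x y => z x y + if x = i ∧ y = k then e else 0, ?_, ?_, ?_, ?_⟩
      · intro x y; have := h0 x y; dsimp only; split_ifs <;> linarith
      · intro x; simp only [h1, zero_add]; rw [if_neg]; rintro ⟨rfl, h⟩; exact hki h.symm
      · intro x
        rw [sum_add_distrib, h2]
        by_cases hx : x = i
        · subst hx; simp
        · simp [hx]
      · intro x
        rw [sum_add_distrib, h3]
        by_cases hx : x = k
        · subst hx; simp
        · simp [hx]
    have hsuma : ∀ e : ℝ, ∑ j, Function.update a i (a i - e) j = ∑ j, a j - e := by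
      intro e
      have := Finset.add_sum_erase univ a (mem_univ i)
      rw [sum_update_of_mem (mem_univ i), ← this, sdiff_singleton_eq_erase]; ring
    have hsumt : ∀ e : ℝ, ∑ j, Function.update τ k (τ k - e) j = ∑ j, τ j - e := by
      intro e
      have := Finset.add_sum_erase univ τ (mem_univ k)
      rw [sum_update_of_mem (mem_univ k), ← this, sdiff_singleton_eq_erase]; ring
    have hnna : ∀ e : ℝ, e ≤ a i → ∀ j, 0 ≤ Function.update a i (a i - e) j := by
      intro e he j; by_cases hj : j = i
      · subst hj; simp; linarith
      · simp [hj, ha]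
    have hnnt : ∀ e : ℝ, e ≤ τ k → ∀ j, 0 ≤ Function.update τ k (τ k - e) j := by
      intro e he j; by_cases hj : j = k
      · subst hj; simp; linarith
      · simp [hj, hτ]
    have hdiag : ∀ e : ℝ, 0 ≤ e → (∀ l, l ≠ i → l ≠ k → a l + τ l + e ≤ ∑ j, τ j) → ∀ l,
        Function.update a i (a i - e) l + Function.update τ k (τ k - e) l ≤ ∑ j, τ j - e := by
      intro e he h l
      by_cases h1 : l = i
      · subst h1
        have h2 : l ≠ k := hki.symm
        simp [h2]; linarith [hd l]
      · by_cases h2 : l = k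
        · subst h2; simp [h1]; linarith [hd l]
        · simp [h1, h2]; linarith [h l h1 h2]
    by_cases hmik : ∃ l, l ≠ i ∧ l ≠ k ∧ ∑ j, τ j - (a l + τ l) ≤ min (a i) (τ k)
    · -- shipping makes a third label tight
      obtain ⟨l, hl1, hl2, hl3⟩ := hmik
      obtain ⟨hmi, hmk, -⟩ := hm2 l hl1 hl2
      set e := ∑ j, τ j - (a m + τ m) with he
      have hepos : 0 < e := by have := hlt m; linarith
      have hle : e ≤ min (a i) (τ k) := by
        have := (hm2 l hl1 hl2).2.2
        linarith
      have h1 : e ≤ a i := hle.trans (min_le_left _ _)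
      have h2 : e ≤ τ k := hle.trans (min_le_right _ _)
      have h3 : ∀ l, l ≠ i → l ≠ k → a l + τ l + e ≤ ∑ j, τ j := by
        intro l ha hb; have := (hm2 l ha hb).2.2; linarith
      refine hstep e hepos h1 h2 h3 ?_
      refine exists_offdiag_transport_of_tight _ _ (hnna e h1) (hnnt e h2)
        (by rw [hsuma, hsumt, hs]) m ?_
      rw [hsumt]; simp [hmi, hmk]; linarith
    · push Not at hmik
      set e := min (a i) (τ k) with he
      have hepos : 0 < e := lt_min hai hk
      have h1 : e ≤ a i := min_le_left _ _
      have h2 : e ≤ τ k := min_le_right _ _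
      have h3 : ∀ l, l ≠ i → l ≠ k → a l + τ l + e ≤ ∑ j, τ j := by
        intro l ha hb; have := hmik l ha hb; linarith
      refine hstep e hepos h1 h2 h3 ?_
      refine ih _ _ (hnna e h1) (hnnt e h2) (by rw [hsuma, hsumt, hs])
        (by rw [hsumt]; exact hdiag e hepos.le h3) ?_
      have ca : ({j | Function.update a i (a i - e) j ≠ 0} : Finset ι) ⊆ ({j | a j ≠ 0} : Finset ι) := by
        intro j; simp only [mem_filter_univ]
        by_cases hj : j = i
        · subst hj; simp [hi]
        · simp [hj]
      have ct : ({j | Function.update τ k (τ k - e) j ≠ 0} : Finset ι) ⊆ ({j | τ j ≠ 0} : Finset ι) := by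
        intro j; simp only [mem_filter_univ]
        by_cases hj : j = k
        · subst hj; simp [hk.ne']
        · simp [hj]
      rcases min_choice (a i) (τ k) with hc | hc
      · have : #{j | Function.update a i (a i - e) j ≠ 0} < #{j | a j ≠ 0} := by
          refine card_lt_card ⟨ca, fun h => ?_⟩
          have := h (show i ∈ ({j | a j ≠ 0} : Finset ι) by simp [hi])
          simp [he, hc] at this
        have := card_le_card ct
        omega
      · have : #{j | Function.update τ k (τ k - e) j ≠ 0} < #{j | τ j ≠ 0} := by
          refine card_lt_card ⟨ct, fun h => ?_⟩
          have := h (show k ∈ ({j | τ j ≠ 0} : Finset ι) by simp [hk.ne'])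
          simp [he, hc] at this
        have := card_le_card ca
        omega

/-- Fractional transport between labelled sources `a` and targets `τ` that never ships between
equal labels. -/
theorem exists_offdiag_transport {ι : Type*} [Fintype ι] [DecidableEq ι] (a τ : ι → ℝ)
    (ha : ∀ i, 0 ≤ a i) (hτ : ∀ i, 0 ≤ τ i) (hs : ∑ i, a i ≤ ∑ i, τ i)
    (hd : ∀ i, a i + τ i ≤ ∑ j, τ j) :
    ∃ z : ι → ι → ℝ, (∀ i j, 0 ≤ z i j) ∧ (∀ i, z i i = 0) ∧ (∀ i, ∑ j, z i j = a i) ∧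
      ∀ j, ∑ i, z i j ≤ τ j := by
  classical
  -- The extra source `none` uses up the spare target capacity. Its own target is 0, so nothing is
  -- shipped to it.
  obtain ⟨z, h0, h1, h2, h3⟩ := exists_offdiag_transport_of_eq (ι := Option ι) _
    (fun o => o.elim (∑ i, τ i - ∑ i, a i) a) (fun o => o.elim 0 τ)
    (by rintro (_ | i) <;> simp [ha, hs]) (by rintro (_ | i) <;> simp [hτ])
    (by simp [Fintype.sum_option])
    (by
      rintro (_ | i)
      · simp only [Fintype.sum_option, Option.elim_none, Option.elim_some]
        linarith [Finset.sum_nonneg fun i (_ : i ∈ Finset.univ) => ha i]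
      · simpa [Fintype.sum_option] using hd i)
    le_rfl
  have hn : ∀ i, z i none = 0 := by
    have := h3 none
    simp only [Option.elim_none] at this
    intro i
    exact (Finset.sum_eq_zero_iff_of_nonneg (fun i _ => h0 i none)).1 this i (Finset.mem_univ i)
  refine ⟨fun i j => z (some i) (some j), fun i j => h0 _ _, fun i => h1 _, fun i => ?_, fun j => ?_⟩
  · have := h2 (some i)
    rw [Fintype.sum_option, hn, zero_add] at this
    exact this
  · have := h3 (some j)
    rw [Fintype.sum_option] at this
    simp only [Option.elim_some] at this
    linarith [h0 none (some j)]

end CapMedian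

namespace CapMedian

/-! ### Closing weights and the plan for the clients of one optimal facility -/

/-- How much of the unit capacity budget one unit of load of a facility with load `n` uses up. -/
noncomputable def loadShare (n : ℝ) : ℝ := if 5 * n ≤ 3 then 5 / 3 else n⁻¹

/-- The total weight with which a facility with load `n` gets closed. -/
noncomputable def closeWeight (n : ℝ) : ℝ := max 0 (1 - 5 / 3 * n)

/-- The fraction of its load that a facility with load `n` can receive in addition. -/
noncomputable def recvRatio (n : ℝ) : ℝ := if 2 * n ≤ 1 then 1 else (1 - n) / n

theorem closeWeight_nonneg (n : ℝ) : 0 ≤ closeWeight n := le_max_left _ _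

theorem closeWeight_le_one {n : ℝ} (hn : 0 ≤ n) : closeWeight n ≤ 1 := by
  unfold closeWeight; rw [max_le_iff]; constructor <;> linarith

/-- The rate `5/3` would overdraw the unit budget for loads above `3/5`. There the rate drops to
`1/n`, which uses the budget exactly. -/
theorem closeWeight_eq (n : ℝ) : closeWeight n = 1 - loadShare n * n := by
  unfold closeWeight loadShare
  split_ifs with h
  · rw [max_eq_right]; linarith
  · push Not at h
    rw [inv_mul_cancel₀ (by linarith), max_eq_left] <;> linarith

theorem closeWeight_pos_iff (n : ℝ) : 0 < closeWeight n ↔ n < 3 / 5 := by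
  unfold closeWeight
  rw [lt_max_iff]; constructor
  · rintro (h | h) <;> linarith
  · intro h; right; linarith

theorem closeWeight_eq_of_lt {n : ℝ} (h : n < 3 / 5) : closeWeight n = 1 - 5 / 3 * n := by
  unfold closeWeight; rw [max_eq_right]; linarith

theorem loadShare_le (n : ℝ) : loadShare n ≤ 5 / 3 := by
  unfold loadShare; split_ifs with h
  · rfl
  · push Not at h
    rw [inv_le_comm₀ (by linarith) (by norm_num)]; linarith

theorem recvRatio_nonneg {n : ℝ} (h1 : n ≤ 1) : 0 ≤ recvRatio n := by
  unfold recvRatio; split_ifs with h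
  · norm_num
  · exact div_nonneg (by linarith) (by linarith)

theorem recvRatio_le_one (n : ℝ) : recvRatio n ≤ 1 := by
  unfold recvRatio; split_ifs with h
  · rfl
  · rw [div_le_one (by linarith)]; linarith

theorem recvRatio_mul_le (n : ℝ) : recvRatio n * n ≤ 1 - n := by
  unfold recvRatio; split_ifs with h
  · linarith
  · rw [div_mul_cancel₀]; linarith

theorem le_recvRatio {n : ℝ} (h : n < 3 / 5) : 2 / 3 ≤ recvRatio n := by
  unfold recvRatio; split_ifs with h
  · norm_num
  · rw [le_div_iff₀ (by linarith)]; linarith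

theorem recvRatio_eq_one {n : ℝ} (h : n ≤ 2 / 5) : recvRatio n = 1 := by
  unfold recvRatio; rw [if_pos]; linarith

/-- For heavy facilities the charge in excess of 1 is exactly what they can receive, as `1/n = 1 +
(1 - n)/n`. This is why a large heavy part, which lowers the surplus, also makes closing easier. -/
theorem loadShare_eq {n : ℝ} (h : 3 / 5 ≤ n) : loadShare n = 1 + recvRatio n := by
  unfold loadShare recvRatio
  rw [if_neg (by linarith : ¬ 2 * n ≤ 1)]
  have : n ≠ 0 := by linarith
  split_ifs with h'
  · have : n = 3 / 5 := by linarith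
    subst this; norm_num
  · field_simp; ring

/-- This leaves a third of the room at the receivers free when the clients of all medium facilities
are spread in proportion to what the others can receive. -/
theorem closeWeight_mul_le {n : ℝ} (h : 2 / 5 < n) (h' : n < 3 / 5) :
    closeWeight n * (1 + recvRatio n) ≤ 2 / 3 * recvRatio n := by
  rw [closeWeight_eq_of_lt h']
  unfold recvRatio
  split_ifs with h2
  · linarith
  · have h0 : 0 < n := by linarith
    rw [← sub_nonneg]
    have : 2 / 3 * ((1 - n) / n) - (1 - 5 / 3 * n) * (1 + (1 - n) / n) = (3 * n - 1) / (3 * n) := by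
      field_simp; ring
    rw [this]
    exact div_nonneg (by linarith) (by linarith)

/-- A rule for reassigning the clients of one optimal facility, where facility `s` has load `n s`
and serves the amount `x s` of these clients: facilities outside `Cap` can be closed,
and `π s` tells where their clients go. -/
structure IsLocalPlan {ι : Type*} [Fintype ι] [DecidableEq ι] (n x : ι → ℝ) (Cap : Finset ι)
    (π : ι → ι → ℝ) : Prop where
  nonneg : ∀ s s', 0 ≤ π s s'
  diag : ∀ s, π s s = 0
  row : ∀ s, s ∉ Cap → 0 < closeWeight (n s) → ∑ s', π s s' = x s
  le : ∀ s s', π s s' ≤ x s'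
  -- If `s` and `s'` together do not exceed one capacity, all clients of `s` fit. Otherwise the
  -- inequalities are summed over the optimal facilities: as the `x s'` add up to at most `n s'`,
  -- the total received is at most the free capacity `1 - n s'`.
  room : ∀ s s', 1 < n s + n s' → π s s' * n s' ≤ (1 - n s') * x s'
  col : ∀ s', ∑ s, (if s ∈ Cap then 0 else closeWeight (n s)) * π s s' ≤ x s'
  -- The right-hand side is the surplus of the optimal facility in the count of closing weights. It
  -- has to compensate for the restricted use of `s`.
  cap : ∀ s ∈ Cap, 0 < closeWeight (n s) ∧
    2 / 3 - 5 / 3 * x s ≤ 5 / 3 - ∑ s', loadShare (n s') * x s'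
  card : Cap.card ≤ 1 ∨ Cap.card = 2 ∧ ∀ s ∈ Cap, 2 / 5 < n s

section LocalPlan

variable {ι : Type*} [Fintype ι] [DecidableEq ι] (n x : ι → ℝ)

/-- Amount served by facilities with small load. -/
noncomputable def tinyPart (s : ι) : ℝ := if n s ≤ 2 / 5 then x s else 0
/-- Amount served by facilities with medium load. -/
noncomputable def midPart (s : ι) : ℝ := if 2 / 5 < n s ∧ n s < 3 / 5 then x s else 0
/-- Amount that can be received by facilities with large load. -/
noncomputable def heavyRecv (s : ι) : ℝ := if 3 / 5 ≤ n s then recvRatio (n s) * x s else 0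

variable {n x}

theorem tinyPart_nonneg (hx : ∀ s, 0 ≤ x s) (s : ι) : 0 ≤ tinyPart n x s := by
  unfold tinyPart; split_ifs <;> simp [hx]

theorem midPart_nonneg (hx : ∀ s, 0 ≤ x s) (s : ι) : 0 ≤ midPart n x s := by
  unfold midPart; split_ifs <;> simp [hx]

theorem heavyRecv_nonneg (hx : ∀ s, 0 ≤ x s) (hn : ∀ s, n s ≤ 1) (s : ι) :
    0 ≤ heavyRecv n x s := by
  unfold heavyRecv; split_ifs
  · exact mul_nonneg (recvRatio_nonneg (hn s)) (hx s)
  · rfl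

/-- Each unit is charged 1, for a total of at most 1, plus an extra: at most `2/3` on small and
medium facilities, and what can be received on heavy ones. -/
theorem surplus_lower_bound (hx : ∀ s, 0 ≤ x s) (hsum : ∑ s, x s ≤ 1) :
    2 / 3 - 2 / 3 * (∑ s, tinyPart n x s + ∑ s, midPart n x s) - ∑ s, heavyRecv n x s ≤
      5 / 3 - ∑ s, loadShare (n s) * x s := by
  have : ∑ s, loadShare (n s) * x s ≤
      ∑ s, (x s + (2 / 3 * tinyPart n x s + 2 / 3 * midPart n x s + heavyRecv n x s)) := by
    refine Finset.sum_le_sum fun s _ => ?_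
    unfold tinyPart midPart heavyRecv
    rcases le_or_gt (n s) (2 / 5) with h | h
    · have h1 : ¬ 2 / 5 < n s := not_lt.2 h
      have h2 : ¬ 3 / 5 ≤ n s := by linarith
      simp only [h, h1, h2, if_true, false_and, if_false]
      nlinarith [loadShare_le (n s), hx s]
    · have h1 : ¬ n s ≤ 2 / 5 := not_le.2 h
      rcases lt_or_ge (n s) (3 / 5) with h3 | h3
      · simp only [h1, h, h3, not_le.2 h3, if_true, and_self, if_false]
        nlinarith [loadShare_le (n s), hx s]
      · simp only [h1, h, not_lt.2 h3, h3, if_true, and_false, if_false]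
        rw [loadShare_eq h3]; linarith
  simp only [Finset.sum_add_distrib, ← Finset.mul_sum] at this
  linarith

theorem parts_le_recv (hx : ∀ s, 0 ≤ x s) (s : ι) :
    tinyPart n x s + 2 / 3 * midPart n x s + heavyRecv n x s ≤ recvRatio (n s) * x s := by
  unfold tinyPart midPart heavyRecv
  rcases le_or_gt (n s) (2 / 5) with h | h
  · have h1 : ¬ 2 / 5 < n s := not_lt.2 h
    have h2 : ¬ 3 / 5 ≤ n s := by linarith
    simp [h, h1, h2, recvRatio_eq_one h]
  · have h1 : ¬ n s ≤ 2 / 5 := not_le.2 h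
    rcases lt_or_ge (n s) (3 / 5) with h3 | h3
    · simp only [h1, h, h3, not_le.2 h3, if_true, and_self, if_false]
      nlinarith [le_recvRatio h3, hx s]
    · simp [h1, h, not_lt.2 h3, h3]

open Finset in
/-- At most two elements of a set can each carry more than two fifths of the total. -/
theorem card_le_two_of_two_fifths {y : ι → ℝ} {C : Finset ι} (hy : ∀ s, 0 ≤ y s)
    (h : ∀ s ∈ C, 2 / 5 * ∑ s, y s < y s) : #C ≤ 2 := by
  by_contra hc
  push Not at hc
  have h1 : (#C : ℝ) * (2 / 5 * ∑ s, y s) ≤ ∑ s ∈ C, y s := by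
    rw [← nsmul_eq_mul]
    exact card_nsmul_le_sum _ _ _ fun s hs => (h s hs).le
  have h2 : ∑ s ∈ C, y s ≤ ∑ s, y s := sum_le_univ_sum_of_nonneg hy
  have h3 : (3 : ℝ) ≤ #C := by exact_mod_cast hc
  have h0 : 0 ≤ ∑ s, y s := sum_nonneg fun s _ => hy s
  obtain ⟨s, hs⟩ : C.Nonempty := card_pos.1 (by omega)
  have h4 := h s hs
  have h5 : y s ≤ ∑ s, y s := single_le_sum (fun s _ => hy s) (mem_univ s)
  nlinarith

end LocalPlan
end CapMedian

namespace CapMedian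
section LocalPlan
variable {ι : Type*} [Fintype ι] [DecidableEq ι] {n x : ι → ℝ}

theorem tinyPart_le (hx : ∀ s, 0 ≤ x s) (s : ι) : tinyPart n x s ≤ x s := by
  unfold tinyPart; split_ifs <;> simp [hx]

theorem midPart_le (hx : ∀ s, 0 ≤ x s) (s : ι) : midPart n x s ≤ x s := by
  unfold midPart; split_ifs <;> simp [hx]

theorem midPart_eq {s : ι} (h1 : 2 / 5 < n s) (h2 : n s < 3 / 5) : midPart n x s = x s := by
  unfold midPart; rw [if_pos ⟨h1, h2⟩]

theorem tinyPart_eq {s : ι} (h1 : n s ≤ 2 / 5) : tinyPart n x s = x s := by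
  unfold tinyPart; rw [if_pos h1]

theorem tinyPart_eq_zero {s : ι} (h1 : 2 / 5 < n s) : tinyPart n x s = 0 := by
  unfold tinyPart; rw [if_neg (not_le.2 h1)]

theorem midPart_eq_zero {s : ι} (h1 : n s ≤ 2 / 5) : midPart n x s = 0 := by
  unfold midPart; rw [if_neg]; intro h; linarith [h.1]

/-- Everything that the other facilities can receive, from below. -/
theorem parts_sub_le_recv_sub (hx : ∀ s, 0 ≤ x s) (s : ι) :
    ∑ i, tinyPart n x i + 2 / 3 * ∑ i, midPart n x i + ∑ i, heavyRecv n x i -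
      (tinyPart n x s + 2 / 3 * midPart n x s + heavyRecv n x s) ≤
      ∑ i, recvRatio (n i) * x i - recvRatio (n s) * x s := by
  have h := Finset.single_le_sum
    (f := fun i => recvRatio (n i) * x i - (tinyPart n x i + 2 / 3 * midPart n x i + heavyRecv n x i))
    (fun i _ => sub_nonneg.2 (parts_le_recv hx i)) (Finset.mem_univ s)
  simp only [Finset.sum_sub_distrib, Finset.sum_add_distrib, ← Finset.mul_sum] at h
  linarith

open Finset in
-- The medium part dominates. Small facilities send their clients to the medium ones in proportion
-- to `x`; a small and a medium load fit into one capacity. Medium facilities send theirs to all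
-- others in proportion to what these can receive. A medium facility conflicts if the others cannot
-- receive its share, and then it holds more than two fifths of the medium part.
theorem exists_localPlan_of_tiny_le_mid (hx : ∀ s, 0 ≤ x s) (hxn : ∀ s, x s ≤ n s)
    (hn : ∀ s, n s ≤ 1) (hsum : ∑ s, x s ≤ 1)
    (hcase : 2 * ∑ s, tinyPart n x s ≤ ∑ s, midPart n x s) :
    ∃ Cap π, IsLocalPlan n x Cap π := by
  classical
  set t := ∑ s, tinyPart n x s with ht
  set g := ∑ s, midPart n x s with hg
  set RH := ∑ s, heavyRecv n x s with hRH
  set r : ι → ℝ := fun s => recvRatio (n s) * x s with hr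
  set R := ∑ s, r s with hR
  have hr0 : ∀ s, 0 ≤ r s := fun s => mul_nonneg (recvRatio_nonneg (hn s)) (hx s)
  have hrx : ∀ s, r s ≤ x s := fun s => mul_le_of_le_one_left (hx s) (recvRatio_le_one _)
  have ht0 : 0 ≤ t := sum_nonneg fun s _ => tinyPart_nonneg hx s
  have hg0 : 0 ≤ g := sum_nonneg fun s _ => midPart_nonneg hx s
  have hRH0 : 0 ≤ RH := sum_nonneg fun s _ => heavyRecv_nonneg hx hn s
  have hxt : ∀ s, tinyPart n x s ≤ t := fun s =>
    single_le_sum (f := tinyPart n x) (fun s _ => tinyPart_nonneg hx s) (mem_univ s)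
  have hrR : ∀ s, r s ≤ R := fun s => single_le_sum (fun s _ => hr0 s) (mem_univ s)
  set Cap : Finset ι := {s | (2 / 5 < n s ∧ n s < 3 / 5) ∧ R - r s < x s} with hCap
  have hcapbd : ∀ s ∈ Cap, t + 2 / 3 * (g - x s) + RH < x s := by
    intro s hs
    obtain ⟨⟨h1, h2⟩, h3⟩ := (mem_filter.1 hs).2
    have := parts_sub_le_recv_sub (n := n) hx s
    rw [midPart_eq h1 h2, tinyPart_eq_zero h1] at this
    have h4 : heavyRecv n x s = 0 := by unfold heavyRecv; rw [if_neg (not_le.2 h2)]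
    rw [h4] at this
    simp only [hr, hR] at h3
    linarith
  -- the plan
  set π : ι → ι → ℝ := fun s s' => if s' = s then 0 else
    if n s ≤ 2 / 5 then x s * midPart n x s' / g else
    if n s < 3 / 5 ∧ s ∉ Cap then x s * r s' / (R - r s) else 0 with hπ
  have hnc : ∀ s, 2 / 5 < n s → n s < 3 / 5 → s ∉ Cap → x s ≤ R - r s := by
    intro s h1 h2 h3
    by_contra h
    exact h3 (mem_filter.2 ⟨mem_univ _, ⟨h1, h2⟩, not_le.1 h⟩)
  have hpi0 : ∀ s s', 0 ≤ π s s' := by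
    intro s s'
    simp only [hπ]
    split_ifs with h1 h2 h3
    · rfl
    · exact div_nonneg (mul_nonneg (hx s) (midPart_nonneg hx s')) hg0
    · exact div_nonneg (mul_nonneg (hx s) (hr0 s')) (sub_nonneg.2 (hrR s))
    · rfl
  have htg : ∀ s, n s ≤ 2 / 5 → x s ≤ g := by
    intro s hs
    have := hxt s
    rw [tinyPart_eq hs] at this
    linarith
  have hTle : ∀ s s', n s ≤ 2 / 5 → x s * midPart n x s' / g ≤ midPart n x s' := by
    intro s s' hs
    rcases hg0.eq_or_lt with h0 | h0
    · rw [← h0, div_zero]; exact midPart_nonneg hx s'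
    · rw [div_le_iff₀ h0, mul_comm]
      exact mul_le_mul_of_nonneg_left (htg s hs) (midPart_nonneg hx s')
  have hGle : ∀ s s', 2 / 5 < n s → n s < 3 / 5 → s ∉ Cap → x s * r s' / (R - r s) ≤ r s' := by
    intro s s' h1 h2 h3
    rcases (sub_nonneg.2 (hrR s)).eq_or_lt with h0 | h0
    · rw [← h0, div_zero]; exact hr0 s'
    · rw [div_le_iff₀ h0, mul_comm]
      exact mul_le_mul_of_nonneg_left (hnc s h1 h2 h3) (hr0 s')
  refine ⟨Cap, π, hpi0, fun s => by simp [hπ], ?_, ?_, ?_, ?_, ?_, ?_⟩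
  · -- rows
    intro s hs hw
    rw [closeWeight_pos_iff] at hw
    rcases le_or_gt (n s) (2 / 5) with h | h
    · have : ∀ s', π s s' = x s * midPart n x s' / g := by
        intro s'
        simp only [hπ]
        split_ifs with h1
        · rw [h1, midPart_eq_zero h]; simp
        · rfl
      simp_rw [this]
      rw [← sum_div, ← mul_sum, ← hg]
      rcases hg0.eq_or_lt with h0 | h0
      · have := htg s h
        rw [← h0, div_zero]; linarith [hx s]
      · field_simp
    · have : ∀ s', π s s' = x s / (R - r s) * (if s' = s then 0 else r s') := by
        intro s'
        simp only [hπ, not_le.2 h, hw, hs]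
        split_ifs with h1
        · simp
        · simp_all
        · ring
        · simp_all
      simp_rw [this]
      rw [← mul_sum]
      have h2 : ∑ s', (if s' = s then 0 else r s') = R - r s := by
        rw [hR, ← Finset.add_sum_erase univ r (mem_univ s), add_sub_cancel_left,
          ← Finset.add_sum_erase univ _ (mem_univ s)]
        simp only [if_true, zero_add]
        exact sum_congr rfl fun i hi => by simp [(mem_erase.1 hi).1]
      rw [h2]
      rcases (sub_nonneg.2 (hrR s)).eq_or_lt with h0 | h0
      · have := hnc s h hw hs
        rw [← h0]; simp; linarith [hx s]
      · field_simp
  · intro s s'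
    simp only [hπ]
    split_ifs with h1 h2 h3
    · exact hx s'
    · exact (hTle s s' h2).trans (midPart_le hx s')
    · exact (hGle s s' (not_le.1 h2) h3.1 h3.2).trans (hrx s')
    · exact hx s'
  · intro s s' hss
    have hnn : 0 ≤ (1 - n s') * x s' := mul_nonneg (by linarith [hn s']) (hx s')
    simp only [hπ]
    split_ifs with h1 h2 h3
    · simpa using hnn
    · unfold midPart
      split_ifs with h4
      · linarith [h4.2]
      · simpa using hnn
    · calc x s * r s' / (R - r s) * n s' ≤ r s' * n s' :=
            mul_le_mul_of_nonneg_right (hGle s s' (not_le.1 h2) h3.1 h3.2) ((hx s').trans (hxn s'))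
        _ = recvRatio (n s') * n s' * x s' := by simp only [hr]; ring
        _ ≤ _ := mul_le_mul_of_nonneg_right (recvRatio_mul_le _) (hx s')
    · simpa using hnn
  · -- columns
    intro s'
    set rG := ∑ s, (if 2 / 5 < n s ∧ n s < 3 / 5 then r s else 0) with hrG
    have hrG0 : 0 ≤ rG := sum_nonneg fun s _ => by split_ifs <;> simp [hr0]
    have hrGg : rG ≤ g := by
      refine sum_le_sum fun s _ => ?_
      unfold midPart
      split_ifs
      · exact hrx s
      · rfl
    have htrR : t + rG ≤ R := by
      rw [ht, hrG, hR, ← sum_add_distrib]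
      refine sum_le_sum fun s _ => ?_
      unfold tinyPart
      rcases le_or_gt (n s) (2 / 5) with h | h
      · simp only [h, if_true, not_lt.2 h, false_and, if_false, hr, recvRatio_eq_one h]; linarith
      · simp only [not_le.2 h, if_false, h, true_and]
        split_ifs
        · linarith
        · simpa using hr0 s
    have hR0 : 0 ≤ R := sum_nonneg fun s _ => hr0 s
    have hterm : ∀ s, (if s ∈ Cap then 0 else closeWeight (n s)) * π s s' ≤
        tinyPart n x s * (midPart n x s' / g) +
          (if 2 / 5 < n s ∧ n s < 3 / 5 then r s else 0) * (2 / 3 * r s' / R) := by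
      intro s
      have hrhs1 : 0 ≤ tinyPart n x s * (midPart n x s' / g) :=
        mul_nonneg (tinyPart_nonneg hx s) (div_nonneg (midPart_nonneg hx s') hg0)
      have hrhs2 : 0 ≤ (if 2 / 5 < n s ∧ n s < 3 / 5 then r s else 0) * (2 / 3 * r s' / R) := by
        refine mul_nonneg (by split_ifs <;> simp [hr0]) (div_nonneg ?_ hR0)
        linarith [hr0 s']
      by_cases hc : s ∈ Cap
      · simp only [hc, if_true, zero_mul]; linarith
      simp only [hc, if_false]
      rcases le_or_gt (n s) (2 / 5) with h | h
      · have h1 : π s s' ≤ tinyPart n x s * (midPart n x s' / g) := by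
          simp only [hπ, h, if_true]
          split_ifs
          · exact hrhs1
          · rw [tinyPart_eq h, mul_div_assoc]
        have h2 := closeWeight_le_one ((hx s).trans (hxn s))
        nlinarith [hpi0 s s', closeWeight_nonneg (n s)]
      · rcases lt_or_ge (n s) (3 / 5) with h3 | h3
        · by_cases hss : s' = s
          · simp only [hπ, hss, if_true, mul_zero]; rw [hss] at hrhs1 hrhs2; linarith
          have h1 : π s s' = x s * r s' / (R - r s) := by
            simp only [hπ, hss, if_false, not_le.2 h, h3, hc, not_false_eq_true, and_self, if_true]
          simp only [h1, h, h3, and_self, if_true]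
          rcases (sub_nonneg.2 (hrR s)).eq_or_lt with h0 | h0
          · rw [← h0, div_zero, mul_zero]
            simp only [h, h3, and_self, if_true] at hrhs2
            linarith
          have hRpos : 0 < R := by linarith [hr0 s]
          have h4 := hnc s h h3 hc
          have h5 := closeWeight_mul_le h h3
          -- Leaving `s` out of its own receivers costs a factor of at most `1 + recvRatio (n s)`,
          -- which the closing weight absorbs by `closeWeight_mul_le`.
          have h6 : R ≤ (R - r s) * (1 + recvRatio (n s)) := by
            have : recvRatio (n s) * x s ≤ recvRatio (n s) * (R - r s) :=
              mul_le_mul_of_nonneg_left h4 (recvRatio_nonneg (hn s))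
            simp only [hr] at this ⊢
            linarith
          have h7 : closeWeight (n s) * (x s * r s' / (R - r s)) ≤ r s * (2 / 3 * r s' / R) := by
            rw [mul_div_assoc', mul_div_assoc', div_le_div_iff₀ h0 hRpos]
            have hw0 := closeWeight_nonneg (n s)
            calc closeWeight (n s) * (x s * r s') * R
                ≤ closeWeight (n s) * (x s * r s') * ((R - r s) * (1 + recvRatio (n s))) :=
                  mul_le_mul_of_nonneg_left h6 (mul_nonneg hw0 (mul_nonneg (hx s) (hr0 s')))
              _ = (closeWeight (n s) * (1 + recvRatio (n s))) * (x s * r s' * (R - r s)) := by ring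
              _ ≤ (2 / 3 * recvRatio (n s)) * (x s * r s' * (R - r s)) :=
                  mul_le_mul_of_nonneg_right h5
                    (mul_nonneg (mul_nonneg (hx s) (hr0 s')) h0.le)
              _ = r s * (2 / 3 * r s') * (R - r s) := by simp only [hr]; ring
          linarith
        · have : closeWeight (n s) = 0 := by
            have := mt (closeWeight_pos_iff (n s)).1 (not_lt.2 h3)
            exact le_antisymm (not_lt.1 this) (closeWeight_nonneg _)
          rw [this, zero_mul]; linarith
    refine (sum_le_sum fun s _ => hterm s).trans ?_
    rw [sum_add_distrib, ← sum_mul, ← sum_mul, ← ht, ← hrG]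
    have h2 : rG * (2 / 3 * r s' / R) ≤ 2 / 3 * r s' := by
      rcases hR0.eq_or_lt with h0 | h0
      · rw [← h0, div_zero, mul_zero]; linarith [hr0 s']
      · rw [mul_div_assoc', div_le_iff₀ h0]
        nlinarith [hr0 s', mul_nonneg (hr0 s') (show 0 ≤ R - rG by linarith)]
    by_cases hmid : 2 / 5 < n s' ∧ n s' < 3 / 5
    · rw [midPart_eq hmid.1 hmid.2]
      rcases hg0.eq_or_lt with h0 | h0
      · rw [← h0, div_zero, mul_zero]; linarith [hrx s', hr0 s']
      · have h3 : rG * (2 / 3 * r s' / R) ≤ 2 / 3 * g / (t + g) * r s' := by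
          rcases hR0.eq_or_lt with h0' | h0'
          · rw [← h0', div_zero, mul_zero]
            exact mul_nonneg (div_nonneg (by linarith) (by linarith)) (hr0 s')
          · have : rG / R ≤ g / (t + g) := by
              rw [div_le_div_iff₀ h0' (by linarith)]
              nlinarith
            calc rG * (2 / 3 * r s' / R) = rG / R * (2 / 3 * r s') := by ring
              _ ≤ g / (t + g) * (2 / 3 * r s') :=
                mul_le_mul_of_nonneg_right this (by linarith [hr0 s'])
              _ = _ := by ring
        -- In terms of `u = t / g ≤ 1/2` this is `3 u² ≤ 1`. The first summand comes from the small
        -- facilities, the second from the medium ones.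
        have h4 : t / g + 2 / 3 * g / (t + g) ≤ 1 := by
          rw [div_add_div _ _ h0.ne' (by linarith), div_le_one (by nlinarith)]
          nlinarith
        have h5 : t * (x s' / g) = t / g * x s' := by ring
        have h6 : 0 ≤ 2 / 3 * g / (t + g) := div_nonneg (by linarith) (by linarith)
        rw [h5]
        nlinarith [hrx s', hx s']
    · have : midPart n x s' = 0 := by unfold midPart; rw [if_neg hmid]
      rw [this]; simp only [zero_div, mul_zero, zero_add]
      linarith [hrx s', hr0 s']
  · intro s hs
    have h1 := hcapbd s hs
    obtain ⟨⟨h2, h3⟩, -⟩ := (mem_filter.1 hs).2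
    refine ⟨(closeWeight_pos_iff _).2 h3, ?_⟩
    have := surplus_lower_bound (n := n) hx hsum
    linarith
  · have hm : ∀ s ∈ Cap, 2 / 5 < n s := fun s hs => (mem_filter.1 hs).2.1.1
    have : #Cap ≤ 2 := by
      refine card_le_two_of_two_fifths (y := midPart n x) (midPart_nonneg hx) fun s hs => ?_
      have h1 := hcapbd s hs
      obtain ⟨⟨h2, h3⟩, -⟩ := (mem_filter.1 hs).2
      rw [midPart_eq h2 h3]
      linarith
    rcases (by omega : #Cap ≤ 1 ∨ #Cap = 2) with h | h
    · exact Or.inl h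
    · exact Or.inr ⟨h, hm⟩

end LocalPlan
end CapMedian

namespace CapMedian
section LocalPlan
variable {ι : Type*} [Fintype ι] [DecidableEq ι] {n x : ι → ℝ}

theorem closeWeight_mid_le {s : ℝ} (h : 2 / 5 < s) : closeWeight s ≤ 1 / 3 := by
  unfold closeWeight; rw [max_le_iff]; constructor <;> linarith

open Finset in
-- The small part is large and no medium facility exceeds it. Medium facilities spread their clients
-- over the small ones; as their closing weights are at most `1/3`, this uses less than the small
-- part. The clients of the small facilities are distributed over what remains by an off-diagonal
-- transport. The only obstruction is a small facility that holds too much of supply and target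
-- together, and there is at most one.
theorem exists_localPlan_of_mid_le_tiny (hx : ∀ s, 0 ≤ x s) (hxn : ∀ s, x s ≤ n s)
    (hn : ∀ s, n s ≤ 1) (hsum : ∑ s, x s ≤ 1)
    (hcase : ∑ s, midPart n x s < 2 * ∑ s, tinyPart n x s)
    (hmid : ∀ s, midPart n x s ≤ ∑ s, tinyPart n x s) :
    ∃ Cap π, IsLocalPlan n x Cap π := by
  classical
  set t := ∑ s, tinyPart n x s with ht
  set g := ∑ s, midPart n x s with hg
  set RH := ∑ s, heavyRecv n x s with hRH
  have hg0 : 0 ≤ g := sum_nonneg fun s _ => midPart_nonneg hx s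
  have ht0 : 0 < t := by linarith
  have hRH0 : 0 ≤ RH := sum_nonneg fun s _ => heavyRecv_nonneg hx hn s
  have hxt : ∀ s, tinyPart n x s ≤ t := fun s =>
    single_le_sum (f := tinyPart n x) (fun s _ => tinyPart_nonneg hx s) (mem_univ s)
  set gw := ∑ s, closeWeight (n s) * midPart n x s with hgw
  have hgw0 : 0 ≤ gw := sum_nonneg fun s _ => mul_nonneg (closeWeight_nonneg _) (midPart_nonneg hx s)
  have hgwg : gw ≤ 1 / 3 * g := by
    rw [hgw, hg, mul_sum]
    refine sum_le_sum fun s _ => ?_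
    rcases le_or_gt (n s) (2 / 5) with h | h
    · rw [midPart_eq_zero h]; simp
    · exact mul_le_mul_of_nonneg_right (closeWeight_mid_le h) (midPart_nonneg hx s)
  -- The fraction of each small facility that is used up, on average, by the clients of medium
  -- facilities.
  set β := gw / t with hβ
  have hβ0 : 0 ≤ β := div_nonneg hgw0 ht0.le
  have hβ1 : β ≤ 1 := by rw [hβ, div_le_one ht0]; linarith
  have hβt : β * t = gw := by rw [hβ]; field_simp
  set τ : ι → ℝ := fun s => (1 - β) * tinyPart n x s + midPart n x s + heavyRecv n x s with hτ
  have hτ0 : ∀ s, 0 ≤ τ s := fun s => by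
    have := mul_nonneg (sub_nonneg.2 hβ1) (tinyPart_nonneg (n := n) hx s)
    have := midPart_nonneg (n := n) hx s
    have := heavyRecv_nonneg hx hn s
    simp only [hτ]; linarith
  have hτs : ∑ s, τ s = t - gw + g + RH := by
    simp only [hτ, sum_add_distrib, ← mul_sum, ← ht, ← hg, ← hRH]
    linarith
  have hτtiny : ∀ s, n s ≤ 2 / 5 → τ s = (1 - β) * x s := by
    intro s h
    have h2 : heavyRecv n x s = 0 := by unfold heavyRecv; rw [if_neg]; linarith
    simp only [hτ, tinyPart_eq h, midPart_eq_zero h, h2]; ring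
  have hτother : ∀ s, 2 / 5 < n s → τ s ≤ x s ∧ (3 / 5 ≤ n s → τ s = recvRatio (n s) * x s) := by
    intro s h
    simp only [hτ, tinyPart_eq_zero h]
    unfold midPart heavyRecv
    rcases lt_or_ge (n s) (3 / 5) with h3 | h3
    · simp only [h, h3, and_self, if_true, not_le.2 h3, if_false]
      constructor
      · linarith
      · intro h4; exact h4.elim
    · simp only [not_lt.2 h3, and_false, if_false, h3, if_true]
      constructor
      · have := mul_le_of_le_one_left (hx s) (recvRatio_le_one (n s)); linarith
      · intro _; ring
  have hτx : ∀ s, τ s ≤ x s := by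
    intro s
    rcases le_or_gt (n s) (2 / 5) with h | h
    · rw [hτtiny s h]; nlinarith [hx s]
    · exact (hτother s h).1
  -- Exactly the small facilities that violate the hypothesis of the transport lemma. Their supply
  -- is omitted from the transport.
  set Cap : Finset ι := {s | n s ≤ 2 / 5 ∧ ∑ i, τ i < x s + τ s} with hCap
  set a : ι → ℝ := fun s => if s ∈ Cap then 0 else tinyPart n x s with ha
  have ha0 : ∀ s, 0 ≤ a s := fun s => by simp only [ha]; split_ifs <;> simp [tinyPart_nonneg hx]
  have hat : ∀ s, a s ≤ tinyPart n x s := fun s => by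
    simp only [ha]; split_ifs <;> simp [tinyPart_nonneg hx]
  obtain ⟨z, hz0, hzd, hzr, hzc⟩ := exists_offdiag_transport a τ ha0 hτ0
    (by
      have : ∑ s, a s ≤ t := sum_le_sum fun s _ => hat s
      linarith)
    (by
      intro s
      have h1 : τ s ≤ ∑ i, τ i := single_le_sum (fun s _ => hτ0 s) (mem_univ s)
      simp only [ha]
      split_ifs with h
      · linarith
      · rcases le_or_gt (n s) (2 / 5) with h2 | h2
        · rw [tinyPart_eq h2]
          by_contra hcon
          exact h (mem_filter.2 ⟨mem_univ _, h2, not_le.1 hcon⟩)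
        · rw [tinyPart_eq_zero h2]; linarith)
  have hzle : ∀ s s', z s s' ≤ τ s' := fun s s' =>
    (single_le_sum (f := fun s => z s s') (fun s _ => hz0 s s') (mem_univ s)).trans (hzc s')
  set π : ι → ι → ℝ := fun s s' => if n s ≤ 2 / 5 then z s s' else
    midPart n x s * tinyPart n x s' / t with hπ
  have hpi0 : ∀ s s', 0 ≤ π s s' := by
    intro s s'
    simp only [hπ]
    split_ifs
    · exact hz0 s s'
    · exact div_nonneg (mul_nonneg (midPart_nonneg hx s) (tinyPart_nonneg hx s')) ht0.le
  have hGle : ∀ s s', midPart n x s * tinyPart n x s' / t ≤ tinyPart n x s' := by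
    intro s s'
    rw [div_le_iff₀ ht0, mul_comm]
    exact mul_le_mul_of_nonneg_left (hmid s) (tinyPart_nonneg hx s')
  refine ⟨Cap, π, hpi0, ?_, ?_, ?_, ?_, ?_, ?_, ?_⟩
  · intro s
    simp only [hπ]
    split_ifs with h
    · exact hzd s
    · rw [tinyPart_eq_zero (not_le.1 h)]; simp
  · intro s hs hw
    rw [closeWeight_pos_iff] at hw
    simp only [hπ]
    rcases le_or_gt (n s) (2 / 5) with h | h
    · simp only [h, if_true, hzr, ha, hs, if_false, tinyPart_eq h]
    · simp only [not_le.2 h, if_false]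
      rw [← sum_div, ← mul_sum, ← ht, midPart_eq h hw]
      field_simp
  · intro s s'
    simp only [hπ]
    split_ifs with h
    · exact (hzle s s').trans (hτx s')
    · exact (hGle s s').trans (tinyPart_le hx s')
  · intro s s' hss
    have hnn : 0 ≤ (1 - n s') * x s' := mul_nonneg (by linarith [hn s']) (hx s')
    simp only [hπ]
    split_ifs with h
    · have h1 := (hτother s' (by linarith)).2 (by linarith)
      have h2 := hzle s s'
      calc z s s' * n s' ≤ τ s' * n s' := mul_le_mul_of_nonneg_right h2 ((hx s').trans (hxn s'))
        _ = recvRatio (n s') * n s' * x s' := by rw [h1]; ring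
        _ ≤ _ := mul_le_mul_of_nonneg_right (recvRatio_mul_le _) (hx s')
    · rcases le_or_gt (n s') (2 / 5) with h2 | h2
      · rcases lt_or_ge (n s) (3 / 5) with h3 | h3
        · linarith
        · have : midPart n x s = 0 := by unfold midPart; rw [if_neg]; intro h; linarith [h.2]
          rw [this]; simpa using hnn
      · rw [tinyPart_eq_zero h2]; simpa using hnn
  · intro s'
    have hterm : ∀ s, (if s ∈ Cap then 0 else closeWeight (n s)) * π s s' ≤
        z s s' + closeWeight (n s) * midPart n x s * (tinyPart n x s' / t) := by
      intro s
      have h0 : 0 ≤ closeWeight (n s) * midPart n x s * (tinyPart n x s' / t) :=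
        mul_nonneg (mul_nonneg (closeWeight_nonneg _) (midPart_nonneg hx s))
          (div_nonneg (tinyPart_nonneg hx s') ht0.le)
      by_cases hc : s ∈ Cap
      · simp only [hc, if_true, zero_mul]; linarith [hz0 s s']
      simp only [hc, if_false, hπ]
      split_ifs with h
      · have h2 := closeWeight_le_one ((hx s).trans (hxn s))
        nlinarith [hz0 s s']
      · have : closeWeight (n s) * (midPart n x s * tinyPart n x s' / t) =
          closeWeight (n s) * midPart n x s * (tinyPart n x s' / t) := by ring
        rw [this]; linarith [hz0 s s']
    refine (sum_le_sum fun s _ => hterm s).trans ?_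
    rw [sum_add_distrib, ← sum_mul, ← hgw]
    have h1 := hzc s'
    have h2 : gw * (tinyPart n x s' / t) = β * tinyPart n x s' := by rw [hβ]; ring
    rw [h2]
    rcases le_or_gt (n s') (2 / 5) with h | h
    · rw [hτtiny s' h] at h1; rw [tinyPart_eq h]; linarith
    · rw [tinyPart_eq_zero h]; linarith [hτx s']
  · intro s hs
    obtain ⟨h2, h3⟩ := (mem_filter.1 hs).2
    refine ⟨(closeWeight_pos_iff _).2 (by linarith), ?_⟩
    have h4 := surplus_lower_bound (n := n) hx hsum
    rw [hτs] at h3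
    have h5 := hτx s
    have h6 := hxt s
    rw [tinyPart_eq h2] at h6
    linarith
  · left
    by_contra hc
    push Not at hc
    obtain ⟨s₁, h₁, s₂, h₂, hne⟩ := one_lt_card.1 hc
    obtain ⟨a2, a3⟩ := (mem_filter.1 h₁).2
    obtain ⟨b2, b3⟩ := (mem_filter.1 h₂).2
    have hpair : ∀ f : ι → ℝ, (∀ s, 0 ≤ f s) → f s₁ + f s₂ ≤ ∑ s, f s := by
      intro f hf
      rw [← sum_pair hne]
      exact sum_le_univ_sum_of_nonneg hf
    have c1 := hpair τ hτ0
    have c2 := hpair (tinyPart n x) (tinyPart_nonneg hx)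
    rw [tinyPart_eq a2, tinyPart_eq b2] at c2
    linarith

open Finset in
-- One medium facility `s₀` exceeds the whole small part, so it can take over all clients of the
-- small facilities. The other medium facilities together hold less than the small part and spread
-- over it. Only `s₀` itself, which spreads over all the others, can conflict.
theorem exists_localPlan_of_large_mid (hx : ∀ s, 0 ≤ x s) (hxn : ∀ s, x s ≤ n s)
    (hn : ∀ s, n s ≤ 1) (hsum : ∑ s, x s ≤ 1)
    (hcase : ∑ s, midPart n x s < 2 * ∑ s, tinyPart n x s)
    (s₀ : ι) (hs₀ : ∑ s, tinyPart n x s < midPart n x s₀) :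
    ∃ Cap π, IsLocalPlan n x Cap π := by
  classical
  set t := ∑ s, tinyPart n x s with ht
  set g := ∑ s, midPart n x s with hg
  set RH := ∑ s, heavyRecv n x s with hRH
  have hg0 : 0 ≤ g := sum_nonneg fun s _ => midPart_nonneg hx s
  have ht0 : 0 < t := by linarith
  have hxt : ∀ s, tinyPart n x s ≤ t := fun s =>
    single_le_sum (f := tinyPart n x) (fun s _ => tinyPart_nonneg hx s) (mem_univ s)
  obtain ⟨hm1, hm2⟩ : 2 / 5 < n s₀ ∧ n s₀ < 3 / 5 := by
    by_contra h
    have : midPart n x s₀ = 0 := by unfold midPart; rw [if_neg h]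
    linarith
  rw [midPart_eq hm1 hm2] at hs₀
  set r : ι → ℝ := fun s => recvRatio (n s) * x s with hr
  have hr0 : ∀ s, 0 ≤ r s := fun s => mul_nonneg (recvRatio_nonneg (hn s)) (hx s)
  have hrx : ∀ s, r s ≤ x s := fun s => mul_le_of_le_one_left (hx s) (recvRatio_le_one _)
  set R := ∑ s, r s - r s₀ with hR
  have hRlow : t + 2 / 3 * (g - x s₀) + RH ≤ R := by
    have := parts_sub_le_recv_sub (n := n) hx s₀
    rw [midPart_eq hm1 hm2, tinyPart_eq_zero hm1] at this
    have h4 : heavyRecv n x s₀ = 0 := by unfold heavyRecv; rw [if_neg (not_le.2 hm2)]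
    rw [h4] at this
    simp only [hR, hr]
    linarith
  have hRH0 : 0 ≤ RH := sum_nonneg fun s _ => heavyRecv_nonneg hx hn s
  -- Hence the other medium facilities share `g - x s₀`, which is less than `2t - t = t`.
  have hgx : x s₀ ≤ g := by
    have := single_le_sum (f := midPart n x) (fun s _ => midPart_nonneg hx s) (mem_univ s₀)
    rwa [midPart_eq hm1 hm2] at this
  have hRpos : 0 < R := by linarith
  have hother : ∀ s, s ≠ s₀ → midPart n x s ≤ t := by
    intro s hs
    have : midPart n x s + midPart n x s₀ ≤ g := by
      rw [hg, ← sum_pair hs]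
      exact sum_le_univ_sum_of_nonneg (midPart_nonneg hx)
    rw [midPart_eq hm1 hm2] at this
    linarith
  set Cap : Finset ι := if R < x s₀ then {s₀} else ∅ with hCap
  have hcapmem : ∀ s, s ∈ Cap → s = s₀ ∧ R < x s₀ := by
    intro s
    simp only [hCap]
    split_ifs with h
    · intro hs; exact ⟨mem_singleton.1 hs, h⟩
    · intro hs; simp at hs
  set π : ι → ι → ℝ := fun s s' =>
    if s = s₀ then (if s' = s₀ ∨ R < x s₀ then 0 else x s₀ * r s' / R) else
    if n s ≤ 2 / 5 then (if s' = s₀ then x s else 0) else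
    midPart n x s * tinyPart n x s' / t with hπ
  have hpi0 : ∀ s s', 0 ≤ π s s' := by
    intro s s'
    simp only [hπ]
    split_ifs
    · rfl
    · exact div_nonneg (mul_nonneg (hx _) (hr0 _)) hRpos.le
    · exact hx s
    · rfl
    · exact div_nonneg (mul_nonneg (midPart_nonneg hx s) (tinyPart_nonneg hx s')) ht0.le
  have hne : ∀ s, n s ≤ 2 / 5 → s ≠ s₀ := by rintro s h rfl; linarith
  have htx : ∀ s, n s ≤ 2 / 5 → x s ≤ t := by
    intro s h; have := hxt s; rwa [tinyPart_eq h] at this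
  have hGle : ∀ s s', s ≠ s₀ → midPart n x s * tinyPart n x s' / t ≤ tinyPart n x s' := by
    intro s s' hs
    rw [div_le_iff₀ ht0, mul_comm]
    exact mul_le_mul_of_nonneg_left (hother s hs) (tinyPart_nonneg hx s')
  have hSle : ∀ s', ¬ R < x s₀ → x s₀ * r s' / R ≤ r s' := by
    intro s' h
    rw [div_le_iff₀ hRpos, mul_comm]
    exact mul_le_mul_of_nonneg_left (not_lt.1 h) (hr0 s')
  refine ⟨Cap, π, hpi0, ?_, ?_, ?_, ?_, ?_, ?_, ?_⟩
  · intro s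
    simp only [hπ]
    split_ifs with h1 h2 h3
    · rfl
    · exact (h2 (Or.inl h1)).elim
    · rfl
    · rw [tinyPart_eq_zero (not_le.1 h3)]; simp
  · intro s hs hw
    rw [closeWeight_pos_iff] at hw
    by_cases h1 : s = s₀
    · subst h1
      have h2 : ¬ R < x s := by
        intro h; apply hs; simp [hCap, h]
      have h3 : ∀ s', π s s' = x s / R * (if s' = s then 0 else r s') := by
        intro s'
        simp only [hπ, if_true, h2, or_false]
        split_ifs
        · simp
        · ring
      simp_rw [h3]
      rw [← mul_sum]
      have h4 : ∑ s', (if s' = s then 0 else r s') = R := by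
        rw [hR, ← Finset.add_sum_erase univ r (mem_univ s), add_sub_cancel_left,
          ← Finset.add_sum_erase univ _ (mem_univ s)]
        simp only [if_true, zero_add]
        exact sum_congr rfl fun i hi => by simp [(mem_erase.1 hi).1]
      rw [h4]; field_simp
    · simp only [hπ, h1, if_false]
      rcases le_or_gt (n s) (2 / 5) with h | h
      · simp [h]
      · simp only [not_le.2 h, if_false]
        rw [← sum_div, ← mul_sum, ← ht, midPart_eq h hw]
        field_simp
  · intro s s'
    simp only [hπ]
    split_ifs with h1 h2 h3 h4
    · exact hx s'
    · exact (hSle s' (fun h => h2 (Or.inr h))).trans (hrx s')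
    · rw [h4]; linarith [htx s h3]
    · exact hx s'
    · exact (hGle s s' h1).trans (tinyPart_le hx s')
  · intro s s' hss
    have hnn : 0 ≤ (1 - n s') * x s' := mul_nonneg (by linarith [hn s']) (hx s')
    simp only [hπ]
    split_ifs with h1 h2 h3 h4
    · simpa using hnn
    · calc x s₀ * r s' / R * n s' ≤ r s' * n s' :=
            mul_le_mul_of_nonneg_right (hSle s' (fun h => h2 (Or.inr h))) ((hx s').trans (hxn s'))
        _ = recvRatio (n s') * n s' * x s' := by simp only [hr]; ring
        _ ≤ _ := mul_le_mul_of_nonneg_right (recvRatio_mul_le _) (hx s')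
    · rw [h4] at hss; linarith
    · simpa using hnn
    · rcases le_or_gt (n s') (2 / 5) with h2 | h2
      · rcases lt_or_ge (n s) (3 / 5) with h5 | h5
        · linarith
        · have : midPart n x s = 0 := by unfold midPart; rw [if_neg]; intro h; linarith [h.2]
          rw [this]; simpa using hnn
      · rw [tinyPart_eq_zero h2]; simpa using hnn
  · intro s'
    have hterm : ∀ s, (if s ∈ Cap then 0 else closeWeight (n s)) * π s s' ≤
        (if s = s₀ then (if s' = s₀ then 0 else 1 / 3 * r s') else 0) +
        ((if s' = s₀ then tinyPart n x s else 0) +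
          midPart n x s * (1 / 3 * tinyPart n x s' / t)) := by
      intro s
      have h0 : 0 ≤ midPart n x s * (1 / 3 * tinyPart n x s' / t) :=
        mul_nonneg (midPart_nonneg hx s)
          (div_nonneg (by linarith [tinyPart_nonneg (n := n) hx s']) ht0.le)
      have h0' : 0 ≤ (if s = s₀ then (if s' = s₀ then 0 else 1 / 3 * r s') else 0) := by
        split_ifs <;> linarith [hr0 s']
      have h0'' : 0 ≤ (if s' = s₀ then tinyPart n x s else 0) := by
        split_ifs <;> simp [tinyPart_nonneg hx]
      by_cases hc : s ∈ Cap
      · simp only [hc, if_true, zero_mul]; linarith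
      simp only [hc, if_false]
      have hw0 := closeWeight_nonneg (n s)
      by_cases h1 : s = s₀
      · subst h1
        have h2 : ¬ R < x s := by
          intro h; apply hc; simp [hCap, h]
        have hw1 := closeWeight_mid_le hm1
        simp only [hπ, if_true, h2, or_false] at h0' ⊢
        split_ifs with h3
        · rw [if_pos h3] at h0''; linarith
        · have h4 := hSle s' h2
          rw [if_neg h3] at h0''
          have h5 : 0 ≤ x s * r s' / R := div_nonneg (mul_nonneg (hx _) (hr0 _)) hRpos.le
          nlinarith
      · simp only [h1, if_false, zero_add]
        rcases le_or_gt (n s) (2 / 5) with h | h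
        · have h2 := closeWeight_le_one ((hx s).trans (hxn s))
          simp only [hπ, h1, if_false, h, if_true] at h0'' ⊢
          rw [tinyPart_eq h]
          split_ifs with h3
          · nlinarith [hx s]
          · linarith
        · simp only [hπ, h1, if_false, not_le.2 h]
          have hw1 := closeWeight_mid_le h
          have h2 : 0 ≤ midPart n x s * tinyPart n x s' / t :=
            div_nonneg (mul_nonneg (midPart_nonneg hx s) (tinyPart_nonneg hx s')) ht0.le
          have h3 : midPart n x s * (1 / 3 * tinyPart n x s' / t) =
            1 / 3 * (midPart n x s * tinyPart n x s' / t) := by ring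
          rw [h3]
          have := mul_le_mul_of_nonneg_right hw1 h2
          linarith
    refine (sum_le_sum fun s _ => hterm s).trans ?_
    rw [sum_add_distrib, sum_add_distrib, ← sum_mul, ← hg]
    simp only [sum_ite_eq', mem_univ, if_true]
    have h2 : g * (1 / 3 * tinyPart n x s' / t) ≤ 2 / 3 * tinyPart n x s' := by
      rw [mul_div_assoc', div_le_iff₀ ht0]
      nlinarith [tinyPart_nonneg (n := n) hx s']
    by_cases h : s' = s₀
    · subst h
      simp only [if_true]
      rw [tinyPart_eq_zero hm1] at h2 ⊢
      linarith
    · simp only [h, if_false, sum_const_zero]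
      linarith [hrx s', tinyPart_le (n := n) hx s']
  · intro s hs
    obtain ⟨rfl, h3⟩ := hcapmem s hs
    refine ⟨(closeWeight_pos_iff _).2 hm2, ?_⟩
    have h4 := surplus_lower_bound (n := n) hx hsum
    linarith
  · left
    simp only [hCap]
    split_ifs <;> simp

/-- The three cases differ in who can absorb the clients of small facilities: the medium facilities
together, the small facilities among themselves with the help of the others, or one large medium
facility. -/
theorem exists_localPlan (hx : ∀ s, 0 ≤ x s) (hxn : ∀ s, x s ≤ n s)
    (hn : ∀ s, n s ≤ 1) (hsum : ∑ s, x s ≤ 1) : ∃ Cap π, IsLocalPlan n x Cap π := by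
  rcases le_or_gt (2 * ∑ s, tinyPart n x s) (∑ s, midPart n x s) with h | h
  · exact exists_localPlan_of_tiny_le_mid hx hxn hn hsum h
  · by_cases h2 : ∀ s, midPart n x s ≤ ∑ s, tinyPart n x s
    · exact exists_localPlan_of_mid_le_tiny hx hxn hn hsum h h2
    · push Not at h2
      obtain ⟨s₀, hs₀⟩ := h2
      exact exists_localPlan_of_large_mid hx hxn hn hsum h s₀ hs₀

end LocalPlan
end CapMedian

/-! ### Weights of the single swaps. -/

namespace CapMedian

open Finset in
/-- Weights for the swaps `(s, o)` that open every `o` exactly once and close every `s` at most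
about `closeWeight (n s)` times, where a facility with a single conflict `s ∈ Cap o` is used only
together with `o` and facilities with several conflicts are not used at all. -/
theorem exists_swap_weights {ι κ : Type*} [Fintype ι] [DecidableEq ι] [Fintype κ] [DecidableEq κ]
    (n : ι → ℝ) (x : κ → ι → ℝ) (σ : κ → ℝ) (Cap : κ → Finset ι)
    (hn0 : ∀ s, 0 ≤ n s) (hx : ∀ o s, 0 ≤ x o s) (hxn : ∀ s, ∑ o, x o s ≤ n s)
    (hσ : ∀ o, 0 ≤ σ o)
    (hcap : ∀ o, ∀ s ∈ Cap o, 0 < closeWeight (n s) ∧ 2 / 3 - 5 / 3 * x o s ≤ σ o)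
    (hcard : ∀ o, #(Cap o) ≤ 1 ∨ #(Cap o) = 2 ∧ ∀ s ∈ Cap o, 2 / 5 < n s)
    (htotal : (Fintype.card κ : ℝ) - 2 / 3 + ∑ o, σ o ≤ ∑ s, closeWeight (n s))
    (hm : 4 < Fintype.card κ) :
    ∃ ω : ι → κ → ℝ, (∀ s o, 0 ≤ ω s o) ∧ (∀ o, ∑ s, ω s o = 1) ∧
      (∀ s, ∑ o, ω s o ≤ (1 + 2 / ((Fintype.card κ : ℝ) - 4)) * closeWeight (n s)) ∧
      ∀ s o o', ω s o ≠ 0 → s ∈ Cap o' → o' = o := by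
  classical
  set w : ι → ℝ := fun s => closeWeight (n s) with hw
  have hw0 : ∀ s, 0 ≤ w s := fun s => closeWeight_nonneg _
  have hw1 : ∀ s, w s ≤ 1 := fun s => closeWeight_le_one (hn0 s)
  set P : ι → Finset κ := fun s => {o | s ∈ Cap o} with hP
  have hmem : ∀ s o, o ∈ P s ↔ s ∈ Cap o := fun s o => by simp [hP]
  have hxs : ∀ o s, x o s ≤ n s := fun o s =>
    (single_le_sum (f := fun o => x o s) (fun o _ => hx o s) (mem_univ o)).trans (hxn s)
  -- The closing weight is split into what is reserved for `o` (`c o`), what is free of conflicts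
  -- (`G`), and what is lost because of several conflicts (`Wb`).
  set c : κ → ℝ := fun o => ∑ s, if P s = {o} then w s else 0 with hc
  set G : ℝ := ∑ s, if P s = ∅ then w s else 0 with hG
  set Wb : ℝ := ∑ s, if 2 ≤ #(P s) then w s else 0 with hWb
  have hc0 : ∀ o, 0 ≤ c o := fun o => sum_nonneg fun s _ => by split_ifs <;> simp [hw0]
  have hG0 : 0 ≤ G := sum_nonneg fun s _ => by split_ifs <;> simp [hw0]
  have hsplit : ∑ s, w s = G + ∑ o, c o + Wb := by
    simp only [hc]
    rw [sum_comm, hG, hWb, ← sum_add_distrib, ← sum_add_distrib]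
    refine sum_congr rfl fun s _ => ?_
    rcases (by omega : #(P s) = 0 ∨ #(P s) = 1 ∨ 2 ≤ #(P s)) with h | h | h
    · have h' := card_eq_zero.1 h
      have : ∀ o : κ, ¬ (∅ : Finset κ) = {o} := fun o => (singleton_ne_empty o).symm
      simp [h', this]
    · obtain ⟨o, ho⟩ := card_eq_one.1 h
      simp [ho]
    · have h1 : P s ≠ ∅ := by rintro h'; simp [h'] at h
      have h2 : ∀ o, P s ≠ {o} := by rintro o h'; simp [h'] at h
      simp [h, h1, h2]
  -- The part of the lost weight of `s` that is charged to `o`. Two conflicts suffice to cover `1 -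
  -- 5/3 * n s`. For loads above `2/5` half the share is enough, so that even two such facilities in
  -- conflict with the same `o` fit into its surplus.
  set share : ι → κ → ℝ := fun s o => if n s ≤ 2 / 5 then max 0 (2 / 3 - 5 / 3 * x o s) else
    max 0 (1 / 3 - 5 / 6 * x o s) with hshare
  have hshare0 : ∀ s o, 0 ≤ share s o := fun s o => by
    simp only [hshare]; split_ifs <;> exact le_max_left _ _
  set cons : κ → ℝ := fun o => ∑ s ∈ Cap o, if 2 ≤ #(P s) then share s o else 0 with hcons
  have hWb_le : Wb ≤ ∑ o, cons o := by
    have h1 : ∑ o, cons o = ∑ s, if 2 ≤ #(P s) then ∑ o ∈ P s, share s o else 0 := by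
      simp only [hcons]
      rw [sum_comm' (t' := univ) (s' := P) (by simp [hP])]
      refine sum_congr rfl fun s _ => ?_
      split_ifs <;> simp
    rw [h1]
    refine sum_le_sum fun s _ => ?_
    split_ifs with h
    · obtain ⟨o, ho⟩ : (P s).Nonempty := card_pos.1 (by omega)
      have hwpos := (hcap o s ((hmem s o).1 ho)).1
      have hn35 := (closeWeight_pos_iff _).1 hwpos
      have hsumx : ∑ o ∈ P s, x o s ≤ n s :=
        (sum_le_univ_sum_of_nonneg fun o => hx o s).trans (hxn s)
      have h2 : (2 : ℝ) ≤ #(P s) := by exact_mod_cast h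
      simp only [hw, closeWeight_eq_of_lt hn35]
      by_cases h25 : n s ≤ 2 / 5
      · calc 1 - 5 / 3 * n s ≤ ∑ o ∈ P s, (2 / 3 - 5 / 3 * x o s) := by
              rw [sum_sub_distrib, ← mul_sum, sum_const, nsmul_eq_mul]; linarith
          _ ≤ _ := sum_le_sum fun o _ => by simp only [hshare, h25, if_true]; exact le_max_right _ _
      · calc 1 - 5 / 3 * n s ≤ ∑ o ∈ P s, (1 / 3 - 5 / 6 * x o s) := by
              rw [sum_sub_distrib, ← mul_sum, sum_const, nsmul_eq_mul]; linarith
          _ ≤ _ := sum_le_sum fun o _ => by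
            simp only [hshare, h25, if_false]; exact le_max_right _ _
    · rfl
  have hcsub : ∀ o, c o = ∑ s ∈ Cap o, if P s = {o} then w s else 0 := by
    intro o
    symm
    refine sum_subset (subset_univ _) fun s _ hs => ?_
    rw [if_neg]
    intro h
    exact hs ((hmem s o).1 (h ▸ mem_singleton_self o))
  have hsingle : ∀ s o, P s = {o} → ¬ 2 ≤ #(P s) := by
    intro s o h; rw [h]; simp
  have hshareσ : ∀ o, ∀ s ∈ Cap o, share s o ≤ σ o := by
    intro o s hs
    have := (hcap o s hs).2
    have h0 := hσ o
    simp only [hshare]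
    split_ifs <;> rw [max_le_iff] <;> constructor <;> linarith
  have hshareσ2 : ∀ o, ∀ s ∈ Cap o, 2 / 5 < n s → share s o ≤ σ o / 2 := by
    intro o s hs h
    have := (hcap o s hs).2
    have h0 := hσ o
    simp only [hshare, not_le.2 h, if_false]
    rw [max_le_iff]; constructor <;> linarith
  -- The surplus of `o` pays for its charges and for the part of the reserved weight above `2/3`.
  -- The latter is needed below: without it, reserved weights near 1 could leave too little demand
  -- for the deficit of `2/3` to be negligible.
  have hlocal : ∀ o, c o ≤ 1 ∧ cons o + max 0 (c o - 2 / 3) ≤ σ o := by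
    intro o
    rw [hcsub]
    simp only [hcons]
    rcases hcard o with h | ⟨h, hmid⟩
    · rcases (by omega : #(Cap o) = 0 ∨ #(Cap o) = 1) with h | h
      · rw [card_eq_zero.1 h]
        simp only [sum_empty]
        rw [max_eq_left (by norm_num)]
        exact ⟨by norm_num, by linarith [hσ o]⟩
      · obtain ⟨s, hs⟩ := card_eq_one.1 h
        have hsC : s ∈ Cap o := by rw [hs]; exact mem_singleton_self s
        rw [hs, sum_singleton, sum_singleton]
        by_cases h1 : P s = {o}
        · rw [if_pos h1, if_neg (hsingle s o h1)]
          refine ⟨hw1 s, ?_⟩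
          have := (hcap o s hsC)
          have h2 := closeWeight_eq_of_lt ((closeWeight_pos_iff _).1 this.1)
          rw [zero_add, max_le_iff]
          refine ⟨hσ o, ?_⟩
          simp only [hw, h2]
          linarith [hxs o s]
        · rw [if_neg h1, max_eq_left (by norm_num)]
          refine ⟨by norm_num, ?_⟩
          have := hshareσ o s hsC
          split_ifs <;> linarith [hσ o]
    · obtain ⟨s₁, s₂, hne, hs⟩ := card_eq_two.1 h
      have hm1 := hmid s₁ (by simp [hs])
      have hm2 := hmid s₂ (by simp [hs])
      have e1 := hshareσ2 o s₁ (by simp [hs]) hm1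
      have e2 := hshareσ2 o s₂ (by simp [hs]) hm2
      have f1 : w s₁ ≤ 1 / 3 := closeWeight_mid_le hm1
      have f2 : w s₂ ≤ 1 / 3 := closeWeight_mid_le hm2
      have hle : ∑ s ∈ Cap o, (if P s = {o} then w s else 0) ≤ 2 / 3 := by
        rw [hs, sum_pair hne]
        have := hw0 s₁
        have := hw0 s₂
        split_ifs <;> linarith
      rw [max_eq_left (by linarith)]
      refine ⟨by linarith, ?_⟩
      rw [hs, sum_pair hne]
      have := hσ o
      split_ifs <;> linarith
  set Nd : ℝ := ∑ o, (1 - c o) with hNd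
  have hNd0 : 0 ≤ Nd := sum_nonneg fun o _ => by linarith [(hlocal o).1]
  set m : ℝ := (Fintype.card κ : ℝ) with hmdef
  have hm4 : 4 < m := by rw [hmdef]; exact_mod_cast hm
  have hNdeq : Nd = m - ∑ o, c o := by
    rw [hNd, sum_sub_distrib]; simp [hmdef]
  have hsurp : ∑ o, cons o + ∑ o, max 0 (c o - 2 / 3) ≤ ∑ o, σ o := by
    rw [← sum_add_distrib]; exact sum_le_sum fun o _ => (hlocal o).2
  have hGN : Nd - 2 / 3 + ∑ o, max 0 (c o - 2 / 3) ≤ G := by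
    have : ∑ s, closeWeight (n s) = ∑ s, w s := rfl
    linarith
  -- The free weight misses the demand `Nd` by at most `2/3` minus the total excess. If the excess
  -- is smaller than `2/3`, almost every `o` has demand about `1/3` on average, so the deficit is
  -- relatively small.
  have hratio : Nd ≤ (1 + 2 / (m - 4)) * G := by
    have hη : 0 ≤ 2 / (m - 4) := div_nonneg (by norm_num) (by linarith)
    rcases le_or_gt (2 / 3) (∑ o, max 0 (c o - 2 / 3)) with h | h
    · nlinarith
    · have h1 : m / 3 - ∑ o, max 0 (c o - 2 / 3) ≤ Nd := by
        have : m / 3 = ∑ o : κ, (1 / 3 : ℝ) := by simp [hmdef]; ring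
        rw [this, hNd, ← sum_sub_distrib]
        refine sum_le_sum fun o _ => ?_
        have := le_max_right 0 (c o - 2 / 3)
        linarith
      have h0 : 0 ≤ ∑ o, max 0 (c o - 2 / 3) := sum_nonneg fun o _ => le_max_left _ _
      have h2 : (1 + 2 / (m - 4)) * G = (m - 2) * G / (m - 4) := by
        have : m - 4 ≠ 0 := by linarith
        field_simp; ring
      rw [h2, le_div_iff₀ (by linarith)]
      nlinarith
  -- Reserved weight goes to its own `o`. Free weight is distributed in proportion to the remaining
  -- demands, and scaled up to meet them.
  refine ⟨fun s o => (if P s = {o} then w s else 0) + (if P s = ∅ then w s else 0) * ((1 - c o) / G),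
    ?_, ?_, ?_, ?_⟩
  · intro s o
    have h1 : 0 ≤ (1 - c o) / G := div_nonneg (by linarith [(hlocal o).1]) hG0
    have := hw0 s
    dsimp only
    split_ifs <;> nlinarith
  · intro o
    rw [sum_add_distrib, ← sum_mul, ← hG]
    change c o + _ = 1
    rcases hG0.eq_or_lt with h | h
    · rw [← h, mul_zero] at hratio
      have h1 : Nd = 0 := le_antisymm hratio hNd0
      have h2 := (sum_eq_zero_iff_of_nonneg
        (fun o (_ : o ∈ (univ : Finset κ)) => (by linarith [(hlocal o).1] : 0 ≤ 1 - c o))).1 h1 o (mem_univ o)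
      rw [← h]; linarith
    · field_simp; ring
  · intro s
    rw [sum_add_distrib, ← mul_sum, ← sum_div, ← hNd]
    have hη : 0 ≤ 2 / (m - 4) := div_nonneg (by norm_num) (by linarith)
    have hNG : Nd / G ≤ 1 + 2 / (m - 4) := by
      rcases hG0.eq_or_lt with h | h
      · rw [← h, div_zero]; linarith
      · rwa [div_le_iff₀ h]
    change _ ≤ (1 + 2 / (m - 4)) * w s
    by_cases h1 : P s = ∅
    · have : ∀ o : κ, ¬ (∅ : Finset κ) = {o} := fun o => (singleton_ne_empty o).symm
      simp only [h1, this, if_false, sum_const_zero, zero_add, if_true]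
      rw [mul_comm]
      exact mul_le_mul_of_nonneg_right hNG (hw0 s)
    · simp only [h1, if_false, zero_mul, add_zero]
      by_cases h2 : ∃ o, P s = {o}
      · obtain ⟨o, ho⟩ := h2
        simp only [ho, singleton_inj, sum_ite_eq, mem_univ, if_true]
        nlinarith [hw0 s]
      · push Not at h2
        simp only [h2, if_false, sum_const_zero]
        exact mul_nonneg (by linarith) (hw0 s)
  · intro s o o' hω ho'
    have h1 : o' ∈ P s := (hmem s o').2 ho'
    by_cases h2 : P s = {o}
    · rw [h2] at h1; exact mem_singleton.1 h1
    · exfalso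
      apply hω
      have h3 : P s ≠ ∅ := by rintro h; rw [h] at h1; simp at h1
      simp [h2, h3]

end CapMedian

/-! ### Rounding of fractional assignments. -/

namespace CapMedian

open Finset in
/-- Integrality of the transportation polytope: a fractional assignment that respects integral
capacities can be rounded to an assignment that is not more expensive. -/
theorem exists_integral_assignment {β X : Type*} [Fintype β] [DecidableEq β] [Fintype X]
    [DecidableEq X] (ζ cost : β → X → ℝ) (u : X → ℕ) (h0 : ∀ b x, 0 ≤ ζ b x)
    (hrow : ∀ b, ∑ x, ζ b x = 1) (hcol : ∀ x, ∑ b, ζ b x ≤ u x) :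
    ∃ r : β → X, (∀ x, #{b | r b = x} ≤ u x) ∧
      ∑ b, cost b (r b) ≤ ∑ b, ∑ x, ζ b x * cost b x := by
  classical
  -- Unit slots: every facility is replaced by as many copies as it has capacity, and its fractional
  -- load is divided evenly among them.
  let Y := Σ x : X, Fin (u x)
  have hcardY : Fintype.card Y = ∑ x, u x := by simp [Y]
  have hle : Fintype.card β ≤ Fintype.card Y := by
    have h1 : (Fintype.card β : ℝ) = ∑ x, ∑ b, ζ b x := by
      rw [sum_comm]; simp [hrow]
    have h2 : (Fintype.card β : ℝ) ≤ Fintype.card Y := by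
      rw [h1, hcardY, Nat.cast_sum]; exact sum_le_sum fun x _ => hcol x
    exact_mod_cast h2
  obtain ⟨e⟩ := Function.Embedding.nonempty_of_card_le hle
  have hz0 : ∀ b x, u x = 0 → ζ b x = 0 := by
    intro b x hu
    have h1 := hcol x
    rw [hu, Nat.cast_zero] at h1
    have h2 : ζ b x ≤ ∑ b, ζ b x := single_le_sum (f := fun b => ζ b x) (fun b _ => h0 b x) (mem_univ b)
    exact le_antisymm (h2.trans h1) (h0 b x)
  set d : β → Y → ℝ := fun b y => ζ b y.1 / u y.1 with hd
  have hd0 : ∀ b y, 0 ≤ d b y := fun b y => div_nonneg (h0 _ _) (Nat.cast_nonneg _)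
  have hdsum : ∀ b (f : X → ℝ), ∑ y, d b y * f y.1 = ∑ x, ζ b x * f x := by
    intro b f
    rw [Fintype.sum_sigma]
    refine sum_congr rfl fun x _ => ?_
    simp only [hd, sum_const, card_univ, Fintype.card_fin, nsmul_eq_mul]
    rcases Nat.eq_zero_or_pos (u x) with h | h
    · rw [hz0 b x h]; simp
    · have : (u x : ℝ) ≠ 0 := by positivity
      field_simp
  have hdrow : ∀ b, ∑ y, d b y = 1 := by
    intro b
    have := hdsum b (fun _ => 1)
    simpa [hrow] using this
  have hdcol : ∀ y, ∑ b, d b y ≤ 1 := by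
    intro y
    have : (0 : ℝ) < u y.1 := by
      have := y.2.pos; exact_mod_cast this
    simp only [hd]
    rw [← sum_div, div_le_one this]
    exact hcol _
  set N : ℝ := (Fintype.card Y : ℝ) - Fintype.card β with hN
  have hN0 : 0 ≤ N := by rw [hN]; have : (Fintype.card β : ℝ) ≤ Fintype.card Y := by exact_mod_cast hle
                         linarith
  have hdtot : ∑ y, (1 - ∑ b, d b y) = N := by
    rw [sum_sub_distrib, sum_comm]; simp [hdrow, hN]
  -- The rows of the embedded clients carry the fractional assignment. The remaining rows share the
  -- unused slot capacity equally, which makes the matrix doubly stochastic.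
  set M : Matrix Y Y ℝ := fun y y' => if h : ∃ b, e b = y then d h.choose y' else
    (1 - ∑ b, d b y') / N with hM
  have hMe : ∀ b y', M (e b) y' = d b y' := by
    intro b y'
    have h : ∃ b', e b' = e b := ⟨b, rfl⟩
    simp only [hM, h, dif_pos]
    rw [e.injective h.choose_spec]
  have hMn : ∀ y y', (¬ ∃ b, e b = y) → M y y' = (1 - ∑ b, d b y') / N := by
    intro y y' h
    simp only [hM, h, dif_neg, not_false_eq_true]
  have hNpos : ∀ y, (¬ ∃ b, e b = y) → N ≠ 0 := by
    intro y hy h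
    have h1 : Fintype.card β = Fintype.card Y := by
      have : (Fintype.card Y : ℝ) = Fintype.card β := by linarith
      exact_mod_cast this.symm
    have := (Fintype.bijective_iff_injective_and_card e).2 ⟨e.injective, h1⟩
    exact hy (this.2 y)
  have hsplit : ∀ f : Y → ℝ, ∑ y, f y = ∑ b, f (e b) + ∑ y with ¬ ∃ b, e b = y, f y := by
    intro f
    rw [← sum_filter_add_sum_filter_not univ (fun y => ∃ b, e b = y)]
    congr 1
    have : (univ.filter fun y => ∃ b, e b = y) = univ.map e := by ext y; simp
    rw [this, sum_map]
  have hMds : M ∈ doublyStochastic ℝ Y := by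
    rw [mem_doublyStochastic_iff_sum]
    refine ⟨?_, ?_, ?_⟩
    · intro y y'
      by_cases h : ∃ b, e b = y
      · obtain ⟨b, rfl⟩ := h
        rw [hMe]; exact hd0 _ _
      · rw [hMn _ _ h]; exact div_nonneg (by linarith [hdcol y']) hN0
    · intro y
      by_cases h : ∃ b, e b = y
      · obtain ⟨b, rfl⟩ := h
        simp_rw [hMe]; exact hdrow b
      · simp_rw [hMn _ _ h]
        rw [← sum_div, hdtot, div_self (hNpos y h)]
    · intro y'
      rw [hsplit]
      simp_rw [hMe]
      rw [sum_congr rfl (g := fun _ => (1 - ∑ b, d b y') / N)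
        (fun y hy => hMn y y' (mem_filter.1 hy).2), sum_const, nsmul_eq_mul]
      have hc : (#{y | ¬ ∃ b, e b = y} : ℝ) = N := by
        have := hsplit (fun _ => 1)
        simp only [sum_const, nsmul_eq_mul, mul_one, card_univ] at this
        rw [hN]; linarith
      rw [hc]
      by_cases hN' : N = 0
      · rw [hN', zero_mul, add_zero]
        rw [hN'] at hdtot
        have := (sum_eq_zero_iff_of_nonneg (fun y (_ : y ∈ (univ : Finset Y)) =>
          (by linarith [hdcol y] : 0 ≤ 1 - ∑ b, d b y))).1 hdtot y' (mem_univ _)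
        linarith
      · field_simp; ring
  obtain ⟨w, hw0, hw1, hwM⟩ := exists_eq_sum_perm_of_mem_doublyStochastic hMds
  have hcost : ∑ σ : Equiv.Perm Y, w σ * ∑ b, cost b (σ (e b)).1 = ∑ b, ∑ x, ζ b x * cost b x := by
    have h1 : ∀ b, ∑ x, ζ b x * cost b x = ∑ y, M (e b) y * cost b y.1 := by
      intro b
      rw [← hdsum b (cost b)]
      simp_rw [hMe]
    simp_rw [h1, ← hwM, mul_sum]
    rw [sum_comm]
    refine sum_congr rfl fun b _ => ?_
    simp only [Matrix.sum_apply, Matrix.smul_apply, smul_eq_mul, sum_mul]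
    rw [sum_comm]
    refine sum_congr rfl fun σ _ => ?_
    rw [sum_eq_single (σ (e b))]
    · simp [Equiv.Perm.permMatrix, PEquiv.toMatrix_apply]
    · intro y _ hy
      simp [Equiv.Perm.permMatrix, PEquiv.toMatrix_apply, hy.symm]
    · simp
  -- The fractional cost is a convex combination of the costs of permutations, so some permutation
  -- does not exceed it.
  obtain ⟨σ, hσ⟩ : ∃ σ : Equiv.Perm Y, ∑ b, cost b (σ (e b)).1 ≤ ∑ b, ∑ x, ζ b x * cost b x := by
    by_contra hcon
    push Not at hcon
    have h1 : ∑ σ : Equiv.Perm Y, w σ * ∑ b, ∑ x, ζ b x * cost b x <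
        ∑ σ : Equiv.Perm Y, w σ * ∑ b, cost b (σ (e b)).1 := by
      refine sum_lt_sum (fun σ _ => mul_le_mul_of_nonneg_left (hcon σ).le (hw0 σ)) ?_
      obtain ⟨σ, -, hσ⟩ : ∃ σ ∈ (univ : Finset (Equiv.Perm Y)), 0 < w σ :=
        exists_lt_of_sum_lt (by simp [hw1])
      exact ⟨σ, mem_univ _, mul_lt_mul_of_pos_left (hcon σ) hσ⟩
    rw [hcost, ← sum_mul, hw1, one_mul] at h1
    exact lt_irrefl _ h1
  refine ⟨fun b => (σ (e b)).1, fun x => ?_, hσ⟩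
  calc #{b | (σ (e b)).1 = x} = #(({b | (σ (e b)).1 = x} : Finset β).image fun b => σ (e b)) :=
        (card_image_of_injective _ (σ.injective.comp e.injective)).symm
    _ ≤ #((univ : Finset (Fin (u x))).image fun i => (⟨x, i⟩ : Y)) := by
        refine card_le_card fun y hy => ?_
        obtain ⟨b, hb, rfl⟩ := mem_image.1 hy
        have hb' := (mem_filter.1 hb).2
        refine mem_image.2 ⟨hb' ▸ (σ (e b)).2, mem_univ _, ?_⟩
        subst hb'
        rfl
    _ ≤ u x := card_image_le.trans (by simp)

end CapMedian

/-! ### Bundles: clients merged into alternating paths. -/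

namespace CapMedian
open Finset

/-- Number of clients assigned to facility `x`. -/
def load {α γ : Type*} [DecidableEq α] [Fintype γ] (φ : γ → α) (x : α) : ℕ := #{j | φ j = x}

/-- The clients grouped into bundles: alternating paths from a facility used by `φ` to a facility
used by `ψ`. Bundle `b` leads from `src b` to `dst b`; its clients pay `s b` under `φ` and `o b`
under `ψ`. -/
structure Bundling (I : Instance ℝ) (φ ψ : Fin I.C → Fin I.F) where
  act : Finset (Fin I.C)
  src : Fin I.C → Fin I.F
  dst : Fin I.C → Fin I.F
  s : Fin I.C → ℝ
  o : Fin I.C → ℝ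
  src_mem : ∀ b ∈ act, ∃ j, φ j = src b
  dst_mem : ∀ b ∈ act, ∃ j, ψ j = dst b
  s_nonneg : ∀ b, 0 ≤ s b
  o_nonneg : ∀ b, 0 ≤ o b
  dist_le : ∀ b ∈ act, I.c (.inl (src b)) (.inl (dst b)) ≤ s b + o b
  sum_s : ∑ b ∈ act, s b = I.cost φ
  sum_o : ∑ b ∈ act, o b = I.cost ψ
  balance : ∀ x, #{b ∈ act | dst b = x} + load φ x = #{b ∈ act | src b = x} + load ψ x
  src_le : ∀ x, #{b ∈ act | src b = x} ≤ load φ x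
  -- The value `none` leaves a bundle as it is. The value `some y` moves every client of the bundle
  -- to its facility under `ψ`, except that the last client goes to `y`. Loads change only at `src
  -- b` and `y`, and the last client pays at most the additional distance from `dst b` to `y`.
  reassign : ∀ r : Fin I.C → Option (Fin I.F), ∃ χ : Fin I.C → Fin I.F,
    (∀ x, load χ x + #{b ∈ act | src b = x} = load φ x + #{b ∈ act | (r b).getD (src b) = x}) ∧
    I.cost χ ≤ I.cost φ +
      ∑ b ∈ act, (r b).elim 0 fun y => o b - s b + I.c (.inl (dst b)) (.inl y)

variable {I : Instance ℝ} {φ ψ : Fin I.C → Fin I.F}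

/-- Every client is a bundle of its own. -/
def Bundling.single (I : Instance ℝ) (φ ψ : Fin I.C → Fin I.F) : Bundling I φ ψ where
  act := univ
  src := φ
  dst := ψ
  s j := I.c (.inl (φ j)) (.inr j)
  o j := I.c (.inl (ψ j)) (.inr j)
  src_mem b _ := ⟨b, rfl⟩
  dst_mem b _ := ⟨b, rfl⟩
  s_nonneg _ := I.c_nonneg _ _
  o_nonneg _ := I.c_nonneg _ _
  dist_le b _ := by
    have := I.c_triangle (.inl (φ b)) (.inr b) (.inl (ψ b))
    rwa [I.c_symm (.inr b)] at this
  sum_s := rfl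
  sum_o := rfl
  balance x := by unfold load; rw [add_comm]
  src_le x := le_rfl
  reassign r := by
    refine ⟨fun j => (r j).getD (φ j), fun x => by unfold load; rw [add_comm], ?_⟩
    unfold Instance.cost
    rw [← sum_add_distrib]
    refine sum_le_sum fun j _ => ?_
    dsimp only
    cases h : r j with
    | none => simp
    | some y =>
      simp only [Option.getD_some, Option.elim_some]
      have := I.c_triangle (.inl y) (.inl (ψ j)) (.inr j)
      rw [I.c_symm (.inl y) (.inl (ψ j))] at this
      linarith

theorem card_filter_update_erase {γ α : Type*} [DecidableEq γ] [DecidableEq α] {A : Finset γ}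
    {b : γ} (hb : b ∈ A) (f : γ → α) (y x : α) :
    #{a ∈ A | Function.update f b y a = x} + (if f b = x then 1 else 0) =
      #{a ∈ A | f a = x} + if y = x then 1 else 0 := by
  have h : ∀ g : γ → α, #{a ∈ A | g a = x} =
      #{a ∈ A.erase b | g a = x} + if g b = x then 1 else 0 := by
    intro g
    simp only [card_filter]
    rw [← Finset.sum_erase_add A _ hb]
  have h2 : #{a ∈ A.erase b | Function.update f b y a = x} = #{a ∈ A.erase b | f a = x} := by
    congr 1
    refine filter_congr fun a ha => ?_
    rw [Function.update_of_ne (mem_erase.1 ha).1]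
  rw [h (Function.update f b y), h f, h2, Function.update_self]
  omega

theorem card_filter_erase {γ α : Type*} [DecidableEq γ] [DecidableEq α] {A : Finset γ}
    {b : γ} (hb : b ∈ A) (f : γ → α) (x : α) :
    #{a ∈ A.erase b | f a = x} + (if f b = x then 1 else 0) = #{a ∈ A | f a = x} := by
  simp only [card_filter]
  rw [← Finset.sum_erase_add A _ hb]

/-- Two consecutive bundles can be merged. -/
theorem Bundling.exists_merge (B : Bundling I φ ψ) {b₁ b₂ : Fin I.C} (h₁ : b₁ ∈ B.act)
    (h₂ : b₂ ∈ B.act) (hne : b₁ ≠ b₂) (heq : B.dst b₁ = B.src b₂) :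
    ∃ B' : Bundling I φ ψ, B'.act = B.act.erase b₂ := by
  have h1' : b₁ ∈ B.act.erase b₂ := mem_erase.2 ⟨hne, h₁⟩
  refine ⟨{
    act := B.act.erase b₂
    src := B.src
    dst := Function.update B.dst b₁ (B.dst b₂)
    s := Function.update B.s b₁ (B.s b₁ + B.s b₂)
    o := Function.update B.o b₁ (B.o b₁ + B.o b₂)
    src_mem := fun b hb => B.src_mem b (mem_of_mem_erase hb)
    dst_mem := ?_, s_nonneg := ?_, o_nonneg := ?_, dist_le := ?_, sum_s := ?_, sum_o := ?_
    balance := ?_, src_le := ?_, reassign := ?_ }, rfl⟩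
  · intro b hb
    by_cases h : b = b₁
    · subst h; simpa using B.dst_mem b₂ h₂
    · simpa [h] using B.dst_mem b (mem_of_mem_erase hb)
  · intro b
    by_cases h : b = b₁
    · subst h; simpa using add_nonneg (B.s_nonneg b) (B.s_nonneg b₂)
    · simpa [h] using B.s_nonneg b
  · intro b
    by_cases h : b = b₁
    · subst h; simpa using add_nonneg (B.o_nonneg b) (B.o_nonneg b₂)
    · simpa [h] using B.o_nonneg b
  · intro b hb
    by_cases h : b = b₁
    · subst h
      simp only [Function.update_self]
      have e1 := B.dist_le b h₁
      have e2 := B.dist_le b₂ h₂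
      have := I.c_triangle (.inl (B.src b)) (.inl (B.dst b)) (.inl (B.dst b₂))
      rw [← heq] at e2
      linarith
    · simpa [h] using B.dist_le b (mem_of_mem_erase hb)
  · rw [← B.sum_s, ← Finset.sum_erase_add _ _ h₂, sum_update_of_mem h1',
      ← Finset.sum_erase_add _ _ h1', sdiff_singleton_eq_erase]; ring
  · rw [← B.sum_o, ← Finset.sum_erase_add _ _ h₂, sum_update_of_mem h1',
      ← Finset.sum_erase_add _ _ h1', sdiff_singleton_eq_erase]; ring
  · intro x
    have e1 := card_filter_update_erase h1' B.dst (B.dst b₂) x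
    have e2 := card_filter_erase h₂ B.dst x
    have e3 := card_filter_erase h₂ B.src x
    have e4 := B.balance x
    rw [heq] at e1
    omega
  · intro x
    exact (card_le_card (filter_subset_filter _ (erase_subset _ _))).trans (B.src_le x)
  · intro r
    -- If the merged bundle moves, its first half goes to its own end, the place that the second
    -- half vacates, and the second half goes to the new target.
    let r₀ : Fin I.C → Option (Fin I.F) := fun b =>
      if b = b₂ then r b₁ else if b = b₁ then (r b₁).map fun _ => B.dst b₁ else r b
    obtain ⟨χ, hχ, hcost⟩ := B.reassign r₀
    have hr2 : r₀ b₂ = r b₁ := by simp [r₀]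
    have hr1 : r₀ b₁ = (r b₁).map fun _ => B.dst b₁ := by simp [r₀, hne]
    have hr : ∀ b, b ≠ b₁ → b ≠ b₂ → r₀ b = r b := fun b e1 e2 => by simp [r₀, e1, e2]
    refine ⟨χ, fun x => ?_, hcost.trans ?_⟩
    · have e1 := hχ x
      have e2 := card_filter_erase h₂ B.src x
      have e3 := card_filter_erase h₂ (fun b => (r₀ b).getD (B.src b)) x
      have e4 := card_filter_update_erase h1' (fun b => (r₀ b).getD (B.src b))
        ((r b₁).getD (B.src b₁)) x
      have e5 : #{a ∈ B.act.erase b₂ | Function.update (fun b => (r₀ b).getD (B.src b)) b₁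
          ((r b₁).getD (B.src b₁)) a = x} = #{b ∈ B.act.erase b₂ | (r b).getD (B.src b) = x} := by
        congr 1
        refine filter_congr fun b hb => ?_
        by_cases h : b = b₁
        · subst h; simp
        · rw [Function.update_of_ne h, hr b h (mem_erase.1 hb).1]
      rw [e5] at e4
      simp only [hr2, hr1] at e3 e4
      cases hrb : r b₁ with
      | none => simp only [hrb, Option.getD_none, Option.map_none] at e3 e4; omega
      | some y =>
        simp only [hrb, Option.getD_some, Option.map_some, heq] at e3 e4
        omega
    · have hsum : ∀ f g : Fin I.C → ℝ, (∀ b, b ≠ b₁ → b ≠ b₂ → f b = g b) → f b₁ + f b₂ = g b₁ →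
          ∑ b ∈ B.act, f b = ∑ b ∈ B.act.erase b₂, g b := by
        intro f g hfg h12
        rw [← Finset.sum_erase_add _ _ h₂, ← Finset.sum_erase_add _ _ h1',
          ← Finset.sum_erase_add _ g h1', add_assoc, h12]
        congr 1
        refine sum_congr rfl fun b hb => ?_
        rw [mem_erase, mem_erase] at hb
        exact hfg b hb.1 hb.2.1
      refine add_le_add_right (le_of_eq (hsum _ _ (fun b e1 e2 => ?_) ?_)) _
      · simp only [hr b e1 e2, Function.update_of_ne e1]
      · simp only [hr1, hr2, Function.update_self]
        cases r b₁ with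
        | none => simp
        | some y => simp [I.c_self]; ring

/-- A bundling in which no two different bundles can be merged. -/
theorem exists_maximal_bundling (I : Instance ℝ) (φ ψ : Fin I.C → Fin I.F) :
    ∃ B : Bundling I φ ψ, ∀ b₁ ∈ B.act, ∀ b₂ ∈ B.act, B.dst b₁ = B.src b₂ → b₁ = b₂ := by
  classical
  -- A bundling with the least number of bundles cannot be merged further. Closed bundles, whose two
  -- ends agree, may remain.
  have hex : ∃ n, ∃ B : Bundling I φ ψ, #B.act = n := ⟨_, Bundling.single I φ ψ, rfl⟩
  obtain ⟨B, hB⟩ := Nat.find_spec hex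
  refine ⟨B, fun b₁ h₁ b₂ h₂ heq => ?_⟩
  by_contra hne
  obtain ⟨B', hB'⟩ := B.exists_merge h₁ h₂ hne heq
  refine Nat.find_min hex (m := #B'.act) ?_ ⟨B', rfl⟩
  rw [← hB, hB']
  exact card_erase_lt_of_mem h₂

end CapMedian

/-! ### The rerouting cost of one optimal facility. -/

namespace CapMedian

section Padding

variable {ι : Type*} [Fintype ι] [DecidableEq ι] {n x : ι → ℝ} {Cap : Finset ι} {π : ι → ι → ℝ}
  {A G D : ι → ℝ}

open Finset in
theorem IsLocalPlan.eq_zero_of_full (h : IsLocalPlan n x Cap π) {s s' : ι} (hs : 0 < n s)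
    (hs' : n s' = 1) : π s s' = 0 := by
  have := h.room s s' (by linarith)
  rw [hs'] at this
  exact le_antisymm (by linarith) (h.nonneg s s')

open Finset in
/-- The change of cost caused by closing one facility is nonnegative. -/
theorem IsLocalPlan.change_nonneg (h : IsLocalPlan n x Cap π)
    (hxn : ∀ s, x s ≤ n s) (hn : ∀ s, n s ≤ 1) (hD : ∀ s, 0 ≤ D s)
    (h0 : ∀ s, x s = 0 → A s = 0 ∧ G s = 0) (hx : ∀ s, 0 ≤ x s)
    (hpair : ∀ s s', n s' < 1 → 0 < x s' → G s - A s ≤ x s * D s') {s : ι} (hs : s ∉ Cap)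
    (hw : 0 < closeWeight (n s)) : 0 ≤ A s - G s + ∑ s', π s s' * D s' := by
  have hp : 0 ≤ ∑ s', π s s' * D s' := sum_nonneg fun s' _ => mul_nonneg (h.nonneg _ _) (hD _)
  rcases (hx s).eq_or_lt with h1 | h1
  · obtain ⟨e1, e2⟩ := h0 s h1.symm
    rw [e1, e2]; linarith
  · have key : 0 ≤ ∑ s', π s s' * (A s - G s + x s * D s') := by
      refine sum_nonneg fun s' _ => ?_
      rcases (h.nonneg s s').eq_or_lt with e | e
      · rw [← e]; simp
      · have : n s' ≠ 1 := fun e' => e.ne' (h.eq_zero_of_full (h1.trans_le (hxn s)) e')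
        have := hpair s s' (lt_of_le_of_ne (hn s') this) (e.trans_le (h.le s s'))
        exact mul_nonneg e.le (by linarith)
    simp only [mul_add, sum_add_distrib, ← sum_mul, h.row s hs hw] at key
    have e : ∑ s', π s s' * (x s * D s') = x s * ∑ s', π s s' * D s' := by
      rw [mul_sum]; exact sum_congr rfl fun _ _ => by ring
    rw [e] at key
    nlinarith

open Finset in
/-- The total weighted change of cost is at most twice the optimal cost. -/
theorem IsLocalPlan.sum_change_le (h : IsLocalPlan n x Cap π)
    (hxn : ∀ s, x s ≤ n s) (hn : ∀ s, n s ≤ 1)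
    (hA : ∀ s, 0 ≤ A s) (hG : ∀ s, 0 ≤ G s)
    (h0 : ∀ s, x s = 0 → A s = 0 ∧ G s = 0) (hx : ∀ s, 0 ≤ x s)
    (hpair : ∀ s s', n s' < 1 → 0 < x s' → G s - A s ≤ x s * D s')
    (hDx : ∀ s, D s * x s ≤ A s + G s) :
    ∑ s, (if s ∈ Cap then 0 else closeWeight (n s)) * (A s - G s + ∑ s', π s s' * D s') ≤
      2 * ∑ s, A s := by
  -- Facility `s` sends away the fraction `w s` of its share and receives the fraction `v s` of its
  -- share. Both kinds of mass have the same total.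
  set w : ι → ℝ := fun s => if s ∈ Cap then 0 else closeWeight (n s) with hw
  set u : ι → ℝ := fun s' => ∑ s, w s * π s s' with hu
  set v : ι → ℝ := fun s => u s / x s with hv
  have hn0 : ∀ s, 0 ≤ n s := fun s => (hx s).trans (hxn s)
  have hw0 : ∀ s, 0 ≤ w s := fun s => by simp only [hw]; split_ifs <;> simp [closeWeight_nonneg]
  have hw1 : ∀ s, w s ≤ 1 := fun s => by
    simp only [hw]; split_ifs <;> simp [closeWeight_le_one (hn0 s)]
  have hu0 : ∀ s, 0 ≤ u s := fun s' => sum_nonneg fun s _ => mul_nonneg (hw0 s) (h.nonneg _ _)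
  have hux : ∀ s, u s ≤ x s := h.col
  have hvx : ∀ s, v s * x s = u s := fun s => by
    simp only [hv]
    rcases eq_or_ne (x s) 0 with e | e
    · rw [e, mul_zero]; have := hux s; have := hu0 s; linarith
    · rw [div_mul_cancel₀ _ e]
  have hv0 : ∀ s, 0 ≤ v s := fun s => div_nonneg (hu0 s) (hx s)
  have hv1 : ∀ s, v s ≤ 1 := fun s => div_le_one_of_le₀ (hux s) (hx s)
  have hmass : ∑ s, u s = ∑ s, w s * x s := by
    simp only [hu]
    rw [sum_comm]
    refine sum_congr rfl fun s _ => ?_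
    rw [← mul_sum]
    by_cases hs : s ∈ Cap
    · simp [hw, hs]
    · rcases (closeWeight_nonneg (n s)).eq_or_lt with e | e
      · simp [hw, hs, ← e]
      · rw [h.row s hs e]
  have hfull : ∀ s, n s = 1 → w s = 0 ∧ v s * x s = 0 := by
    intro s hs
    refine ⟨?_, ?_⟩
    · simp only [hw]; rw [hs]
      simp [closeWeight]; norm_num
    · rw [hvx]
      refine sum_eq_zero fun s' _ => ?_
      rcases (hx s').eq_or_lt with e | e
      · by_cases hc : s' ∈ Cap
        · simp [hw, hc]
        · rcases (closeWeight_nonneg (n s')).eq_or_lt with e2 | e2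
          · simp [hw, hc, ← e2]
          · have := h.row s' hc e2
            rw [← e] at this
            rw [(sum_eq_zero_iff_of_nonneg fun i _ => h.nonneg s' i).1 this s (mem_univ _), mul_zero]
      · rw [h.eq_zero_of_full (e.trans_le (hxn s')) hs, mul_zero]
  have e1 : ∑ s, w s * (A s - G s + ∑ s', π s s' * D s') =
      ∑ s, w s * (A s - G s) + ∑ s, u s * D s := by
    simp only [mul_add, sum_add_distrib, hu, sum_mul, mul_sum]
    congr 1
    rw [sum_comm]
    exact sum_congr rfl fun _ _ => sum_congr rfl fun _ _ => by ring
  have e2 : ∑ s, u s * D s ≤ ∑ s, v s * (A s + G s) := by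
    refine sum_le_sum fun s _ => ?_
    rw [← hvx s, mul_assoc, mul_comm (x s)]
    exact mul_le_mul_of_nonneg_left (hDx s) (hv0 s)
  set N : Finset ι := univ.filter fun s => n s < 1 with hN
  have hx0 : ∀ s, x s = 0 → A s = 0 ∧ G s = 0 := h0
  -- Padding: the mass that is not sent, `(1 - w s) * x s`, and the room that is not used, `(1 - v
  -- s) * x s`, have equal totals over the facilities with spare capacity. A fictitious proportional
  -- transport between them completes the plan to one in which everything is sent once and received
  -- once. For that plan the cost is at most `∑ (A - G) + ∑ (A + G) = 2 ∑ A`. Full facilities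
  -- neither send nor receive and need no padding.
  have key : ∑ s, (1 - w s) * (G s - A s) ≤ ∑ s, (1 - v s) * (A s + G s) := by
    rw [← sum_filter_add_sum_filter_not univ (fun s => n s < 1),
      ← sum_filter_add_sum_filter_not univ (fun s => n s < 1) (fun s => (1 - v s) * (A s + G s))]
    refine add_le_add ?_ ?_
    · set M := ∑ s ∈ N, (1 - w s) * x s with hM
      have hM2 : ∑ s ∈ N, (1 - v s) * x s = M := by
        have a1 := sum_filter_add_sum_filter_not univ (fun s => n s < 1) (fun s => u s)
        have a2 := sum_filter_add_sum_filter_not univ (fun s => n s < 1) (fun s => w s * x s)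
        have a3 : ∑ s with ¬ n s < 1, u s = 0 := sum_eq_zero fun s hs => by
          rw [← hvx]
          exact (hfull s (le_antisymm (hn s) (not_lt.1 (mem_filter.1 hs).2))).2
        have a4 : ∑ s with ¬ n s < 1, w s * x s = 0 := sum_eq_zero fun s hs => by
          rw [(hfull s (le_antisymm (hn s) (not_lt.1 (mem_filter.1 hs).2))).1, zero_mul]
        simp only [hM, sub_mul, one_mul, sum_sub_distrib, hvx]
        simp only [hN]
        linarith
      have hM0 : 0 ≤ M := sum_nonneg fun s _ => mul_nonneg (by linarith [hw1 s]) (hx s)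
      rcases hM0.eq_or_lt with hz | hpos
      · have z1 : ∀ s ∈ N, (1 - w s) * (G s - A s) = 0 := by
          intro s hs
          have := (sum_eq_zero_iff_of_nonneg
            fun s _ => mul_nonneg (by linarith [hw1 s]) (hx s)).1 hz.symm s hs
          rcases mul_eq_zero.1 this with e | e
          · rw [e, zero_mul]
          · rw [(h0 s e).1, (h0 s e).2]; simp
        rw [sum_eq_zero z1]
        exact sum_nonneg fun s _ => mul_nonneg (by linarith [hv1 s]) (by linarith [hA s, hG s])
      -- The common total `M` is written as the sum over senders on one side and over receivers on
      -- the other, which reduces the claim to pairs of a sender and a receiver.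
      · have pr : (∑ s ∈ N, (1 - w s) * (G s - A s)) * M ≤
            M * ∑ s ∈ N, (1 - v s) * (A s + G s) := by
          nth_rw 1 [← hM2]
          rw [hM, sum_mul_sum, sum_mul_sum]
          refine sum_le_sum fun s _ => sum_le_sum fun s' hs' => ?_
          have hs1 : n s' < 1 := (mem_filter.1 hs').2
          have pp : 0 ≤ (1 - w s) * (1 - v s') :=
            mul_nonneg (by linarith [hw1 s]) (by linarith [hv1 s'])
          have : (G s - A s) * x s' ≤ x s * (A s' + G s') := by
            rcases (hx s').eq_or_lt with e | e
            · rw [← e, mul_zero]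
              exact mul_nonneg (hx s) (by linarith [hA s', hG s'])
            · calc (G s - A s) * x s' ≤ (x s * D s') * x s' :=
                    mul_le_mul_of_nonneg_right (hpair s s' hs1 e) (hx s')
                _ = x s * (D s' * x s') := by ring
                _ ≤ _ := mul_le_mul_of_nonneg_left (hDx s') (hx s)
          calc _ = ((1 - w s) * (1 - v s')) * ((G s - A s) * x s') := by ring
            _ ≤ ((1 - w s) * (1 - v s')) * (x s * (A s' + G s')) :=
                mul_le_mul_of_nonneg_left this pp
            _ = _ := by ring
        rw [mul_comm M] at pr
        exact le_of_mul_le_mul_right pr hpos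
    · refine sum_le_sum fun s hs => ?_
      obtain ⟨f1, f2⟩ := hfull s (le_antisymm (hn s) (not_lt.1 (mem_filter.1 hs).2))
      rcases mul_eq_zero.1 f2 with e | e
      · rw [f1, e]; linarith [hA s, hG s]
      · rw [(h0 s e).1, (h0 s e).2]; simp
  calc _ = ∑ s, w s * (A s - G s) + ∑ s, u s * D s := e1
    _ ≤ ∑ s, w s * (A s - G s) + ∑ s, v s * (A s + G s) := by linarith
    _ ≤ 2 * ∑ s, A s := by
      have t1 : ∑ s, (1 - w s) * (G s - A s) =
          ∑ s, G s - ∑ s, A s + ∑ s, w s * (A s - G s) := by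
        rw [← sum_sub_distrib, ← sum_add_distrib]; exact sum_congr rfl fun _ _ => by ring
      have t2 : ∑ s, (1 - v s) * (A s + G s) =
          ∑ s, A s + ∑ s, G s - ∑ s, v s * (A s + G s) := by
        rw [← sum_add_distrib, ← sum_sub_distrib]; exact sum_congr rfl fun _ _ => by ring
      linarith

end Padding
end CapMedian

/-! ### From local plans to an assignment after one swap. -/

namespace CapMedian

section Swap
open Finset

variable {I : Instance ℝ} {φ ψ : Fin I.C → Fin I.F} (B : Bundling I φ ψ)
  {S O : Finset (Fin I.F)}

/-- Bundles leading from `s` to `o`. -/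
def Bundling.between (s o : Fin I.F) : Finset (Fin I.C) := {b ∈ B.act | B.src b = s ∧ B.dst b = o}

/-- The amount of the clients of `o` that are served by a facility `s` of `S \ O`, in units of the
capacity. -/
noncomputable def Bundling.served (S O : Finset (Fin I.F)) (o s : Fin I.F) : ℝ :=
  if s ∈ S \ O then (#(B.between s o) : ℝ) / I.U else 0

variable {B}

theorem load_eq_zero {α γ : Type*} [DecidableEq α] [Fintype γ] {φ : γ → α} {T : Finset α}
    (h : ∀ j, φ j ∈ T) {x : α} (hx : x ∉ T) : load φ x = 0 := by
  unfold load
  rw [card_eq_zero, filter_eq_empty_iff]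
  rintro j - rfl
  exact hx (h j)

theorem Bundling.src_mem_of (hφ : ∀ j, φ j ∈ S) {b : Fin I.C} (hb : b ∈ B.act) : B.src b ∈ S := by
  obtain ⟨j, hj⟩ := B.src_mem b hb; rw [← hj]; exact hφ j

theorem Bundling.dst_mem_of (hψ : ∀ j, ψ j ∈ O) {b : Fin I.C} (hb : b ∈ B.act) : B.dst b ∈ O := by
  obtain ⟨j, hj⟩ := B.dst_mem b hb; rw [← hj]; exact hψ j

theorem Bundling.card_src_eq_zero (hφ : ∀ j, φ j ∈ S) {x : Fin I.F} (hx : x ∉ S) :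
    #{b ∈ B.act | B.src b = x} = 0 := by
  rw [card_eq_zero, filter_eq_empty_iff]
  rintro b hb rfl
  exact hx (B.src_mem_of hφ hb)

theorem Bundling.card_dst_eq_zero (hψ : ∀ j, ψ j ∈ O) {x : Fin I.F} (hx : x ∉ O) :
    #{b ∈ B.act | B.dst b = x} = 0 := by
  rw [card_eq_zero, filter_eq_empty_iff]
  rintro b hb rfl
  exact hx (B.dst_mem_of hψ hb)

theorem Bundling.card_src (hψ : ∀ j, ψ j ∈ O) {x : Fin I.F} (hx : x ∉ O) :
    #{b ∈ B.act | B.src b = x} = load φ x := by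
  have := B.balance x
  rw [B.card_dst_eq_zero hψ hx, load_eq_zero hψ hx] at this
  omega

theorem Bundling.card_dst_le (B : Bundling I φ ψ) (x : Fin I.F) :
    #{b ∈ B.act | B.dst b = x} ≤ load ψ x := by
  have := B.balance x
  have := B.src_le x
  omega

/-- In a maximal bundling the bundles that arrive at a facility exclude bundles that leave it. -/
theorem Bundling.card_src_eq_zero_of_dst
    (hB : ∀ b₁ ∈ B.act, ∀ b₂ ∈ B.act, B.dst b₁ = B.src b₂ → b₁ = b₂) {b : Fin I.C}
    (hb : b ∈ B.act) (hne : B.src b ≠ B.dst b) : #{b' ∈ B.act | B.src b' = B.dst b} = 0 := by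
  rw [card_eq_zero, filter_eq_empty_iff]
  intro b' hb' h
  have := hB b hb b' hb' h.symm
  subst this
  exact hne h

variable (B) in
/-- A fractional reassignment of the bundles can be turned into an assignment. -/
theorem Bundling.exists_assignment_of_fractional {T : Finset (Fin I.F)}
    (hφ : I.IsAssignment S φ)
    (ζ : Fin I.C → Fin I.F → ℝ) (h0 : ∀ b x, 0 ≤ ζ b x) (hrow : ∀ b ∈ B.act, ∑ x, ζ b x = 1)
    (hT : ∀ x ∈ T, ∑ b ∈ B.act, ζ b x + load φ x ≤ I.U + (#{b ∈ B.act | B.src b = x} : ℝ))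
    (hT' : ∀ x ∉ T, (∀ b ∈ B.act, ζ b x = 0) ∧ load φ x = #{b ∈ B.act | B.src b = x}) :
    ∃ χ, I.IsAssignment T χ ∧ I.cost χ ≤ I.cost φ + ∑ b ∈ B.act, ∑ x, ζ b x *
      (if x = B.src b then 0 else B.o b - B.s b + I.c (.inl (B.dst b)) (.inl x)) := by
  obtain ⟨r, hr, hcost⟩ := exists_integral_assignment (β := B.act) (X := Fin I.F)
    (fun b x => ζ b x)
    (fun b x => if x = B.src b then 0 else B.o b - B.s b + I.c (.inl (B.dst b)) (.inl x))
    -- All bundles that start at `x` are taken out first, and a bundle that stays counts as one sent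
    -- to its own source. Load of `x` that starts no bundle stays in place.
    (fun x => if x ∈ T then I.U + #{b ∈ B.act | B.src b = x} - load φ x else 0)
    (fun b x => h0 b x) (fun b => hrow b b.2) (by
      intro x
      rw [sum_coe_sort B.act (fun b => ζ b x)]
      split_ifs with h
      · have := hφ.2 x
        rw [Nat.cast_sub (by unfold load; omega)]
        push_cast
        linarith [hT x h]
      · rw [sum_eq_zero (hT' x h).1]; simp)
  let r' : Fin I.C → Option (Fin I.F) := fun b =>
    if h : b ∈ B.act then (if r ⟨b, h⟩ = B.src b then none else some (r ⟨b, h⟩)) else none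
  have hr' : ∀ b (h : b ∈ B.act), (r' b).getD (B.src b) = r ⟨b, h⟩ := by
    intro b h
    simp only [r', h, dif_pos]
    split_ifs with h2
    · simp [h2]
    · simp
  obtain ⟨χ, hχ, hχc⟩ := B.reassign r'
  have hcnt : ∀ x, #{b ∈ B.act | (r' b).getD (B.src b) = x} = #{b | r b = x} := by
    intro x
    simp only [card_filter]
    rw [← sum_coe_sort B.act]
    exact sum_congr rfl fun b _ => by rw [hr' b b.2]
  have hload : ∀ x, load χ x ≤ I.U ∧ (x ∉ T → load χ x = 0) := by
    intro x
    have h1 := hχ x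
    have h2 := hr x
    rw [hcnt] at h1
    have h3 : load φ x ≤ I.U := hφ.2 x
    split_ifs at h2 with h
    · exact ⟨by have := B.src_le x; omega, fun h' => absurd h h'⟩
    · have := (hT' x h).2
      exact ⟨by omega, fun _ => by omega⟩
  refine ⟨χ, ⟨fun j => ?_, fun x => (hload x).1⟩, hχc.trans ?_⟩
  · by_contra h
    have := (hload _).2 h
    unfold load at this
    rw [card_eq_zero, filter_eq_empty_iff] at this
    exact this (mem_univ j) rfl
  · refine add_le_add_right ?_ _
    rw [← sum_coe_sort B.act (fun b => ∑ x, ζ b x * _)]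
    refine le_trans (le_of_eq ?_) hcost
    rw [← sum_coe_sort B.act]
    refine sum_congr rfl fun b _ => ?_
    simp only [r', b.2, dif_pos]
    split_ifs with h2 <;> simp

theorem Bundling.served_nonneg (o s : Fin I.F) : 0 ≤ B.served S O o s := by
  unfold Bundling.served; split_ifs <;> positivity

theorem Bundling.sum_served_le (s : Fin I.F) (K : Finset (Fin I.F)) :
    ∑ o ∈ K, B.served S O o s ≤ (load φ s : ℝ) / I.U := by
  unfold Bundling.served
  split_ifs with h
  · rw [← sum_div, ← Nat.cast_sum]
    refine div_le_div_of_nonneg_right (Nat.cast_le.2 ?_) (Nat.cast_nonneg _)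
    refine le_trans ?_ (B.src_le s)
    have : ∑ o ∈ K, #(B.between s o) = #(K.biUnion fun o => B.between s o) := by
      rw [card_biUnion]
      intro o _ o' _ hne
      refine disjoint_left.2 fun b hb hb' => hne ?_
      rw [← (mem_filter.1 hb).2.2, (mem_filter.1 hb').2.2]
    rw [this]
    refine card_le_card fun b hb => ?_
    obtain ⟨o, -, hb⟩ := mem_biUnion.1 hb
    exact mem_filter.2 ⟨(mem_filter.1 hb).1, (mem_filter.1 hb).2.1⟩
  · simp only [sum_const_zero]; positivity

theorem Bundling.sum_between (hψ : ∀ j, ψ j ∈ O) (s o : Fin I.F) (f : Fin I.C → ℝ) :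
    ∑ b ∈ B.act with (B.src b = s ∧ B.dst b ∉ S ∧ B.dst b ≠ o), f b =
      ∑ o' ∈ (O \ S).erase o, ∑ b ∈ B.between s o', f b := by
  rw [← sum_fiberwise_of_maps_to (s := {b ∈ B.act | B.src b = s ∧ B.dst b ∉ S ∧ B.dst b ≠ o})
    (t := (O \ S).erase o) (g := B.dst)]
  · refine sum_congr rfl fun o' ho' => sum_congr ?_ fun _ _ => rfl
    rw [mem_erase, mem_sdiff] at ho'
    ext b
    simp only [Bundling.between, mem_filter]
    constructor
    · rintro ⟨⟨h1, h2, -, -⟩, h3⟩; exact ⟨h1, h2, h3⟩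
    · rintro ⟨h1, h2, rfl⟩; exact ⟨⟨h1, h2, ho'.2.2, ho'.1⟩, rfl⟩
  · intro b hb
    obtain ⟨h1, h2, h3, h4⟩ := mem_filter.1 hb
    exact mem_erase.2 ⟨h4, mem_sdiff.2 ⟨B.dst_mem_of hψ h1, h3⟩⟩

set_option maxHeartbeats 800000 in
variable (B) in
/-- Cost of a single swap that closes `s` and opens `o`. -/
theorem Bundling.exists_swap_assignment (hφ : I.IsAssignment S φ) (hψ : I.IsAssignment O ψ)
    (hB : ∀ b₁ ∈ B.act, ∀ b₂ ∈ B.act, B.dst b₁ = B.src b₂ → b₁ = b₂)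
    {s o : Fin I.F} (hs : s ∈ S \ O) (ho : o ∈ O \ S) (π : Fin I.F → Fin I.F → ℝ)
    (hU : 0 < I.U)
    (h0 : ∀ o' x, 0 ≤ π o' x) (hdiag : ∀ o', π o' s = 0)
    (hrow : ∀ o' ∈ O \ S, o' ≠ o → ∑ x, π o' x = B.served S O o' s)
    (hle : ∀ o' x, π o' x ≤ B.served S O o' x)
    (hroom : ∀ o' x, x ∈ S \ O → 1 < (load φ s : ℝ) / I.U + load φ x / I.U →
      π o' x * (load φ x / I.U) ≤ (1 - load φ x / I.U) * B.served S O o' x) :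
    ∃ χ, I.IsAssignment (insert o (S.erase s)) χ ∧ I.cost χ ≤ I.cost φ +
      ∑ b ∈ B.act with B.dst b = o, (B.o b - B.s b) +
      ∑ b ∈ B.act with B.src b = s ∧ B.dst b ∈ S, (B.o b - B.s b) +
      ∑ o' ∈ (O \ S).erase o, (∑ b ∈ B.between s o', (B.o b - B.s b) +
        ∑ x, π o' x * (I.U * I.c (.inl o') (.inl x))) := by
  classical
  obtain ⟨hsS, hsO⟩ := mem_sdiff.1 hs
  obtain ⟨hoO, hoS⟩ := mem_sdiff.1 ho
  have hos : o ≠ s := fun e => hoS (e ▸ hsS)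
  have hU' : (0 : ℝ) < I.U := Nat.cast_pos.2 hU
  have hπ0 : ∀ o' x, x ∉ S \ O → π o' x = 0 := fun o' x hx => by
    have := hle o' x
    rw [Bundling.served, if_neg hx] at this
    exact le_antisymm this (h0 o' x)
  have hdiv : ∀ o' ∈ (O \ S).erase o, ∀ x,
      (#(B.between s o') : ℝ) * (π o' x / B.served S O o' s) = I.U * π o' x := by
    intro o' ho' x
    have hr := hrow o' (mem_of_mem_erase ho') (mem_erase.1 ho').1
    have hsv : B.served S O o' s = #(B.between s o') / I.U := if_pos hs
    rcases Nat.eq_zero_or_pos #(B.between s o') with e | e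
    · rw [hsv, e, Nat.cast_zero, zero_div] at hr
      rw [e, (sum_eq_zero_iff_of_nonneg fun x _ => h0 o' x).1 hr x (mem_univ x)]; simp
    · rw [hsv]
      have : (#(B.between s o') : ℝ) ≠ 0 := by positivity
      field_simp
  -- Bundles ending at `o` go to `o`. Bundles from `s` that end at an open facility are completed.
  -- Other bundles from `s` are spread according to the plan of their end, normalised by the amount
  -- that `s` serves there. All the rest stay.
  set ζ : Fin I.C → Fin I.F → ℝ := fun b x =>
    if B.dst b = o then (if x = o then 1 else 0)
    else if B.src b = s then
      (if B.dst b ∈ S then (if x = B.dst b then 1 else 0)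
        else π (B.dst b) x / B.served S O (B.dst b) s)
    else if x = B.src b then 1 else 0 with hζ
  have z1 : ∀ b x, B.dst b = o → ζ b x = if x = o then 1 else 0 := fun b x c1 => if_pos c1
  have z2 : ∀ b x, B.dst b ≠ o → B.src b = s → B.dst b ∈ S →
      ζ b x = if x = B.dst b then 1 else 0 := fun b x c1 c2 c3 => by
    simp only [hζ, if_neg c1, if_pos c2, if_pos c3]
  have z3 : ∀ b x, B.dst b ≠ o → B.src b = s → B.dst b ∉ S →
      ζ b x = π (B.dst b) x / B.served S O (B.dst b) s := fun b x c1 c2 c3 => by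
    simp only [hζ, if_neg c1, if_pos c2, if_neg c3]
  have z4 : ∀ b x, B.dst b ≠ o → B.src b ≠ s →
      ζ b x = if x = B.src b then 1 else 0 := fun b x c1 c2 => by
    simp only [hζ, if_neg c1, if_neg c2]
  have hserved : ∀ b ∈ B.act, B.src b = s → 0 < B.served S O (B.dst b) s := by
    intro b hb hbs
    rw [Bundling.served, if_pos hs]
    have : 0 < #(B.between s (B.dst b)) := card_pos.2 ⟨b, mem_filter.2 ⟨hb, hbs, rfl⟩⟩
    positivity
  have hrow1 : ∀ b ∈ B.act, B.src b = s → B.dst b ≠ o → B.dst b ∉ S →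
      ∑ x, π (B.dst b) x / B.served S O (B.dst b) s = 1 := by
    intro b hb hbs hbo hbS
    rw [← sum_div, hrow _ (mem_sdiff.2 ⟨B.dst_mem_of hψ.1 hb, hbS⟩) hbo,
      div_self (hserved b hb hbs).ne']
  have hload1 : ∀ x, load φ x ≤ I.U := hφ.2
  have hload2 : ∀ x, load ψ x ≤ I.U := hψ.2
  obtain ⟨χ, hχ, hc⟩ := B.exists_assignment_of_fractional (T := insert o (S.erase s)) hφ ζ
    (fun b x => by
      simp only [hζ]
      split_ifs
      all_goals first
        | exact zero_le_one
        | exact le_rfl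
        | exact div_nonneg (h0 _ _) (B.served_nonneg _ _))
    (fun b hb => by
      simp only [hζ]
      split_ifs with h1 h2 h3
      · simp
      · simp
      · exact hrow1 b hb h2 h1 h3
      · simp)
    (by
      intro x hx
      rcases mem_insert.1 hx with rfl | hx
      · have : ∑ b ∈ B.act, ζ b x = #{b ∈ B.act | B.dst b = x} := by
          rw [card_filter, Nat.cast_sum]
          refine sum_congr rfl fun b hb => ?_
          have h4 : x ≠ B.src b := fun e => hoS (e ▸ B.src_mem_of hφ.1 hb)
          push_cast
          by_cases c1 : B.dst b = x
          · rw [z1 b x c1, if_pos rfl, if_pos c1]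
          · rw [if_neg c1]
            by_cases c2 : B.src b = s
            · by_cases c3 : B.dst b ∈ S
              · rw [z2 b x c1 c2 c3, if_neg (Ne.symm c1)]
              · rw [z3 b x c1 c2 c3, hπ0 _ _ fun h => hoS (mem_sdiff.1 h).1, zero_div]
            · rw [z4 b x c1 c2, if_neg h4]
        rw [this, load_eq_zero hφ.1 hoS]
        have : (#{b ∈ B.act | B.dst b = x} : ℝ) ≤ I.U :=
          Nat.cast_le.2 ((B.card_dst_le x).trans (hload2 x))
        have : (0 : ℝ) ≤ #{b ∈ B.act | B.src b = x} := Nat.cast_nonneg _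
        simp only [Nat.cast_zero]; linarith
      obtain ⟨hxs, hxS⟩ := mem_erase.1 hx
      have hxo : x ≠ o := fun e => hoS (e ▸ hxS)
      by_cases hxO : x ∈ O
      · have hx0 : ∀ o', π o' x = 0 := fun o' => hπ0 o' x fun h => (mem_sdiff.1 h).2 hxO
        -- If some bundle from `s` is completed at `x`, then by maximality no bundle leaves `x`, and
        -- its final load is bounded by the one under `ψ`. Otherwise nothing new arrives at `x`.
        by_cases hex : ∃ b₁ ∈ B.act, B.src b₁ = s ∧ B.dst b₁ = x
        · obtain ⟨b₁, hb₁, e1, e2⟩ := hex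
          have hz := B.card_src_eq_zero_of_dst hB hb₁ (by rw [e1, e2]; exact hxs.symm)
          rw [e2] at hz
          have : ∑ b ∈ B.act, ζ b x ≤ #{b ∈ B.act | B.dst b = x} := by
            rw [card_filter, Nat.cast_sum]
            refine sum_le_sum fun b hb => ?_
            have h4 : x ≠ B.src b := fun e => by
              rw [card_eq_zero, filter_eq_empty_iff] at hz
              exact hz hb e.symm
            have h7 : (0 : ℝ) ≤ if B.dst b = x then 1 else 0 := by split_ifs <;> norm_num
            push_cast
            by_cases c1 : B.dst b = o
            · rw [z1 b x c1, if_neg hxo]; exact h7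
            · by_cases c2 : B.src b = s
              · by_cases c3 : B.dst b ∈ S
                · rw [z2 b x c1 c2 c3]; simp only [eq_comm]; rfl
                · rw [z3 b x c1 c2 c3, hx0, zero_div]; exact h7
              · rw [z4 b x c1 c2, if_neg h4]; exact h7
          have h5 := B.balance x
          have h6 : (#{b ∈ B.act | B.dst b = x} : ℝ) + load φ x ≤ I.U := by
            exact_mod_cast (by have := hload2 x; omega)
          have : (0 : ℝ) ≤ #{b ∈ B.act | B.src b = x} := Nat.cast_nonneg _
          linarith
        · have : ∑ b ∈ B.act, ζ b x ≤ #{b ∈ B.act | B.src b = x} := by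
            rw [card_filter, Nat.cast_sum]
            refine sum_le_sum fun b hb => ?_
            have h4 : B.src b = s → B.dst b ≠ x := fun e e' => hex ⟨b, hb, e, e'⟩
            have h7 : (0 : ℝ) ≤ if B.src b = x then 1 else 0 := by split_ifs <;> norm_num
            push_cast
            by_cases c1 : B.dst b = o
            · rw [z1 b x c1, if_neg hxo]; exact h7
            · by_cases c2 : B.src b = s
              · by_cases c3 : B.dst b ∈ S
                · rw [z2 b x c1 c2 c3, if_neg fun e => h4 c2 e.symm]; exact h7
                · rw [z3 b x c1 c2 c3, hx0, zero_div]; exact h7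
              · rw [z4 b x c1 c2]; simp only [eq_comm]; rfl
          have : (load φ x : ℝ) ≤ I.U := Nat.cast_le.2 (hload1 x)
          linarith
      · have hxSO : x ∈ S \ O := mem_sdiff.2 ⟨hxS, hxO⟩
        have hsrc := B.card_src hψ.1 hxO
        have hbound : ∑ b ∈ B.act, ζ b x ≤ #{b ∈ B.act | B.src b = x} +
            ∑ b ∈ B.act with (B.src b = s ∧ B.dst b ∉ S ∧ B.dst b ≠ o),
              π (B.dst b) x / B.served S O (B.dst b) s := by
          rw [card_filter, Nat.cast_sum, sum_filter, ← sum_add_distrib]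
          refine sum_le_sum fun b hb => ?_
          have h4 : x ≠ B.dst b := fun e => hxO (e ▸ B.dst_mem_of hψ.1 hb)
          have h5 : 0 ≤ π (B.dst b) x / B.served S O (B.dst b) s :=
            div_nonneg (h0 _ _) (B.served_nonneg _ _)
          have h7 : (0 : ℝ) ≤ if B.src b = x then 1 else 0 := by split_ifs <;> norm_num
          push_cast
          by_cases c1 : B.dst b = o
          · rw [z1 b x c1, if_neg hxo, if_neg (by tauto : ¬ (_ ∧ _ ∧ _)), add_zero]; exact h7
          · by_cases c2 : B.src b = s
            · by_cases c3 : B.dst b ∈ S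
              · rw [z2 b x c1 c2 c3, if_neg h4, if_neg (by tauto : ¬ (_ ∧ _ ∧ _)), add_zero]
                exact h7
              · rw [z3 b x c1 c2 c3, if_pos (⟨c2, c3, c1⟩ : _ ∧ _ ∧ _)]; linarith
            · rw [z4 b x c1 c2, if_neg (by tauto : ¬ (_ ∧ _ ∧ _)), add_zero]
              simp only [eq_comm]; rfl
        rw [B.sum_between hψ.1] at hbound
        have e1 : ∑ o' ∈ (O \ S).erase o, ∑ b ∈ B.between s o',
            π (B.dst b) x / B.served S O (B.dst b) s =
            I.U * ∑ o' ∈ (O \ S).erase o, π o' x := by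
          rw [mul_sum]
          refine sum_congr rfl fun o' ho' => ?_
          rw [← hdiv o' ho' x, ← nsmul_eq_mul, ← sum_const]
          refine sum_congr rfl fun b hb => ?_
          rw [(mem_filter.1 hb).2.2]
        rw [e1] at hbound
        have hn1 : (load φ x : ℝ) / I.U ≤ 1 :=
          div_le_one_of_le₀ (Nat.cast_le.2 (hload1 x)) hU'.le
        -- Either all of the load of `s` fits next to that of `x`, or the `room` inequalities are
        -- added over the optimal facilities and divided by the load of `x`, which is positive
        -- because the load of `s` is at most 1.
        have hkey : ∑ o' ∈ (O \ S).erase o, π o' x ≤ 1 - load φ x / I.U := by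
          rcases le_or_gt ((load φ s : ℝ) / I.U + load φ x / I.U) 1 with h | h
          · have : ∑ o' ∈ (O \ S).erase o, π o' x ≤ ∑ o' ∈ (O \ S).erase o, B.served S O o' s := by
              refine sum_le_sum fun o' ho' => ?_
              rw [← hrow o' (mem_of_mem_erase ho') (mem_erase.1 ho').1]
              exact single_le_sum (f := fun x => π o' x) (fun x _ => h0 o' x) (mem_univ x)
            linarith [B.sum_served_le (S := S) (O := O) s ((O \ S).erase o)]
          · have hpos : 0 < (load φ x : ℝ) / I.U := by
              have : (load φ s : ℝ) / I.U ≤ 1 :=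
                div_le_one_of_le₀ (Nat.cast_le.2 (hload1 s)) hU'.le
              linarith
            have : (∑ o' ∈ (O \ S).erase o, π o' x) * (load φ x / I.U) ≤
                (1 - load φ x / I.U) * ∑ o' ∈ (O \ S).erase o, B.served S O o' x := by
              rw [sum_mul, mul_sum]
              exact sum_le_sum fun o' _ => hroom o' x hxSO h
            have h7 := mul_le_mul_of_nonneg_left
              (B.sum_served_le (S := S) (O := O) x ((O \ S).erase o)) (sub_nonneg.2 hn1)
            exact le_of_mul_le_mul_right (this.trans h7) hpos
        have := mul_le_mul_of_nonneg_left hkey hU'.le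
        rw [mul_sub, mul_one, mul_div_cancel₀ _ hU'.ne'] at this
        linarith)
    (by
      intro x hx
      by_cases hxS : x ∈ S
      · have hxs : x = s := by
          by_contra h
          exact hx (mem_insert_of_mem (mem_erase.2 ⟨h, hxS⟩))
        subst hxs
        refine ⟨fun b hb => ?_, (B.card_src hψ.1 hsO).symm⟩
        have h4 : x ≠ B.dst b := fun e => hsO (e ▸ B.dst_mem_of hψ.1 hb)
        have h5 : x ≠ o := hos.symm
        by_cases c1 : B.dst b = o
        · rw [z1 b x c1, if_neg h5]
        · by_cases c2 : B.src b = x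
          · by_cases c3 : B.dst b ∈ S
            · rw [z2 b x c1 c2 c3, if_neg h4]
            · rw [z3 b x c1 c2 c3, hdiag, zero_div]
          · rw [z4 b x c1 c2, if_neg (Ne.symm c2)]
      · refine ⟨fun b hb => ?_, by rw [load_eq_zero hφ.1 hxS, B.card_src_eq_zero hφ.1 hxS]⟩
        have h4 : x ≠ B.src b := fun e => hxS (e ▸ B.src_mem_of hφ.1 hb)
        have h5 : x ≠ o := fun e => hx (e ▸ mem_insert_self _ _)
        have h6 : B.dst b ∈ S → x ≠ B.dst b := fun e e' => hxS (e' ▸ e)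
        have h7 : ∀ o', π o' x = 0 := fun o' => hπ0 o' x fun h => hxS (mem_sdiff.1 h).1
        by_cases c1 : B.dst b = o
        · rw [z1 b x c1, if_neg h5]
        · by_cases c2 : B.src b = s
          · by_cases c3 : B.dst b ∈ S
            · rw [z2 b x c1 c2 c3, if_neg (h6 c3)]
            · rw [z3 b x c1 c2 c3, h7, zero_div]
          · rw [z4 b x c1 c2, if_neg h4])
  refine ⟨χ, hχ, hc.trans ?_⟩
  rw [add_assoc, add_assoc]
  refine add_le_add_right (le_of_eq ?_) _
  have hval : ∀ b ∈ B.act, ∑ x, ζ b x *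
      (if x = B.src b then 0 else B.o b - B.s b + I.c (.inl (B.dst b)) (.inl x)) =
      (if B.dst b = o then B.o b - B.s b else 0) +
      ((if B.src b = s ∧ B.dst b ∈ S then B.o b - B.s b else 0) +
      if B.src b = s ∧ B.dst b ∉ S ∧ B.dst b ≠ o then B.o b - B.s b +
        ∑ x, π (B.dst b) x / B.served S O (B.dst b) s * I.c (.inl (B.dst b)) (.inl x) else 0) := by
    intro b hb
    have hsrc : B.src b ≠ o := fun e => hoS (e ▸ B.src_mem_of hφ.1 hb)
    by_cases c1 : B.dst b = o
    · have h1 : ¬ (B.src b = s ∧ B.dst b ∈ S) := by rw [c1]; tauto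
      have h2 : ¬ (B.src b = s ∧ B.dst b ∉ S ∧ B.dst b ≠ o) := by tauto
      rw [if_pos c1, if_neg h1, if_neg h2]
      simp only [hζ, if_pos c1, ite_mul, one_mul, zero_mul]
      rw [Finset.sum_ite_eq' univ o]
      simp [hsrc.symm, c1, I.c_self]
    · by_cases c2 : B.src b = s
      · by_cases c3 : B.dst b ∈ S
        · have h4 : B.dst b ≠ B.src b := by
            rw [c2]; exact fun e => hsO (e ▸ B.dst_mem_of hψ.1 hb)
          rw [if_neg c1, if_pos ⟨c2, c3⟩, if_neg (by tauto)]
          simp only [hζ, if_neg c1, if_pos c2, if_pos c3, ite_mul, one_mul, zero_mul]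
          rw [Finset.sum_ite_eq' univ (B.dst b)]
          simp [h4, I.c_self]
        · rw [if_neg c1, if_neg (by tauto), if_pos ⟨c2, c3, c1⟩]
          simp only [hζ, if_neg c1, if_pos c2, if_neg c3, zero_add]
          have : ∀ x, π (B.dst b) x / B.served S O (B.dst b) s *
              (if x = B.src b then 0 else B.o b - B.s b + I.c (.inl (B.dst b)) (.inl x)) =
              π (B.dst b) x / B.served S O (B.dst b) s * (B.o b - B.s b) +
              π (B.dst b) x / B.served S O (B.dst b) s * I.c (.inl (B.dst b)) (.inl x) := by
            intro x
            split_ifs with h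
            · rw [h, c2, hdiag]; simp
            · ring
          simp only [this, sum_add_distrib]
          rw [← sum_mul, hrow1 b hb c2 c1 c3, one_mul]
      · rw [if_neg c1, if_neg (by tauto), if_neg (by tauto)]
        simp only [hζ, if_neg c1, if_neg c2, ite_mul, one_mul, zero_mul]
        rw [Finset.sum_ite_eq' univ (B.src b)]
        simp
  rw [sum_congr rfl hval, sum_add_distrib, sum_add_distrib, ← sum_filter, ← sum_filter,
    ← sum_filter, B.sum_between hψ.1]
  congr 2
  refine sum_congr rfl fun o' ho' => ?_
  rw [sum_add_distrib]
  congr 1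
  rw [sum_comm]
  refine sum_congr rfl fun x _ => ?_
  have : ∀ b ∈ B.between s o', π (B.dst b) x / B.served S O (B.dst b) s *
      I.c (.inl (B.dst b)) (.inl x) = π o' x / B.served S O o' s * I.c (.inl o') (.inl x) :=
    fun b hb => by rw [(mem_filter.1 hb).2.2]
  rw [sum_congr rfl this, sum_const, nsmul_eq_mul, ← mul_assoc, hdiv o' ho' x]
  ring

end Swap
end CapMedian

/-! ### Consequences of optimal assignments, and the count of closing weights. -/

namespace CapMedian

section Analysis
open Finset

variable {I : Instance ℝ} {φ ψ : Fin I.C → Fin I.F} (B : Bundling I φ ψ)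
  {S O : Finset (Fin I.F)}

/-- Rerouting a single bundle to a facility with spare capacity does not reduce the cost. -/
theorem Bundling.reroute_nonneg (hφ : I.IsOptAssignment S φ) {b : Fin I.C} (hb : b ∈ B.act)
    {y : Fin I.F} (hy : y ∈ S) (hload : load φ y < I.U ∨ y = B.src b) :
    0 ≤ B.o b - B.s b + I.c (.inl (B.dst b)) (.inl y) := by
  classical
  obtain ⟨χ, hχ, hc⟩ := B.reassign (Function.update (fun _ => none) b (some y))
  have hcount : ∀ x, load χ x + (if B.src b = x then 1 else 0) =
      load φ x + if y = x then 1 else 0 := by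
    intro x
    have h1 := hχ x
    have h2 := card_filter_update_erase hb B.src y x
    have h3 : #{a ∈ B.act | ((Function.update (fun _ => none) b (some y) :
        Fin I.C → Option (Fin I.F)) a).getD (B.src a) = x} =
        #{a ∈ B.act | Function.update B.src b y a = x} := by
      congr 1
      refine filter_congr fun a _ => ?_
      by_cases h : a = b
      · subst h; simp
      · simp [Function.update_of_ne h]
    rw [h3] at h1
    omega
  have hle : ∀ x, load φ x ≤ I.U := hφ.1.2
  have hassign : I.IsAssignment S χ := by
    refine ⟨fun j => ?_, fun x => ?_⟩
    · by_contra h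
      have h1 := hcount (χ j)
      rw [load_eq_zero hφ.1.1 h, if_neg (fun e : y = χ j => h (e ▸ hy))] at h1
      have : load χ (χ j) = 0 := by omega
      unfold load at this
      rw [card_eq_zero, filter_eq_empty_iff] at this
      exact this (mem_univ j) rfl
    · change load χ x ≤ I.U
      have h1 := hcount x
      have h2 := hle x
      by_cases e : y = x
      · subst e
        rcases hload with h | h
        · rw [if_pos rfl] at h1; omega
        · rw [if_pos rfl, if_pos h.symm] at h1; omega
      · rw [if_neg e] at h1; omega
  have h := (hφ.2 χ hassign).trans hc
  rw [← Finset.sum_erase_add _ _ hb, sum_eq_zero, Function.update_self] at h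
  · simpa using h
  · intro a ha
    rw [Function.update_of_ne (mem_erase.1 ha).1]; rfl

/-- Such a bundle can be completed without any swap: its end has spare capacity under `φ`, since no
bundle leaves it and it has more clients under `ψ`. If the bundle is closed, completing it does not
change any load. -/
theorem Bundling.le_of_dst_mem (hφ : I.IsOptAssignment S φ) (hψ : I.IsAssignment O ψ)
    (hB : ∀ b₁ ∈ B.act, ∀ b₂ ∈ B.act, B.dst b₁ = B.src b₂ → b₁ = b₂) {b : Fin I.C}
    (hb : b ∈ B.act) (hS : B.dst b ∈ S) : B.s b ≤ B.o b := by
  have h := B.reroute_nonneg hφ hb hS (by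
    by_cases e : B.dst b = B.src b
    · exact Or.inr e
    · left
      have h1 := B.card_src_eq_zero_of_dst hB hb (Ne.symm e)
      have h2 := B.balance (B.dst b)
      have h3 : 0 < #{b' ∈ B.act | B.dst b' = B.dst b} :=
        card_pos.2 ⟨b, mem_filter.2 ⟨hb, rfl⟩⟩
      have h4 : load ψ (B.dst b) ≤ I.U := hψ.2 _
      omega)
  rw [I.c_self] at h
  linarith

/-- The loads in units of the capacity; facilities outside `S \ O` count as full. -/
noncomputable def relLoad (S O : Finset (Fin I.F)) (φ : Fin I.C → Fin I.F) (s : Fin I.F) : ℝ :=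
  if s ∈ S \ O then (load φ s : ℝ) / I.U else 1

theorem Bundling.served_le_relLoad (o s : Fin I.F) : B.served S O o s ≤ relLoad S O φ s := by
  unfold relLoad
  split_ifs with h
  · simpa using B.sum_served_le (S := S) (O := O) s {o}
  · unfold Bundling.served; rw [if_neg h]; norm_num

theorem relLoad_le_one (hφ : I.IsAssignment S φ) (s : Fin I.F) : relLoad S O φ s ≤ 1 := by
  unfold relLoad
  split_ifs with h
  · exact div_le_one_of_le₀ (Nat.cast_le.2 (hφ.2 s)) (Nat.cast_nonneg _)
  · rfl

theorem Bundling.sum_served_dst_le (hψ : I.IsAssignment O ψ) (o : Fin I.F) :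
    ∑ s, B.served S O o s ≤ 1 := by
  have h1 : ∑ s, B.served S O o s ≤ ∑ s, (#(B.between s o) : ℝ) / I.U := by
    refine sum_le_sum fun s _ => ?_
    unfold Bundling.served
    split_ifs
    · rfl
    · positivity
  refine h1.trans ?_
  rw [← sum_div, ← Nat.cast_sum]
  refine div_le_one_of_le₀ (Nat.cast_le.2 ?_) (Nat.cast_nonneg _)
  refine le_trans ?_ ((B.card_dst_le o).trans (hψ.2 o))
  rw [card_eq_sum_card_fiberwise (f := B.src) (t := univ) (fun _ _ => mem_univ _)]
  refine sum_le_sum fun s _ => card_le_card fun b hb => ?_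
  obtain ⟨h1, h2, h3⟩ := mem_filter.1 hb
  exact mem_filter.2 ⟨mem_filter.2 ⟨h1, h3⟩, h2⟩

/-- Counting: the weights with which facilities are to be closed suffice. -/
theorem Bundling.card_add_surplus_le (hψ : I.IsAssignment O ψ)
    (hk : #O ≤ I.k) (hS : 8 * I.k ≤ 3 * #S + 2) (hU : 0 < I.U) :
    (#(O \ S) : ℝ) - 2 / 3 +
      ∑ o ∈ O \ S, (5 / 3 - ∑ s, loadShare (relLoad S O φ s) * B.served S O o s) ≤
      ∑ s, closeWeight (relLoad S O φ s) := by
  have hU' : (0 : ℝ) < I.U := Nat.cast_pos.2 hU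
  set n := relLoad S O φ with hn
  have hn0 : ∀ s, 0 ≤ n s := fun s => (B.served_nonneg s s).trans (B.served_le_relLoad s s)
  have h1 : ∑ s ∈ S \ O, closeWeight (n s) ≤ ∑ s, closeWeight (n s) :=
    sum_le_univ_sum_of_nonneg fun s => closeWeight_nonneg _
  -- The load of `s` that belongs to optimal facilities in `S ∩ O`. It is charged at the full rate
  -- `5/3`; in total it is at most the capacity of `S ∩ O`.
  set E : Fin I.F → ℕ := fun s => #{b ∈ B.act | B.src b = s ∧ B.dst b ∈ S} with hE
  have hns : ∀ s ∈ S \ O, n s = ∑ o ∈ O \ S, B.served S O o s + (E s : ℝ) / I.U := by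
    intro s hs
    have e1 : load φ s = ∑ o ∈ O \ S, #(B.between s o) + E s := by
      rw [← B.card_src hψ.1 (mem_sdiff.1 hs).2,
        ← card_filter_add_card_filter_not (s := {b ∈ B.act | B.src b = s})
          (fun b => B.dst b ∈ S), filter_filter, filter_filter, add_comm]
      congr 1
      rw [card_eq_sum_card_fiberwise (f := B.dst) (t := O \ S)]
      · refine sum_congr rfl fun o ho => ?_
        congr 1
        ext b
        simp only [mem_filter, Bundling.between]
        constructor
        · rintro ⟨⟨a1, a2, a3⟩, a4⟩; exact ⟨a1, a2, a4⟩
        · rintro ⟨a1, a2, rfl⟩; exact ⟨⟨a1, a2, (mem_sdiff.1 ho).2⟩, rfl⟩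
      · intro b hb
        obtain ⟨a1, a2, a3⟩ := mem_filter.1 hb
        exact mem_coe.2 (mem_sdiff.2 ⟨B.dst_mem_of hψ.1 a1, a3⟩)
    have e2 : ∀ o ∈ O \ S, B.served S O o s = (#(B.between s o) : ℝ) / I.U :=
      fun o _ => if_pos hs
    rw [sum_congr rfl e2, hn, relLoad, if_pos hs, e1, ← sum_div, ← add_div]
    push_cast; rfl
  have hEsum : ∑ s ∈ S \ O, E s ≤ #(S ∩ O) * I.U := by
    have a1 : ∑ s ∈ S \ O, E s ≤ #{b ∈ B.act | B.dst b ∈ S ∩ O} := by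
      rw [card_eq_sum_card_fiberwise (f := B.src) (t := univ) (fun _ _ => mem_univ _)]
      refine le_trans (sum_le_univ_sum_of_nonneg fun _ => Nat.zero_le _) ?_
      refine sum_le_sum fun s _ => card_le_card fun b hb => ?_
      obtain ⟨a1, a2, a3⟩ := mem_filter.1 hb
      exact mem_filter.2 ⟨mem_filter.2 ⟨a1, mem_inter.2 ⟨a3, B.dst_mem_of hψ.1 a1⟩⟩, a2⟩
    refine a1.trans ?_
    rw [card_eq_sum_card_fiberwise (f := B.dst) (t := S ∩ O)
      (fun b hb => mem_coe.2 (mem_filter.1 hb).2), ← smul_eq_mul]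
    refine sum_le_card_nsmul _ _ _ fun y hy => ?_
    refine le_trans (card_le_card fun b hb => ?_) ((B.card_dst_le y).trans (hψ.2 y))
    rw [mem_filter, mem_filter] at hb
    exact mem_filter.2 ⟨hb.1.1, hb.2⟩
  have hweight : ∀ s ∈ S \ O, 1 - ∑ o ∈ O \ S, loadShare (n s) * B.served S O o s -
      5 / 3 * ((E s : ℝ) / I.U) ≤ closeWeight (n s) := by
    intro s hs
    rw [closeWeight_eq]
    have e := hns s hs
    have e2 : loadShare (n s) * n s = loadShare (n s) * (∑ o ∈ O \ S, B.served S O o s) +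
        loadShare (n s) * ((E s : ℝ) / I.U) := by rw [← mul_add, ← e]
    rw [e2, mul_sum]
    have : loadShare (n s) * ((E s : ℝ) / I.U) ≤ 5 / 3 * ((E s : ℝ) / I.U) :=
      mul_le_mul_of_nonneg_right (loadShare_le _) (by positivity)
    linarith
  have h2 := (sum_le_sum hweight).trans h1
  simp only [sum_sub_distrib, sum_const, nsmul_eq_mul, mul_one] at h2 ⊢
  rw [← mul_sum, ← sum_div, ← Nat.cast_sum] at h2
  have h3 : ((∑ s ∈ S \ O, E s : ℕ) : ℝ) / I.U ≤ #(S ∩ O) := by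
    rw [div_le_iff₀ hU']; exact_mod_cast hEsum
  have h4 : ∑ s ∈ S \ O, ∑ o ∈ O \ S, loadShare (n s) * B.served S O o s =
      ∑ o ∈ O \ S, ∑ s, loadShare (n s) * B.served S O o s := by
    rw [sum_comm]
    refine sum_congr rfl fun o _ => sum_subset (subset_univ _) fun s _ hs => ?_
    rw [Bundling.served, if_neg hs, mul_zero]
  rw [h4] at h2
  have h5 : #(S \ O) + #(S ∩ O) = #S := card_sdiff_add_card_inter S O
  have h6 : #(O \ S) + #(S ∩ O) = #O := by rw [inter_comm]; exact card_sdiff_add_card_inter O S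
  -- Every common facility contributes `8/3` on the left and `1` on the right. The difference `5/3`
  -- pays for the load charged to it.
  have h7 : (8 : ℝ) * (#(O \ S) + #(S ∩ O)) ≤ 3 * (#(S \ O) + #(S ∩ O)) + 2 := by
    have : 8 * (#(O \ S) + #(S ∩ O)) ≤ 3 * (#(S \ O) + #(S ∩ O)) + 2 := by omega
    exact_mod_cast this
  linarith

end Analysis
end CapMedian

/-! ### Averaging the inequalities of the single swaps. -/

namespace CapMedian

section Analysis
open Finset

variable {I : Instance ℝ} {φ ψ : Fin I.C → Fin I.F} (B : Bundling I φ ψ)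
  {S O : Finset (Fin I.F)}

/-- Cost under `ψ` of the bundles from `s` to `o`, for a facility `s` of `S \ O`. -/
noncomputable def Bundling.optPart (S O : Finset (Fin I.F)) (o s : Fin I.F) : ℝ :=
  if s ∈ S \ O then ∑ b ∈ B.between s o, B.o b else 0

/-- Cost under `φ` of the bundles from `s` to `o`, for a facility `s` of `S \ O`. -/
noncomputable def Bundling.locPart (S O : Finset (Fin I.F)) (o s : Fin I.F) : ℝ :=
  if s ∈ S \ O then ∑ b ∈ B.between s o, B.s b else 0

theorem Bundling.optPart_nonneg (o s : Fin I.F) : 0 ≤ B.optPart S O o s := by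
  unfold Bundling.optPart; split_ifs
  · exact sum_nonneg fun b _ => B.o_nonneg b
  · rfl

theorem Bundling.locPart_nonneg (o s : Fin I.F) : 0 ≤ B.locPart S O o s := by
  unfold Bundling.locPart; split_ifs
  · exact sum_nonneg fun b _ => B.s_nonneg b
  · rfl

theorem Bundling.parts_eq_zero (hU : 0 < I.U) {o s : Fin I.F} (h : B.served S O o s = 0) :
    B.optPart S O o s = 0 ∧ B.locPart S O o s = 0 := by
  unfold Bundling.optPart Bundling.locPart
  unfold Bundling.served at h
  split_ifs at h ⊢ with hs
  · have hU' : (I.U : ℝ) ≠ 0 := by positivity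
    have : #(B.between s o) = 0 := by
      rcases div_eq_zero_iff.1 h with h | h
      · exact_mod_cast h
      · exact absurd h hU'
    rw [card_eq_zero.1 this]; simp
  · simp

/-- Any one of these bundles could be rerouted to `s'`, which has spare capacity. The resulting
inequalities are added. -/
theorem Bundling.locPart_sub_optPart_le (hφ : I.IsOptAssignment S φ) (hU : 0 < I.U)
    {o s s' : Fin I.F} (h : relLoad S O φ s' < 1) : B.locPart S O o s - B.optPart S O o s ≤
      B.served S O o s * (I.U * I.c (.inl o) (.inl s')) := by
  unfold relLoad at h
  split_ifs at h with hs'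
  · unfold Bundling.optPart Bundling.locPart Bundling.served
    split_ifs with hs
    · have hU' : (I.U : ℝ) ≠ 0 := by positivity
      have : (#(B.between s o) : ℝ) / I.U * (I.U * I.c (.inl o) (.inl s')) =
          #(B.between s o) * I.c (.inl o) (.inl s') := by field_simp
      rw [this, ← nsmul_eq_mul, ← sum_const, ← sum_sub_distrib]
      refine sum_le_sum fun b hb => ?_
      obtain ⟨h1, h2, rfl⟩ := mem_filter.1 hb
      have := B.reroute_nonneg hφ h1 (mem_sdiff.1 hs').1 (Or.inl (by
        rw [div_lt_one (by positivity)] at h; exact_mod_cast h))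
      linarith
    · simp
  · exact absurd h (lt_irrefl _)

theorem Bundling.dist_mul_served_le (hU : 0 < I.U) (o s : Fin I.F) :
    I.U * I.c (.inl o) (.inl s) * B.served S O o s ≤ B.optPart S O o s + B.locPart S O o s := by
  unfold Bundling.optPart Bundling.locPart Bundling.served
  split_ifs with hs
  · have hU' : (I.U : ℝ) ≠ 0 := by positivity
    have : I.U * I.c (.inl o) (.inl s) * ((#(B.between s o) : ℝ) / I.U) =
        #(B.between s o) * I.c (.inl o) (.inl s) := by field_simp
    rw [this, ← nsmul_eq_mul, ← sum_const, ← sum_add_distrib]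
    refine sum_le_sum fun b hb => ?_
    obtain ⟨h1, rfl, rfl⟩ := mem_filter.1 hb
    have := B.dist_le b h1
    rw [I.c_symm (.inl (B.src b)) (.inl (B.dst b))] at this
    linarith
  · simp

theorem Bundling.sum_dst_notMem (hψ : ∀ j, ψ j ∈ O) (f : Fin I.C → ℝ) :
    ∑ o ∈ O \ S, ∑ b ∈ B.act with B.dst b = o, f b = ∑ b ∈ B.act with B.dst b ∉ S, f b := by
  rw [← sum_fiberwise_of_maps_to (s := {b ∈ B.act | B.dst b ∉ S}) (t := O \ S) (g := B.dst)]
  · refine sum_congr rfl fun o ho => sum_congr ?_ fun _ _ => rfl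
    ext b
    simp only [mem_filter]
    constructor
    · rintro ⟨h1, rfl⟩; exact ⟨⟨h1, (mem_sdiff.1 ho).2⟩, rfl⟩
    · rintro ⟨⟨h1, -⟩, h2⟩; exact ⟨h1, h2⟩
  · intro b hb
    obtain ⟨h1, h2⟩ := mem_filter.1 hb
    exact mem_sdiff.2 ⟨B.dst_mem_of hψ h1, h2⟩

theorem Bundling.sum_optPart_le (hψ : ∀ j, ψ j ∈ O) :
    ∑ o ∈ O \ S, ∑ s, B.optPart S O o s ≤ ∑ b ∈ B.act with B.dst b ∉ S, B.o b := by
  rw [← B.sum_dst_notMem hψ]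
  refine sum_le_sum fun o _ => ?_
  have h1 : ∑ s, B.optPart S O o s ≤ ∑ s, ∑ b ∈ B.between s o, B.o b := by
    refine sum_le_sum fun s _ => ?_
    unfold Bundling.optPart
    split_ifs
    · rfl
    · exact sum_nonneg fun b _ => B.o_nonneg b
  refine h1.trans (le_of_eq ?_)
  rw [← sum_fiberwise_of_maps_to (s := {b ∈ B.act | B.dst b = o}) (t := univ) (g := B.src)
    (fun _ _ => mem_univ _)]
  refine sum_congr rfl fun s _ => sum_congr ?_ fun _ _ => rfl
  ext b
  simp only [mem_filter, Bundling.between]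
  tauto

set_option maxHeartbeats 800000 in
/-- If no single swap reduces the cost by more than `δ`, then the cost is about three times the
cost of any solution that opens at most `k` facilities. -/
theorem cost_le_of_swaps (hφ : I.IsOptAssignment S φ) (hψ : I.IsAssignment O ψ)
    (hk : #O ≤ I.k) (hS : 8 * I.k ≤ 3 * #S + 2) (hU : 0 < I.U) (hm : 4 < #(O \ S)) {δ : ℝ}
    (hswap : ∀ s ∈ S \ O, ∀ o ∈ O \ S, ∀ χ, I.IsAssignment (insert o (S.erase s)) χ →
      I.cost φ - δ ≤ I.cost χ) :
    I.cost φ ≤ (3 + 2 * (2 / ((#(O \ S) : ℝ) - 4))) * I.cost ψ + #(O \ S) * δ := by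
  classical
  obtain ⟨B, hB⟩ := exists_maximal_bundling I φ ψ
  have hU' : (0 : ℝ) < I.U := Nat.cast_pos.2 hU
  set n := relLoad S O φ with hn
  have hn1 : ∀ s, n s ≤ 1 := relLoad_le_one hφ.1
  have hxn : ∀ o s, B.served S O o s ≤ n s := fun o s => B.served_le_relLoad o s
  have hx0 : ∀ o s, 0 ≤ B.served S O o s := fun o s => B.served_nonneg o s
  have hn0 : ∀ s, 0 ≤ n s := fun s => (hx0 s s).trans (hxn s s)
  have hplan : ∀ o : Fin I.F, ∃ Cap π, IsLocalPlan n (B.served S O o) Cap π := fun o =>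
    exists_localPlan (hx0 o) (hxn o) hn1 (B.sum_served_dst_le hψ o)
  choose Cap π hπ using hplan
  have hcardκ : Fintype.card (O \ S : Finset _) = #(O \ S) := Fintype.card_coe _
  set η : ℝ := 2 / ((#(O \ S) : ℝ) - 4) with hη
  have hm' : (4 : ℝ) < #(O \ S) := by exact_mod_cast hm
  have hη0 : 0 ≤ η := div_nonneg (by norm_num) (by linarith)
  -- Facilities outside `S \ O` count as full and have closing weight 0, so they never take part in
  -- a swap.
  obtain ⟨ω, hω0, hω1, hωw, hωC⟩ := exists_swap_weights (κ := (O \ S : Finset (Fin I.F))) n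
    (fun o s => B.served S O o s)
    (fun o => 5 / 3 - ∑ s, loadShare (n s) * B.served S O o s) (fun o => Cap o) hn0
    (fun o s => hx0 o s)
    (fun s => by
      rw [sum_coe_sort (O \ S) (fun o => B.served S O o s)]
      by_cases hs : s ∈ S \ O
      · have := B.sum_served_le (S := S) (O := O) s (O \ S)
        simpa only [hn, relLoad, if_pos hs] using this
      · simp only [Bundling.served, if_neg hs, sum_const_zero]; exact hn0 s)
    (fun o => by
      have : ∑ s, loadShare (n s) * B.served S O o s ≤ ∑ s, 5 / 3 * B.served S O o s :=
        sum_le_sum fun s _ => mul_le_mul_of_nonneg_right (loadShare_le _) (hx0 o s)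
      rw [← mul_sum] at this
      linarith [B.sum_served_dst_le (S := S) hψ o])
    (fun o s hs => (hπ o).cap s hs) (fun o => (hπ o).card)
    (by
      rw [hcardκ, sum_coe_sort (O \ S)
        (fun o => 5 / 3 - ∑ s, loadShare (n s) * B.served S O o s)]
      exact B.card_add_surplus_le hψ hk hS hU)
    (by rw [hcardκ]; exact hm)
  rw [hcardκ, ← hη] at hωw
  have hωpos : ∀ s o, ω s o ≠ 0 → 0 < closeWeight (n s) ∧ s ∈ S \ O := by
    intro s o hne
    have h1 : 0 < ω s o := lt_of_le_of_ne (hω0 s o) hne.symm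
    have h2 : 0 < closeWeight (n s) := by
      by_contra h
      have h3 : closeWeight (n s) = 0 := le_antisymm (not_lt.1 h) (closeWeight_nonneg _)
      have h4 := (single_le_sum (f := fun o => ω s o) (fun o _ => hω0 s o) (mem_univ o)).trans
        (hωw s)
      rw [h3, mul_zero] at h4
      exact absurd h1 (not_lt.2 h4)
    refine ⟨h2, ?_⟩
    by_contra hs
    rw [closeWeight_pos_iff] at h2
    simp only [hn, relLoad, if_neg hs] at h2
    norm_num at h2
  set D : Fin I.F → Fin I.F → ℝ := fun o x => I.U * I.c (.inl o) (.inl x) with hD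
  have hD0 : ∀ o x, 0 ≤ D o x := fun o x => mul_nonneg hU'.le (I.c_nonneg _ _)
  set E : Fin I.F → Fin I.F → ℝ := fun s o =>
    B.optPart S O o s - B.locPart S O o s + ∑ x, π o s x * D o x with hE
  have hE0 : ∀ o s, s ∉ Cap o → 0 < closeWeight (n s) → 0 ≤ E s o := fun o s hs hw =>
    (hπ o).change_nonneg (hxn o) hn1 (hD0 o) (fun s h => B.parts_eq_zero hU h) (hx0 o)
      (fun s s' h _ => B.locPart_sub_optPart_le hφ hU h) hs hw
  have hEsum : ∀ o, ∑ s, (if s ∈ Cap o then 0 else closeWeight (n s)) * E s o ≤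
      2 * ∑ s, B.optPart S O o s := fun o =>
    (hπ o).sum_change_le (hxn o) hn1 (fun s => B.optPart_nonneg o s)
      (fun s => B.locPart_nonneg o s) (fun s h => B.parts_eq_zero hU h) (hx0 o)
      (fun s s' h _ => B.locPart_sub_optPart_le hφ hU h) (B.dist_mul_served_le hU o)
  set G : Fin I.F → ℝ := fun o => ∑ b ∈ B.act with B.dst b = o, (B.o b - B.s b) with hG
  set H : Fin I.F → ℝ := fun s =>
    ∑ b ∈ B.act with B.src b = s ∧ B.dst b ∈ S, (B.o b - B.s b) with hH
  have hH0 : ∀ s, 0 ≤ H s := fun s => sum_nonneg fun b hb => by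
    obtain ⟨h1, -, h2⟩ := mem_filter.1 hb
    linarith [B.le_of_dst_mem hφ hψ hB h1 h2]
  -- The inequality of one swap: `G` is the gain from opening `o`, `H` comes from completing bundles
  -- that end in `S`, and `E` from rerouting the bundles of every other optimal facility.
  have hineq : ∀ s, ∀ o : (O \ S : Finset (Fin I.F)), ω s o * (-δ) ≤
      ω s o * G o + ω s o * H s +
        ∑ o' : (O \ S : Finset (Fin I.F)), if o' = o then 0 else ω s o * E s o' := by
    intro s o
    rcases eq_or_ne (ω s o) 0 with h | h
    · rw [h]; simp
    · obtain ⟨hw, hs⟩ := hωpos s o h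
      obtain ⟨χ, hχ, hc⟩ := B.exists_swap_assignment hφ.1 hψ hB hs o.2 (fun o' x => π o' s x) hU
        (fun o' x => (hπ o').nonneg s x) (fun o' => (hπ o').diag s)
        (fun o' ho' hne => (hπ o').row s
          (fun hC => hne (congrArg Subtype.val (hωC s o ⟨o', ho'⟩ h hC))) hw)
        (fun o' x => (hπ o').le s x)
        (fun o' x hx hlt => by
          have := (hπ o').room s x
          simp only [hn, relLoad, if_pos hs, if_pos hx] at this
          exact this hlt)
      have h1 := hswap s hs o o.2 χ hχ
      have h2 : ∑ o' ∈ (O \ S).erase o, (∑ b ∈ B.between s o', (B.o b - B.s b) +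
          ∑ x, π o' s x * (I.U * I.c (.inl o') (.inl x))) =
          ∑ o' : (O \ S : Finset (Fin I.F)), if o' = o then 0 else E s o' := by
        have e1 : ∀ o' : (O \ S : Finset (Fin I.F)), (if o' = o then 0 else E s o') =
            if (o' : Fin I.F) = o then 0 else E s o' := fun o' => by
          simp only [Subtype.ext_iff]
        rw [sum_congr rfl fun o' _ => e1 o',
          sum_coe_sort (O \ S) (fun o' => if o' = (o : Fin I.F) then 0 else E s o'),
          ← add_sum_erase _ _ o.2, if_pos rfl, zero_add]
        refine sum_congr rfl fun o' ho' => ?_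
        rw [if_neg (mem_erase.1 ho').1]
        simp only [hE, Bundling.optPart, Bundling.locPart, if_pos hs, hD, sum_sub_distrib]
      rw [h2] at hc
      have h3 : -δ ≤ G o + H s +
          ∑ o' : (O \ S : Finset (Fin I.F)), if o' = o then 0 else E s o' := by
        simp only [hG, hH]; linarith
      have h4 := mul_le_mul_of_nonneg_left h3 (hω0 s o)
      simp only [mul_add, mul_sum, mul_ite, mul_zero] at h4
      exact h4
  have hsum := sum_le_sum fun s (_ : s ∈ univ) => sum_le_sum fun o (_ : o ∈ univ) => hineq s o
  simp only [sum_add_distrib] at hsum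
  have t0 : ∑ s, ∑ o, ω s o * (-δ) = -(#(O \ S) * δ) := by
    rw [sum_comm]
    simp only [← sum_mul, hω1, sum_const, card_univ, hcardκ, nsmul_eq_mul, mul_one]
    ring
  have t1 : ∑ s, ∑ o : (O \ S : Finset (Fin I.F)), ω s o * G o =
      ∑ b ∈ B.act with B.dst b ∉ S, (B.o b - B.s b) := by
    rw [sum_comm]
    simp only [← sum_mul, hω1, one_mul]
    rw [sum_coe_sort (O \ S) G, hG, B.sum_dst_notMem hψ.1]
  have t2 : ∑ s, ∑ o, ω s o * H s ≤ (1 + η) * ∑ b ∈ B.act with B.dst b ∈ S, (B.o b - B.s b) := by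
    have e : ∑ b ∈ B.act with B.dst b ∈ S, (B.o b - B.s b) = ∑ s, H s := by
      rw [← sum_fiberwise_of_maps_to (s := {b ∈ B.act | B.dst b ∈ S}) (t := univ) (g := B.src)
        (fun _ _ => mem_univ _)]
      refine sum_congr rfl fun s _ => sum_congr ?_ fun _ _ => rfl
      ext b; simp only [mem_filter]; tauto
    rw [e, mul_sum]
    refine sum_le_sum fun s _ => ?_
    rw [← sum_mul]
    refine mul_le_mul_of_nonneg_right ((hωw s).trans ?_) (hH0 s)
    have := closeWeight_le_one (hn0 s)
    nlinarith
  -- If `s` conflicts with `o'`, it is closed only together with opening `o'`, and then the term is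
  -- absent. Otherwise the terms are nonnegative and the total weight of closing `s` is at most `1 +
  -- η` times its closing weight.
  have t3 : ∑ s, ∑ o, ∑ o' : (O \ S : Finset (Fin I.F)),
      (if o' = o then 0 else ω s o * E s o') ≤
      (1 + η) * (2 * ∑ b ∈ B.act with B.dst b ∉ S, B.o b) := by
    have e1 : ∀ s, ∀ o' : (O \ S : Finset (Fin I.F)),
        ∑ o, (if o' = o then 0 else ω s o * E s o') ≤
        (1 + η) * ((if s ∈ Cap o' then 0 else closeWeight (n s)) * E s o') := by
      intro s o'
      by_cases hC : s ∈ Cap o'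
      · rw [if_pos hC, zero_mul, mul_zero]
        refine (sum_eq_zero fun o _ => ?_).le
        split_ifs with h
        · rfl
        · by_cases hz : ω s o = 0
          · rw [hz, zero_mul]
          · exact absurd (hωC s o o' hz hC) h
      · rw [if_neg hC]
        rcases (closeWeight_nonneg (n s)).eq_or_lt with hw | hw
        · rw [← hw, zero_mul, mul_zero]
          refine (sum_eq_zero fun o _ => ?_).le
          split_ifs
          · rfl
          · by_cases hz : ω s o = 0
            · rw [hz, zero_mul]
            · exact absurd (hωpos s o hz).1 (by rw [← hw]; exact lt_irrefl _)
        · have hEs := hE0 o' s hC hw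
          calc ∑ o, (if o' = o then 0 else ω s o * E s o') ≤ ∑ o, ω s o * E s o' := by
                refine sum_le_sum fun o _ => ?_
                split_ifs
                · exact mul_nonneg (hω0 s o) hEs
                · rfl
            _ = (∑ o, ω s o) * E s o' := by rw [sum_mul]
            _ ≤ ((1 + η) * closeWeight (n s)) * E s o' :=
                mul_le_mul_of_nonneg_right (hωw s) hEs
            _ = _ := by ring
    calc _ = ∑ s, ∑ o' : (O \ S : Finset (Fin I.F)),
          ∑ o, (if o' = o then 0 else ω s o * E s o') := sum_congr rfl fun s _ => sum_comm
      _ ≤ ∑ s, ∑ o' : (O \ S : Finset (Fin I.F)),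
          (1 + η) * ((if s ∈ Cap o' then 0 else closeWeight (n s)) * E s o') :=
        sum_le_sum fun s _ => sum_le_sum fun o' _ => e1 s o'
      _ = (1 + η) * ∑ o' ∈ O \ S,
          ∑ s, (if s ∈ Cap o' then 0 else closeWeight (n s)) * E s o' := by
        rw [sum_comm, mul_sum, ← sum_coe_sort (O \ S)]
        exact sum_congr rfl fun o' _ => by rw [mul_sum]
      _ ≤ (1 + η) * (2 * ∑ b ∈ B.act with B.dst b ∉ S, B.o b) := by
        refine mul_le_mul_of_nonneg_left ?_ (by linarith)
        refine (sum_le_sum fun o _ => hEsum o).trans ?_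
        rw [← mul_sum]
        exact mul_le_mul_of_nonneg_left (B.sum_optPart_le hψ.1) (by norm_num)
  have c1 : I.cost φ = ∑ b ∈ B.act with B.dst b ∈ S, B.s b +
      ∑ b ∈ B.act with B.dst b ∉ S, B.s b := by
    rw [← B.sum_s, sum_filter_add_sum_filter_not]
  have c2 : I.cost ψ = ∑ b ∈ B.act with B.dst b ∈ S, B.o b +
      ∑ b ∈ B.act with B.dst b ∉ S, B.o b := by
    rw [← B.sum_o, sum_filter_add_sum_filter_not]
  have c3 : 0 ≤ ∑ b ∈ B.act with B.dst b ∈ S, B.s b := sum_nonneg fun b _ => B.s_nonneg b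
  have c4 : 0 ≤ ∑ b ∈ B.act with B.dst b ∈ S, B.o b := sum_nonneg fun b _ => B.o_nonneg b
  rw [sum_sub_distrib] at t1 t2
  rw [t0, t1] at hsum
  rw [c1, c2]
  -- Optimal cost of bundles ending outside `S` occurs once from opening and `2 (1 + η)` times from
  -- rerouting. That of bundles ending in `S` occurs `1 + η` times.
  nlinarith [mul_nonneg hη0 c3, mul_nonneg hη0 c4]

end Analysis
end CapMedian

/-! ### Local optima are within a factor of about three. -/

namespace CapMedian

section LocalOptimum
open Finset

theorem Instance.exists_isOptAssignment {R : Type} [CommSemiring R] [LinearOrder R]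
    (I : Instance R) {T : Finset (Fin I.F)} (h : ∃ χ, I.IsAssignment T χ) :
    ∃ χ, I.IsOptAssignment T χ := by
  obtain ⟨χ, h1, h2⟩ := Set.exists_min_image {χ | I.IsAssignment T χ} I.cost (Set.toFinite _) h
  exact ⟨χ, h1, h2⟩

theorem Instance.cost_nonneg (I : Instance ℝ) (φ : Fin I.C → Fin I.F) : 0 ≤ I.cost φ :=
  sum_nonneg fun _ _ => I.c_nonneg _ _

/-- The stopping rule speaks of optimal assignments after a swap; any other assignment costs at
least as much. A violation would also be a strict decrease, so the first condition of a step comes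
for free. -/
theorem Instance.IsLocalOpt.le_of_multiSwap {I : Instance ℝ} {p q : ℕ} {s : I.State}
    (h : I.IsLocalOpt p q s) {T : Finset (Fin I.F)} (hT : MultiSwap p s.1 T)
    {χ : Fin I.C → Fin I.F} (hχ : I.IsAssignment T χ) :
    (q : ℝ) * I.cost s.2 ≤ q * I.cost χ + I.cost s.2 := by
  obtain ⟨χ', h1⟩ := I.exists_isOptAssignment ⟨χ, hχ⟩
  have h2 := h.2 (T, χ')
  have h3 : (q : ℝ) * I.cost χ' ≤ q * I.cost χ :=
    mul_le_mul_of_nonneg_left (h1.2 χ hχ) (Nat.cast_nonneg _)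
  have h4 := I.cost_nonneg s.2
  by_contra hlt
  push Not at hlt
  refine h2 ⟨hT, h1, ?_, by linarith⟩
  have h5 : (q : ℝ) * I.cost χ' < q * I.cost s.2 := by linarith
  exact lt_of_mul_lt_mul_left h5 (Nat.cast_nonneg _)

theorem multiSwap_insert_erase {N p : ℕ} (hp : 1 ≤ p) {S : Finset (Fin N)} {s o : Fin N}
    (hs : s ∈ S) (ho : o ∉ S) : MultiSwap p S (insert o (S.erase s)) :=
  ⟨{o}, {s}, singleton_subset_iff.2 hs, disjoint_singleton_left.2 ho, rfl, hp, by
    rw [sdiff_singleton_eq_erase, union_comm, singleton_union]⟩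

/-- All of `O \ S` is opened and equally many facilities outside `O` are closed. After that the
assignment of `O` can be used as it is. -/
theorem exists_multiSwap_superset {N p : ℕ} {S O : Finset (Fin N)} (hcard : #O ≤ #S)
    (hp : #(O \ S) ≤ p) : ∃ T, MultiSwap p S T ∧ O ⊆ T := by
  have h1 : #(O \ S) ≤ #(S \ O) := by
    have h5 : #(S \ O) + #(S ∩ O) = #S := card_sdiff_add_card_inter S O
    have h6 : #(O \ S) + #(S ∩ O) = #O := by rw [inter_comm]; exact card_sdiff_add_card_inter O S
    omega
  obtain ⟨B, hB, hBc⟩ := exists_subset_card_eq h1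
  refine ⟨_, ⟨O \ S, B, hB.trans sdiff_subset, sdiff_disjoint, hBc.symm, hBc ▸ hp, rfl⟩,
    fun o ho => ?_⟩
  by_cases h : o ∈ S
  · exact mem_union_left _ (mem_sdiff.2 ⟨h, fun hb => (mem_sdiff.1 (hB hb)).2 ho⟩)
  · exact mem_union_right _ (mem_sdiff.2 ⟨ho, h⟩)

/-- Local optima are within a factor `3 + 1 / e` of every solution with at most `k` facilities. -/
theorem Instance.IsLocalOpt.cost_le {I : Instance ℝ} {e : ℕ} (he : 1 ≤ e) {s : I.State}
    (h : I.IsLocalOpt (40 * e) (40 * (I.F + I.C) * e + 1) s)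
    (hcard : #s.1 = min (8 * I.k / 3) I.F) {O : Finset (Fin I.F)} {ψ : Fin I.C → Fin I.F}
    (hO : #O ≤ I.k) (hψ : I.IsAssignment O ψ) : I.cost s.2 ≤ (3 + 1 / (e : ℝ)) * I.cost ψ := by
  obtain ⟨S, φ⟩ := s
  dsimp only at *
  have he' : (1 : ℝ) ≤ e := by exact_mod_cast he
  have hφ0 := I.cost_nonneg φ
  have hψ0 := I.cost_nonneg ψ
  have hone : 0 ≤ 1 / (e : ℝ) := by positivity
  have hfac : I.cost ψ ≤ (3 + 1 / (e : ℝ)) * I.cost ψ := by nlinarith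
  rcases Nat.eq_zero_or_pos I.C with hC | hC
  · have : I.cost φ = 0 := by
      unfold Instance.cost
      refine sum_eq_zero fun j _ => ?_
      exact absurd j.2 (by omega)
    rw [this]; positivity
  have hU : 0 < I.U := by
    refine lt_of_lt_of_le ?_ (hψ.2 (ψ ⟨0, hC⟩))
    exact card_pos.2 ⟨⟨0, hC⟩, mem_filter.2 ⟨mem_univ _, rfl⟩⟩
  have hS0 : #S ≤ I.F := by simpa using card_le_univ S
  rcases Nat.lt_or_ge #S I.F with hSF | hSF
  swap
  · have : S = univ := by
      rw [← card_eq_iff_eq_univ]; simp only [Fintype.card_fin]; omega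
    exact (h.1.2 ψ ⟨fun j => this ▸ mem_univ _, hψ.2⟩).trans hfac
  have hSk : #S = 8 * I.k / 3 := by omega
  -- Few missing facilities are swapped in at once. With many, the errors `2 / (m - 4)` and `m / q`
  -- of the averaging argument are of order `1 / e`.
  rcases le_or_gt #(O \ S) (40 * e) with hm | hm
  · obtain ⟨T, hT, hOT⟩ := exists_multiSwap_superset (S := S) (O := O) (by omega) hm
    have h1 := h.le_of_multiSwap hT (χ := ψ) ⟨fun j => hOT (hψ.1 j), hψ.2⟩
    dsimp only at h1
    have hq : (1 : ℝ) ≤ ((I.F + I.C : ℕ) : ℝ) * e := by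
      have : 1 ≤ (I.F + I.C) * e := Nat.mul_pos (by omega) he
      exact_mod_cast this
    push_cast at h1 hq
    generalize hX : ((I.F : ℝ) + I.C) * e = X at hq
    have h2 : 40 * ((I.F : ℝ) + I.C) * e = 40 * X := by rw [← hX]; ring
    rw [h2] at h1
    have h3 : 40 * X * I.cost φ ≤ (40 * X + 1) * I.cost ψ := by linarith
    have h4 : (40 * X + 1) * I.cost ψ ≤ 40 * X * (3 * I.cost ψ) := by nlinarith
    have h5 : I.cost φ ≤ 3 * I.cost ψ := le_of_mul_le_mul_left (h3.trans h4) (by linarith)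
    nlinarith
  · have hmF : #(O \ S) ≤ I.F := by simpa using card_le_univ (O \ S)
    set m := #(O \ S) with hmdef
    set q : ℕ := 40 * (I.F + I.C) * e + 1 with hq
    have hq0 : (0 : ℝ) < q := by positivity
    have key := cost_le_of_swaps (S := S) (φ := φ) (δ := I.cost φ / q) h.1 hψ hO (by omega) hU (by omega)
      (fun s hs o ho χ hχ => by
        have h1 := h.le_of_multiSwap (multiSwap_insert_erase (by omega) (mem_sdiff.1 hs).1
          (mem_sdiff.1 ho).2) hχ
        dsimp only at h1
        have h2 : (q : ℝ) * (I.cost φ - I.cost φ / q) = q * I.cost φ - I.cost φ := by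
          field_simp
        refine le_of_mul_le_mul_left ?_ hq0
        rw [h2]; linarith)
    rw [← hmdef] at key
    have h40 : (40 : ℝ) * e + 1 ≤ m := by exact_mod_cast hm
    -- This is why `q` is proportional to `(F + C) * e`: the loss `cost / q` is incurred up to `m ≤
    -- F` times and must stay below the fraction `1 / (40 e)` of the cost.
    have h1 : (m : ℝ) * (40 * e) ≤ q := by
      have : m * (40 * e) ≤ q := by
        rw [hq]
        calc m * (40 * e) ≤ (I.F + I.C) * (40 * e) := Nat.mul_le_mul_right _ (by omega)
          _ ≤ _ := by rw [mul_comm 40 (I.F + I.C), mul_assoc]; omega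
      exact_mod_cast this
    have h2 : (m : ℝ) * (I.cost φ / q) ≤ I.cost φ * (1 / (40 * e)) := by
      rw [mul_div_assoc', mul_one_div, div_le_div_iff₀ hq0 (by positivity)]
      nlinarith
    set t : ℝ := 1 / (e : ℝ) with ht
    have ht1 : t ≤ 1 := by rw [ht, div_le_one (by linarith)]; exact he'
    have ht2 : 1 / (40 * (e : ℝ)) = t / 40 := by rw [ht]; field_simp
    have h3 : 2 / ((m : ℝ) - 4) ≤ 2 * t / 37 := by
      rw [ht, div_le_div_iff₀ (by linarith) (by norm_num)]
      have : 2 * (1 / (e : ℝ)) * (m - 4) ≥ 2 * (1 / (e : ℝ)) * (37 * e) := by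
        refine mul_le_mul_of_nonneg_left (by linarith) (by positivity)
      have h5 : 2 * (1 / (e : ℝ)) * (37 * e) = 74 := by field_simp; norm_num
      linarith
    rw [ht2] at h2
    have h4 : (3 + 2 * (2 / ((m : ℝ) - 4))) * I.cost ψ ≤ (3 + 4 * t / 37) * I.cost ψ :=
      mul_le_mul_of_nonneg_right (by linarith) hψ0
    have h5 : I.cost φ * (1 - t / 40) ≤ (3 + 4 * t / 37) * I.cost ψ := by linarith
    have h6 : (3 + 4 * t / 37) ≤ (1 - t / 40) * (3 + t) := by nlinarith
    have h7 : I.cost φ * (1 - t / 40) ≤ ((3 + t) * I.cost ψ) * (1 - t / 40) := by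
      refine h5.trans ?_
      calc _ ≤ ((1 - t / 40) * (3 + t)) * I.cost ψ := mul_le_mul_of_nonneg_right h6 hψ0
        _ = _ := by ring
    exact le_of_mul_le_mul_right h7 (by linarith)

end LocalOptimum
end CapMedian

namespace CapMedian

/-! ### A small imperative language with bounded loops -/

/-- Scalar variables. -/
inductive Var : Type
  | nF | nC | nK | nU | i | j | t | w | bs | bi | bj | fnd | done | j0 | tot | sc | rc | cnt | dif
  | y | found
  deriving DecidableEq

/-- Arrays. -/
inductive Arr : Type
  | row | cur | sol | best | asg | sasg | rasg | dual | price | load | reach | alt | idx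
  deriving DecidableEq

def Var.code : Var → ℕ
  | nF => 0 | nC => 1 | nK => 2 | nU => 3 | i => 4 | j => 5 | t => 6 | w => 7 | bs => 8 | bi => 9
  | bj => 10 | fnd => 11 | done => 12 | j0 => 13 | tot => 14 | sc => 15 | rc => 16 | cnt => 17
  | dif => 18 | y => 19 | found => 20

def Var.decode : ℕ → Var
  | 0 => nF | 1 => nC | 2 => nK | 3 => nU | 4 => i | 5 => j | 6 => t | 7 => w | 8 => bs | 9 => bi
  | 10 => bj | 11 => fnd | 12 => done | 13 => j0 | 14 => tot | 15 => sc | 16 => rc | 17 => cnt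
  | 18 => dif | 19 => y | _ => found

theorem Var.code_injective : Function.Injective Var.code :=
  Function.LeftInverse.injective (g := Var.decode) fun x => by cases x <;> rfl

/-- The arrays are interleaved above the input and output block: entry `i` of the array with code
`k` is cell `B + 16 i + k`. The factor 16 is obtained by four doublings. -/
def Arr.code : Arr → ℕ
  | row => 0 | cur => 1 | sol => 2 | best => 3 | asg => 4 | sasg => 5 | rasg => 6 | dual => 7
  | price => 8 | load => 9 | reach => 10 | alt => 11 | idx => 12

def Arr.decode : ℕ → Arr
  | 0 => row | 1 => cur | 2 => sol | 3 => best | 4 => asg | 5 => sasg | 6 => rasg | 7 => dual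
  | 8 => price | 9 => load | 10 => reach | 11 => alt | _ => idx

theorem Arr.code_injective : Function.Injective Arr.code :=
  Function.LeftInverse.injective (g := Arr.decode) fun x => by cases x <;> rfl

theorem Arr.code_lt (k : Arr) : k.code < 16 := by cases k <;> decide

/-- States: scalar variables, arrays, and the memory block that holds input and output. -/
structure St where
  v : Var → ℕ
  a : Arr → ℕ → ℕ
  low : ℕ → ℕ

def St.setV (s : St) (x : Var) (y : ℕ) : St := { s with v := Function.update s.v x y }
def St.setA (s : St) (k : Arr) (i y : ℕ) : St :=
  { s with a := Function.update s.a k (Function.update (s.a k) i y) }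
def St.setL (s : St) (i y : ℕ) : St := { s with low := Function.update s.low i y }

@[simp] theorem St.setV_v (s : St) (x : Var) (y : ℕ) : (s.setV x y).v = Function.update s.v x y := rfl
@[simp] theorem St.setV_a (s : St) (x : Var) (y : ℕ) : (s.setV x y).a = s.a := rfl
@[simp] theorem St.setV_low (s : St) (x : Var) (y : ℕ) : (s.setV x y).low = s.low := rfl
@[simp] theorem St.setA_v (s : St) (k : Arr) (i y : ℕ) : (s.setA k i y).v = s.v := rfl
@[simp] theorem St.setA_a (s : St) (k : Arr) (i y : ℕ) :
    (s.setA k i y).a = Function.update s.a k (Function.update (s.a k) i y) := rfl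
@[simp] theorem St.setA_low (s : St) (k : Arr) (i y : ℕ) : (s.setA k i y).low = s.low := rfl
@[simp] theorem St.setL_v (s : St) (i y : ℕ) : (s.setL i y).v = s.v := rfl
@[simp] theorem St.setL_a (s : St) (i y : ℕ) : (s.setL i y).a = s.a := rfl
@[simp] theorem St.setL_low (s : St) (i y : ℕ) :
    (s.setL i y).low = Function.update s.low i y := rfl

/-- Expressions. -/
inductive Ex : Type
  | c (k : ℕ)
  | v (x : Var)
  | add (e f : Ex)
  | sub (e f : Ex)
  | rd (k : Arr) (e : Ex)
  | lo (e : Ex)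

/-- Value of an expression; `B` is the size of the input and output block. -/
def Ex.ev (B : ℕ) : Ex → St → ℕ
  | c k, _ => k
  | v x, s => s.v x
  | add e f, s => e.ev B s + f.ev B s
  | sub e f, s => e.ev B s - f.ev B s
  | rd k e, s => s.a k (e.ev B s)
  | lo e, s => if e.ev B s < B then s.low (e.ev B s) else 0

/-- Commands. -/
inductive Com : Type
  | skip
  | set (x : Var) (e : Ex)
  | wr (k : Arr) (e f : Ex)
  | wlo (e f : Ex)
  | seq (P Q : Com)
  | ite (e : Ex) (P Q : Com)
  | loop (x : Var) (P : Com)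

/-- Bounded iteration. -/
def iterFrom (f : ℕ → St → St) : ℕ → St → St
  | 0, s => s
  | k + 1, s => f k (iterFrom f k s)

/-- The effect of a command; all loops run `n` times. -/
def Com.ev (n B : ℕ) : Com → St → St
  | skip, s => s
  | set x e, s => s.setV x (e.ev B s)
  | wr k e f, s => s.setA k (e.ev B s) (f.ev B s)
  | wlo e f, s => if e.ev B s < B then s.setL (e.ev B s) (f.ev B s) else s
  | seq P Q, s => Q.ev n B (P.ev n B s)
  | ite e P Q, s => if e.ev B s ≠ 0 then P.ev n B s else Q.ev n B s
  | loop x P, s => iterFrom (fun i s => P.ev n B (s.setV x i)) n s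

/-! ### Compilation -/

/-- The number `d` is the height of the evaluation stack. The value ends up in register `3d + 4`,
and `3d + 7` is the next stack cell. -/
def Ex.comp : Ex → ℕ → Prog
  | c k, d => .const (3 * d + 4) k
  | v x, d => .add (3 * d + 4) (3 * x.code + 3) 2
  | add e f, d => .seq (e.comp d) (.seq (f.comp (d + 1)) (.add (3 * d + 4) (3 * d + 4) (3 * d + 7)))
  | sub e f, d => .seq (e.comp d) (.seq (f.comp (d + 1)) (.sub (3 * d + 4) (3 * d + 4) (3 * d + 7)))
  | rd k e, d => .seq (e.comp d) (.seq (.add (3 * d + 4) (3 * d + 4) (3 * d + 4))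
      (.seq (.add (3 * d + 4) (3 * d + 4) (3 * d + 4)) (.seq (.add (3 * d + 4) (3 * d + 4) (3 * d + 4))
      (.seq (.add (3 * d + 4) (3 * d + 4) (3 * d + 4)) (.seq (.add (3 * d + 4) (3 * d + 4) 1)
      (.seq (.const (3 * d + 7) k.code) (.seq (.add (3 * d + 4) (3 * d + 4) (3 * d + 7))
      (.load (3 * d + 4) (3 * d + 4)))))))))
  | lo e, d => .seq (e.comp d) (.seq (.sub (3 * d + 7) 1 (3 * d + 4))
      (.ite (3 * d + 7) (.load (3 * d + 4) (3 * d + 4)) (.const (3 * d + 4) 0)))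

def Ex.cost : Ex → ℕ
  | c _ => 1
  | v _ => 1
  | add e f => e.cost + f.cost + 1
  | sub e f => e.cost + f.cost + 1
  | rd _ e => e.cost + 8
  | lo e => e.cost + 3

/-- The number `l` is the loop nesting level. The counter of a loop is kept in register `3l + 5`,
apart from the program variable, so a loop body may overwrite that variable. -/
def Com.comp : Com → ℕ → Prog
  | skip, _ => .const 4 0
  | set x e, _ => .seq (e.comp 0) (.add (3 * x.code + 3) 4 2)
  | wr k e f, _ => .seq (e.comp 0) (.seq (f.comp 1) (.seq (.add 4 4 4) (.seq (.add 4 4 4)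
      (.seq (.add 4 4 4) (.seq (.add 4 4 4) (.seq (.add 4 4 1) (.seq (.const 10 k.code)
      (.seq (.add 4 4 10) (.store 4 7)))))))))
  | wlo e f, _ => .seq (e.comp 0) (.seq (f.comp 1) (.seq (.sub 10 1 4)
      (.ite 10 (.store 4 7) (.const 10 0))))
  | seq P Q, l => .seq (P.comp l) (Q.comp l)
  | ite e P Q, l => .seq (e.comp 0) (.ite 4 (P.comp l) (Q.comp l))
  | loop x P, l => .seq (.const (3 * l + 5) 0) (.seq (.sub 4 0 (3 * l + 5)) (.while 4
      (.seq (.add (3 * x.code + 3) (3 * l + 5) 2) (.seq (P.comp (l + 1))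
        (.seq (.const 4 1) (.seq (.add (3 * l + 5) (3 * l + 5) 4) (.sub 4 0 (3 * l + 5))))))))

/-- A bound on the number of machine steps. -/
def Com.cost (n : ℕ) : Com → ℕ
  | skip => 1
  | set _ e => e.cost + 1
  | wr _ e f => e.cost + f.cost + 8
  | wlo e f => e.cost + f.cost + 3
  | seq P Q => P.cost n + Q.cost n
  | ite e P Q => e.cost + (P.cost n + Q.cost n) + 1
  | loop _ P => n * (P.cost n + 5) + 3

/-- The machine configuration `σ` represents the state `s`. -/
structure Rep (n B : ℕ) (s : St) (σ : Config) : Prop where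
  rn : σ.reg 0 = n
  rB : σ.reg 1 = B
  rz : σ.reg 2 = 0
  rv : ∀ x, σ.reg (3 * x.code + 3) = s.v x
  ra : ∀ (k : Arr) i, σ.mem (B + 16 * i + k.code) = s.a k i
  rl : ∀ i < B, σ.mem i = s.low i

theorem Rep.of_eq {n B : ℕ} {s : St} {σ τ : Config} (h : Rep n B s σ) (hm : τ.mem = σ.mem)
    (hr : ∀ r, r % 3 = 0 ∨ r < 3 → τ.reg r = σ.reg r) : Rep n B s τ where
  rn := by rw [hr 0 (by omega), h.rn]
  rB := by rw [hr 1 (by omega), h.rB]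
  rz := by rw [hr 2 (by omega), h.rz]
  rv x := by rw [hr (3 * x.code + 3) (by omega), h.rv]
  ra k i := by rw [hm, h.ra]
  rl i hi := by rw [hm, h.rl i hi]

@[simp] theorem Config.setReg_mem (σ : Config) (x y : ℕ) : (σ.setReg x y).mem = σ.mem := rfl
@[simp] theorem Config.setReg_reg (σ : Config) (x y r : ℕ) :
    (σ.setReg x y).reg r = if r = x then y else σ.reg r := by
  simp [Config.setReg, Function.update_apply]
@[simp] theorem Config.setMem_reg (σ : Config) (x y : ℕ) : (σ.setMem x y).reg = σ.reg := rfl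
@[simp] theorem Config.setMem_mem (σ : Config) (x y r : ℕ) :
    (σ.setMem x y).mem r = if r = x then y else σ.mem r := by
  simp [Config.setMem, Function.update_apply]

/-- Evaluation only touches stack cells from height `d` upwards, so variables, loop counters and
pending intermediate values survive. -/
theorem Ex.comp_correct {n B : ℕ} {s : St} (e : Ex) : ∀ (d : ℕ) (σ : Config), Rep n B s σ →
    ∃ t τ, Exec (e.comp d) σ t τ ∧ t ≤ e.cost ∧ τ.mem = σ.mem ∧ τ.reg (3 * d + 4) = e.ev B s ∧
      ∀ r, r % 3 ≠ 1 ∨ r < 3 * d + 4 → τ.reg r = σ.reg r := by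
  induction e with
  | c k =>
    intro d σ h
    exact ⟨_, _, Exec.const _ _ _, le_rfl, rfl, by simp [Ex.ev], fun r hr => by
      simp only [Config.setReg_reg]; rw [if_neg (by omega)]⟩
  | v x =>
    intro d σ h
    exact ⟨_, _, Exec.add _ _ _ _, le_rfl, rfl, by simp [Ex.ev, h.rv, h.rz], fun r hr => by
      simp only [Config.setReg_reg]; rw [if_neg (by omega)]⟩
  | add e f ihe ihf =>
    intro d σ h
    obtain ⟨t, τ, h1, h2, h3, h4, h5⟩ := ihe d σ h
    obtain ⟨t', τ', h1', h2', h3', h4', h5'⟩ := ihf (d + 1) τ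
      (h.of_eq h3 fun r hr => h5 r (by omega))
    refine ⟨_, _, .seq h1 (.seq h1' (.add _ _ _ _)), by simp only [Ex.cost]; omega,
      by simp [h3, h3'], ?_, fun r hr => ?_⟩
    · have e1 : 3 * (d + 1) + 4 = 3 * d + 7 := by ring
      rw [e1] at h4'
      simp [Ex.ev, h4', h5' (3 * d + 4) (by omega), h4]
    · simp only [Config.setReg_reg]
      rw [if_neg (by omega), h5' r (by omega), h5 r hr]
  | sub e f ihe ihf =>
    intro d σ h
    obtain ⟨t, τ, h1, h2, h3, h4, h5⟩ := ihe d σ h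
    obtain ⟨t', τ', h1', h2', h3', h4', h5'⟩ := ihf (d + 1) τ
      (h.of_eq h3 fun r hr => h5 r (by omega))
    refine ⟨_, _, .seq h1 (.seq h1' (.sub _ _ _ _)), by simp only [Ex.cost]; omega,
      by simp [h3, h3'], ?_, fun r hr => ?_⟩
    · have e1 : 3 * (d + 1) + 4 = 3 * d + 7 := by ring
      rw [e1] at h4'
      simp [Ex.ev, h4', h5' (3 * d + 4) (by omega), h4]
    · simp only [Config.setReg_reg]
      rw [if_neg (by omega), h5' r (by omega), h5 r hr]
  | rd k e ihe =>
    intro d σ h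
    obtain ⟨t, τ, h1, h2, h3, h4, h5⟩ := ihe d σ h
    refine ⟨_, _, .seq h1 (.seq (.add _ _ _ _) (.seq (.add _ _ _ _) (.seq (.add _ _ _ _)
      (.seq (.add _ _ _ _) (.seq (.add _ _ _ _) (.seq (.const _ _ _) (.seq (.add _ _ _ _)
      (.load _ _ _)))))))), by simp only [Ex.cost]; omega, by simp [h3], ?_, fun r hr => ?_⟩
    · have e1 : τ.reg 1 = B := by rw [h5 1 (by omega), h.rB]
      simp [Ex.ev, h4, e1, h3]
      rw [← h.ra k]
      congr 1; ring
    · simp only [Config.setReg_reg]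
      split_ifs <;> first | omega | exact h5 r hr
  | lo e ihe =>
    intro d σ h
    obtain ⟨t, τ, h1, h2, h3, h4, h5⟩ := ihe d σ h
    have e1 : τ.reg 1 = B := by rw [h5 1 (by omega), h.rB]
    by_cases hlt : e.ev B s < B
    · refine ⟨_, _, .seq h1 (.seq (.sub _ _ _ _) (.ite_true ?_ (.load _ _ _))),
        by simp only [Ex.cost]; omega, by simp [h3], ?_, fun r hr => ?_⟩
      · simp [e1, h4]; omega
      · simp [Ex.ev, h4, h3, hlt, h.rl _ hlt]
      · simp only [Config.setReg_reg]
        split_ifs <;> first | omega | exact h5 r hr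
    · refine ⟨_, _, .seq h1 (.seq (.sub _ _ _ _) (.ite_false ?_ (.const _ _ _))),
        by simp only [Ex.cost]; omega, by simp [h3], ?_, fun r hr => ?_⟩
      · simp [e1, h4]; omega
      · simp [Ex.ev, hlt]
      · simp only [Config.setReg_reg]
        split_ifs <;> first | omega | exact h5 r hr

/-- The last clause, that counters of enclosing loops are preserved, is what carries the induction
through nested loops. -/
theorem Com.comp_correct {n B : ℕ} (P : Com) : ∀ (l : ℕ) (s : St) (σ : Config), Rep n B s σ →
    ∃ t τ, Exec (P.comp l) σ t τ ∧ t ≤ P.cost n ∧ Rep n B (P.ev n B s) τ ∧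
      ∀ r < l, τ.reg (3 * r + 5) = σ.reg (3 * r + 5) := by
  induction P with
  | skip =>
    intro l s σ h
    refine ⟨_, _, .const _ _ _, le_rfl, h.of_eq rfl fun r hr => ?_, fun r hr => ?_⟩ <;>
    · simp only [Config.setReg_reg]; rw [if_neg (by omega)]
  | set x e =>
    intro l s σ h
    obtain ⟨t, τ, h1, h2, h3, h4, h5⟩ := e.comp_correct 0 σ h
    have hτ : Rep n B s τ := h.of_eq h3 fun r hr => h5 r (by omega)
    refine ⟨_, _, .seq h1 (.add _ _ _ _), by simp only [Com.cost]; omega, ?_, fun r hr => ?_⟩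
    · refine ⟨?_, ?_, ?_, fun y => ?_, fun k i => ?_, fun i hi => ?_⟩
      · simpa using hτ.rn
      · simpa using hτ.rB
      · simpa using hτ.rz
      · simp only [Config.setReg_reg, Com.ev, St.setV, Function.update_apply]
        by_cases hy : y = x
        · subst hy; simp [hτ.rz]; simpa using h4
        · rw [if_neg (by have : y.code ≠ x.code := fun h => hy (Var.code_injective h); omega), if_neg hy, hτ.rv]
      · exact hτ.ra k i
      · exact hτ.rl i hi
    · simp only [Config.setReg_reg]
      rw [if_neg (by omega), h5 _ (by omega)]
  | wr k e f =>
    intro l s σ h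
    obtain ⟨t, τ, h1, h2, h3, h4, h5⟩ := e.comp_correct 0 σ h
    have hτ : Rep n B s τ := h.of_eq h3 fun r hr => h5 r (by omega)
    obtain ⟨t', τ', h1', h2', h3', h4', h5'⟩ := f.comp_correct 1 τ hτ
    have hτ' : Rep n B s τ' := hτ.of_eq h3' fun r hr => h5' r (by omega)
    have e4 : τ'.reg 4 = e.ev B s := by rw [h5' 4 (by omega)]; exact h4
    have e7 : τ'.reg 7 = f.ev B s := h4'
    refine ⟨_, _, .seq h1 (.seq h1' (.seq (.add _ _ _ _) (.seq (.add _ _ _ _)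
      (.seq (.add _ _ _ _) (.seq (.add _ _ _ _) (.seq (.add _ _ _ _) (.seq (.const _ _ _)
      (.seq (.add _ _ _ _) (.store _ _ _))))))))), by simp only [Com.cost]; omega, ?_,
      fun r hr => ?_⟩
    · have key : ∀ m, (m = B + 16 * e.ev B s + k.code) ↔ m = e.ev B s + e.ev B s +
          (e.ev B s + e.ev B s) + (e.ev B s + e.ev B s + (e.ev B s + e.ev B s)) +
          (e.ev B s + e.ev B s + (e.ev B s + e.ev B s) + (e.ev B s + e.ev B s +
          (e.ev B s + e.ev B s))) + B + k.code := fun m => by constructor <;> intro h <;> omega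
      refine ⟨?_, ?_, ?_, fun y => ?_, fun k' i => ?_, fun i hi => ?_⟩
      · simpa using hτ'.rn
      · simpa using hτ'.rB
      · simpa using hτ'.rz
      · simp [Com.ev, St.setA, show 3 * y.code + 3 ≠ 4 by omega, show 3 * y.code + 3 ≠ 10 by omega, hτ'.rv]
      · simp only [Config.setMem_mem, Config.setReg_reg, Config.setReg_mem, Com.ev, St.setA, e4, e7,
          hτ'.rB, Function.update_apply, if_true, reduceIte, Nat.reduceEqDiff]
        have hk := k.code_lt
        have hk' := k'.code_lt
        by_cases hkk : k' = k
        · subst hkk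
          by_cases hi : i = e.ev B s
          · subst hi
            rw [if_pos ((key _).1 rfl)]; simp
          · rw [if_neg (by rw [← key]; omega), hτ'.ra]; simp [hi]
        · have : k'.code ≠ k.code := fun h => hkk (Arr.code_injective h)
          rw [if_neg (by rw [← key]; omega), hτ'.ra]; simp [hkk]
      · simp only [Config.setMem_mem, Config.setReg_reg, Config.setReg_mem, Com.ev, St.setA, e4, e7,
          hτ'.rB, if_true, reduceIte, Nat.reduceEqDiff]
        rw [if_neg (by rw [← key]; omega), hτ'.rl i hi]
    · simp only [Config.setMem_reg, Config.setReg_reg]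
      rw [if_neg (by omega), if_neg (by omega), if_neg (by omega), if_neg (by omega),
        if_neg (by omega), if_neg (by omega), if_neg (by omega), h5' _ (by omega), h5 _ (by omega)]
  | wlo e f =>
    intro l s σ h
    obtain ⟨t, τ, h1, h2, h3, h4, h5⟩ := e.comp_correct 0 σ h
    have hτ : Rep n B s τ := h.of_eq h3 fun r hr => h5 r (by omega)
    obtain ⟨t', τ', h1', h2', h3', h4', h5'⟩ := f.comp_correct 1 τ hτ
    have hτ' : Rep n B s τ' := hτ.of_eq h3' fun r hr => h5' r (by omega)
    have e4 : τ'.reg 4 = e.ev B s := by rw [h5' 4 (by omega)]; exact h4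
    have e7 : τ'.reg 7 = f.ev B s := h4'
    by_cases hlt : e.ev B s < B
    · refine ⟨_, _, .seq h1 (.seq h1' (.seq (.sub _ _ _ _) (.ite_true ?_ (.store _ _ _)))),
        by simp only [Com.cost]; omega, ?_, fun r hr => ?_⟩
      · simp [e4, hτ'.rB]; omega
      · refine ⟨?_, ?_, ?_, fun y => ?_, fun k' i => ?_, fun i hi => ?_⟩
        · simpa using hτ'.rn
        · simpa using hτ'.rB
        · simpa using hτ'.rz
        · simp [Com.ev, hlt, St.setL, show 3 * y.code + 3 ≠ 10 by omega, hτ'.rv]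
        · simp [Com.ev, hlt, St.setL, e4, hτ'.ra]
          intro h; omega
        · simp [Com.ev, hlt, St.setL, e4, e7, hτ'.rl i hi, Function.update_apply]
      · simp only [Config.setMem_reg, Config.setReg_reg]
        rw [if_neg (by omega), h5' _ (by omega), h5 _ (by omega)]
    · refine ⟨_, _, .seq h1 (.seq h1' (.seq (.sub _ _ _ _) (.ite_false ?_ (.const _ _ _)))),
        by simp only [Com.cost]; omega, ?_, fun r hr => ?_⟩
      · simp [e4, hτ'.rB]; omega
      · simp only [Com.ev, hlt, if_false]
        refine hτ'.of_eq rfl fun r hr => ?_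
        simp only [Config.setReg_reg]
        rw [if_neg (by omega), if_neg (by omega)]
      · simp only [Config.setReg_reg]
        rw [if_neg (by omega), if_neg (by omega), h5' _ (by omega), h5 _ (by omega)]
  | seq P Q ihP ihQ =>
    intro l s σ h
    obtain ⟨t, τ, h1, h2, h3, h4⟩ := ihP l s σ h
    obtain ⟨t', τ', h1', h2', h3', h4'⟩ := ihQ l _ τ h3
    exact ⟨_, _, .seq h1 h1', by simp only [Com.cost]; omega, h3', fun r hr => by
      rw [h4' r hr, h4 r hr]⟩
  | ite e P Q ihP ihQ =>
    intro l s σ h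
    obtain ⟨t, τ, h1, h2, h3, h4, h5⟩ := e.comp_correct 0 σ h
    have hτ : Rep n B s τ := h.of_eq h3 fun r hr => h5 r (by omega)
    have h4 : τ.reg 4 = e.ev B s := h4
    by_cases he : e.ev B s = 0
    · obtain ⟨t', τ', h1', h2', h3', h4'⟩ := ihQ l s τ hτ
      refine ⟨_, _, .seq h1 (.ite_false (by rw [h4, he]) h1'), by simp only [Com.cost]; omega, ?_,
        fun r hr => by rw [h4' r hr, h5 _ (by omega)]⟩
      simpa only [Com.ev, he, ne_eq, not_true_eq_false, if_false] using h3'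
    · obtain ⟨t', τ', h1', h2', h3', h4'⟩ := ihP l s τ hτ
      refine ⟨_, _, .seq h1 (.ite_true (by rw [h4]; exact he) h1'),
        by simp only [Com.cost]; omega, ?_, fun r hr => by rw [h4' r hr, h5 _ (by omega)]⟩
      simpa only [Com.ev, ne_eq, he, not_false_eq_true, if_true] using h3'
  | loop x P ihP =>
    intro l s σ h
    set W : Prog := .while 4 (.seq (.add (3 * x.code + 3) (3 * l + 5) 2) (.seq (P.comp (l + 1))
        (.seq (.const 4 1) (.seq (.add (3 * l + 5) (3 * l + 5) 4) (.sub 4 0 (3 * l + 5)))))) with hW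
    -- Induction on the number `m` of remaining iterations. The tested register 4 always holds this
    -- number at the head of the loop.
    have key : ∀ m i σ, i + m = n → Rep n B (iterFrom (fun i s => P.ev n B (s.setV x i)) i s) σ →
        σ.reg (3 * l + 5) = i → σ.reg 4 = n - i →
        ∃ t τ, Exec W σ t τ ∧ t ≤ m * (P.cost n + 5) + 1 ∧
          Rep n B (iterFrom (fun i s => P.ev n B (s.setV x i)) n s) τ ∧
          ∀ r < l, τ.reg (3 * r + 5) = σ.reg (3 * r + 5) := by
      intro m
      induction m with
      | zero =>
        intro i σ hi hR hc h4
        obtain rfl : i = n := by omega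
        exact ⟨1, σ, .while_false (by rw [h4]; omega), by omega, hR, fun _ _ => rfl⟩
      | succ m ih =>
        intro i σ hi hR hc h4
        have hR1 : Rep n B ((iterFrom (fun i s => P.ev n B (s.setV x i)) i s).setV x i)
            (σ.setReg (3 * x.code + 3) (σ.reg (3 * l + 5) + σ.reg 2)) := by
          refine ⟨?_, ?_, ?_, fun y => ?_, fun k i => hR.ra k i, fun i hi => hR.rl i hi⟩
          · simpa using hR.rn
          · simpa using hR.rB
          · simpa using hR.rz
          · simp only [Config.setReg_reg, St.setV_v, Function.update_apply]
            by_cases hy : y = x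
            · subst hy; simp [hR.rz, hc]
            · rw [if_neg (by have : y.code ≠ x.code := fun h => hy (Var.code_injective h); omega), if_neg hy, hR.rv]
        obtain ⟨t, τ, h1, h2, h3, h4'⟩ := ihP (l + 1) _ _ hR1
        have hτc : τ.reg (3 * l + 5) = i := by
          rw [h4' l (by omega)]
          simp only [Config.setReg_reg]
          rw [if_neg (by omega), hc]
        set τ' := ((τ.setReg 4 1).setReg (3 * l + 5) ((τ.setReg 4 1).reg (3 * l + 5) +
          (τ.setReg 4 1).reg 4)) with hτ'
        have g1 : τ'.reg (3 * l + 5) = i + 1 := by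
          simp [hτ', hτc]
        have g0 : τ'.reg 0 = n := by
          simp [hτ', h3.rn]
        obtain ⟨t2, υ, k1, k2, k3, k4⟩ := ih (i + 1) (τ'.setReg 4 (τ'.reg 0 - τ'.reg (3 * l + 5)))
          (by omega) (h3.of_eq rfl fun r hr => by
            simp only [hτ', Config.setReg_reg]
            rw [if_neg (by omega), if_neg (by omega), if_neg (by omega)])
          (by simp only [Config.setReg_reg]; rw [if_neg (by omega), g1])
          (by simp [g1, g0])
        refine ⟨_, υ, .while_true (by rw [h4]; omega) (.seq (.add _ _ _ _) (.seq h1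
          (.seq (.const _ _ _) (.seq (.add _ _ _ _) (.sub _ _ _ _))))) k1, ?_, k3, fun r hr => ?_⟩
        · rw [Nat.succ_mul]; omega
        · rw [k4 r hr]
          simp only [hτ', Config.setReg_reg]
          rw [if_neg (by omega), if_neg (by omega), if_neg (by omega), h4' r (by omega)]
          simp only [Config.setReg_reg]
          rw [if_neg (by omega)]
    set σ1 := σ.setReg (3 * l + 5) 0 with hσ1
    have g0 : σ1.reg 0 = n := by simp [hσ1, h.rn]
    have g1 : σ1.reg (3 * l + 5) = 0 := by simp [hσ1]
    obtain ⟨t, τ, h1, h2, h3, h4⟩ := key n 0 (σ1.setReg 4 (σ1.reg 0 - σ1.reg (3 * l + 5)))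
      (by omega) (h.of_eq rfl fun r hr => by
        simp only [hσ1, Config.setReg_reg]
        rw [if_neg (by omega), if_neg (by omega)])
      (by simp only [Config.setReg_reg]; rw [if_neg (by omega), g1])
      (by simp [g1, g0])
    refine ⟨_, τ, .seq (.const _ _ _) (.seq (.sub _ _ _ _) h1), ?_, h3, fun r hr => ?_⟩
    · simp only [Com.cost]; omega
    · rw [h4 r hr]
      simp only [hσ1, Config.setReg_reg]
      rw [if_neg (by omega), if_neg (by omega)]

end CapMedian

namespace CapMedian

instance : Add Ex := ⟨Ex.add⟩
instance : Sub Ex := ⟨Ex.sub⟩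

section Eval
variable (B : ℕ) (s : St)

@[simp] theorem Ex.ev_c (k : ℕ) : (Ex.c k).ev B s = k := (rfl)
@[simp] theorem Ex.ev_v (x : Var) : (Ex.v x).ev B s = s.v x := (rfl)
@[simp] theorem Ex.ev_add (e f : Ex) : (e + f).ev B s = e.ev B s + f.ev B s := (rfl)
@[simp] theorem Ex.ev_sub (e f : Ex) : (e - f).ev B s = e.ev B s - f.ev B s := (rfl)
@[simp] theorem Ex.ev_rd (k : Arr) (e : Ex) : (Ex.rd k e).ev B s = s.a k (e.ev B s) := (rfl)
@[simp] theorem Ex.ev_lo (e : Ex) :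
    (Ex.lo e).ev B s = if e.ev B s < B then s.low (e.ev B s) else 0 := (rfl)

variable (n : ℕ)

@[simp] theorem Com.ev_skip : Com.skip.ev n B s = s := (rfl)
@[simp] theorem Com.ev_set (x : Var) (e : Ex) : (Com.set x e).ev n B s = s.setV x (e.ev B s) := (rfl)
@[simp] theorem Com.ev_wr (k : Arr) (e f : Ex) :
    (Com.wr k e f).ev n B s = s.setA k (e.ev B s) (f.ev B s) := (rfl)
@[simp] theorem Com.ev_wlo (e f : Ex) : (Com.wlo e f).ev n B s =
    if e.ev B s < B then s.setL (e.ev B s) (f.ev B s) else s := (rfl)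
@[simp] theorem Com.ev_seq (P Q : Com) : (P.seq Q).ev n B s = Q.ev n B (P.ev n B s) := (rfl)
@[simp] theorem Com.ev_ite (e : Ex) (P Q : Com) : (Com.ite e P Q).ev n B s =
    if e.ev B s ≠ 0 then P.ev n B s else Q.ev n B s := (rfl)

end Eval

/-! ### What a command may change -/

def Com.wv : Com → Var → Bool
  | set x _, y => x == y
  | seq P Q, y => P.wv y || Q.wv y
  | ite _ P Q, y => P.wv y || Q.wv y
  | loop x P, y => x == y || P.wv y
  | _, _ => false

def Com.wa : Com → Arr → Bool
  | wr k _ _, y => k == y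
  | seq P Q, y => P.wa y || Q.wa y
  | ite _ P Q, y => P.wa y || Q.wa y
  | loop _ P, y => P.wa y
  | _, _ => false

def Com.wl : Com → Bool
  | wlo _ _ => true
  | seq P Q => P.wl || Q.wl
  | ite _ P Q => P.wl || Q.wl
  | loop _ P => P.wl
  | _ => false

theorem iterFrom_inv {f : ℕ → St → St} (Inv : ℕ → St → Prop) {n : ℕ} {s : St} (h0 : Inv 0 s)
    (hstep : ∀ i < n, ∀ s, Inv i s → Inv (i + 1) (f i s)) : Inv n (iterFrom f n s) := by
  have : ∀ m ≤ n, Inv m (iterFrom f m s) := by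
    intro m
    induction m with
    | zero => exact fun _ => h0
    | succ m ih => exact fun hm => hstep m (by omega) _ (ih (by omega))
  exact this n le_rfl

/-- Invariant rule for loops. -/
theorem Com.ev_loop_inv {n B : ℕ} {x : Var} {P : Com} {s : St} (Inv : ℕ → St → Prop) (h0 : Inv 0 s)
    (hstep : ∀ i < n, ∀ s, Inv i s → Inv (i + 1) (P.ev n B (s.setV x i))) :
    Inv n ((Com.loop x P).ev n B s) :=
  iterFrom_inv Inv h0 hstep

theorem Com.ev_v_eq {n B : ℕ} (P : Com) : ∀ (s : St) {x : Var}, P.wv x = false →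
    (P.ev n B s).v x = s.v x := by
  induction P with
  | skip => intro s x _; rfl
  | set y e =>
    intro s x h
    simp only [Com.wv, beq_eq_false_iff_ne] at h
    simp [Function.update_of_ne h.symm]
  | wr k e f => intro s x _; rfl
  | wlo e f => intro s x _; simp only [Com.ev_wlo]; split_ifs <;> rfl
  | seq P Q ihP ihQ =>
    intro s x h
    simp only [Com.wv, Bool.or_eq_false_iff] at h
    rw [Com.ev_seq, ihQ _ h.2, ihP _ h.1]
  | ite e P Q ihP ihQ =>
    intro s x h
    simp only [Com.wv, Bool.or_eq_false_iff] at h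
    rw [Com.ev_ite]
    split_ifs
    · exact ihP _ h.1
    · exact ihQ _ h.2
  | loop y P ih =>
    intro s x h
    simp only [Com.wv, Bool.or_eq_false_iff, beq_eq_false_iff_ne] at h
    refine Com.ev_loop_inv (fun _ s' => s'.v x = s.v x) rfl fun i _ s' hs' => ?_
    rw [ih _ h.2, St.setV_v, Function.update_of_ne h.1.symm, hs']

theorem Com.ev_a_eq {n B : ℕ} (P : Com) : ∀ (s : St) {k : Arr}, P.wa k = false →
    (P.ev n B s).a k = s.a k := by
  induction P with
  | skip => intro s x _; rfl
  | set y e => intro s x h; rfl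
  | wr k e f =>
    intro s x h
    simp only [Com.wa, beq_eq_false_iff_ne] at h
    simp [Function.update_of_ne h.symm]
  | wlo e f => intro s x _; simp only [Com.ev_wlo]; split_ifs <;> rfl
  | seq P Q ihP ihQ =>
    intro s x h
    simp only [Com.wa, Bool.or_eq_false_iff] at h
    rw [Com.ev_seq, ihQ _ h.2, ihP _ h.1]
  | ite e P Q ihP ihQ =>
    intro s x h
    simp only [Com.wa, Bool.or_eq_false_iff] at h
    rw [Com.ev_ite]
    split_ifs
    · exact ihP _ h.1
    · exact ihQ _ h.2
  | loop y P ih =>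
    intro s x h
    simp only [Com.wa] at h
    refine Com.ev_loop_inv (fun _ s' => s'.a x = s.a x) rfl fun i _ s' hs' => ?_
    rw [ih _ h, St.setV_a, hs']

theorem Com.ev_low_eq {n B : ℕ} (P : Com) : ∀ (s : St), P.wl = false →
    (P.ev n B s).low = s.low := by
  induction P with
  | skip => intro s _; rfl
  | set y e => intro s h; rfl
  | wr k e f => intro s h; rfl
  | wlo e f => intro s h; exact absurd h (by simp [Com.wl])
  | seq P Q ihP ihQ =>
    intro s h
    simp only [Com.wl, Bool.or_eq_false_iff] at h
    rw [Com.ev_seq, ihQ _ h.2, ihP _ h.1]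
  | ite e P Q ihP ihQ =>
    intro s h
    simp only [Com.wl, Bool.or_eq_false_iff] at h
    rw [Com.ev_ite]
    split_ifs
    · exact ihP _ h.1
    · exact ihQ _ h.2
  | loop y P ih =>
    intro s h
    simp only [Com.wl] at h
    refine Com.ev_loop_inv (fun _ s' => s'.low = s.low) rfl fun i _ s' hs' => ?_
    rw [ih _ h, St.setV_low, hs']

/-- Invariant rule for loops, with the unchanged part of the state for free. -/
theorem Com.ev_loop_frame {n B : ℕ} {x : Var} {P : Com} {s : St} (Inv : ℕ → St → Prop)
    (h0 : Inv 0 s)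
    (hstep : ∀ i < n, ∀ s' : St, (∀ y, (Com.loop x P).wv y = false → s'.v y = s.v y) →
      (∀ k, P.wa k = false → s'.a k = s.a k) → (P.wl = false → s'.low = s.low) →
      Inv i s' → Inv (i + 1) (P.ev n B (s'.setV x i))) :
    Inv n ((Com.loop x P).ev n B s) := by
  refine (Com.ev_loop_inv (fun i s' => Inv i s' ∧ (∀ y, (Com.loop x P).wv y = false →
    s'.v y = s.v y) ∧ (∀ k, P.wa k = false → s'.a k = s.a k) ∧ (P.wl = false → s'.low = s.low))
    ⟨h0, fun _ _ => rfl, fun _ _ => rfl, fun _ => rfl⟩ fun i hi s' hs' => ?_).1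
  refine ⟨hstep i hi s' hs'.2.1 hs'.2.2.1 hs'.2.2.2 hs'.1, fun y hy => ?_, fun k hk => ?_,
    fun h => ?_⟩
  · have h2 := hy
    simp only [Com.wv, Bool.or_eq_false_iff, beq_eq_false_iff_ne] at h2
    rw [Com.ev_v_eq _ _ h2.2, St.setV_v, Function.update_of_ne h2.1.symm, hs'.2.1 y hy]
  · rw [Com.ev_a_eq _ _ hk, St.setV_a, hs'.2.2.1 k hk]
  · rw [Com.ev_low_eq _ _ h, St.setV_low, hs'.2.2.2 h]

/-- A loop that fills an array. -/
theorem Com.ev_loop_fill {n B : ℕ} {x : Var} {P : Com} {s : St} (k : Arr) (f : ℕ → ℕ)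
    (hstep : ∀ i < n, ∀ s' : St, (∀ y, (Com.loop x P).wv y = false → s'.v y = s.v y) →
      (∀ k, P.wa k = false → s'.a k = s.a k) → (P.wl = false → s'.low = s.low) →
      s'.a k i = s.a k i →
      (P.ev n B (s'.setV x i)).a k = Function.update (s'.a k) i (f i)) :
    ((Com.loop x P).ev n B s).a k = fun i => if i < n then f i else s.a k i := by
  have := Com.ev_loop_frame (n := n) (B := B) (x := x) (P := P) (s := s)
    (fun m s' => s'.a k = fun i => if i < m then f i else s.a k i) (by simp)
    (fun i hi s' hv ha hl hI => by
      rw [hstep i hi s' hv ha hl (by rw [hI]; simp), hI]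
      funext j
      simp only [Function.update_apply]
      by_cases h : j = i
      · subst h; simp
      · rw [if_neg h]
        exact if_congr (by omega) rfl rfl)
  exact this

/-- A loop that accumulates a value in a variable. -/
theorem Com.ev_loop_fold {n B : ℕ} {x : Var} {P : Com} {s : St} (y : Var) (g : ℕ → ℕ)
    (h0 : s.v y = g 0)
    (hstep : ∀ i < n, ∀ s' : St, (∀ y, (Com.loop x P).wv y = false → s'.v y = s.v y) →
      (∀ k, P.wa k = false → s'.a k = s.a k) → (P.wl = false → s'.low = s.low) →
      s'.v y = g i → (P.ev n B (s'.setV x i)).v y = g (i + 1)) :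
    ((Com.loop x P).ev n B s).v y = g n :=
  Com.ev_loop_frame (fun m s' => s'.v y = g m) h0 hstep

/-! ### Running time -/

/-- Nesting depth of loops. -/
def Com.depth : Com → ℕ
  | seq P Q => max P.depth Q.depth
  | ite _ P Q => max P.depth Q.depth
  | loop _ P => P.depth + 1
  | _ => 0

/-- Loops have a fixed number of iterations, so the bound can be read off the syntax: each nesting
level contributes one factor. -/
theorem Com.cost_le (P : Com) : ∃ K, ∀ n, P.cost n ≤ K * (n + 1) ^ P.depth := by
  have mono : ∀ (K n d d' : ℕ), d ≤ d' → K * (n + 1) ^ d ≤ K * (n + 1) ^ d' := fun K n d d' h =>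
    Nat.mul_le_mul_left _ (Nat.pow_le_pow_right (by omega) h)
  induction P with
  | skip => exact ⟨1, fun n => by simp [Com.cost, Com.depth]⟩
  | set y e => exact ⟨e.cost + 1, fun n => by simp [Com.cost, Com.depth]⟩
  | wr k e f => exact ⟨e.cost + f.cost + 8, fun n => by simp [Com.cost, Com.depth]⟩
  | wlo e f => exact ⟨e.cost + f.cost + 3, fun n => by simp [Com.cost, Com.depth]⟩
  | seq P Q ihP ihQ =>
    obtain ⟨K, hK⟩ := ihP
    obtain ⟨L, hL⟩ := ihQ
    refine ⟨K + L, fun n => ?_⟩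
    rw [add_mul]
    exact add_le_add ((hK n).trans (mono _ _ _ _ (le_max_left _ _)))
      ((hL n).trans (mono _ _ _ _ (le_max_right _ _)))
  | ite e P Q ihP ihQ =>
    obtain ⟨K, hK⟩ := ihP
    obtain ⟨L, hL⟩ := ihQ
    refine ⟨K + L + (e.cost + 1), fun n => ?_⟩
    have h1 := (hK n).trans (mono _ _ _ _ (le_max_left P.depth Q.depth))
    have h2 := (hL n).trans (mono _ _ _ _ (le_max_right P.depth Q.depth))
    have h3 : 1 ≤ (n + 1) ^ max P.depth Q.depth := Nat.one_le_pow _ _ (by omega)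
    simp only [Com.cost, Com.depth]
    nlinarith
  | loop y P ih =>
    obtain ⟨K, hK⟩ := ih
    refine ⟨K + 8, fun n => ?_⟩
    have h3 : 1 ≤ (n + 1) ^ P.depth := Nat.one_le_pow _ _ (by omega)
    simp only [Com.cost, Com.depth, pow_succ]
    have h1 := hK n
    generalize (n + 1) ^ P.depth = X at *
    have h2 : n * (P.cost n + 5) ≤ n * (K * X + 5 * X) := Nat.mul_le_mul_left _ (by omega)
    nlinarith

end CapMedian

namespace CapMedian

/-! ### Primal-dual optimal assignments -/

section Hungarian
open Finset

/-- An assignment `asg` of the first `m` clients to `T` with loads `ld`, together with client prices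
`u` and facility prices `v` that prove its optimality. -/
structure OptCert (c : ℕ → ℕ → ℕ) (T : Finset ℕ) (U m : ℕ) (asg u v ld : ℕ → ℕ) : Prop where
  mem : ∀ j < m, asg j ∈ T
  tight : ∀ j < m, u j = c (asg j) j + v (asg j)
  feas : ∀ j < m, ∀ i ∈ T, u j ≤ c i j + v i
  load : ∀ i ∈ T, ld i = #{j ∈ range m | asg j = i}
  cap : ∀ i ∈ T, ld i ≤ U
  full : ∀ i ∈ T, 0 < v i → ld i = U

/-- Weak duality with complementary slackness. Each client minimises cost plus facility price, and
the total price collected is the largest possible, because every facility with a positive price is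
full. -/
theorem OptCert.sum_le {c : ℕ → ℕ → ℕ} {T : Finset ℕ} {U m : ℕ} {asg u v ld : ℕ → ℕ}
    (h : OptCert c T U m asg u v ld) (χ : ℕ → ℕ) (hχ : ∀ j < m, χ j ∈ T)
    (hcap : ∀ i ∈ T, #{j ∈ range m | χ j = i} ≤ U) :
    ∑ j ∈ range m, c (asg j) j ≤ ∑ j ∈ range m, c (χ j) j := by
  have price : ∀ ψ : ℕ → ℕ, (∀ j < m, ψ j ∈ T) →
      ∑ j ∈ range m, v (ψ j) = ∑ i ∈ T, #{j ∈ range m | ψ j = i} * v i := by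
    intro ψ hψ
    rw [← sum_fiberwise_of_maps_to (s := range m) (t := T) (g := ψ)
      (fun j hj => hψ j (mem_range.1 hj))]
    refine sum_congr rfl fun i _ => ?_
    rw [sum_congr rfl fun j hj => by rw [(mem_filter.1 hj).2], sum_const, smul_eq_mul]
  have h1 : ∑ j ∈ range m, v (χ j) ≤ ∑ j ∈ range m, v (asg j) := by
    rw [price χ hχ, price asg h.mem]
    refine sum_le_sum fun i hi => ?_
    rcases Nat.eq_zero_or_pos (v i) with e | e
    · rw [e]; simp
    · rw [← h.load i hi, h.full i hi e]
      exact Nat.mul_le_mul_right _ (hcap i hi)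
  have h2 : ∑ j ∈ range m, (c (asg j) j + v (asg j)) ≤ ∑ j ∈ range m, (c (χ j) j + v (χ j)) := by
    refine sum_le_sum fun j hj => ?_
    rw [mem_range] at hj
    rw [← h.tight j hj]
    exact h.feas j hj _ (hχ j hj)
  rw [sum_add_distrib, sum_add_distrib] at h2
  omega

/-- State of the search while client `m` is being inserted. It is placed on the dummy facility `F`,
and `alt i` is, for each reached facility `i`, a tight assignment that has moved the place of the
dummy to `i`. -/
structure Grow (c : ℕ → ℕ → ℕ) (T : Finset ℕ) (U F m : ℕ) (asg u v ld : ℕ → ℕ) (W : Finset ℕ)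
    (alt : ℕ → ℕ → ℕ) : Prop where
  dummy : F ∉ T
  mem : ∀ j < m, asg j ∈ T
  new : asg m = F
  dummy_mem : F ∈ W
  sub : ∀ i ∈ W, i ≠ F → i ∈ T
  feas : ∀ j ≤ m, ∀ i ∈ T, u j ≤ c i j + v i
  tight : ∀ i ∈ W, ∀ j ≤ m, alt i j ≠ F → alt i j ∈ T ∧ u j = c (alt i j) j + v (alt i j)
  load : ∀ i ∈ T, ld i = #{j ∈ range m | asg j = i}
  cap : ∀ i ∈ T, ld i ≤ U
  full : ∀ i ∈ T, 0 < v i → ld i = U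
  loads : ∀ i ∈ W, ∀ x, #{j ∈ range (m + 1) | alt i j = x} + (if x = F then 1 else 0) =
    #{j ∈ range (m + 1) | asg j = x} + if x = i then 1 else 0
  -- The path behind `alt i` moves only clients of facilities reached before `i`. Hence the clients
  -- at `i` itself are still there when the path is extended beyond `i`.
  keep : ∀ i ∈ W, ∀ j ≤ m, (asg j ∉ W ∨ asg j = i) → alt i j = asg j
  reached : ∀ i ∈ W, ∀ j ≤ m, asg j ∈ W → alt i j ∈ W

variable {c : ℕ → ℕ → ℕ} {T : Finset ℕ} {U F m : ℕ} {asg u v ld : ℕ → ℕ} {W : Finset ℕ}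
  {alt : ℕ → ℕ → ℕ}

/-- The new client starts on the dummy with price 0, which is feasible since costs and prices are
natural numbers. Nothing but the dummy is reached. -/
theorem OptCert.grow (h : OptCert c T U m asg u v ld) (hF : F ∉ T) {asg' u' : ℕ → ℕ}
    (ha : ∀ j < m, asg' j = asg j) (ham : asg' m = F) (hu : ∀ j < m, u' j = u j) (hum : u' m = 0)
    (halt : ∀ j ≤ m, alt F j = asg' j) : Grow c T U F m asg' u' v ld {F} alt where
  dummy := hF
  mem j hj := by rw [ha j hj]; exact h.mem j hj
  new := ham
  dummy_mem := mem_singleton_self F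
  sub i hi hne := absurd (mem_singleton.1 hi) hne
  feas j hj i hi := by
    rcases hj.eq_or_lt with rfl | hj
    · rw [hum]; omega
    · rw [hu j hj]; exact h.feas j hj i hi
  tight i hi j hj hne := by
    rw [mem_singleton.1 hi, halt j hj] at *
    rcases hj.eq_or_lt with rfl | hj
    · exact absurd ham hne
    · rw [ha j hj, hu j hj]; exact ⟨h.mem j hj, h.tight j hj⟩
  load i hi := by
    rw [h.load i hi]
    congr 1
    exact filter_congr fun j hj => by rw [ha j (mem_range.1 hj)]
  cap := h.cap
  full := h.full
  loads i hi x := by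
    rw [mem_singleton.1 hi]
    congr 2
    exact filter_congr fun j hj => by rw [halt j (by have := mem_range.1 hj; omega)]
  keep i hi j hj _ := by rw [mem_singleton.1 hi, halt j hj]
  reached i hi j hj hW := by rw [mem_singleton.1 hi, halt j hj]; exact hW

/-- As long as all reached facilities are full, some facility is not yet reached. -/
theorem Grow.exists_notMem (h : Grow c T U F m asg u v ld W alt)
    (hfull : ∀ i ∈ W, i ≠ F → ld i = U) (hm : m < #T * U) : ∃ i ∈ T, i ∉ W := by
  by_contra hcon
  push Not at hcon
  have h1 : #(range m) = ∑ i ∈ T, #{j ∈ range m | asg j = i} :=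
    card_eq_sum_card_fiberwise fun j hj => mem_coe.2 (h.mem j (mem_range.1 (mem_coe.1 hj)))
  have h2 : ∑ i ∈ T, #{j ∈ range m | asg j = i} = ∑ i ∈ T, U := sum_congr rfl fun i hi => by
    rw [← h.load i hi, hfull i (hcon i hi) fun e => h.dummy (e ▸ hi)]
  rw [h2, sum_const, smul_eq_mul, card_range] at h1
  omega

/-- Raising the prices and reaching one more facility. -/
theorem Grow.step (h : Grow c T U F m asg u v ld W alt) (hfull : ∀ i ∈ W, i ≠ F → ld i = U)
    {δ bi bj : ℕ} (hbi : bi ∈ T) (hbiW : bi ∉ W) (hbj : bj ≤ m) (hbjW : asg bj ∈ W)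
    (hδ : c bi bj + v bi = u bj + δ)
    (hmin : ∀ i ∈ T, i ∉ W → ∀ j ≤ m, asg j ∈ W → u j + δ ≤ c i j + v i)
    {u' v' : ℕ → ℕ} {alt' : ℕ → ℕ → ℕ} (hu : ∀ j ≤ m, u' j = if asg j ∈ W then u j + δ else u j)
    (hv : ∀ i ∈ T, v' i = if i ∈ W then v i + δ else v i)
    (halt : ∀ i ∈ W, ∀ j ≤ m, alt' i j = alt i j)
    (haltb : ∀ j ≤ m, alt' bi j = if j = bj then bi else alt (asg bj) j) :
    Grow c T U F m asg u' v' ld (insert bi W) alt' := by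
  have hbiF : bi ≠ F := fun e => h.dummy (e ▸ hbi)
  have hne : ∀ i ∈ W, i ≠ bi := fun i hi e => hbiW (e ▸ hi)
  -- A client of a reached facility stays within reached facilities in `alt i`, so both sides rise
  -- by `δ`. Other clients are not moved, and neither side changes.
  have tight_old : ∀ i ∈ W, ∀ j ≤ m, alt i j ≠ F →
      alt i j ∈ T ∧ u' j = c (alt i j) j + v' (alt i j) := by
    intro i hi j hj hF
    obtain ⟨h1, h2⟩ := h.tight i hi j hj hF
    refine ⟨h1, ?_⟩
    rw [hu j hj, hv _ h1]
    by_cases hW : asg j ∈ W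
    · rw [if_pos hW, if_pos (h.reached i hi j hj hW), h2]; ring
    · have e := h.keep i hi j hj (Or.inl hW)
      rw [if_neg hW, if_neg (by rw [e]; exact hW), h2]
  refine ⟨h.dummy, h.mem, h.new, mem_insert_of_mem h.dummy_mem, ?_, ?_, ?_, h.load, h.cap, ?_, ?_,
    ?_, ?_⟩
  · intro i hi hiF
    rcases mem_insert.1 hi with rfl | hi
    · exact hbi
    · exact h.sub i hi hiF
  · intro j hj i hi
    have h1 := h.feas j hj i hi
    rw [hu j hj, hv i hi]
    by_cases hW : asg j ∈ W <;> by_cases hiW : i ∈ W <;> simp only [hW, hiW, if_true, if_false]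
    · omega
    · exact hmin i hi hiW j hj hW
    · omega
    · exact h1
  · intro i hi j hj hF
    rcases mem_insert.1 hi with rfl | hi
    · rw [haltb j hj] at hF ⊢
      split_ifs at hF ⊢ with hjb
      · subst hjb
        refine ⟨hbi, ?_⟩
        rw [hu j hj, hv _ hbi, if_pos hbjW, if_neg hbiW, hδ]
      · exact tight_old _ hbjW j hj hF
    · rw [halt i hi j hj] at hF ⊢
      exact tight_old i hi j hj hF
  · intro i hi hpos
    by_cases hiW : i ∈ W
    · exact hfull i hiW fun e => h.dummy (e ▸ hi)
    · rw [hv i hi, if_neg hiW] at hpos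
      exact h.full i hi hpos
  · intro i hi x
    rcases mem_insert.1 hi with rfl | hi
    · have h1 := h.loads _ hbjW x
      have h2 : #{j ∈ range (m + 1) | alt' i j = x} + (if asg bj = x then 1 else 0) =
          #{j ∈ range (m + 1) | alt (asg bj) j = x} + if i = x then 1 else 0 := by
        have hb : bj ∈ range (m + 1) := mem_range.2 (by omega)
        simp only [card_filter]
        rw [← sum_erase_add _ _ hb, ← sum_erase_add _ (fun j => if alt (asg bj) j = x then 1 else 0) hb,
          haltb bj hbj, if_pos rfl, h.keep _ hbjW bj hbj (Or.inr rfl)]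
        have : ∑ j ∈ (range (m + 1)).erase bj, (if alt' i j = x then 1 else 0) =
            ∑ j ∈ (range (m + 1)).erase bj, if alt (asg bj) j = x then 1 else 0 :=
          sum_congr rfl fun j hj => by
            obtain ⟨e1, e2⟩ := mem_erase.1 hj
            rw [haltb j (by have := mem_range.1 e2; omega), if_neg e1]
        omega
      simp only [eq_comm (a := x)] at h1 ⊢
      omega
    · have : #{j ∈ range (m + 1) | alt' i j = x} = #{j ∈ range (m + 1) | alt i j = x} := by
        congr 1
        exact filter_congr fun j hj => by rw [halt i hi j (by have := mem_range.1 hj; omega)]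
      rw [this]
      exact h.loads i hi x
  · intro i hi j hj hk
    rcases mem_insert.1 hi with rfl | hi
    · have hnW : asg j ∉ W := by
        rcases hk with hk | hk
        · exact fun e => hk (mem_insert_of_mem e)
        · rw [hk]; exact hbiW
      rw [haltb j hj, if_neg (fun e : j = bj => hnW (e ▸ hbjW))]
      exact h.keep _ hbjW j hj (Or.inl hnW)
    · rw [halt i hi j hj]
      refine h.keep i hi j hj (hk.imp_left fun hk e => hk (mem_insert_of_mem e))
  · intro i hi j hj hW
    have old : ∀ i ∈ W, alt i j ∈ insert bi W := by
      intro i hi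
      rcases mem_insert.1 hW with e | e
      · rw [h.keep i hi j hj (Or.inl (by rw [e]; exact hbiW)), e]
        exact mem_insert_self _ _
      · exact mem_insert_of_mem (h.reached i hi j hj e)
    rcases mem_insert.1 hi with rfl | hi
    · rw [haltb j hj]
      split_ifs
      · exact mem_insert_self _ _
      · exact old _ hbjW
    · rw [halt i hi j hj]; exact old i hi

/-- Once a facility with spare capacity is reached, the new client can be inserted. -/
theorem Grow.optCert (h : Grow c T U F m asg u v ld W alt) {b : ℕ} (hb : b ∈ W) (hbT : b ∈ T)
    (hlt : ld b < U) {asg' ld' : ℕ → ℕ} (ha : ∀ j ≤ m, asg' j = alt b j)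
    (hld : ∀ i ∈ T, ld' i = if i = b then ld i + 1 else ld i) :
    OptCert c T U (m + 1) asg' u v ld' := by
  have hbF : b ≠ F := fun e => h.dummy (e ▸ hbT)
  -- The dummy had a single client, the new one, and `alt b` moves the place of the dummy to `b`. So
  -- the dummy is now empty.
  have hnF : ∀ j ≤ m, alt b j ≠ F := by
    have h1 := h.loads b hb F
    have h2 : #{j ∈ range (m + 1) | asg j = F} ≤ 1 := by
      rw [card_le_one]
      have : ∀ j ∈ ({j ∈ range (m + 1) | asg j = F} : Finset ℕ), j = m := by
        intro j hj
        obtain ⟨e1, e2⟩ := mem_filter.1 hj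
        by_contra hne
        exact h.dummy (e2 ▸ h.mem j (by have := mem_range.1 e1; omega))
      intro a ha b hb
      rw [this a ha, this b hb]
    rw [if_pos rfl, if_neg hbF.symm] at h1
    have h3 : #{j ∈ range (m + 1) | alt b j = F} = 0 := by omega
    rw [card_eq_zero, filter_eq_empty_iff] at h3
    exact fun j hj => h3 (mem_range.2 (by omega))
  have hld2 : ∀ i ∈ T, ld' i = #{j ∈ range (m + 1) | asg' j = i} := by
    intro i hi
    have h1 := h.loads b hb i
    have hiF : i ≠ F := fun e => h.dummy (e ▸ hi)
    have h2 : #{j ∈ range (m + 1) | asg' j = i} = #{j ∈ range (m + 1) | alt b j = i} := by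
      congr 1
      exact filter_congr fun j hj => by rw [ha j (by have := mem_range.1 hj; omega)]
    have h3 : #{j ∈ range (m + 1) | asg j = i} = #{j ∈ range m | asg j = i} := by
      rw [range_add_one, filter_insert, if_neg (by rw [h.new]; exact hiF.symm)]
    rw [hld i hi, h2, h.load i hi]
    rw [if_neg hiF] at h1
    split_ifs at h1 ⊢ <;> omega
  refine ⟨?_, ?_, ?_, hld2, ?_, ?_⟩
  · intro j hj
    rw [ha j (by omega)]
    exact (h.tight b hb j (by omega) (hnF j (by omega))).1
  · intro j hj
    rw [ha j (by omega)]
    exact (h.tight b hb j (by omega) (hnF j (by omega))).2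
  · intro j hj
    exact h.feas j (by omega)
  · intro i hi
    have := h.cap i hi
    rw [hld i hi]
    split_ifs with e
    · subst e; omega
    · exact this
  · intro i hi hpos
    have := h.full i hi hpos
    rw [hld i hi]
    split_ifs with e
    · subst e; omega
    · exact this

end Hungarian
end CapMedian

namespace CapMedian

/-! ### The program for optimal assignments -/

/-- `e < f` as a test. -/
def Ex.lt (e f : Ex) : Ex := f - e

@[simp] theorem Ex.ev_lt {B : ℕ} {s : St} {e f : Ex} :
    (e.lt f).ev B s = f.ev B s - e.ev B s := (rfl)

/-- One-sided conditional. -/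
def Com.cond (e : Ex) (P : Com) : Com := .ite e P .skip

@[simp] theorem Com.ev_cond {n B : ℕ} {s : St} (e : Ex) (P : Com) :
    (Com.cond e P).ev n B s = if e.ev B s ≠ 0 then P.ev n B s else s := (rfl)

/-- Cost of serving client `j` from facility `i`. -/
def Ex.dist (i j : Ex) : Ex := .lo (.c 4 + .rd .row i + j)

namespace Code

def keepBest : Com :=
  .seq (.set .bs (.v .t)) (.seq (.set .bi (.v .i)) (.seq (.set .bj (.v .j)) (.set .fnd (.c 1))))

/-- Inspect the pair of facility `i` and client `j`. -/
def inspect : Com :=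
  .cond (.lt (.v .i) (.v .nF)) (.cond (.rd .cur (.v .i)) (.ite (.rd .reach (.v .i)) .skip
    (.seq (.set .t (.dist (.v .i) (.v .j) + .rd .price (.v .i) - .rd .dual (.v .j)))
      (.ite (.v .fnd) (.cond (.lt (.v .t) (.v .bs)) keepBest) keepBest))))

/-- Find the cheapest way to reach a new facility. -/
def search : Com :=
  .seq (.set .fnd (.c 0)) (.loop .j (.cond (.lt (.v .j) (.v .j0 + .c 1))
    (.cond (.rd .reach (.rd .asg (.v .j))) (.loop .i inspect))))

def raiseDual : Com :=
  .loop .j (.cond (.lt (.v .j) (.v .j0 + .c 1)) (.cond (.rd .reach (.rd .asg (.v .j)))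
    (.wr .dual (.v .j) (.rd .dual (.v .j) + .v .bs))))

def raisePrice : Com :=
  .loop .i (.cond (.rd .reach (.v .i)) (.wr .price (.v .i) (.rd .price (.v .i) + .v .bs)))

def newAlt : Com :=
  .seq (.set .w (.rd .asg (.v .bj)))
    (.seq (.loop .j (.cond (.lt (.v .j) (.v .nC))
      (.wr .alt (.rd .row (.v .bi) + .v .j) (.rd .alt (.rd .row (.v .w) + .v .j)))))
    (.seq (.wr .alt (.rd .row (.v .bi) + .v .bj) (.v .bi)) (.wr .reach (.v .bi) (.c 1))))

def commit : Com :=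
  .cond (.lt (.rd .load (.v .bi)) (.v .nU))
    (.seq (.loop .j (.cond (.lt (.v .j) (.v .nC))
      (.wr .asg (.v .j) (.rd .alt (.rd .row (.v .bi) + .v .j)))))
    (.seq (.wr .load (.v .bi) (.rd .load (.v .bi) + .c 1)) (.set .done (.c 1))))

def growStep : Com :=
  .ite (.v .done) .skip (.seq search (.seq raiseDual (.seq raisePrice (.seq newAlt commit))))

/-- Prepare the insertion of client `j0`. -/
def startInsert : Com :=
  .seq (.wr .asg (.v .j0) (.v .nF)) (.seq (.wr .dual (.v .j0) (.c 0))
    (.seq (.loop .i (.wr .reach (.v .i) (.c 0))) (.seq (.wr .reach (.v .nF) (.c 1))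
    (.seq (.loop .j (.cond (.lt (.v .j) (.v .nC))
      (.wr .alt (.rd .row (.v .nF) + .v .j) (.rd .asg (.v .j))))) (.set .done (.c 0))))))

def insertClient : Com := .seq startInsert (.loop .y growStep)

/-- Compute a cheapest assignment to the facilities marked in `cur`. -/
def optimize : Com :=
  .seq (.loop .i (.wr .load (.v .i) (.c 0))) (.seq (.loop .i (.wr .price (.v .i) (.c 0)))
    (.loop .j0 (.cond (.lt (.v .j0) (.v .nC)) insertClient)))

/-- Compute the cost of the assignment `asg`. -/
def evalCost : Com :=
  .seq (.set .tot (.c 0)) (.loop .j (.cond (.lt (.v .j) (.v .nC))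
    (.set .tot (.v .tot + .dist (.rd .asg (.v .j)) (.v .j)))))

end Code

open Finset

/-- Service costs, indexed by natural numbers. -/
def Instance.dist (I : Instance ℕ) (i j : ℕ) : ℕ :=
  if h : i < I.F ∧ j < I.C then I.c (.inl ⟨i, h.1⟩) (.inr ⟨j, h.2⟩) else 0

/-- The state holds the data of the instance. -/
structure Env (I : Instance ℕ) (s : St) : Prop where
  nF : s.v .nF = I.F
  nC : s.v .nC = I.C
  nK : s.v .nK = I.k
  nU : s.v .nU = I.U
  row : ∀ i ≤ I.F, s.a .row i = i * I.C
  low : ∀ i < I.F, ∀ j < I.C, s.low (4 + i * I.C + j) = I.dist i j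

theorem Env.congr {I : Instance ℕ} {s s' : St} (h : Env I s) (h1 : s'.v .nF = s.v .nF)
    (h2 : s'.v .nC = s.v .nC) (h3 : s'.v .nK = s.v .nK) (h4 : s'.v .nU = s.v .nU)
    (h5 : s'.a .row = s.a .row) (h6 : s'.low = s.low) : Env I s' :=
  ⟨h1.trans h.nF, h2.trans h.nC, h3.trans h.nK, h4.trans h.nU, by rw [h5]; exact h.row,
    by rw [h6]; exact h.low⟩

theorem Env.ev {I : Instance ℕ} {n B : ℕ} {s : St} (h : Env I s) (P : Com)
    (h1 : P.wv .nF = false := by rfl)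
    (h2 : P.wv .nC = false := by rfl) (h3 : P.wv .nK = false := by rfl)
    (h4 : P.wv .nU = false := by rfl) (h5 : P.wa .row = false := by rfl)
    (h6 : P.wl = false := by rfl) : Env I (P.ev n B s) :=
  h.congr (P.ev_v_eq s h1) (P.ev_v_eq s h2) (P.ev_v_eq s h3) (P.ev_v_eq s h4) (P.ev_a_eq s h5)
    (P.ev_low_eq s h6)

theorem Env.ev_dist {I : Instance ℕ} {B : ℕ} {s : St} (h : Env I s)
    (hB : 4 + I.F * I.C + I.F + I.C ≤ B) {e f : Ex} (he : e.ev B s < I.F) (hf : f.ev B s < I.C) :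
    (Ex.dist e f).ev B s = I.dist (e.ev B s) (f.ev B s) := by
  have h1 : (e.ev B s + 1) * I.C ≤ I.F * I.C := Nat.mul_le_mul_right _ he
  rw [add_mul] at h1
  simp only [Ex.dist, Ex.ev_lo, Ex.ev_add, Ex.ev_c, Ex.ev_rd, h.row _ he.le]
  rw [if_pos (by omega), h.low _ he _ hf]

/-- The set marked by an array. -/
def marked (f : ℕ → ℕ) (m : ℕ) : Finset ℕ := {i ∈ range m | f i ≠ 0}

theorem mem_marked {f : ℕ → ℕ} {m i : ℕ} : i ∈ marked f m ↔ i < m ∧ f i ≠ 0 := by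
  simp [marked]

section Search

variable {I : Instance ℕ} {B : ℕ} {s : St}

/-- Facility `i` can be reached through client `j`. -/
def Cand (I : Instance ℕ) (s : St) (i j : ℕ) : Prop :=
  i < I.F ∧ s.a .cur i ≠ 0 ∧ s.a .reach i = 0 ∧ j ≤ s.v .j0 ∧ s.a .reach (s.a .asg j) ≠ 0

/-- The slack of the pair. -/
def slack (I : Instance ℕ) (s : St) (i j : ℕ) : ℕ := I.dist i j + s.a .price i - s.a .dual j

/-- The best candidate among those seen so far is stored in `s'`. -/
def BestOf (I : Instance ℕ) (s s' : St) (Seen : ℕ → ℕ → Prop) : Prop :=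
  (s'.v .fnd = 0 ∧ ∀ i j, Seen i j → ¬ Cand I s i j) ∨
  (s'.v .fnd ≠ 0 ∧ Cand I s (s'.v .bi) (s'.v .bj) ∧ s'.v .bs = slack I s (s'.v .bi) (s'.v .bj) ∧
    ∀ i j, Seen i j → Cand I s i j → s'.v .bs ≤ slack I s i j)

theorem BestOf.mono {s' : St} {Seen Seen' : ℕ → ℕ → Prop} (h : BestOf I s s' Seen)
    (hsub : ∀ i j, Cand I s i j → Seen' i j → Seen i j) : BestOf I s s' Seen' := by
  rcases h with ⟨h1, h2⟩ | ⟨h1, h2, h3, h4⟩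
  · exact Or.inl ⟨h1, fun i j hs hc => h2 i j (hsub i j hc hs) hc⟩
  · exact Or.inr ⟨h1, h2, h3, fun i j hs hc => h4 i j (hsub i j hc hs) hc⟩

theorem ev_inspect (hE : Env I s) (hB : 4 + I.F * I.C + I.F + I.C ≤ B) (n : ℕ)
    (hC : s.v .j0 < I.C) {s' : St}
    (hv : ∀ x, Code.inspect.wv x = false → x ≠ .i → x ≠ .j → s'.v x = s.v x) (ha : s'.a = s.a)
    (hl : s'.low = s.low) (hj : s'.v .j ≤ s.v .j0)
    (hr : s.a .reach (s.a .asg (s'.v .j)) ≠ 0) {Seen : ℕ → ℕ → Prop} (h : BestOf I s s' Seen) :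
    BestOf I s (Code.inspect.ev n B s')
      (fun i j => Seen i j ∨ i = s'.v .i ∧ j = s'.v .j) := by
  have hE' : Env I s' := hE.congr (hv _ rfl (by decide) (by decide)) (hv _ rfl (by decide) (by decide))
    (hv _ rfl (by decide) (by decide)) (hv _ rfl (by decide) (by decide)) (by rw [ha]) hl
  have hskip : ¬ Cand I s (s'.v .i) (s'.v .j) → BestOf I s s'
      (fun i j => Seen i j ∨ i = s'.v .i ∧ j = s'.v .j) := fun hn => h.mono fun i j hc hs => by
    rcases hs with hs | ⟨rfl, rfl⟩
    · exact hs
    · exact absurd hc hn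
  simp only [Code.inspect, Com.ev_cond, Ex.ev_lt, Ex.ev_v, Ex.ev_rd, Com.ev_ite, Com.ev_skip,
    Com.ev_seq, Com.ev_set, hE'.nF]
  by_cases c1 : s'.v .i < I.F
  swap
  · rw [if_neg (by omega)]
    exact hskip fun hc => c1 hc.1
  rw [if_pos (by omega)]
  by_cases c2 : s'.a .cur (s'.v .i) = 0
  · rw [if_neg (by simpa using c2)]
    exact hskip fun hc => hc.2.1 (by rw [← ha]; exact c2)
  rw [if_pos c2]
  by_cases c3 : s'.a .reach (s'.v .i) = 0
  swap
  · rw [if_pos c3]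
    exact hskip fun hc => c3 (by rw [ha]; exact hc.2.2.1)
  rw [if_neg (by simpa using c3)]
  rw [ha] at c2 c3
  have hcand : Cand I s (s'.v .i) (s'.v .j) := ⟨c1, c2, c3, hj, hr⟩
  have ht : (Ex.dist (.v .i) (.v .j) + .rd .price (.v .i) - .rd .dual (.v .j)).ev B s' =
      slack I s (s'.v .i) (s'.v .j) := by
    rw [Ex.ev_sub, Ex.ev_add, hE'.ev_dist hB (by exact c1) (by simp only [Ex.ev_v]; omega)]
    simp only [Ex.ev_v, Ex.ev_rd, ha, slack]
  rw [ht]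
  have hkeep : (∀ i j, Seen i j → Cand I s i j → slack I s (s'.v .i) (s'.v .j) ≤ slack I s i j) →
      BestOf I s (Code.keepBest.ev n B (s'.setV .t (slack I s (s'.v .i) (s'.v .j))))
        (fun i j => Seen i j ∨ i = s'.v .i ∧ j = s'.v .j) := by
    intro hmin
    right
    simp only [Code.keepBest, Com.ev_seq, Com.ev_set, Ex.ev_v, Ex.ev_c, St.setV_v,
      Function.update_apply, reduceCtorEq, if_true, if_false]
    refine ⟨one_ne_zero, hcand, trivial, fun i j hs hc => ?_⟩
    rcases hs with hs | ⟨rfl, rfl⟩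
    · exact hmin i j hs hc
    · exact le_rfl
  simp only [St.setV_v, Function.update_apply, reduceCtorEq, if_true, if_false]
  rcases h with ⟨h1, h2⟩ | ⟨h1, h2, h3, h4⟩
  · rw [if_neg (by simpa using h1)]
    exact hkeep fun i j hs hc => absurd hc (h2 i j hs)
  · rw [if_pos h1]
    split_ifs with hlt
    · exact hkeep fun i j hs hc => (by omega : _ ≤ s'.v .bs).trans (h4 i j hs hc)
    · right
      simp only [St.setV_v, Function.update_apply, reduceCtorEq, if_false]
      refine ⟨h1, h2, h3, fun i j hs hc => ?_⟩
      rcases hs with hs | ⟨rfl, rfl⟩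
      · exact h4 i j hs hc
      · omega

theorem ev_search (hE : Env I s) (hB : 4 + I.F * I.C + I.F + I.C ≤ B) (hC : s.v .j0 < I.C) :
    BestOf I s (Code.search.ev (I.F + I.C + 1) B s) fun _ _ => True := by
  rw [Code.search, Com.ev_seq]
  set s0 := (Com.set Var.fnd (Ex.c 0)).ev (I.F + I.C + 1) B s with hs0
  have v0 : ∀ x, x ≠ .fnd → s0.v x = s.v x := fun x hx => by
    simp [hs0, Function.update_of_ne hx]
  have key : BestOf I s ((Com.loop .j (.cond (.lt (.v .j) (.v .j0 + .c 1))
      (.cond (.rd .reach (.rd .asg (.v .j))) (.loop .i Code.inspect)))).ev (I.F + I.C + 1) B s0)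
      fun _ j => j < I.F + I.C + 1 := by
    refine Com.ev_loop_frame (s := s0) (fun m s' => BestOf I s s' fun _ j => j < m) ?_ ?_
    · left
      exact ⟨by simp [hs0], fun _ _ h => absurd h (by omega)⟩
    · intro j hj s1 hv ha hl hbest
      have hv' : ∀ x, Code.inspect.wv x = false → x ≠ .i → x ≠ .j →
          (s1.setV .j j).v x = s.v x := by
        intro x hx hxi hxj
        rw [St.setV_v, Function.update_of_ne hxj, hv, v0]
        · rintro rfl; exact absurd hx (by decide)
        · simp [Com.wv, Com.cond, hx, hxi.symm, hxj.symm]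
      have ha' : (s1.setV .j j).a = s.a := by
        funext k; rw [St.setV_a, ha k (by cases k <;> rfl)]; rfl
      have hl' : (s1.setV .j j).low = s.low := by rw [St.setV_low, hl rfl]; rfl
      have hj0 : (s1.setV .j j).v .j0 = s.v .j0 := hv' _ rfl (by decide) (by decide)
      have hjj : (s1.setV .j j).v .j = j := by simp
      have hskip : (∀ i, ¬ Cand I s i j) → BestOf I s (s1.setV .j j) fun _ j' => j' < j + 1 := by
        intro hn
        have : BestOf I s (s1.setV .j j) fun _ j' => j' < j := by
          simpa [BestOf, Function.update_apply] using hbest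
        refine this.mono fun i j' hc hlt => ?_
        rcases Nat.lt_succ_iff_lt_or_eq.1 hlt with h | rfl
        · exact h
        · exact absurd hc (hn i)
      simp only [Com.ev_cond, Ex.ev_lt, Ex.ev_add, Ex.ev_v, Ex.ev_c, Ex.ev_rd, hj0, hjj, ha']
      by_cases c1 : j ≤ s.v .j0
      swap
      · rw [if_neg (by omega)]
        exact hskip fun i hc => c1 hc.2.2.2.1
      rw [if_pos (by omega)]
      by_cases c2 : s.a .reach (s.a .asg j) = 0
      · rw [if_neg (by simpa using c2)]
        exact hskip fun i hc => hc.2.2.2.2 c2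
      rw [if_pos c2]
      have inner : BestOf I s ((Com.loop .i Code.inspect).ev (I.F + I.C + 1) B (s1.setV .j j))
          fun i' j' => j' < j ∨ (i' < I.F + I.C + 1 ∧ j' = j) := by
        refine Com.ev_loop_frame
          (fun m s' => BestOf I s s' fun i' j' => j' < j ∨ (i' < m ∧ j' = j)) ?_ ?_
        · have : BestOf I s (s1.setV .j j) fun _ j' => j' < j := by
            simpa [BestOf, Function.update_apply] using hbest
          exact this.mono fun i' j' _ h => by omega
        · intro i hi s2 hv2 ha2 hl2 hb2
          have hj2 : (s2.setV .i i).v .j = j := by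
            simp only [St.setV_v, Function.update_apply, reduceCtorEq, if_false]
            rw [hv2 .j rfl, hjj]
          have hb2' : BestOf I s (s2.setV .i i) fun i' j' => j' < j ∨ (i' < i ∧ j' = j) := by
            simpa [BestOf, Function.update_apply] using hb2
          have := ev_inspect hE hB (I.F + I.C + 1) hC (s' := s2.setV .i i) (fun x hx hxi hxj => by
            rw [St.setV_v, Function.update_of_ne hxi, hv2 x (by
              simp only [Com.wv, hx, Bool.or_false, beq_eq_false_iff_ne]; exact hxi.symm)]
            exact hv' x hx hxi hxj) (by
            funext k; rw [St.setV_a, ha2 k (by cases k <;> rfl), ha']) (by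
            rw [St.setV_low, hl2 rfl, hl']) (by rw [hj2]; exact c1) (by rw [hj2]; exact c2) hb2'
          refine this.mono fun i' j' _ h => ?_
          rw [hj2]
          simp only [St.setV_v, Function.update_self]
          omega
      refine inner.mono fun i' j' hc h => ?_
      have := hc.1
      omega
  exact key.mono fun i j hc _ => by have := hc.2.2.2.1; omega

end Search
end CapMedian

namespace CapMedian
section Optimize
open Finset

variable {I : Instance ℕ} {n B : ℕ} {s : St}

theorem row_add_inj {C i j i' j' : ℕ} (hj : j < C) (hj' : j' < C) (h : i * C + j = i' * C + j') :
    i = i' ∧ j = j' := by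
  have h1 : (i * C + j) / C = i := by
    rw [mul_comm, Nat.mul_add_div (by omega), Nat.div_eq_of_lt hj, add_zero]
  have h2 : (i' * C + j') / C = i' := by
    rw [mul_comm, Nat.mul_add_div (by omega), Nat.div_eq_of_lt hj', add_zero]
  have : i = i' := by rw [← h1, ← h2, h]
  subst this
  exact ⟨rfl, by omega⟩

theorem ev_raiseDual (j : ℕ) (hj : j < n) : (Code.raiseDual.ev n B s).a .dual j =
    if j ≤ s.v .j0 ∧ s.a .reach (s.a .asg j) ≠ 0 then s.a .dual j + s.v .bs else s.a .dual j := by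
  have := Com.ev_loop_fill (n := n) (B := B) (x := .j) (s := s)
    (P := .cond (.lt (.v .j) (.v .j0 + .c 1)) (.cond (.rd .reach (.rd .asg (.v .j)))
    (.wr .dual (.v .j) (.rd .dual (.v .j) + .v .bs)))) .dual
    (fun j => if j ≤ s.v .j0 ∧ s.a .reach (s.a .asg j) ≠ 0 then s.a .dual j + s.v .bs
      else s.a .dual j) (by
    intro i hi s' hv ha hl hk
    have e1 := hv .j0 rfl
    have e2 := hv .bs rfl
    have e3 := ha .reach rfl
    have e4 := ha .asg rfl
    simp only [Com.ev_cond, Ex.ev_lt, Ex.ev_add, Ex.ev_v, Ex.ev_c, Ex.ev_rd, St.setV_v, St.setV_a,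
      Function.update_apply, reduceCtorEq, if_true, if_false, e1, e2, e3, e4, Com.ev_wr]
    by_cases c1 : i ≤ s.v .j0
    · rw [if_pos (by omega)]
      by_cases c2 : s.a .reach (s.a .asg i) = 0
      · rw [if_neg (by simpa using c2), if_neg (by tauto), ← hk, Function.update_eq_self]; rfl
      · rw [if_pos c2, if_pos ⟨c1, c2⟩]
        simp [hk]
    · rw [if_neg (by omega), if_neg (by tauto), ← hk, Function.update_eq_self]; rfl)
  rw [Code.raiseDual, this]
  simp [hj]

theorem ev_raisePrice (i : ℕ) (hi : i < n) : (Code.raisePrice.ev n B s).a .price i =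
    if s.a .reach i ≠ 0 then s.a .price i + s.v .bs else s.a .price i := by
  have := Com.ev_loop_fill (n := n) (B := B) (x := .i) (s := s)
    (P := .cond (.rd .reach (.v .i)) (.wr .price (.v .i) (.rd .price (.v .i) + .v .bs))) .price
    (fun i => if s.a .reach i ≠ 0 then s.a .price i + s.v .bs else s.a .price i) (by
    intro i hi s' hv ha hl hk
    have e2 := hv .bs rfl
    have e3 := ha .reach rfl
    simp only [Com.ev_cond, Ex.ev_add, Ex.ev_v, Ex.ev_rd, St.setV_v, St.setV_a,
      Function.update_apply, reduceCtorEq, if_true, if_false, e2, e3, Com.ev_wr]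
    by_cases c2 : s.a .reach i = 0
    · rw [if_neg (by simpa using c2), if_neg (by simpa using c2), ← hk, Function.update_eq_self]; rfl
    · rw [if_pos c2, if_pos c2]
      simp [hk])
  rw [Code.raisePrice, this]
  simp [hi]

/-- Copying a row of `alt`. -/
theorem ev_copyRow (hE : Env I s) (hbi : s.v .bi ≤ I.F) (hw : s.v .w ≤ I.F)
    (hne : s.v .w ≠ s.v .bi) (i j : ℕ) (hj : j < I.C) :
    ((Com.loop .j (.cond (.lt (.v .j) (.v .nC)) (.wr .alt (.rd .row (.v .bi) + .v .j)
      (.rd .alt (.rd .row (.v .w) + .v .j))))).ev (I.F + I.C + 1) B s).a .alt (i * I.C + j) =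
    if i = s.v .bi then s.a .alt (s.v .w * I.C + j) else s.a .alt (i * I.C + j) := by
  have := Com.ev_loop_frame (n := I.F + I.C + 1) (B := B) (x := .j) (s := s)
    (P := .cond (.lt (.v .j) (.v .nC)) (.wr .alt (.rd .row (.v .bi) + .v .j)
      (.rd .alt (.rd .row (.v .w) + .v .j))))
    (fun m s' => ∀ i j, j < I.C → s'.a .alt (i * I.C + j) =
      if i = s.v .bi ∧ j < m then s.a .alt (s.v .w * I.C + j) else s.a .alt (i * I.C + j))
    (by simp) (by
    intro m hm s' hv ha hl hI i j hj
    have e1 := hv .bi rfl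
    have e2 := hv .w rfl
    have e3 := ha .row rfl
    have e4 := hv .nC rfl
    simp only [Com.ev_cond, Ex.ev_lt, Ex.ev_add, Ex.ev_v, Ex.ev_rd, St.setV_v, St.setV_a,
      Function.update_apply, reduceCtorEq, if_true, if_false, e1, e2, e3, e4, Com.ev_wr,
      hE.row _ hbi, hE.row _ hw, hE.nC]
    by_cases c1 : m < I.C
    · rw [if_pos (by omega)]
      simp only [St.setA_a, St.setV_a, Function.update_self, Function.update_apply]
      by_cases c2 : i * I.C + j = s.v .bi * I.C + m
      · obtain ⟨rfl, rfl⟩ := row_add_inj hj c1 c2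
        rw [if_pos rfl, hI _ _ hj, if_neg (by tauto), if_pos ⟨rfl, by omega⟩]
      · rw [if_neg c2, hI _ _ hj]
        refine if_congr (and_congr_right fun e => ?_) rfl rfl
        have : j ≠ m := fun e' => c2 (by rw [e, e'])
        omega
    · rw [if_neg (by omega)]
      simp only [St.setV_a]
      rw [hI _ _ hj]
      exact if_congr (and_congr_right fun e => by omega) rfl rfl)
  rw [this i j hj]
  exact if_congr (by omega) rfl rfl

theorem ev_newAlt (hE : Env I s) (hbi : s.v .bi ≤ I.F) (hw : s.a .asg (s.v .bj) ≤ I.F)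
    (hne : s.a .asg (s.v .bj) ≠ s.v .bi) (hbj : s.v .bj < I.C) :
    (∀ i j, j < I.C → (Code.newAlt.ev (I.F + I.C + 1) B s).a .alt (i * I.C + j) =
      if i = s.v .bi then (if j = s.v .bj then s.v .bi else
        s.a .alt (s.a .asg (s.v .bj) * I.C + j)) else s.a .alt (i * I.C + j)) ∧
    (Code.newAlt.ev (I.F + I.C + 1) B s).a .reach = Function.update (s.a .reach) (s.v .bi) 1 := by
  rw [Code.newAlt, Com.ev_seq, Com.ev_seq, Com.ev_seq]
  set s1 := (Com.set .w (.rd .asg (.v .bj))).ev (I.F + I.C + 1) B s with hs1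
  have f1 : ∀ x, x ≠ .w → s1.v x = s.v x := fun x hx => by simp [hs1, Function.update_of_ne hx]
  have f2 : s1.a = s.a := rfl
  have f3 : s1.v .w = s.a .asg (s.v .bj) := by simp [hs1]
  have hE1 : Env I s1 := hE.ev _
  have hcopy := ev_copyRow (B := B) hE1 (by rw [f1 _ (by decide)]; exact hbi) (by rw [f3]; exact hw)
    (by rw [f3, f1 _ (by decide)]; exact hne)
  set P : Com := Com.loop .j (.cond (.lt (.v .j) (.v .nC)) (.wr .alt (.rd .row (.v .bi) + .v .j)
      (.rd .alt (.rd .row (.v .w) + .v .j)))) with hP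
  set s2 := P.ev (I.F + I.C + 1) B s1 with hs2
  have g1 : s2.v .bi = s.v .bi := by
    rw [hs2, P.ev_v_eq s1 (by rw [hP]; rfl), f1 _ (by decide)]
  have g2 : s2.v .bj = s.v .bj := by
    rw [hs2, P.ev_v_eq s1 (by rw [hP]; rfl), f1 _ (by decide)]
  have g3 : s2.a .reach = s.a .reach := by
    rw [hs2, P.ev_a_eq s1 (by rw [hP]; rfl), f2]
  have g4 : s2.a .row = s.a .row := by
    rw [hs2, P.ev_a_eq s1 (by rw [hP]; rfl), f2]
  constructor
  · intro i j hj
    simp only [Com.ev_wr, St.setA_a, Ex.ev_add, Ex.ev_rd, Ex.ev_v, St.setA_v, g1, g2, g4,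
      Function.update_apply, reduceCtorEq, if_true, if_false, hE.row _ hbi]
    by_cases c : i * I.C + j = s.v .bi * I.C + s.v .bj
    · obtain ⟨e1, e2⟩ := row_add_inj hj hbj c
      rw [if_pos c, if_pos e1, if_pos e2]
    · rw [if_neg c, hcopy i j hj, f1 _ (by decide), f3, f2]
      by_cases e : i = s.v .bi
      · rw [if_pos e, if_pos e, if_neg fun e' => c (by rw [e, e'])]
      · rw [if_neg e, if_neg e]
  · simp only [Com.ev_wr, St.setA_a, Ex.ev_c, Ex.ev_v, St.setA_v, g1, Function.update_self,
      Function.update_of_ne (show Arr.reach ≠ .alt by decide), g3]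

theorem ev_commit (hE : Env I s) (hbi : s.v .bi ≤ I.F) :
    if s.a .load (s.v .bi) < I.U then
      (∀ j < I.C, (Code.commit.ev (I.F + I.C + 1) B s).a .asg j =
        s.a .alt (s.v .bi * I.C + j)) ∧
      (Code.commit.ev (I.F + I.C + 1) B s).a .load =
        Function.update (s.a .load) (s.v .bi) (s.a .load (s.v .bi) + 1) ∧
      (Code.commit.ev (I.F + I.C + 1) B s).v .done = 1
    else Code.commit.ev (I.F + I.C + 1) B s = s := by
  split_ifs with h
  · rw [Code.commit, Com.ev_cond, if_pos (by simp [hE.nU]; omega), Com.ev_seq, Com.ev_seq]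
    have hfill := Com.ev_loop_fill (n := I.F + I.C + 1) (B := B) (x := .j) (s := s)
      (P := .cond (.lt (.v .j) (.v .nC)) (.wr .asg (.v .j) (.rd .alt (.rd .row (.v .bi) + .v .j))))
      .asg (fun j => if j < I.C then s.a .alt (s.v .bi * I.C + j) else s.a .asg j) (by
      intro i hi s' hv ha hl hk
      have e1 := hv .bi rfl
      have e2 := hv .nC rfl
      have e3 := ha .alt rfl
      have e4 := ha .row rfl
      simp only [Com.ev_cond, Ex.ev_lt, Ex.ev_add, Ex.ev_v, Ex.ev_rd, St.setV_v, St.setV_a,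
        Function.update_apply, reduceCtorEq, if_true, if_false, e1, e2, e3, e4, Com.ev_wr,
        hE.row _ hbi, hE.nC]
      by_cases c1 : i < I.C
      · rw [if_pos (by omega), if_pos c1]
        simp
      · rw [if_neg (by omega), if_neg c1, ← hk, Function.update_eq_self]; rfl)
    set P : Com := .loop .j (.cond (.lt (.v .j) (.v .nC))
      (.wr .asg (.v .j) (.rd .alt (.rd .row (.v .bi) + .v .j)))) with hP
    have g1 : (P.ev (I.F + I.C + 1) B s).v .bi = s.v .bi := P.ev_v_eq s (by rw [hP]; rfl)
    have g2 : (P.ev (I.F + I.C + 1) B s).a .load = s.a .load := P.ev_a_eq s (by rw [hP]; rfl)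
    refine ⟨fun j hj => ?_, ?_, ?_⟩
    · simp only [Com.ev_set, Com.ev_wr, St.setV_a, St.setA_a,
        Function.update_of_ne (show Arr.asg ≠ .load by decide), hfill]
      rw [if_pos (by omega), if_pos hj]
    · simp [g1, g2]
    · simp
  · rw [Code.commit, Com.ev_cond, if_neg (by simp [hE.nU]; omega)]

end Optimize
end CapMedian

/-! ### Correctness of the program for optimal assignments. -/

namespace CapMedian
section Optimize
open Finset

variable {I : Instance ℕ} {B : ℕ} {s : St}

/-- The facilities marked in `cur`. -/
abbrev curSet (I : Instance ℕ) (s : St) : Finset ℕ := marked (s.a .cur) I.F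

/-- The reached facilities, including the dummy. -/
abbrev reachSet (I : Instance ℕ) (s : St) : Finset ℕ := marked (s.a .reach) (I.F + 1)

/-- The state holds an optimal assignment of the first `m` clients to the set `T`. -/
abbrev HasCert (I : Instance ℕ) (T : Finset ℕ) (s : St) (m : ℕ) : Prop :=
  OptCert I.dist T I.U m (s.a .asg) (s.a .dual) (s.a .price) (s.a .load)

/-- The state is one of the search for a place for client `m`. -/
abbrev Growing (I : Instance ℕ) (s : St) (m : ℕ) : Prop :=
  Grow I.dist (curSet I s) I.U I.F m (s.a .asg) (s.a .dual) (s.a .price) (s.a .load)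
    (reachSet I s) (fun i j => s.a .alt (i * I.C + j))

/-- The cheapest pair of an unreached open facility and a client of a reached one determines the
price increase `δ`, and the facility becomes reached. If it has spare capacity the insertion is
completed, otherwise all reached facilities are still full. Total capacity above `m` guarantees that
a pair exists. -/
theorem growStep_spec (hE : Env I s) (hB : 4 + I.F * I.C + I.F + I.C ≤ B) {m : ℕ}
    (hm : s.v .j0 = m) (hmC : m < I.C) (hd : s.v .done = 0) (hG : Growing I s m)
    (hfull : ∀ i ∈ reachSet I s, i ≠ I.F → s.a .load i = I.U)
    (hcap : m < #(curSet I s) * I.U) {s' : St} (hs' : s' = Code.growStep.ev (I.F + I.C + 1) B s) :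
    (s'.v .done ≠ 0 ∧ HasCert I (curSet I s) s' (m + 1)) ∨
    (s'.v .done = 0 ∧ Growing I s' m ∧
      (∀ i ∈ reachSet I s', i ≠ I.F → s'.a .load i = I.U) ∧
      #(reachSet I s') = #(reachSet I s) + 1) := by
  set n := I.F + I.C + 1 with hn
  rw [Code.growStep, Com.ev_ite, if_neg (by simpa using hd), Com.ev_seq, Com.ev_seq, Com.ev_seq,
    Com.ev_seq] at hs'
  set s1 := Code.search.ev n B s with h1
  set s2 := Code.raiseDual.ev n B s1 with h2
  set s3 := Code.raisePrice.ev n B s2 with h3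
  set s4 := Code.newAlt.ev n B s3 with h4
  have a1 : s1.a = s.a := by funext k; exact Code.search.ev_a_eq s (by cases k <;> rfl)
  have hasgF : ∀ j ≤ m, s.a .asg j ≤ I.F := by
    intro j hj
    rcases hj.eq_or_lt with rfl | hj
    · rw [hG.new]
    · exact (mem_marked.1 (hG.mem j hj)).1.le
  have hreach : ∀ i ≤ I.F, i ∈ reachSet I s ↔ s.a .reach i ≠ 0 := fun i hi => by
    rw [mem_marked]; exact and_iff_right (by omega)
  obtain ⟨i₀, hi₀, hi₀'⟩ := hG.exists_notMem hfull hcap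
  have hc₀ : Cand I s i₀ m := by
    have h := mem_marked.1 hi₀
    refine ⟨h.1, h.2, ?_, hm.ge, ?_⟩
    · by_contra hne; exact hi₀' ((hreach _ h.1.le).2 hne)
    · rw [hG.new]; exact (hreach _ le_rfl).1 hG.dummy_mem
  rcases ev_search hE hB (by rw [hm]; exact hmC) with ⟨-, hno⟩ | ⟨-, hcand, hbs, hmin⟩
  · exact absurd hc₀ (hno _ _ trivial)
  rw [← hn, ← h1] at hcand hbs hmin
  set bi := s1.v .bi with hbi
  set bj := s1.v .bj with hbj
  set δ := s1.v .bs with hδ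
  obtain ⟨c1, c2, c3, c4, c5⟩ := hcand
  rw [hm] at c4
  have hbiT : bi ∈ curSet I s := mem_marked.2 ⟨c1, c2⟩
  have hbiW : bi ∉ reachSet I s := fun h => (hreach _ c1.le).1 h c3
  have hbjW : s.a .asg bj ∈ reachSet I s := (hreach _ (hasgF _ c4)).2 c5
  have hslack : ∀ i ∈ curSet I s, ∀ j ≤ m, s.a .dual j + slack I s i j =
      I.dist i j + s.a .price i := fun i hi j hj => by
    have := hG.feas j hj i hi
    unfold slack; omega
  have hE1 : Env I s1 := hE.ev _
  have hE2 : Env I s2 := hE1.ev _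
  have hE3 : Env I s3 := hE2.ev _
  have hE4 : Env I s4 := hE3.ev _
  have v3bi : s3.v .bi = bi := by
    rw [h3, Code.raisePrice.ev_v_eq s2 rfl, h2, Code.raiseDual.ev_v_eq s1 rfl]
  have v3bj : s3.v .bj = bj := by
    rw [h3, Code.raisePrice.ev_v_eq s2 rfl, h2, Code.raiseDual.ev_v_eq s1 rfl]
  have v2bs : s2.v .bs = δ := by rw [h2, Code.raiseDual.ev_v_eq s1 rfl]
  have v1j0 : s1.v .j0 = m := by rw [h1, Code.search.ev_v_eq s rfl, hm]
  have a2 : ∀ k, k ≠ .dual → s2.a k = s.a k := fun k hk => by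
    rw [h2, Code.raiseDual.ev_a_eq s1 (by cases k <;> first | rfl | exact absurd rfl hk), a1]
  have a3 : ∀ k, k ≠ .dual → k ≠ .price → s3.a k = s.a k := fun k hk hk' => by
    rw [h3, Code.raisePrice.ev_a_eq s2 (by cases k <;> first | rfl | exact absurd rfl hk'), a2 k hk]
  have a3d : s3.a .dual = s2.a .dual := by rw [h3, Code.raisePrice.ev_a_eq s2 rfl]
  have hasg3 : s3.a .asg = s.a .asg := a3 _ (by decide) (by decide)
  obtain ⟨halt, hreach4⟩ := ev_newAlt (B := B) hE3 (by rw [v3bi]; exact c1.le)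
    (by rw [v3bj, hasg3]; exact hasgF _ c4)
    (by rw [v3bj, hasg3, v3bi]; exact fun e => hbiW (e ▸ hbjW)) (by rw [v3bj]; omega)
  rw [← hn, ← h4, v3bi, v3bj, hasg3, a3 .alt (by decide) (by decide)] at halt
  rw [← hn, ← h4, v3bi, a3 .reach (by decide) (by decide)] at hreach4
  have a4 : ∀ k, k ≠ .alt → k ≠ .reach → s4.a k = s3.a k := fun k hk hk' => by
    rw [h4, Code.newAlt.ev_a_eq s3
      (by cases k <;> first | rfl | exact absurd rfl hk | exact absurd rfl hk')]
  have hcur4 : s4.a .cur = s.a .cur := by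
    rw [a4 _ (by decide) (by decide), a3 _ (by decide) (by decide)]
  have hload4 : s4.a .load = s.a .load := by
    rw [a4 _ (by decide) (by decide), a3 _ (by decide) (by decide)]
  have hW4 : reachSet I s4 = insert bi (reachSet I s) := by
    ext i
    rw [mem_insert, mem_marked, mem_marked, hreach4, Function.update_apply]
    by_cases e : i = bi
    · subst e; simp; omega
    · simp [e]
  have hG4 : Growing I s4 m := by
    unfold Growing
    rw [hW4]
    simp only [curSet]
    rw [hcur4, hload4, a4 .asg (by decide) (by decide), hasg3, a4 .dual (by decide) (by decide),
      a3d, a4 .price (by decide) (by decide)]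
    refine hG.step hfull hbiT hbiW c4 hbjW (δ := δ) ?_ ?_ ?_ ?_ ?_ ?_
    · rw [hbs, hslack _ hbiT _ c4]
    · intro i hi hiW j hj hjW
      have hi' := mem_marked.1 hi
      have h5 : Cand I s i j := ⟨hi'.1, hi'.2, by
        by_contra hne; exact hiW ((hreach _ hi'.1.le).2 hne), by rw [hm]; exact hj,
        (hreach _ (hasgF j hj)).1 hjW⟩
      have := hmin i j trivial h5
      have := hslack i hi j hj
      omega
    · intro j hj
      rw [h2, ev_raiseDual j (by omega), a1, v1j0]
      refine if_congr ?_ rfl rfl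
      rw [hreach _ (hasgF j hj)]
      exact and_iff_right hj
    · intro i hi
      have hiF := (mem_marked.1 hi).1
      rw [h3, ev_raisePrice i (by omega), v2bs, a2 .reach (by decide), a2 .price (by decide)]
      exact if_congr (hreach _ hiF.le).symm rfl rfl
    · intro i hi j hj
      rw [halt i j (by omega), if_neg fun e : i = bi => hbiW (e ▸ hi)]
    · intro j hj
      rw [halt bi j (by omega), if_pos rfl]
  have v4bi : s4.v .bi = bi := by rw [h4, Code.newAlt.ev_v_eq s3 rfl, v3bi]
  have v4d : s4.v .done = 0 := by
    rw [h4, Code.newAlt.ev_v_eq s3 rfl, h3, Code.raisePrice.ev_v_eq s2 rfl, h2,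
      Code.raiseDual.ev_v_eq s1 rfl, h1, Code.search.ev_v_eq s rfl, hd]
  have hcom := ev_commit (B := B) hE4 (by rw [v4bi]; exact c1.le)
  rw [v4bi, ← hn, ← hs', hload4] at hcom
  split_ifs at hcom with hlt
  · left
    obtain ⟨k1, k2, k3⟩ := hcom
    refine ⟨by rw [k3]; exact one_ne_zero, ?_⟩
    have hbi4 : bi ∈ reachSet I s4 := by rw [hW4]; exact mem_insert_self _ _
    have hT4 : curSet I s4 = curSet I s := by simp only [curSet]; rw [hcur4]
    have kd : s'.a .dual = s4.a .dual := by rw [hs', Code.commit.ev_a_eq s4 rfl]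
    have kp : s'.a .price = s4.a .price := by rw [hs', Code.commit.ev_a_eq s4 rfl]
    have := hG4.optCert (b := bi) hbi4 (by rw [hT4]; exact hbiT) (by rw [hload4]; exact hlt)
      (asg' := s'.a .asg) (ld' := s'.a .load) (fun j hj => k1 j (by omega)) (fun i _ => by
        rw [k2, hload4, Function.update_apply]
        split_ifs with e
        · rw [e]
        · rfl)
    rw [hT4] at this
    unfold HasCert
    rw [kd, kp]
    exact this
  · right
    rw [hcom]
    refine ⟨v4d, hG4, ?_, ?_⟩
    · intro i hi hiF
      rw [hload4]
      rw [hW4, mem_insert] at hi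
      rcases hi with rfl | hi
      · have := hG.cap _ hbiT
        omega
      · exact hfull i hi hiF
    · rw [hW4, card_insert_of_notMem hbiW]

theorem startInsert_spec (hE : Env I s) {m : ℕ} (hm : s.v .j0 = m) (hmC : m < I.C)
    (hH : HasCert I (curSet I s) s m) {s' : St}
    (hs' : s' = Code.startInsert.ev (I.F + I.C + 1) B s) :
    s'.v .done = 0 ∧ Growing I s' m ∧ ∀ i ∈ reachSet I s', i ≠ I.F → s'.a .load i = I.U := by
  set n := I.F + I.C + 1 with hn
  rw [Code.startInsert, Com.ev_seq, Com.ev_seq, Com.ev_seq, Com.ev_seq, Com.ev_seq] at hs'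
  set s1 := (Com.wr .asg (.v .j0) (.v .nF)).ev n B s with h1
  set s2 := (Com.wr .dual (.v .j0) (.c 0)).ev n B s1 with h2
  set s3 := (Com.loop .i (.wr .reach (.v .i) (.c 0))).ev n B s2 with h3
  set s4 := (Com.wr .reach (.v .nF) (.c 1)).ev n B s3 with h4
  set P : Com := .loop .j (.cond (.lt (.v .j) (.v .nC))
      (.wr .alt (.rd .row (.v .nF) + .v .j) (.rd .asg (.v .j)))) with hP
  set s5 := P.ev n B s4 with h5
  have hE2 : Env I s2 := (hE.ev _).ev _
  have hE3 : Env I s3 := hE2.ev (Com.loop .i (.wr .reach (.v .i) (.c 0)))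
  have hE4 : Env I s4 := hE3.ev _
  have asg2 : s2.a .asg = Function.update (s.a .asg) m I.F := by
    simp [h2, h1, hm, hE.nF]
  have dual2 : s2.a .dual = Function.update (s.a .dual) m 0 := by
    simp [h2, h1, hm]
  have k2 : ∀ k, k ≠ .asg → k ≠ .dual → s2.a k = s.a k := fun k h h' => by
    simp [h2, h1, Function.update_of_ne h, Function.update_of_ne h']
  have k3 : ∀ k, k ≠ .reach → s3.a k = s2.a k := fun k h =>
    Com.ev_a_eq (Com.loop .i (.wr .reach (.v .i) (.c 0))) s2
      (by cases k <;> first | rfl | exact absurd rfl h)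
  have reach3 : s3.a .reach = fun i => if i < n then 0 else s2.a .reach i :=
    Com.ev_loop_fill .reach (fun _ => 0) fun i hi s' hv ha hl hk => by simp
  have k4 : ∀ k, k ≠ .reach → s4.a k = s2.a k := fun k h => by
    rw [h4, Com.ev_wr, St.setA_a, Function.update_of_ne h, k3 k h]
  have k5 : ∀ k, k ≠ .alt → s5.a k = s4.a k := fun k h =>
    Com.ev_a_eq P s4 (by rw [hP]; cases k <;> first | rfl | exact absurd rfl h)
  have reach4 : s4.a .reach = Function.update (s3.a .reach) I.F 1 := by
    rw [h4, Com.ev_wr, St.setA_a, Function.update_self, Ex.ev_v, hE3.nF]; rfl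
  have alt5 : ∀ j < I.C, s5.a .alt (I.F * I.C + j) = s4.a .asg j := by
    have := Com.ev_loop_frame (n := n) (B := B) (x := .j) (s := s4)
      (P := .cond (.lt (.v .j) (.v .nC))
        (.wr .alt (.rd .row (.v .nF) + .v .j) (.rd .asg (.v .j))))
      (fun m s' => ∀ j < I.C, j < m → s'.a .alt (I.F * I.C + j) = s4.a .asg j)
      (fun j _ h => absurd h (by omega)) (by
      intro m hm s' hv ha hl hI j hj hjm
      have e1 := hv .nF rfl
      have e2 := hv .nC rfl
      have e3 := ha .row rfl
      have e4 := ha .asg rfl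
      simp only [Com.ev_cond, Ex.ev_lt, Ex.ev_add, Ex.ev_v, Ex.ev_rd, St.setV_v, St.setV_a,
        Function.update_apply, reduceCtorEq, if_true, if_false, e1, e2, e3, e4, Com.ev_wr,
        hE4.nF, hE4.nC, hE4.row _ le_rfl]
      by_cases c1 : m < I.C
      · rw [if_pos (by omega)]
        simp only [St.setA_a, St.setV_a, Function.update_self, Function.update_apply]
        by_cases c2 : j = m
        · rw [if_pos (by rw [c2]), c2]
        · rw [if_neg (by omega)]; exact hI j hj (by omega)
      · rw [if_neg (by omega)]
        exact hI j hj (by omega))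
    exact fun j hj => this j hj (by omega)
  have ks' : s'.a = s5.a := by rw [hs']; rfl
  have hW : reachSet I s' = {I.F} := by
    ext i
    rw [mem_marked, mem_singleton, ks', k5 _ (by decide), reach4, reach3, Function.update_apply]
    split_ifs <;> simp <;> omega
  have hcur : curSet I s' = curSet I s := by
    simp only [curSet]
    rw [ks', k5 _ (by decide), k4 _ (by decide), k2 _ (by decide) (by decide)]
  refine ⟨by rw [hs']; simp, ?_, ?_⟩
  · unfold Growing
    rw [hW, hcur, ks', k5 .load (by decide), k4 .load (by decide), k2 .load (by decide) (by decide),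
      k5 .price (by decide), k4 .price (by decide), k2 .price (by decide) (by decide),
      k5 .asg (by decide), k4 .asg (by decide), k5 .dual (by decide), k4 .dual (by decide)]
    refine hH.grow (fun h => absurd (mem_marked.1 h).1 (lt_irrefl _)) ?_ ?_ ?_ ?_ ?_
    · intro j hj; rw [asg2, Function.update_of_ne (by omega)]
    · rw [asg2, Function.update_self]
    · intro j hj; rw [dual2, Function.update_of_ne (by omega)]
    · rw [dual2, Function.update_self]
    · intro j hj
      rw [alt5 j (by omega), k4 .asg (by decide)]
  · intro i hi hiF
    rw [hW] at hi
    exact absurd (mem_singleton.1 hi) hiF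

/-- Every pass of the loop either finishes or reaches one more of the `F + 1` facilities, dummy
included. The number of passes exceeds this, so the insertion succeeds. -/
theorem insertClient_spec (hE : Env I s) (hB : 4 + I.F * I.C + I.F + I.C ≤ B) {m : ℕ}
    (hm : s.v .j0 = m) (hmC : m < I.C) (hH : HasCert I (curSet I s) s m)
    (hcap : m < #(curSet I s) * I.U) :
    HasCert I (curSet I s) (Code.insertClient.ev (I.F + I.C + 1) B s) (m + 1) := by
  rw [Code.insertClient, Com.ev_seq]
  set n := I.F + I.C + 1 with hn
  set s1 := Code.startInsert.ev n B s with h1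
  obtain ⟨g1, g2, g3⟩ := startInsert_spec hE hm hmC hH h1
  have hcur1 : curSet I s1 = curSet I s := by
    simp only [curSet]; rw [h1, Code.startInsert.ev_a_eq s rfl]
  have hj1 : s1.v .j0 = m := by rw [h1, Code.startInsert.ev_v_eq s rfl, hm]
  have hE1 : Env I s1 := hE.ev _
  have key := Com.ev_loop_frame (n := n) (B := B) (x := .y) (s := s1) (P := Code.growStep)
    (fun k s' => (s'.v .done ≠ 0 ∧ HasCert I (curSet I s) s' (m + 1)) ∨
      (s'.v .done = 0 ∧ Growing I s' m ∧
      (∀ i ∈ reachSet I s', i ≠ I.F → s'.a .load i = I.U) ∧ k + 1 ≤ #(reachSet I s')))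
    (Or.inr ⟨g1, g2, g3, card_pos.2 ⟨_, g2.dummy_mem⟩⟩) (by
    intro k hk s' hv ha hl hI
    rcases hI with ⟨d1, d2⟩ | ⟨d1, d2, d3, d4⟩
    · left
      rw [Code.growStep, Com.ev_ite, if_pos (by simpa [Function.update_apply] using d1), Com.ev_skip]
      exact ⟨by simpa [Function.update_apply] using d1, d2⟩
    · have hcur' : curSet I s' = curSet I s := by
        simp only [curSet]; rw [ha .cur rfl]; exact hcur1
      -- Setting the loop variable is itself the effect of a command, for which the loop bound and
      -- the block size play no role.
      have hE' : Env I (s'.setV .y k) := (hE1.congr (hv _ rfl) (hv _ rfl) (hv _ rfl) (hv _ rfl)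
        (ha _ rfl) (hl rfl)).ev (n := 0) (B := 0) (Com.set .y (.c k))
      have := growStep_spec (s := s'.setV .y k) hE' hB (m := m)
        (by simp only [St.setV_v, Function.update_apply, reduceCtorEq, if_false, hv .j0 rfl, hj1])
        hmC (by simpa [Function.update_apply] using d1) d2 d3
        (by change m < #(curSet I s') * I.U; rw [hcur']; exact hcap) rfl
      rcases this with ⟨e1, e2⟩ | ⟨e1, e2, e3, e4⟩
      · left
        refine ⟨e1, ?_⟩
        rw [← hcur']; exact e2
      · right
        refine ⟨e1, e2, e3, ?_⟩
        rw [e4]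
        exact Nat.succ_le_succ d4)
  rcases key with ⟨-, h⟩ | ⟨-, -, -, h⟩
  · exact h
  · have : #(reachSet I ((Com.loop .y Code.growStep).ev n B s1)) ≤ I.F + 1 := by
      refine (card_filter_le _ _).trans ?_
      rw [card_range]
    omega

theorem optimize_spec (hE : Env I s) (hB : 4 + I.F * I.C + I.F + I.C ≤ B)
    (hcap : I.C ≤ #(curSet I s) * I.U) :
    HasCert I (curSet I s) (Code.optimize.ev (I.F + I.C + 1) B s) I.C := by
  rw [Code.optimize, Com.ev_seq, Com.ev_seq]
  set n := I.F + I.C + 1 with hn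
  set s1 := (Com.loop .i (.wr .load (.v .i) (.c 0))).ev n B s with h1
  set s2 := (Com.loop .i (.wr .price (.v .i) (.c 0))).ev n B s1 with h2
  have load1 : s1.a .load = fun i => if i < n then 0 else s.a .load i :=
    Com.ev_loop_fill .load (fun _ => 0) fun i hi s' hv ha hl hk => by simp
  have price2 : s2.a .price = fun i => if i < n then 0 else s1.a .price i :=
    Com.ev_loop_fill .price (fun _ => 0) fun i hi s' hv ha hl hk => by simp
  have load2 : s2.a .load = s1.a .load :=
    Com.ev_a_eq (Com.loop .i (.wr .price (.v .i) (.c 0))) s1 rfl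
  have hcur2 : s2.a .cur = s.a .cur :=
    (Com.ev_a_eq (Com.loop .i (.wr .price (.v .i) (.c 0))) s1 rfl).trans
      (Com.ev_a_eq (Com.loop .i (.wr .load (.v .i) (.c 0))) s rfl)
  have hE2 : Env I s2 := (hE.ev (Com.loop .i (.wr .load (.v .i) (.c 0)))).ev
    (Com.loop .i (.wr .price (.v .i) (.c 0)))
  have hzero : HasCert I (curSet I s) s2 0 := by
    refine ⟨by simp, by simp, by simp, fun i hi => ?_, fun i hi => ?_, fun i hi h => ?_⟩
    · have := (mem_marked.1 hi).1
      rw [load2, load1]; dsimp only; rw [if_pos (by omega)]; rfl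
    · have := (mem_marked.1 hi).1
      rw [load2, load1]; dsimp only; rw [if_pos (by omega)]; exact Nat.zero_le _
    · have := (mem_marked.1 hi).1
      rw [price2] at h; dsimp only at h; rw [if_pos (by omega)] at h
      exact absurd h (lt_irrefl _)
  have key := Com.ev_loop_frame (n := n) (B := B) (x := .j0) (s := s2)
    (P := .cond (.lt (.v .j0) (.v .nC)) Code.insertClient)
    -- All loops run `F + C + 1` times. The guard makes the iterations beyond the number of clients
    -- idle, hence the minimum.
    (fun m s' => HasCert I (curSet I s) s' (min m I.C)) (by simpa using hzero) (by
    intro m hm s' hv ha hl hI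
    have hcur' : curSet I s' = curSet I s := by
      simp only [curSet]; rw [ha .cur rfl, hcur2]
    have e1 := hv .nC rfl
    simp only [Com.ev_cond, Ex.ev_lt, Ex.ev_v, St.setV_v, Function.update_apply, reduceCtorEq,
      if_true, if_false, e1, hE2.nC]
    by_cases c : m < I.C
    · rw [if_pos (by omega)]
      rw [min_eq_left (by omega)] at hI ⊢
      have hE' : Env I (s'.setV .j0 m) := (hE2.congr (hv _ rfl) (hv _ rfl) (hv _ rfl) (hv _ rfl)
        (ha _ rfl) (hl rfl)).ev (n := 0) (B := 0) (Com.set .j0 (.c m))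
      have := insertClient_spec (s := s'.setV .j0 m) hE' hB (m := m) (by simp) c
        (by change HasCert I (curSet I s') s' m; rw [hcur']; exact hI)
        (by change m < #(curSet I s') * I.U; rw [hcur']; omega)
      change HasCert I (curSet I s') _ _ at this
      rw [hcur'] at this
      exact this
    · rw [if_neg (by omega)]
      rw [min_eq_right (by omega)] at hI ⊢
      exact hI)
  rwa [min_eq_right (by omega)] at key

theorem evalCost_spec (hE : Env I s) (hB : 4 + I.F * I.C + I.F + I.C ≤ B)
    (hasg : ∀ j < I.C, s.a .asg j < I.F) :
    (Code.evalCost.ev (I.F + I.C + 1) B s).v .tot =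
      ∑ j ∈ range I.C, I.dist (s.a .asg j) j := by
  rw [Code.evalCost, Com.ev_seq]
  set s1 := (Com.set .tot (.c 0)).ev (I.F + I.C + 1) B s with h1
  have hE1 : Env I s1 := hE.ev _
  have key := Com.ev_loop_fold (n := I.F + I.C + 1) (B := B) (x := .j) (s := s1)
    (P := .cond (.lt (.v .j) (.v .nC))
      (.set .tot (.v .tot + .dist (.rd .asg (.v .j)) (.v .j)))) .tot
    (fun m => ∑ j ∈ range (min m I.C), I.dist (s.a .asg j) j) (by simp [h1]) (by
    intro m hm s' hv ha hl hI
    have e1 := hv .nC rfl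
    have e2 : s'.a .asg = s.a .asg := ha .asg rfl
    have hE' : Env I (s'.setV .j m) := (hE1.congr (hv _ rfl) (hv _ rfl) (hv _ rfl) (hv _ rfl)
        (ha _ rfl) (hl rfl)).ev (n := 0) (B := 0) (Com.set .j (.c m))
    rw [Com.ev_cond]
    by_cases c : m < I.C
    · rw [if_pos (by simp [e1, hE1.nC]; omega), Com.ev_set, St.setV_v,
        Function.update_self, Ex.ev_add, hE'.ev_dist hB (by simp [e2, hasg m c]) (by simpa using c)]
      simp only [Ex.ev_v, Ex.ev_rd, St.setV_v, St.setV_a, Function.update_apply, reduceCtorEq,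
        if_true, if_false, hI, e2]
      rw [min_eq_left (by omega), min_eq_left (by omega), sum_range_succ]
    · rw [if_neg (by simp [e1, hE1.nC]; omega), St.setV_v,
        Function.update_of_ne (by decide), hI, min_eq_right (by omega), min_eq_right (by omega)])
  have h2 := key
  rw [min_eq_right (by omega)] at h2
  exact h2

end Optimize
end CapMedian

/-! ### Testing and recording a candidate set. -/

namespace CapMedian
section Record
open Finset

/-- `f` is the characteristic vector of `S`. -/
def Ind (I : Instance ℕ) (f : ℕ → ℕ) (S : Finset (Fin I.F)) : Prop :=
  ∀ i : Fin I.F, f i = if i ∈ S then 1 else 0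

/-- The arrays `f` and `g` hold the state `x` of the local search. -/
def Stored (I : Instance ℕ) (f g : ℕ → ℕ) (x : I.State) : Prop :=
  Ind I f x.1 ∧ ∀ j : Fin I.C, g j = x.2 j

variable {I : Instance ℕ} {B : ℕ} {s : St}

theorem Ind.marked_eq {f : ℕ → ℕ} {S : Finset (Fin I.F)} (h : Ind I f S) :
    marked f I.F = S.map Fin.valEmbedding := by
  ext i
  simp only [mem_marked, mem_map, Fin.valEmbedding_apply]
  constructor
  · rintro ⟨h1, h2⟩
    refine ⟨⟨i, h1⟩, ?_, rfl⟩
    have := h ⟨i, h1⟩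
    by_contra hn
    rw [if_neg hn] at this
    exact h2 this
  · rintro ⟨a, ha, rfl⟩
    exact ⟨a.2, by rw [h a, if_pos ha]; exact one_ne_zero⟩

theorem Ind.card_marked {f : ℕ → ℕ} {S : Finset (Fin I.F)} (h : Ind I f S) :
    #(marked f I.F) = #S := by
  rw [h.marked_eq, card_map]

theorem Ind.congr {f g : ℕ → ℕ} {S : Finset (Fin I.F)} (h : Ind I f S)
    (hfg : ∀ i < I.F, g i = f i) : Ind I g S := fun i => by rw [hfg i i.2, h i]

theorem card_filter_range_eq {m : ℕ} (f : ℕ → ℕ) (i : ℕ) :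
    #{j ∈ range m | f j = i} = #{j : Fin m | f j = i} := by
  rw [card_filter, card_filter, sum_range]

/-- Transfers the certificate from arrays of natural numbers to the finite types of the instance. -/
theorem HasCert.exists_isOptAssignment {f : ℕ → ℕ} {S : Finset (Fin I.F)} (hS : Ind I f S)
    (h : HasCert I (marked f I.F) s I.C) : ∃ φ : Fin I.C → Fin I.F,
      (∀ j : Fin I.C, s.a .asg j = φ j) ∧ I.IsOptAssignment S φ ∧
      I.cost φ = ∑ j ∈ range I.C, I.dist (s.a .asg j) j := by
  have hlt : ∀ j < I.C, s.a .asg j < I.F := fun j hj => (mem_marked.1 (h.mem j hj)).1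
  have hcost : ∀ (g : ℕ → ℕ) (ψ : Fin I.C → Fin I.F), (∀ j : Fin I.C, g j = ψ j) →
      I.cost ψ = ∑ j ∈ range I.C, I.dist (g j) j := by
    intro g ψ hg
    rw [sum_range]
    refine sum_congr rfl fun j _ => ?_
    rw [Instance.dist, dif_pos ⟨by rw [hg]; exact (ψ j).2, j.2⟩]
    congr 2
    exact Fin.ext (hg j).symm
  have hmem : ∀ i : Fin I.F, (i : ℕ) ∈ marked f I.F ↔ i ∈ S := fun i => by
    rw [hS.marked_eq, mem_map]
    exact ⟨fun ⟨a, ha, e⟩ => Fin.ext (show (a : ℕ) = i from e) ▸ ha, fun hi => ⟨i, hi, rfl⟩⟩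
  refine ⟨fun j => ⟨s.a .asg j, hlt j j.2⟩, fun _ => rfl, ⟨⟨fun j => ?_, fun i => ?_⟩, ?_⟩, ?_⟩
  · rw [← hmem]
    exact h.mem j j.2
  · by_cases hi : i ∈ S
    · have h1 := h.cap i ((hmem i).2 hi)
      rw [h.load i ((hmem i).2 hi), card_filter_range_eq] at h1
      refine le_trans (le_of_eq ?_) h1
      congr 1
      ext j
      simp [Fin.ext_iff]
    · rw [filter_eq_empty_iff.2, card_empty]
      · exact Nat.zero_le _
      · rintro j - rfl
        exact hi ((hmem _).1 (h.mem j j.2))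
  · intro ψ hψ
    set χ : ℕ → ℕ := fun j => if hj : j < I.C then ψ ⟨j, hj⟩ else 0 with hχ
    have hχψ : ∀ j : Fin I.C, χ j = ψ j := fun j => by simp [hχ]
    rw [hcost (s.a .asg) _ fun _ => rfl, hcost χ ψ hχψ]
    refine h.sum_le χ (fun j hj => ?_) fun i hi => ?_
    · rw [hχψ ⟨j, hj⟩]
      exact (hmem _).2 (hψ.1 _)
    · refine le_trans (le_of_eq ?_) (hψ.2 ⟨i, (mem_marked.1 hi).1⟩)
      rw [card_filter_range_eq]
      congr 1
      ext j
      simp [Fin.ext_iff, hχψ]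
  · exact hcost (s.a .asg) _ fun _ => rfl

/-! ### Testing one set -/

/-- Multiples of an expression. -/
def Ex.smul (e : Ex) : ℕ → Ex
  | 0 => .c 0
  | m + 1 => e.smul m + e

@[simp] theorem Ex.ev_smul (e : Ex) (m : ℕ) : (e.smul m).ev B s = m * e.ev B s := by
  induction m with
  | zero => simp [Ex.smul]
  | succ m ih => rw [Ex.smul, Ex.ev_add, ih]; ring

namespace Code

def copy (k k' : Arr) : Com := .loop .i (.wr k' (.v .i) (.rd k (.v .i)))

/-- Count the closed and the opened facilities. -/
def countSwap : Com :=
  .seq (.set .cnt (.c 0)) (.seq (.set .dif (.c 0)) (.loop .i (.cond (.lt (.v .i) (.v .nF))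
    (.seq (.set .cnt (.v .cnt + (.rd .sol (.v .i) - .rd .cur (.v .i))))
      (.set .dif (.v .dif + (.rd .cur (.v .i) - .rd .sol (.v .i))))))))

/-- Compute the decrease of cost and its product with `w (F + C) + 1`. -/
def gain (w : ℕ) : Com :=
  .seq (.set .t (.v .sc - .v .tot)) (.seq (.set .y (.v .t)) (.loop .i
    (.cond (.lt (.v .i) (.v .nF + .v .nC)) (.set .y (.v .y + (Ex.v .t).smul w)))))

def record : Com :=
  .seq (copy .cur .best) (.seq (copy .asg .rasg) (.seq (.set .rc (.v .tot)) (.set .found (.c 1))))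

def recordIfBetter (w : ℕ) : Com :=
  .seq optimize (.seq evalCost (.seq (gain w)
    (.cond (.v .t) (.cond (.lt (.v .sc) (.v .y + .c 1)) record))))

/-- Record the set `cur` if it arises by an admissible step. -/
def tryOne (p w : ℕ) : Com :=
  .seq countSwap (.ite (.v .cnt - .v .dif + (.v .dif - .v .cnt)) .skip
    (.cond (.lt (.v .cnt) (.c (p + 1))) (recordIfBetter w)))

end Code

theorem ev_copy {n : ℕ} {k k' : Arr} (hk : k ≠ k') :
    ((Code.copy k k').ev n B s).a k' = fun i => if i < n then s.a k i else s.a k' i :=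
  Com.ev_loop_fill k' (s.a k) fun i _ s' _ ha _ _ => by
    have : s'.a k = s.a k := ha k (by simp [Com.wa, hk.symm])
    simp [this]

theorem sum_tsub_eq_card {f g : ℕ → ℕ} {S T : Finset (Fin I.F)} (hS : Ind I f S)
    (hT : Ind I g T) : ∑ i ∈ range I.F, (f i - g i) = #(S \ T) := by
  rw [sum_range, ← filter_univ_mem (S \ T), card_filter]
  refine sum_congr rfl fun i _ => ?_
  rw [hS i, hT i]
  by_cases h1 : i ∈ S <;> by_cases h2 : i ∈ T <;> simp [h1, h2]

theorem ev_countSwap (hE : Env I s) {S T : Finset (Fin I.F)} (hS : Ind I (s.a .sol) S)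
    (hT : Ind I (s.a .cur) T) :
    (Code.countSwap.ev (I.F + I.C + 1) B s).v .cnt = #(S \ T) ∧
    (Code.countSwap.ev (I.F + I.C + 1) B s).v .dif = #(T \ S) := by
  rw [Code.countSwap, Com.ev_seq, Com.ev_seq]
  set s1 := (Com.set .dif (.c 0)).ev (I.F + I.C + 1) B ((Com.set .cnt (.c 0)).ev (I.F + I.C + 1) B s)
    with h1
  have hE1 : Env I s1 := (hE.ev _).ev _
  have a1 : s1.a = s.a := rfl
  have key := Com.ev_loop_frame (n := I.F + I.C + 1) (B := B) (x := .i) (s := s1)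
    (P := .cond (.lt (.v .i) (.v .nF))
    (.seq (.set .cnt (.v .cnt + (.rd .sol (.v .i) - .rd .cur (.v .i))))
      (.set .dif (.v .dif + (.rd .cur (.v .i) - .rd .sol (.v .i))))))
    (fun m s' => s'.v .cnt = ∑ i ∈ range (min m I.F), (s.a .sol i - s.a .cur i) ∧
      s'.v .dif = ∑ i ∈ range (min m I.F), (s.a .cur i - s.a .sol i))
    (by simp [h1]) (by
      intro m hm s' hv ha hl hI
      have e1 : s'.v .nF = I.F := (hv _ rfl).trans hE1.nF
      have e2 : s'.a = s.a := by funext k; exact ha k rfl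
      rw [Com.ev_cond]
      by_cases c : m < I.F
      · rw [if_pos (by simp [e1]; omega)]
        simp only [Com.ev_seq, Com.ev_set, Ex.ev_add, Ex.ev_sub, Ex.ev_v, Ex.ev_rd, St.setV_v,
          St.setV_a, Function.update_apply, reduceCtorEq, if_true, if_false, e2, hI.1, hI.2]
        rw [min_eq_left (by omega), min_eq_left (by omega), sum_range_succ, sum_range_succ]
        exact ⟨rfl, rfl⟩
      · rw [if_neg (by simp [e1]; omega), St.setV_v,
          Function.update_of_ne (by decide), Function.update_of_ne (by decide), hI.1, hI.2,
          min_eq_right (by omega), min_eq_right (by omega)]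
        exact ⟨rfl, rfl⟩)
  rw [min_eq_right (by omega)] at key
  refine ⟨key.1.trans ?_, key.2.trans ?_⟩
  · exact sum_tsub_eq_card hS hT
  · exact sum_tsub_eq_card hT hS

theorem multiSwap_iff {n p : ℕ} {S T : Finset (Fin n)} :
    MultiSwap p S T ↔ #(S \ T) = #(T \ S) ∧ #(S \ T) ≤ p := by
  constructor
  · rintro ⟨A, B, hB, hA, h1, h2, rfl⟩
    have hA' : ∀ i ∈ A, i ∉ S := fun i hi hs => disjoint_left.1 hA hi hs
    have e1 : S \ (S \ B ∪ A) = B := by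
      ext i
      have h3 := hA' i
      have h4 := @hB i
      simp only [mem_sdiff, mem_union]
      tauto
    have e2 : (S \ B ∪ A) \ S = A := by
      ext i
      have h3 := hA' i
      simp only [mem_sdiff, mem_union]
      tauto
    rw [e1, e2]
    exact ⟨h1.symm, h2⟩
  · rintro ⟨h1, h2⟩
    refine ⟨T \ S, S \ T, sdiff_subset, sdiff_disjoint, h1.symm, h2, ?_⟩
    ext i
    simp only [mem_sdiff, mem_union]
    tauto

theorem ev_gain (hE : Env I s) (w : ℕ) :
    ((Code.gain w).ev (I.F + I.C + 1) B s).v .t = s.v .sc - s.v .tot ∧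
    ((Code.gain w).ev (I.F + I.C + 1) B s).v .y =
      (w * (I.F + I.C) + 1) * (s.v .sc - s.v .tot) := by
  rw [Code.gain, Com.ev_seq, Com.ev_seq]
  set s1 := (Com.set .y (.v .t)).ev (I.F + I.C + 1) B
    ((Com.set .t (.v .sc - .v .tot)).ev (I.F + I.C + 1) B s) with h1
  have hE1 : Env I s1 := (hE.ev _).ev _
  have t1 : s1.v .t = s.v .sc - s.v .tot := by simp [h1]
  have y1 : s1.v .y = s.v .sc - s.v .tot := by simp [h1]
  set P : Com := .cond (.lt (.v .i) (.v .nF + .v .nC)) (.set .y (.v .y + (Ex.v .t).smul w)) with hP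
  refine ⟨(Com.ev_v_eq (Com.loop .i P) s1 rfl).trans t1, ?_⟩
  have key := Com.ev_loop_fold (n := I.F + I.C + 1) (B := B) (x := .i) (s := s1) (P := P) .y
    (fun m => (w * min m (I.F + I.C) + 1) * (s.v .sc - s.v .tot)) (by simp [y1]) (by
      intro m hm s' hv ha hl hI
      have e1 : s'.v .nF = I.F := (hv _ rfl).trans hE1.nF
      have e2 : s'.v .nC = I.C := (hv _ rfl).trans hE1.nC
      have e3 : s'.v .t = s.v .sc - s.v .tot := (hv _ rfl).trans t1
      rw [hP, Com.ev_cond]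
      by_cases c : m < I.F + I.C
      · rw [if_pos (by simp [e1, e2]; omega)]
        simp only [Com.ev_set, Ex.ev_add, Ex.ev_smul, Ex.ev_v, St.setV_v,
          Function.update_apply, reduceCtorEq, if_true, if_false, e3, hI]
        rw [min_eq_left (by omega), min_eq_left (by omega)]
        ring
      · rw [if_neg (by simp [e1, e2]; omega), St.setV_v,
          Function.update_of_ne (by decide), hI,
          min_eq_right (by omega), min_eq_right (by omega)])
  rw [min_eq_right (by omega)] at key
  exact key

/-- If the state holds a recorded improvement of `x`, it is a local search step. -/
def Good (I : Instance ℕ) (p q : ℕ) (x : I.State) (s : St) : Prop :=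
  s.v .found ≠ 0 → ∃ y, Stored I (s.a .best) (s.a .rasg) y ∧ s.v .rc = I.cost y.2 ∧ I.Step p q x y

theorem Good.congr {p q : ℕ} {x : I.State} {s' : St} (h : Good I p q x s)
    (h1 : s'.v .found = s.v .found) (h2 : s'.v .rc = s.v .rc) (h3 : s'.a .best = s.a .best)
    (h4 : s'.a .rasg = s.a .rasg) : Good I p q x s' := by
  unfold Good; rw [h1, h2, h3, h4]; exact h

/-- A record is always a genuine step, a record is never lost although it may be replaced, and an
unsuccessful test excludes every step to `T`. The capacity hypothesis passes from `x` to `T`, which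
has the same size. -/
theorem tryOne_spec (hE : Env I s) (hB : 4 + I.F * I.C + I.F + I.C ≤ B) {p w : ℕ} {x : I.State}
    (hsol : Ind I (s.a .sol) x.1) (hsc : s.v .sc = I.cost x.2) (hcap : I.C ≤ #x.1 * I.U)
    {T : Finset (Fin I.F)} (hT : Ind I (s.a .cur) T) (hG : Good I p (w * (I.F + I.C) + 1) x s)
    {s' : St} (hs' : s' = (Code.tryOne p w).ev (I.F + I.C + 1) B s) :
    Good I p (w * (I.F + I.C) + 1) x s' ∧ (s.v .found ≠ 0 → s'.v .found ≠ 0) ∧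
    (s'.v .found = 0 → ∀ y, I.Step p (w * (I.F + I.C) + 1) x y → y.1 ≠ T) := by
  set n := I.F + I.C + 1 with hn
  rw [Code.tryOne, Com.ev_seq] at hs'
  obtain ⟨c1, c2⟩ := ev_countSwap (B := B) hE hsol hT
  rw [← hn] at c1 c2
  set s1 := Code.countSwap.ev n B s with h1
  have hE1 : Env I s1 := hE.ev _
  have a1 : s1.a = s.a := by funext k; exact Com.ev_a_eq Code.countSwap s rfl
  have f1 : s1.v .found = s.v .found := Com.ev_v_eq Code.countSwap s rfl
  have hG1 : Good I p (w * (I.F + I.C) + 1) x s1 :=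
    hG.congr f1 (Com.ev_v_eq Code.countSwap s rfl) (by rw [a1]) (by rw [a1])
  have hno : ¬ MultiSwap p x.1 T → Good I p (w * (I.F + I.C) + 1) x s1 ∧
      (s.v .found ≠ 0 → s1.v .found ≠ 0) ∧
      (s1.v .found = 0 → ∀ y, I.Step p (w * (I.F + I.C) + 1) x y → y.1 ≠ T) := fun h =>
    ⟨hG1, by rw [f1]; exact id, fun _ y hy e => h (e ▸ hy.1)⟩
  rw [multiSwap_iff] at hno
  simp only [Com.ev_ite, Com.ev_skip, Com.ev_cond, Ex.ev_add, Ex.ev_sub, Ex.ev_v, Ex.ev_lt, Ex.ev_c,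
    c1, c2] at hs'
  by_cases e1 : #(x.1 \ T) = #(T \ x.1)
  swap
  · rw [if_pos (by omega)] at hs'
    subst hs'
    exact hno fun h => e1 h.1
  rw [if_neg (by omega)] at hs'
  by_cases e2 : #(x.1 \ T) ≤ p
  swap
  · rw [if_neg (by omega)] at hs'
    subst hs'
    exact hno fun h => e2 h.2
  rw [if_pos (by omega), Code.recordIfBetter, Com.ev_seq, Com.ev_seq, Com.ev_seq] at hs'
  clear hno
  have hswap : MultiSwap p x.1 T := multiSwap_iff.2 ⟨e1, e2⟩
  have hT1 : Ind I (s1.a .cur) T := by rw [a1]; exact hT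
  have hcard : #x.1 = #T := by
    have h3 := card_sdiff_add_card_inter x.1 T
    have h4 := card_sdiff_add_card_inter T x.1
    rw [inter_comm] at h4
    omega
  have hcert := optimize_spec hE1 hB (by rw [hT1.card_marked, ← hcard]; exact hcap)
  rw [← hn] at hcert
  set s2 := Code.optimize.ev n B s1 with h2
  have hE2 : Env I s2 := hE1.ev _
  obtain ⟨φ, hφ, hopt, hcost⟩ := HasCert.exists_isOptAssignment hT1 hcert
  have htot := evalCost_spec hE2 hB fun j hj => by
    have := hφ ⟨j, hj⟩
    rw [show s2.a .asg j = φ ⟨j, hj⟩ from this]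
    exact (φ ⟨j, hj⟩).2
  rw [← hn, ← hcost] at htot
  set s3 := Code.evalCost.ev n B s2 with h3
  have hE3 : Env I s3 := hE2.ev _
  have sc3 : s3.v .sc = I.cost x.2 := by
    rw [h3, Com.ev_v_eq Code.evalCost s2 rfl, h2, Com.ev_v_eq Code.optimize s1 rfl, h1,
      Com.ev_v_eq Code.countSwap s rfl, hsc]
  obtain ⟨g1, g2⟩ := ev_gain (B := B) hE3 w
  rw [← hn] at g1 g2
  set s4 := (Code.gain w).ev n B s3 with h4
  have v4 : ∀ z, Code.optimize.wv z = false → Code.evalCost.wv z = false →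
      (Code.gain w).wv z = false → s4.v z = s1.v z := fun z k1 k2 k3 => by
    rw [h4, Com.ev_v_eq _ s3 k3, h3, Com.ev_v_eq _ s2 k2, h2, Com.ev_v_eq _ s1 k1]
  have a3 : s3.a = s2.a := by funext k; exact Com.ev_a_eq Code.evalCost s2 rfl
  have a4 : s4.a = s2.a := by
    rw [← a3]; funext k; exact Com.ev_a_eq (Code.gain w) s3 rfl
  have hG4 : Good I p (w * (I.F + I.C) + 1) x s4 := hG1.congr (v4 _ rfl rfl rfl) (v4 _ rfl rfl rfl)
    (by rw [a4, h2, Com.ev_a_eq Code.optimize s1 rfl])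
    (by rw [a4, h2, Com.ev_a_eq Code.optimize s1 rfl])
  have f4 : s4.v .found = s.v .found := (v4 _ rfl rfl rfl).trans f1
  have sc4 : s4.v .sc = I.cost x.2 := by rw [← sc3]; exact Com.ev_v_eq (Code.gain w) s3 rfl
  have tot4 : s4.v .tot = I.cost φ := by rw [← htot]; exact Com.ev_v_eq (Code.gain w) s3 rfl
  rw [sc3, htot] at g1 g2
  have hstep : I.Step p (w * (I.F + I.C) + 1) x (T, φ) ↔
      I.cost x.2 - I.cost φ ≠ 0 ∧ I.cost x.2 ≤
        (w * (I.F + I.C) + 1) * (I.cost x.2 - I.cost φ) := by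
    rw [Nat.mul_sub]
    constructor
    · rintro ⟨-, -, k1, k2⟩
      simp only [Nat.cast_id] at k1 k2
      constructor <;> omega
    · rintro ⟨k1, k2⟩
      have : (w * (I.F + I.C) + 1) * I.cost φ ≤ (w * (I.F + I.C) + 1) * I.cost x.2 :=
        Nat.mul_le_mul_left _ (by omega)
      exact ⟨hswap, hopt, (by omega : I.cost φ < I.cost x.2), by
        simp only [Nat.cast_id]; omega⟩
  -- All optimal assignments to `T` have the same cost, so it suffices to test the computed one.
  have hall : ∀ y, I.Step p (w * (I.F + I.C) + 1) x y → y.1 = T →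
      I.Step p (w * (I.F + I.C) + 1) x (T, φ) := by
    rintro ⟨T', ψ⟩ ⟨k1, k2, k3, k4⟩ rfl
    have : I.cost ψ = I.cost φ := le_antisymm (k2.2 _ hopt.1) (hopt.2 _ k2.1)
    exact ⟨k1, hopt, by rw [← this]; exact k3, by rw [← this]; exact k4⟩
  simp only [Com.ev_cond, Ex.ev_v, Ex.ev_lt, Ex.ev_add, Ex.ev_c, g1, g2, sc4] at hs'
  by_cases k : I.Step p (w * (I.F + I.C) + 1) x (T, φ)
  · obtain ⟨k1, k2⟩ := hstep.1 k
    rw [if_pos k1, if_pos (by omega)] at hs'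
    have hf : s'.v .found ≠ 0 := by
      rw [hs', Code.record]; simp
    refine ⟨fun _ => ⟨(T, φ), ⟨?_, fun j => ?_⟩, ?_, k⟩, fun _ => hf, fun h => absurd h hf⟩
    · have : s'.a .best = ((Code.copy .cur .best).ev n B s4).a .best := by
        rw [hs', Code.record, Com.ev_seq]
        exact Com.ev_a_eq (Com.seq (Code.copy .asg .rasg) (.seq (.set .rc (.v .tot))
          (.set .found (.c 1)))) _ rfl
      rw [this, ev_copy (by decide)]
      refine hT1.congr fun i hi => ?_
      rw [if_pos (by omega), a4, h2, Com.ev_a_eq Code.optimize s1 rfl]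
    · have : s'.a .rasg = ((Code.copy .asg .rasg).ev n B
          ((Code.copy .cur .best).ev n B s4)).a .rasg := by
        rw [hs', Code.record]; rfl
      rw [this, ev_copy (by decide), Com.ev_a_eq (Code.copy .cur .best) _ rfl, a4]
      dsimp only
      rw [if_pos (by omega), hφ]
    · rw [← tot4, hs', Code.record]
      have : ((Code.copy .asg .rasg).ev n B ((Code.copy .cur .best).ev n B s4)).v .tot = s4.v .tot :=
        Com.ev_v_eq (Com.seq (Code.copy .cur .best) (Code.copy .asg .rasg)) s4 rfl
      simp [this]
  · have : s' = s4 := by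
      rw [hs']
      by_cases k1 : I.cost x.2 - I.cost φ = 0
      · rw [if_neg (by simpa using k1)]
      · rw [if_pos k1, if_neg]
        intro h
        exact k (hstep.2 ⟨k1, by omega⟩)
    subst this
    exact ⟨hG4, by rw [f4]; exact id, fun _ y hy e => k (hall y hy e)⟩

end Record
end CapMedian

/-! ### Enumeration of the multi-swaps and one round of the search. -/

namespace CapMedian

namespace Code

/-- Open or close the facility stored at position `m` of `idx`. -/
def toggle (m : ℕ) : Com :=
  .cond (.lt (.rd .idx (.c m)) (.v .nF))
    (.wr .cur (.rd .idx (.c m)) (.c 1 - .rd .cur (.rd .idx (.c m))))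

/-- Test all sets that differ from `cur` in at most `m` facilities. -/
def enum (p w : ℕ) : ℕ → Com
  | 0 => tryOne p w
  -- The loop variable is shared by all levels and overwritten inside, so its value is saved in
  -- `idx` at position `m` for the second toggle, which undoes the first.
  | m + 1 => .loop .i (.seq (.wr .idx (.c m) (.v .i))
      (.seq (toggle m) (.seq (enum p w m) (toggle m))))

def move : Com :=
  .seq (copy .best .sol) (.seq (copy .best .cur) (.seq (copy .rasg .sasg) (.set .sc (.v .rc))))

/-- Perform one step of the local search. -/
def round (p w : ℕ) : Com :=
  .seq (.set .found (.c 0)) (.seq (enum p w (2 * p)) (.cond (.v .found) move))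

end Code

section Enum
open Finset

variable {I : Instance ℕ} {B : ℕ} {s : St}

theorem enum_wv {p w m : ℕ} {x : Var} (h : (Code.tryOne p w).wv x = false)
    (hx : (Var.i == x) = false) : (Code.enum p w m).wv x = false := by
  induction m with
  | zero => exact h
  | succ m ih => simp [Code.enum, Code.toggle, Com.cond, Com.wv, ih, hx]

theorem enum_wa {p w m : ℕ} {k : Arr} (h : (Code.tryOne p w).wa k = false)
    (h1 : (Arr.idx == k) = false) (h2 : (Arr.cur == k) = false) :
    (Code.enum p w m).wa k = false := by
  induction m with
  | zero => exact h
  | succ m ih => simp [Code.enum, Code.toggle, Com.cond, Com.wa, ih, h1, h2]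

theorem enum_wl {p w m : ℕ} : (Code.enum p w m).wl = false := by
  induction m with
  | zero => rfl
  | succ m ih => simp [Code.enum, Code.toggle, Com.cond, Com.wl, ih]

/-- Open or close facility `i`, if it exists. -/
def toggled (I : Instance ℕ) (S : Finset (Fin I.F)) (i : ℕ) : Finset (Fin I.F) :=
  if h : i < I.F then symmDiff S {⟨i, h⟩} else S

theorem toggled_toggled (S : Finset (Fin I.F)) (i : ℕ) : toggled I (toggled I S i) i = S := by
  unfold toggled
  split_ifs
  · exact symmDiff_symmDiff_cancel_right _ _
  · rfl

/-- A toggle at an element of the symmetric difference removes it. If the sets already agree, the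
index `F` is an idle toggle, so `m` levels reach all sets at distance at most `m`, not only those at
distance exactly `m`. -/
theorem exists_toggled {S T : Finset (Fin I.F)} {m : ℕ} (h : #(symmDiff S T) ≤ m + 1) :
    ∃ i ≤ I.F, #(symmDiff (toggled I S i) T) ≤ m := by
  rcases (symmDiff S T).eq_empty_or_nonempty with e | ⟨i, hi⟩
  · exact ⟨I.F, le_rfl, by rw [toggled, dif_neg (lt_irrefl _), e]; simp⟩
  · refine ⟨i, i.2.le, ?_⟩
    rw [toggled, dif_pos i.2, symmDiff_right_comm]
    have : symmDiff (symmDiff S T) {i} = (symmDiff S T).erase i := by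
      ext a
      simp only [mem_symmDiff, mem_singleton, mem_erase] at hi ⊢
      by_cases ha : a = i
      · subst ha; tauto
      · tauto
    rw [show (⟨(i : ℕ), i.2⟩ : Fin I.F) = i from rfl, this, card_erase_of_mem hi]
    omega

theorem toggle_spec (hE : Env I s) {n m i : ℕ} {S : Finset (Fin I.F)} (hS : Ind I (s.a .cur) S)
    (hi : s.a .idx m = i) :
    Ind I (((Code.toggle m).ev n B s).a .cur) (toggled I S i) := by
  rw [Code.toggle, Com.ev_cond, Ex.ev_lt, Ex.ev_v, Ex.ev_rd, Ex.ev_c, hE.nF, hi, toggled]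
  by_cases h : i < I.F
  · rw [if_pos (by omega), dif_pos h]
    intro j
    simp only [Com.ev_wr, St.setA_a, Function.update_self, Ex.ev_sub, Ex.ev_rd, Ex.ev_c, hi]
    have h1 := hS ⟨i, h⟩
    dsimp only at h1
    rw [h1]
    by_cases e : j = ⟨i, h⟩
    · subst e
      rw [Function.update_self]
      by_cases hm : (⟨i, h⟩ : Fin I.F) ∈ S <;> simp [hm, mem_symmDiff]
    · rw [Function.update_of_ne (fun e' => e (Fin.ext e')), hS j]
      simp [mem_symmDiff, e]
  · rw [if_neg (by omega), dif_neg h]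
    exact hS

/-- The state describes the current solution `x` of the local search. -/
structure Holds (I : Instance ℕ) (x : I.State) (s : St) : Prop where
  env : Env I s
  sol : Ind I (s.a .sol) x.1
  sc : s.v .sc = I.cost x.2

theorem Holds.congr {x : I.State} (h : Holds I x s) (P : Com) (n B : ℕ)
    (hE : Env I (P.ev n B s)) (h1 : P.wa .sol = false := by rfl)
    (h2 : P.wv .sc = false := by rfl) : Holds I x (P.ev n B s) :=
  ⟨hE, by rw [P.ev_a_eq s h1]; exact h.sol, by rw [P.ev_v_eq s h2]; exact h.sc⟩

theorem enum_env {p w m n : ℕ} (hE : Env I s) : Env I ((Code.enum p w m).ev n B s) :=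
  hE.ev _ (enum_wv rfl rfl) (enum_wv rfl rfl) (enum_wv rfl rfl) (enum_wv rfl rfl)
    (enum_wa rfl rfl rfl) enum_wl

/-- The clause on `idx` says that deeper levels leave the saved indices of outer levels alone.
Together with `toggled_toggled` it ensures that `cur` is restored after each iteration. Since
`found` is never reset, `found = 0` at the end means that every test failed. -/
theorem enum_spec (hB : 4 + I.F * I.C + I.F + I.C ≤ B) {p w : ℕ} {x : I.State}
    (hcap : I.C ≤ #x.1 * I.U) : ∀ (m : ℕ) (s : St) (T : Finset (Fin I.F)), Holds I x s →
    Ind I (s.a .cur) T → Good I p (w * (I.F + I.C) + 1) x s → ∀ s' : St,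
    s' = (Code.enum p w m).ev (I.F + I.C + 1) B s →
    Ind I (s'.a .cur) T ∧ Good I p (w * (I.F + I.C) + 1) x s' ∧
    (s.v .found ≠ 0 → s'.v .found ≠ 0) ∧ (∀ k, m ≤ k → s'.a .idx k = s.a .idx k) ∧
    (s'.v .found = 0 → ∀ y, I.Step p (w * (I.F + I.C) + 1) x y → ¬ #(symmDiff T y.1) ≤ m) := by
  intro m
  induction m with
  | zero =>
    intro s T h hT hG s' hs'
    rw [Code.enum] at hs'
    obtain ⟨h1, h2, h3⟩ := tryOne_spec h.env hB h.sol h.sc hcap hT hG hs'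
    refine ⟨?_, h1, h2, fun k _ => ?_, fun hf y hy hc => h3 hf y hy ?_⟩
    · rw [hs', Com.ev_a_eq (Code.tryOne p w) s rfl]; exact hT
    · rw [hs', Com.ev_a_eq (Code.tryOne p w) s rfl]
    · rw [Nat.le_zero, card_eq_zero] at hc
      exact (symmDiff_eq_bot.1 hc).symm
  | succ m ih =>
    intro s T h hT hG s' hs'
    set P : Com := .seq (.wr .idx (.c m) (.v .i))
      (.seq (Code.toggle m) (.seq (Code.enum p w m) (Code.toggle m))) with hP
    have hs' : s' = (Com.loop .i P).ev (I.F + I.C + 1) B s := hs'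
    have hPwv : ∀ x, (Code.tryOne p w).wv x = false → (Var.i == x) = false →
        (Com.loop .i P).wv x = false := fun x h1 h2 => by
      simp [hP, Code.toggle, Com.cond, Com.wv, enum_wv h1 h2, h2]
    have hPwa : ∀ x, (Code.tryOne p w).wa x = false → (Arr.idx == x) = false →
        (Arr.cur == x) = false → P.wa x = false := fun x h1 h2 h3 => by
      simp [hP, Code.toggle, Com.cond, Com.wa, enum_wa h1 h2 h3, h2, h3]
    have hPwl : P.wl = false := by simp [hP, Code.toggle, Com.cond, Com.wl, enum_wl]
    have key := Com.ev_loop_frame (n := I.F + I.C + 1) (B := B) (x := .i) (s := s) (P := P)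
      (fun l s' => Ind I (s'.a .cur) T ∧ Good I p (w * (I.F + I.C) + 1) x s' ∧
        (s.v .found ≠ 0 → s'.v .found ≠ 0) ∧ (∀ k, m + 1 ≤ k → s'.a .idx k = s.a .idx k) ∧
        (s'.v .found = 0 → ∀ i < l, ∀ y, I.Step p (w * (I.F + I.C) + 1) x y →
          ¬ #(symmDiff (toggled I T i) y.1) ≤ m))
      ⟨hT, hG, id, fun _ _ => rfl, fun _ i hi => absurd hi (Nat.not_lt_zero i)⟩ (by
      intro l hl s1 hv ha hlow hI
      obtain ⟨i1, i2, i3, i4, i5⟩ := hI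
      have hE1 : Env I s1 := h.env.congr (hv _ (hPwv _ rfl rfl)) (hv _ (hPwv _ rfl rfl))
        (hv _ (hPwv _ rfl rfl)) (hv _ (hPwv _ rfl rfl)) (ha _ (hPwa _ rfl rfl rfl)) (hlow hPwl)
      have h1 : Holds I x s1 := ⟨hE1, by rw [ha _ (hPwa _ rfl rfl rfl)]; exact h.sol,
        by rw [hv _ (hPwv _ rfl rfl)]; exact h.sc⟩
      rw [hP, Com.ev_seq, Com.ev_seq, Com.ev_seq]
      set s2 := (Com.wr .idx (.c m) (.v .i)).ev (I.F + I.C + 1) B (s1.setV .i l) with h2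
      have hE2 : Env I s2 := (hE1.ev (n := 0) (B := 0) (Com.set .i (.c l))).ev _
      have idx2 : ∀ k, s2.a .idx k = if k = m then l else s1.a .idx k := fun k => by
        simp [h2, Function.update_apply]
      have a2 : ∀ k, k ≠ .idx → s2.a k = s1.a k := fun k hk => by
        simp [h2, Function.update_of_ne hk]
      have v2 : ∀ y, y ≠ .i → s2.v y = s1.v y := fun y hy => by
        simp [h2, Function.update_of_ne hy]
      have hH2 : Holds I x s2 := ⟨hE2, by rw [a2 _ (by decide)]; exact h1.sol,
        by rw [v2 _ (by decide)]; exact h1.sc⟩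
      set s3 := (Code.toggle m).ev (I.F + I.C + 1) B s2 with h3
      have hH3 : Holds I x s3 := hH2.congr (Code.toggle m) _ _ (hE2.ev _)
      have hT3 : Ind I (s3.a .cur) (toggled I T l) :=
        toggle_spec hE2 (by rw [a2 _ (by decide)]; exact i1) (by rw [idx2, if_pos rfl])
      have f3 : s3.v .found = s1.v .found :=
        (Com.ev_v_eq (Code.toggle m) s2 rfl).trans (v2 _ (by decide))
      have hG3 : Good I p (w * (I.F + I.C) + 1) x s3 := i2.congr f3
        ((Com.ev_v_eq (Code.toggle m) s2 rfl).trans (v2 _ (by decide)))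
        ((Com.ev_a_eq (Code.toggle m) s2 rfl).trans (a2 _ (by decide)))
        ((Com.ev_a_eq (Code.toggle m) s2 rfl).trans (a2 _ (by decide)))
      obtain ⟨j1, j2, j3, j4, j5⟩ := ih s3 _ hH3 hT3 hG3 _ rfl
      set s4 := (Code.enum p w m).ev (I.F + I.C + 1) B s3 with h4
      have hE4 : Env I s4 := enum_env hH3.env
      have idx4 : ∀ k, m ≤ k → s4.a .idx k = s2.a .idx k := fun k hk => by
        rw [j4 k hk, h3, Com.ev_a_eq (Code.toggle m) s2 rfl]
      have f5 : ((Code.toggle m).ev (I.F + I.C + 1) B s4).v .found = s4.v .found :=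
        Com.ev_v_eq (Code.toggle m) s4 rfl
      refine ⟨?_, ?_, ?_, fun k hk => ?_, ?_⟩
      · rw [← toggled_toggled T l]
        exact toggle_spec hE4 j1 (by rw [idx4 m le_rfl, idx2, if_pos rfl])
      · exact j2.congr f5 (Com.ev_v_eq (Code.toggle m) s4 rfl)
          (Com.ev_a_eq (Code.toggle m) s4 rfl) (Com.ev_a_eq (Code.toggle m) s4 rfl)
      · intro hf
        rw [f5]
        exact j3 (by rw [f3]; exact i3 hf)
      · rw [Com.ev_a_eq (Code.toggle m) s4 rfl, idx4 k (by omega), idx2, if_neg (by omega),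
          i4 k hk]
      · intro hf i hi y hy
        rw [f5] at hf
        rcases Nat.lt_succ_iff_lt_or_eq.1 hi with hi | rfl
        · refine i5 ?_ i hi y hy
          by_contra hne
          exact j3 (by rw [f3]; exact hne) hf
        · exact j5 hf y hy)
    rw [← hs'] at key
    obtain ⟨i1, i2, i3, i4, i5⟩ := key
    refine ⟨i1, i2, i3, i4, fun hf y hy hc => ?_⟩
    obtain ⟨i, hi, hi'⟩ := exists_toggled hc
    exact i5 hf i (by omega) y hy hi'

/-- The state describes the current solution `x` of the local search and its assignment. -/
structure Current (I : Instance ℕ) (x : I.State) (s : St) : Prop extends Holds I x s where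
  cur : Ind I (s.a .cur) x.1
  asg : ∀ j : Fin I.C, s.a .sasg j = x.2 j
  opt : I.IsOptAssignment x.1 x.2
  cap : I.C ≤ #x.1 * I.U

theorem MultiSwap.card_symmDiff_le {n p : ℕ} {S T : Finset (Fin n)} (h : MultiSwap p S T) :
    #(symmDiff S T) ≤ 2 * p := by
  rw [multiSwap_iff] at h
  have := card_union_le (S \ T) (T \ S)
  rw [show symmDiff S T = S \ T ∪ T \ S from rfl]
  omega

theorem MultiSwap.card_eq {n p : ℕ} {S T : Finset (Fin n)} (h : MultiSwap p S T) : #T = #S := by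
  rw [multiSwap_iff] at h
  have h3 := card_sdiff_add_card_inter S T
  have h4 := card_sdiff_add_card_inter T S
  rw [inter_comm] at h4
  omega

/-- A multi-swap of size at most `p` changes at most `2 * p` facilities, so the enumeration of depth
`2 * p` misses no step. -/
theorem round_spec (hB : 4 + I.F * I.C + I.F + I.C ≤ B) {p w : ℕ} {x : I.State}
    (h : Current I x s) {s' : St} (hs' : s' = (Code.round p w).ev (I.F + I.C + 1) B s) :
    (s'.v .found = 0 ∧ Current I x s' ∧ I.IsLocalOpt p (w * (I.F + I.C) + 1) x) ∨
    (s'.v .found ≠ 0 ∧ ∃ y, Current I y s' ∧ I.Step p (w * (I.F + I.C) + 1) x y) := by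
  set n := I.F + I.C + 1 with hn
  rw [Code.round, Com.ev_seq, Com.ev_seq] at hs'
  set s1 := (Com.set .found (.c 0)).ev n B s with h1
  have hE1 : Env I s1 := h.env.ev _
  have hH1 : Holds I x s1 := h.toHolds.congr (Com.set .found (.c 0)) n B hE1
  have f1 : s1.v .found = 0 := by simp [h1]
  obtain ⟨j1, j2, -, -, j5⟩ := enum_spec hB (p := p) (w := w) h.cap (2 * p) s1 x.1 hH1
    h.cur (fun hf => absurd f1 hf) _ rfl
  rw [← hn] at j1 j2 j5
  set s2 := (Code.enum p w (2 * p)).ev n B s1 with h2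
  have hE2 : Env I s2 := enum_env hE1
  rw [Com.ev_cond, Ex.ev_v] at hs'
  by_cases hf : s2.v .found = 0
  · rw [if_neg (by simpa using hf)] at hs'
    subst hs'
    refine Or.inl ⟨hf, ⟨hH1.congr _ _ _ hE2 (enum_wa rfl rfl rfl) (enum_wv rfl rfl), j1, fun j => ?_,
      h.opt, h.cap⟩, h.opt, fun y hy => j5 hf y hy hy.1.card_symmDiff_le⟩
    rw [h2, Com.ev_a_eq _ s1 (enum_wa rfl rfl rfl)]
    exact h.asg j
  · rw [if_pos hf] at hs'
    obtain ⟨y, ⟨hy1, hy2⟩, hy3, hy4⟩ := j2 hf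
    refine Or.inr ⟨?_, y, ⟨⟨?_, ?_, ?_⟩, ?_, fun j => ?_, hy4.2.1, ?_⟩, hy4⟩
    · rw [hs', Com.ev_v_eq Code.move s2 rfl]; exact hf
    · rw [hs']; exact hE2.ev _
    · have : s'.a .sol = ((Code.copy .best .sol).ev n B s2).a .sol := by
        rw [hs', Code.move, Com.ev_seq]
        exact Com.ev_a_eq (Com.seq (Code.copy .best .cur) (.seq (Code.copy .rasg .sasg)
          (.set .sc (.v .rc)))) _ rfl
      rw [this, ev_copy (by decide)]
      refine hy1.congr fun i hi => ?_
      rw [if_pos (by omega)]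
    · rw [hs', Code.move, ← hy3]
      have : ((Code.copy .rasg .sasg).ev n B ((Code.copy .best .cur).ev n B
          ((Code.copy .best .sol).ev n B s2))).v .rc = s2.v .rc :=
        Com.ev_v_eq (n := n) (B := B) (x := .rc) (Com.seq (Code.copy .best .sol)
          (.seq (Code.copy .best .cur) (Code.copy .rasg .sasg))) s2 rfl
      simp [this]
    · have : s'.a .cur = ((Code.copy .best .cur).ev n B
          ((Code.copy .best .sol).ev n B s2)).a .cur := by
        rw [hs', Code.move, Com.ev_seq, Com.ev_seq]
        exact Com.ev_a_eq (Com.seq (Code.copy .rasg .sasg) (.set .sc (.v .rc))) _ rfl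
      rw [this, ev_copy (by decide), Com.ev_a_eq (Code.copy .best .sol) _ rfl]
      refine hy1.congr fun i hi => ?_
      rw [if_pos (by omega)]
    · have : s'.a .sasg = ((Code.copy .rasg .sasg).ev n B ((Code.copy .best .cur).ev n B
          ((Code.copy .best .sol).ev n B s2))).a .sasg := by
        rw [hs', Code.move]; rfl
      rw [this, ev_copy (by decide), Com.ev_a_eq (Code.copy .best .cur) _ rfl,
        Com.ev_a_eq (Code.copy .best .sol) _ rfl]
      dsimp only
      rw [if_pos (by omega), hy2]
    · rw [hy4.1.card_eq]; exact h.cap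

end Enum
end CapMedian

/-! ### Starting state, output, and preparation of the memory. -/

namespace CapMedian

namespace Code

def readInput : Com :=
  .seq (.set .nF (.lo (.c 0))) (.seq (.set .nC (.lo (.c 1))) (.seq (.set .nK (.lo (.c 2)))
    (.set .nU (.lo (.c 3)))))

def fillRow : Com :=
  .seq (.set .t (.c 0))
    (.loop .i (.seq (.wr .row (.v .i) (.v .t)) (.set .t (.v .t + .v .nC))))

/-- Opens the first `⌊8k/3⌋` facilities, as far as they exist: `3 i + 2 < 8 k` is equivalent to `i <
⌊8k/3⌋`. -/
def startSet : Com :=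
  .loop .i (.ite (.lt ((Ex.v .i).smul 3 + .c 2) ((Ex.v .nK).smul 8)) (.wr .cur (.v .i) (.c 1))
    (.wr .cur (.v .i) (.c 0)))

/-- Compute the starting state of the local search. -/
def init : Com :=
  .seq readInput (.seq fillRow (.seq startSet (.seq (copy .cur .sol) (.seq optimize
    -- The variable `found` controls the main loop and has to be nonzero at its first test.
    (.seq evalCost (.seq (copy .asg .sasg) (.seq (.set .sc (.v .tot)) (.set .found (.c 1)))))))))

/-- Write the solution to the output block. -/
def output : Com :=
  .seq (.loop .j (.cond (.lt (.v .j) (.v .nC)) (.wlo (.v .j) (.rd .sasg (.v .j)))))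
    (.loop .i (.cond (.lt (.v .i) (.v .nF)) (.wlo (.v .nC + .v .i) (.rd .sol (.v .i)))))

end Code

section Init
open Finset

variable {I : Instance ℕ} {B : ℕ} {s : St}

theorem Instance.IsAssignment.clients_le {S : Finset (Fin I.F)} {ψ : Fin I.C → Fin I.F}
    (h : I.IsAssignment S ψ) : I.C ≤ #S * I.U := by
  have h1 : #(univ : Finset (Fin I.C)) = ∑ i ∈ S, #{j | ψ j = i} :=
    card_eq_sum_card_fiberwise fun j _ => h.1 j
  rw [card_univ, Fintype.card_fin] at h1
  rw [h1, ← smul_eq_mul]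
  exact sum_le_card_nsmul _ _ _ fun i _ => h.2 i

theorem ev_fillRow (hC : s.v .nC = I.C) {n : ℕ} (i : ℕ) (hi : i < n) :
    (Code.fillRow.ev n B s).a .row i = i * I.C := by
  rw [Code.fillRow, Com.ev_seq]
  set s1 := (Com.set .t (.c 0)).ev n B s with h1
  have key := Com.ev_loop_frame (n := n) (B := B) (x := .i) (s := s1)
    (P := .seq (.wr .row (.v .i) (.v .t)) (.set .t (.v .t + .v .nC)))
    (fun m s' => s'.v .t = m * I.C ∧ ∀ i < m, s'.a .row i = i * I.C) (by simp [h1]) (by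
      intro m hm s' hv _ _ hI
      have e : s'.v .nC = I.C := (hv _ rfl).trans (by simp [h1, hC])
      refine ⟨?_, fun i hi => ?_⟩
      · simp [hI.1, e]; ring
      · by_cases c : i = m
        · subst c; simp [hI.1]
        · simp [c, hI.2 i (by omega)])
  exact key.2 i hi

theorem ev_startSet {n : ℕ} : ((Code.startSet.ev n B s).a .cur) =
    fun i => if i < n then (if 3 * i + 2 < 8 * s.v .nK then 1 else 0) else s.a .cur i :=
  Com.ev_loop_fill .cur (fun i => if 3 * i + 2 < 8 * s.v .nK then 1 else 0)
    fun i _ s' hv _ _ _ => by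
      have e : s'.v .nK = s.v .nK := hv _ rfl
      rw [Com.ev_ite]
      by_cases c : 3 * i + 2 < 8 * s.v .nK
      · rw [if_pos c, if_pos (by simp [e]; omega)]; simp
      · rw [if_neg c, if_neg (by simp [e]; omega)]; simp

/-- The block of memory below `B` holds the input. -/
structure HasInput (I : Instance ℕ) (s : St) : Prop where
  F : s.low 0 = I.F
  C : s.low 1 = I.C
  k : s.low 2 = I.k
  U : s.low 3 = I.U
  c : ∀ i < I.F, ∀ j < I.C, s.low (4 + i * I.C + j) = I.dist i j

theorem init_spec (hI : HasInput I s) (hB : 4 + I.F * I.C + I.F + I.C ≤ B) (hF : I.Feasible)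
    {s' : St} (hs' : s' = Code.init.ev (I.F + I.C + 1) B s) :
    ∃ x, I.IsStart x ∧ Current I x s' ∧ s'.v .found ≠ 0 := by
  set n := I.F + I.C + 1 with hn
  rw [Code.init] at hs'
  iterate 6 rw [Com.ev_seq] at hs'
  set s1 := Code.readInput.ev n B s with h1
  have nF1 : s1.v .nF = I.F := by
    simp [h1, Code.readInput, hI.F]; omega
  have nC1 : s1.v .nC = I.C := by
    simp [h1, Code.readInput, hI.C]; omega
  have nK1 : s1.v .nK = I.k := by
    simp [h1, Code.readInput, hI.k]; omega
  have nU1 : s1.v .nU = I.U := by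
    simp [h1, Code.readInput, hI.U]; omega
  have low1 : s1.low = s.low := Com.ev_low_eq Code.readInput s rfl
  set s2 := Code.fillRow.ev n B s1 with h2
  have hE2 : Env I s2 :=
    ⟨(Com.ev_v_eq Code.fillRow s1 rfl).trans nF1, (Com.ev_v_eq Code.fillRow s1 rfl).trans nC1,
      (Com.ev_v_eq Code.fillRow s1 rfl).trans nK1, (Com.ev_v_eq Code.fillRow s1 rfl).trans nU1,
      fun i hi => ev_fillRow nC1 i (by omega), by
        rw [h2, Com.ev_low_eq Code.fillRow s1 rfl, low1]; exact hI.c⟩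
  set S : Finset (Fin I.F) := {i | 3 * (i : ℕ) + 2 < 8 * I.k} with hS
  have hScard : #S = min (8 * I.k / 3) I.F := by
    have : #S = #{i ∈ range I.F | 3 * i + 2 < 8 * I.k} := by
      rw [card_filter, card_filter, sum_range]
    rw [this, ← card_range (min (8 * I.k / 3) I.F)]
    congr 1
    ext i
    simp only [mem_filter, mem_range]
    omega
  set s3 := Code.startSet.ev n B s2 with h3
  have hE3 : Env I s3 := hE2.ev _
  have hS3 : Ind I (s3.a .cur) S := by
    intro i
    rw [h3, ev_startSet]
    dsimp only
    rw [if_pos (by omega), hE2.nK]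
    simp [hS]
  set s4 := (Code.copy .cur .sol).ev n B s3 with h4
  have hE4 : Env I s4 := hE3.ev _
  have hS4 : Ind I (s4.a .cur) S := by
    rw [h4, Com.ev_a_eq (Code.copy .cur .sol) s3 rfl]; exact hS3
  have hSol4 : Ind I (s4.a .sol) S := by
    rw [h4, ev_copy (by decide)]
    refine hS3.congr fun i hi => ?_
    rw [if_pos (by omega)]
  have hcap : I.C ≤ #S * I.U := by
    obtain ⟨O, ψ, hO, hψ⟩ := hF
    refine hψ.clients_le.trans (Nat.mul_le_mul_right _ ?_)
    have := card_le_univ O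
    rw [Fintype.card_fin] at this
    omega
  have hcert := optimize_spec hE4 hB (by rw [hS4.card_marked]; exact hcap)
  rw [← hn] at hcert
  set s5 := Code.optimize.ev n B s4 with h5
  have hE5 : Env I s5 := hE4.ev _
  obtain ⟨φ, hφ, hopt, hcost⟩ := HasCert.exists_isOptAssignment hS4 hcert
  have htot := evalCost_spec hE5 hB fun j hj => by
    rw [show s5.a .asg j = φ ⟨j, hj⟩ from hφ ⟨j, hj⟩]
    exact (φ ⟨j, hj⟩).2
  rw [← hn, ← hcost] at htot
  set s6 := Code.evalCost.ev n B s5 with h6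
  have hE6 : Env I s6 := hE5.ev _
  have a6 : s6.a = s5.a := by funext k; exact Com.ev_a_eq Code.evalCost s5 rfl
  have tot7 : ((Code.copy .asg .sasg).ev n B s6).v .tot = I.cost φ :=
    (Com.ev_v_eq (Code.copy .asg .sasg) s6 rfl).trans htot
  have hs'2 : s' = (Com.seq (Code.copy .asg .sasg)
      (.seq (.set .sc (.v .tot)) (.set .found (.c 1)))).ev n B s6 := hs'
  refine ⟨(S, φ), ⟨hScard, hopt⟩, ⟨⟨?_, ?_, ?_⟩, ?_, fun j => ?_, hopt, hcap⟩, ?_⟩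
  · rw [hs'2]; exact hE6.ev _
  · rw [hs'2, Com.ev_a_eq _ s6 rfl, a6, h5, Com.ev_a_eq Code.optimize s4 rfl]; exact hSol4
  · rw [hs'2]; simp [tot7]
  · rw [hs'2, Com.ev_a_eq _ s6 rfl, a6, h5, Com.ev_a_eq Code.optimize s4 rfl]; exact hS4
  · have : s'.a .sasg = ((Code.copy .asg .sasg).ev n B s6).a .sasg := by rw [hs'2]; rfl
    rw [this, ev_copy (by decide)]
    dsimp only
    rw [if_pos (by omega), a6, hφ]
  · rw [hs'2]; simp

theorem output_spec (hB : 4 + I.F * I.C + I.F + I.C ≤ B) {x : I.State} (h : Current I x s)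
    {s' : St} (hs' : s' = Code.output.ev (I.F + I.C + 1) B s) :
    (∀ j : Fin I.C, s'.low j = x.2 j) ∧ ∀ i : Fin I.F, s'.low (I.C + i) = if i ∈ x.1 then 1 else 0 := by
  set n := I.F + I.C + 1 with hn
  rw [Code.output, Com.ev_seq] at hs'
  set P : Com := .cond (.lt (.v .j) (.v .nC)) (.wlo (.v .j) (.rd .sasg (.v .j))) with hP
  set Q : Com := .cond (.lt (.v .i) (.v .nF)) (.wlo (.v .nC + .v .i) (.rd .sol (.v .i))) with hQ
  have key1 := Com.ev_loop_frame (n := n) (B := B) (x := .j) (s := s) (P := P)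
    (fun m s' => ∀ j < m, j < I.C → s'.low j = s.a .sasg j) (by simp) (by
      intro m hm s' hv ha _ hI j hj hjC
      have e : s'.v .nC = I.C := (hv _ rfl).trans h.env.nC
      have e2 : s'.a .sasg = s.a .sasg := ha _ rfl
      rw [hP, Com.ev_cond]
      by_cases c : m < I.C
      · rw [if_pos (by simp [e]; omega), Com.ev_wlo, if_pos (by simp; omega)]
        by_cases c2 : j = m
        · subst c2; simp [e2]
        · simp [c2, hI j (by omega) hjC]
      · rw [if_neg (by simp [e]; omega)]
        exact hI j (by omega) hjC)
  set s1 := (Com.loop .j P).ev n B s with h1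
  have sol1 : s1.a .sol = s.a .sol := Com.ev_a_eq (Com.loop .j P) s rfl
  have key2 := Com.ev_loop_frame (n := n) (B := B) (x := .i) (s := s1) (P := Q)
    (fun m s' => (∀ j < I.C, s'.low j = s1.low j) ∧
      ∀ i < m, i < I.F → s'.low (I.C + i) = s.a .sol i) (by simp) (by
      intro m hm s' hv ha _ hI
      have e : s'.v .nF = I.F :=
        (hv _ rfl).trans ((Com.ev_v_eq (Com.loop .j P) s rfl).trans h.env.nF)
      have e1 : s'.v .nC = I.C :=
        (hv _ rfl).trans ((Com.ev_v_eq (Com.loop .j P) s rfl).trans h.env.nC)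
      have e2 : s'.a .sol = s.a .sol := (ha _ rfl).trans sol1
      rw [hQ, Com.ev_cond]
      by_cases c : m < I.F
      · rw [if_pos (by simp [e]; omega), Com.ev_wlo, if_pos (by simp [e1]; omega)]
        refine ⟨fun j hj => ?_, fun i hi hiF => ?_⟩
        · simp [Function.update_apply, e1, ← hI.1 j hj]; omega
        · by_cases c2 : i = m
          · subst c2; simp [e1, e2]
          · simp [e1, c2, hI.2 i (by omega) hiF]
      · rw [if_neg (by simp [e]; omega)]
        exact ⟨hI.1, fun i hi hiF => hI.2 i (by omega) hiF⟩)
  rw [← hs'] at key2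
  refine ⟨fun j => ?_, fun i => ?_⟩
  · rw [key2.1 j j.2, key1 j (by omega) j.2, h.asg]
  · rw [key2.2 i (by omega) i.2, h.sol]

/-! ### The input in memory -/

theorem getD_flatMap {α : Type*} {m : ℕ} (r : α → List ℕ) (hr : ∀ a, (r a).length = m)
    (l : List α) : ∀ (i : ℕ) (a : α) (j : ℕ), l[i]? = some a → j < m →
      (l.flatMap r).getD (i * m + j) 0 = (r a).getD j 0 := by
  induction l with
  | nil => intro i a j h; simp at h
  | cons b l ih =>
    intro i a j h hj
    rw [List.flatMap_cons]
    cases i with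
    | zero =>
      obtain rfl : b = a := by simpa using h
      rw [zero_mul, zero_add, List.getD_append _ _ _ _ (by rw [hr]; exact hj)]
    | succ i =>
      rw [List.getD_append_right _ _ _ _ (by rw [hr, Nat.succ_mul]; omega), hr,
        show (i + 1) * m + j - m = i * m + j by rw [Nat.succ_mul]; omega]
      exact ih i a j (by simpa using h) hj

theorem Instance.length_input : I.input.length = 4 + I.F * I.C := by
  simp [Instance.input]; ring

/-- The state of the machine after the preparation. -/
def Instance.prepared (I : Instance ℕ) : St :=
  ⟨fun _ => 0, fun _ _ => 0, fun a => I.input.getD a 0⟩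

theorem Instance.hasInput_prepared : HasInput I I.prepared where
  F := rfl
  C := rfl
  k := rfl
  U := rfl
  c i hi j hj := by
    have h1 : I.prepared.low (4 + i * I.C + j) = ((List.finRange I.F).flatMap fun i =>
        (List.finRange I.C).map fun j => I.c (.inl i) (.inr j)).getD (i * I.C + j) 0 := by
      have : 4 + i * I.C + j = i * I.C + j + 1 + 1 + 1 + 1 := by ring
      rw [this]
      rfl
    rw [h1, getD_flatMap _ (m := I.C) (by simp) _ i ⟨i, hi⟩ j (by simp [hi]) hj,
      Instance.dist, dif_pos ⟨hi, hj⟩]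
    simp [List.getD, hj]

/-- Compute the bound for loops and the size of the input and output block. -/
def Code.prepare : Prog :=
  .seq (.const 4 0) (.seq (.load 7 4) (.seq (.const 4 1) (.seq (.load 10 4) (.seq (.add 0 7 10)
    (.seq (.add 0 0 4) (.seq (.const 1 4) (.seq (.add 1 1 7) (.seq (.add 1 1 10)
      (.while 7 (.seq (.add 1 1 10) (.sub 7 7 4)))))))))))

/-- Without multiplication, the product `F * C` in the block size is obtained by repeated addition.
-/
theorem exec_addLoop : ∀ (F C : ℕ) (σ : Config), σ.reg 7 = F → σ.reg 10 = C → σ.reg 4 = 1 →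
    ∃ τ, Exec (.while 7 (.seq (.add 1 1 10) (.sub 7 7 4))) σ (3 * F + 1) τ ∧ τ.mem = σ.mem ∧
      τ.reg 1 = σ.reg 1 + F * C ∧ ∀ r, r ≠ 1 → r ≠ 7 → τ.reg r = σ.reg r := by
  intro F
  induction F with
  | zero =>
    intro C σ h7 _ _
    exact ⟨σ, .while_false h7, rfl, by simp, fun _ _ _ => rfl⟩
  | succ F ih =>
    intro C σ h7 h10 h4
    set σ1 := σ.setReg 1 (σ.reg 1 + σ.reg 10) with h1
    obtain ⟨τ, t1, t2, t3, t4⟩ := ih C (σ1.setReg 7 (σ1.reg 7 - σ1.reg 4)) (by simp [h1, h7, h4])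
      (by simp [h1, h10]) (by simp [h1, h4])
    refine ⟨τ, ?_, t2, ?_, fun r k1 k2 => ?_⟩
    · have := Exec.while_true (x := 7) (by rw [h7]; omega)
        (.seq (.add 1 1 10 σ) (.sub 7 7 4 σ1)) t1
      convert this using 1
      ring
    · rw [t3]; simp [h1, h10]; ring
    · rw [t4 r k1 k2]; simp [h1, k1, k2]

theorem exec_prepare (I : Instance ℕ) : ∃ τ, Exec Code.prepare I.initial (3 * I.F + 10) τ ∧
    Rep (I.F + I.C + 1) (4 + I.F * I.C + I.F + I.C) I.prepared τ := by
  set σ1 := I.initial.setReg 4 0 with h1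
  set σ2 := σ1.setReg 7 (σ1.mem (σ1.reg 4)) with h2
  set σ3 := σ2.setReg 4 1 with h3
  set σ4 := σ3.setReg 10 (σ3.mem (σ3.reg 4)) with h4
  set σ5 := σ4.setReg 0 (σ4.reg 7 + σ4.reg 10) with h5
  set σ6 := σ5.setReg 0 (σ5.reg 0 + σ5.reg 4) with h6
  set σ7 := σ6.setReg 1 4 with h7
  set σ8 := σ7.setReg 1 (σ7.reg 1 + σ7.reg 7) with h8
  set σ9 := σ8.setReg 1 (σ8.reg 1 + σ8.reg 10) with h9
  have m0 : I.initial.mem 0 = I.F := rfl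
  have m1 : I.initial.mem 1 = I.C := rfl
  have r0 : ∀ r, I.initial.reg r = 0 := fun _ => rfl
  have e7 : σ9.reg 7 = I.F := by simp [h9, h8, h7, h6, h5, h4, h3, h2, h1, m0]
  have e10 : σ9.reg 10 = I.C := by simp [h9, h8, h7, h6, h5, h4, h3, h2, h1, m1]
  have e4 : σ9.reg 4 = 1 := by simp [h9, h8, h7, h6, h5, h4, h3]
  have e1 : σ9.reg 1 = 4 + I.F + I.C := by simp [h9, h8, h7, h6, h5, h4, h3, h2, h1, m0, m1]
  have e0 : σ9.reg 0 = I.F + I.C + 1 := by simp [h9, h8, h7, h6, h5, h4, h3, h2, h1, m0, m1]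
  have er : ∀ r, r ≠ 0 → r ≠ 1 → r ≠ 4 → r ≠ 7 → r ≠ 10 → σ9.reg r = 0 :=
    fun r k0 k1 k4 k7 k10 => by
      simp [h9, h8, h7, h6, h5, h4, h3, h2, h1, r0, k0, k1, k4, k7, k10]
  obtain ⟨τ, t1, t2, t3, t4⟩ := exec_addLoop I.F I.C σ9 e7 e10 e4
  have hm : τ.mem = fun a => I.input.getD a 0 := t2
  refine ⟨τ, ?_, ?_, ?_, ?_, fun x => ?_, fun k i => ?_, fun i _ => ?_⟩
  · have := Exec.seq (.const 4 0 I.initial) (.seq (.load 7 4 σ1) (.seq (.const 4 1 σ2)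
      (.seq (.load 10 4 σ3) (.seq (.add 0 7 10 σ4) (.seq (.add 0 0 4 σ5) (.seq (.const 1 4 σ6)
      (.seq (.add 1 1 7 σ7) (.seq (.add 1 1 10 σ8) t1))))))))
    rw [Code.prepare]
    convert this using 1
    ring
  · rw [t4 0 (by decide) (by decide), e0]
  · rw [t3, e1]; ring
  · rw [t4 2 (by decide) (by decide), er 2] <;> decide
  · rw [t4 _ (by omega) (by omega), er _ (by omega) (by omega) (by omega) (by omega) (by omega)]
    rfl
  · rw [hm]
    exact List.getD_eq_default _ _ (by rw [Instance.length_input]; omega)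
  · rw [hm]; rfl

end Init
end CapMedian

/-! ### The machine program, its running time, and the theorem. -/

namespace CapMedian
section Machine
open Finset

/-- The machine program for the local search. -/
def searchProg (p w : ℕ) : Prog :=
  .seq Code.prepare (.seq (Code.init.comp 0)
    -- Register 63 is that of the variable `found`. This is the only loop, apart from the
    -- preparation, that is not a loop of the small language.
    (.seq (.while 63 ((Code.round p w).comp 0)) (Code.output.comp 0)))

variable {I : Instance ℕ}

/-- A step to a positive cost lowers `q * log cost` by at least 1, since `log t ≤ t - 1`. A step to
cost 0 is treated separately, as `Real.log 0 = 0`; it can only be the last one, which explains the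
summand 1. -/
theorem log_le_of_step {p q : ℕ} {x y : I.State} (hq : 0 < q) (h : I.Step p q x y) {r : ℕ}
    (hr : (r : ℝ) ≤ q * Real.log (I.cost y.2) + 1) :
    ((r + 1 : ℕ) : ℝ) ≤ q * Real.log (I.cost x.2) + 1 ∨ I.cost y.2 = 0 ∧ r ≤ 1 := by
  obtain ⟨-, -, h3, h4⟩ := h
  rcases Nat.eq_zero_or_pos (I.cost y.2) with e | e
  · right
    refine ⟨e, ?_⟩
    rw [e] at hr
    have : (r : ℝ) ≤ 1 := by simpa using hr
    exact_mod_cast this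
  · left
    set a : ℝ := (I.cost x.2 : ℝ) with ha
    set b : ℝ := (I.cost y.2 : ℝ) with hb
    have hb0 : 0 < b := by rw [hb]; exact_mod_cast e
    have ha0 : 0 < a := by rw [ha]; exact_mod_cast (e.trans h3)
    have hq0 : (0 : ℝ) < q := by exact_mod_cast hq
    have h5 : (q : ℝ) * b + a ≤ q * a := by
      rw [ha, hb]; exact_mod_cast h4
    have h6 : Real.log (b / a) ≤ b / a - 1 := Real.log_le_sub_one_of_pos (by positivity)
    rw [Real.log_div hb0.ne' ha0.ne'] at h6
    have h7 : (q : ℝ) * (b / a - 1) ≤ -1 := by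
      have : (q : ℝ) * (b / a - 1) = (q * b - q * a) / a := by field_simp
      rw [this, div_le_iff₀ ha0]
      linarith
    have h8 := mul_le_mul_of_nonneg_left h6 hq0.le
    push_cast
    linarith

/-- The cost is a natural number that drops in each step, so the loop terminates. The potential `q *
log cost` gives the polynomial bound on the number `r` of steps, and one more round detects local
optimality. -/
theorem exec_search {B p w : ℕ} (hB : 4 + I.F * I.C + I.F + I.C ≤ B) : ∀ (m : ℕ) (x : I.State)
    (s : St) (σ : Config), I.cost x.2 ≤ m → Current I x s → s.v .found ≠ 0 →
    Rep (I.F + I.C + 1) B s σ → ∃ (r t : ℕ) (τ : Config) (s' : St) (y : I.State),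
      Exec (.while 63 ((Code.round p w).comp 0)) σ t τ ∧
      t ≤ (r + 1) * ((Code.round p w).cost (I.F + I.C + 1) + 1) + 1 ∧
      Rep (I.F + I.C + 1) B s' τ ∧ Current I y s' ∧
      Relation.ReflTransGen (I.Step p (w * (I.F + I.C) + 1)) x y ∧
      I.IsLocalOpt p (w * (I.F + I.C) + 1) y ∧
      (r : ℝ) ≤ (w * (I.F + I.C) + 1 : ℕ) * Real.log (I.cost x.2) + 1 ∧
      (I.cost x.2 = 0 → r = 0) := by
  intro m
  induction m using Nat.strong_induction_on with
  | _ m ih =>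
  intro x s σ hm hx hf hR
  obtain ⟨t, τ, h1, h2, h3, -⟩ := (Code.round p w).comp_correct 0 s σ hR
  have h63 : σ.reg 63 ≠ 0 := by
    have := hR.rv .found
    rw [show 3 * Var.found.code + 3 = 63 from rfl] at this
    rw [this]; exact hf
  have hlog : (0 : ℝ) ≤ (w * (I.F + I.C) + 1 : ℕ) * Real.log (I.cost x.2) :=
    mul_nonneg (Nat.cast_nonneg _) (Real.log_natCast_nonneg _)
  have hreg := h3.rv .found
  rw [show 3 * Var.found.code + 3 = 63 from rfl] at hreg
  rcases round_spec hB (p := p) (w := w) hx rfl with ⟨k1, k2, k3⟩ | ⟨k1, y, k2, k3⟩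
  · refine ⟨0, _, τ, _, x, .while_true h63 h1 (.while_false (by rw [hreg, k1])), by omega, h3, k2,
      .refl, k3, ?_, fun _ => rfl⟩
    rw [Nat.cast_zero]
    linarith
  · obtain ⟨r, t', τ', s', z, g1, g2, g3, g4, g5, g6, g7, g8⟩ :=
      ih (I.cost y.2) (lt_of_lt_of_le k3.2.2.1 hm) y _ τ le_rfl k2 k1 h3
    refine ⟨r + 1, _, τ', s', z, .while_true h63 h1 g1, ?_, g3, g4, .head k3 g5, g6, ?_, ?_⟩
    · rw [add_mul (r + 1) 1, one_mul]
      omega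
    · rcases log_le_of_step (by omega) k3 g7 with e | ⟨e, -⟩
      · exact e
      · rw [g8 e, zero_add, Nat.cast_one]
        linarith
    · intro e
      have := k3.2.2.1
      omega

/-- The sum is less than the product of the factors `a + 1`, and `a + 1 ≤ 2 ^ a.size`. -/
theorem sum_lt_two_pow (l : List ℕ) : l.sum < 2 ^ (l.map fun w => w.size + 1).sum := by
  induction l with
  | nil => simp
  | cons a l ih =>
    rw [List.sum_cons, List.map_cons, List.sum_cons, pow_add, pow_succ]
    have h1 := Nat.lt_size_self a
    set A := 2 ^ a.size
    set L := 2 ^ (l.map fun w => w.size + 1).sum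
    have h2 : (a + 1) * (l.sum + 1) ≤ A * L := Nat.mul_le_mul h1 ih
    rw [show (a + 1) * (l.sum + 1) = a * l.sum + a + l.sum + 1 by ring] at h2
    rw [show A * 2 * L = 2 * (A * L) by ring]
    omega

theorem Instance.cost_lt_two_pow_size (φ : Fin I.C → Fin I.F) : I.cost φ < 2 ^ I.size := by
  have h1 : I.cost φ ≤ I.input.sum := by
    have h2 : I.input.sum = I.F + I.C + I.k + I.U +
        ∑ i : Fin I.F, ∑ j : Fin I.C, I.c (.inl i) (.inr j) := by
      rw [Instance.input, List.sum_append]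
      congr 1
      · simp; ring
      · rw [List.flatMap_def, List.sum_flatten, List.map_map, ← List.ofFn_eq_map, List.sum_ofFn]
        refine sum_congr rfl fun i _ => ?_
        rw [Function.comp_apply, ← List.ofFn_eq_map, List.sum_ofFn]
    rw [h2, Instance.cost, sum_comm]
    refine le_trans (sum_le_sum fun j _ => ?_) (Nat.le_add_left _ _)
    exact single_le_sum (f := fun i : Fin I.F => I.c (.inl i) (.inr j)) (fun _ _ => Nat.zero_le _)
      (mem_univ (φ j))
  refine h1.trans_lt ((sum_lt_two_pow _).trans_le (Nat.pow_le_pow_right two_pos ?_))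
  rw [Instance.size]
  omega

theorem Instance.log_cost_le_size (φ : Fin I.C → Fin I.F) : Real.log (I.cost φ) ≤ I.size := by
  rcases Nat.eq_zero_or_pos (I.cost φ) with e | e
  · rw [e]; simp
  · have h1 : (I.cost φ : ℝ) ≤ 2 ^ I.size := by exact_mod_cast (I.cost_lt_two_pow_size φ).le
    have h2 := Real.log_le_log (by exact_mod_cast e) h1
    rw [Real.log_pow] at h2
    have h3 : Real.log 2 ≤ 1 := by
      have := Real.log_le_sub_one_of_pos (show (0 : ℝ) < 2 by norm_num)
      linarith
    have h4 : (I.size : ℝ) * Real.log 2 ≤ I.size * 1 :=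
      mul_le_mul_of_nonneg_left h3 (Nat.cast_nonneg _)
    linarith

theorem Instance.add_four_le_size (I : Instance ℕ) : I.F + I.C + 4 ≤ I.size := by
  rw [Instance.size, Instance.input, List.map_append, List.sum_append]
  simp only [List.map_cons, List.map_nil, List.sum_cons, List.sum_nil]
  omega

/-- The 4 comes from computing an assignment: loops over the clients to be inserted, the growth
steps, and the pairs of client and facility. -/
theorem enum_depth (p w m : ℕ) : (Code.enum p w m).depth = m + 4 := by
  induction m with
  | zero => rfl
  | succ m ih => simp [Code.enum, Code.toggle, Com.cond, Com.depth, ih]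

theorem round_depth (p w : ℕ) : (Code.round p w).depth = 2 * p + 4 := by
  rw [Code.round, Com.depth, Com.depth, enum_depth]
  have h1 : (Com.cond (.v .found) Code.move).depth = 1 := rfl
  have h2 : (Com.set .found (.c 0)).depth = 0 := rfl
  rw [h1, h2]
  omega

theorem natCast_step_bound {r w N z : ℕ} {L : ℝ} (hN : N + 1 ≤ z) (hL : L ≤ z)
    (hr : (r : ℝ) ≤ (w * N + 1 : ℕ) * L + 1) : r ≤ (w + 1) * (z * z) + 1 := by
  have h1 : w * N + 1 ≤ (w + 1) * z := by nlinarith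
  have h2 : ((w * N + 1 : ℕ) : ℝ) * L ≤ ((w + 1) * z : ℕ) * (z : ℝ) :=
    (mul_le_mul_of_nonneg_left hL (Nat.cast_nonneg _)).trans
      (mul_le_mul_of_nonneg_right (Nat.cast_le.2 h1) (Nat.cast_nonneg _))
  have h3 : (r : ℝ) ≤ (((w + 1) * z * z + 1 : ℕ) : ℝ) := by
    rw [Nat.cast_add, Nat.cast_mul, Nat.cast_one]
    linarith
  rw [← mul_assoc]
  exact_mod_cast h3

/-- The machine performs the local search in polynomial time. -/
theorem exec_searchProg (p w : ℕ) : ∃ a : ℕ, ∀ I : Instance ℕ, I.Feasible →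
    ∃ (t : ℕ) (τ : Config) (x : I.State), Exec (searchProg p w) I.initial t τ ∧
      t ≤ a * I.size ^ (2 * p + 6) ∧ I.Outputs τ x ∧
      I.IsSearchResult p (w * (I.F + I.C) + 1) x := by
  obtain ⟨K₀, h₀⟩ := Code.init.cost_le
  obtain ⟨K₁, h₁⟩ := (Code.round p w).cost_le
  obtain ⟨K₂, h₂⟩ := Code.output.cost_le
  -- With `z` the input size, there are at most `(w + 3) * z ^ 2` rounds of at most `(K₁ + 1) * z ^
  -- (2 * p + 4)` steps each. `K₀` and `K₂` account for start and output, and 4 for the preparation.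
  refine ⟨K₀ + (w + 3) * (K₁ + 1) + K₂ + 4, fun I hF => ?_⟩
  obtain ⟨σ₁, e₁, R₁⟩ := exec_prepare I
  obtain ⟨t₂, σ₂, e₂, l₂, R₂, -⟩ := Code.init.comp_correct 0 _ _ R₁
  obtain ⟨x, hx, hc, hf⟩ := init_spec I.hasInput_prepared le_rfl hF rfl
  obtain ⟨r, t₃, σ₃, s₃, y, e₃, l₃, R₃, hy, hxy, hopt, hr, -⟩ :=
    exec_search (p := p) (w := w) le_rfl (I.cost x.2) x _ σ₂ le_rfl hc hf R₂
  obtain ⟨t₄, σ₄, e₄, l₄, R₄, -⟩ := Code.output.comp_correct 0 _ _ R₃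
  obtain ⟨o₁, o₂⟩ := output_spec le_rfl hy rfl
  refine ⟨_, σ₄, y, .seq e₁ (.seq e₂ (.seq e₃ e₄)), ?_, ⟨fun j => ?_, fun i => ?_⟩,
    ⟨x, hx, hxy, hopt⟩⟩
  · have hz := I.add_four_le_size
    have hr2 := natCast_step_bound (N := I.F + I.C) (by omega) (I.log_cost_le_size x.2) hr
    clear hr
    generalize I.size = z at *
    set n := I.F + I.C + 1 with hn
    have pw : ∀ d, d ≤ 2 * p + 4 → (n + 1) ^ d ≤ z ^ (2 * p + 4) := fun d hd =>
      (Nat.pow_le_pow_left (by omega) d).trans (Nat.pow_le_pow_right (by omega) hd)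
    set Z := z ^ (2 * p + 4) with hZ
    have hZ1 : 1 ≤ Z := Nat.one_le_pow _ _ (by omega)
    have hzz : z ^ (2 * p + 6) = z * z * Z := by rw [hZ]; ring
    have b₀ : t₂ ≤ K₀ * Z := l₂.trans ((h₀ n).trans (Nat.mul_le_mul_left _ (pw _ (by
      rw [show Code.init.depth = 4 from rfl]; omega))))
    have b₂ : t₄ ≤ K₂ * Z := l₄.trans ((h₂ n).trans (Nat.mul_le_mul_left _ (pw _ (by
      rw [show Code.output.depth = 1 from rfl]; omega))))
    have b₁ : (Code.round p w).cost n ≤ K₁ * Z := (h₁ n).trans (Nat.mul_le_mul_left _ (pw _ (by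
      rw [round_depth])))
    have hzz1 : 16 ≤ z * z := by nlinarith
    have b₃ : t₃ ≤ ((w + 3) * (z * z)) * ((K₁ + 1) * Z) + 1 := by
      refine l₃.trans (Nat.add_le_add_right (Nat.mul_le_mul ?_ ?_) 1)
      · nlinarith
      · rw [add_mul]; omega
    have b₄ : 3 * I.F + 11 ≤ 4 * (z * z) := by nlinarith
    rw [hzz]
    have c₀ : K₀ * Z ≤ K₀ * (z * z * Z) := Nat.mul_le_mul_left _ (Nat.le_mul_of_pos_left _ (by omega))
    have c₂ : K₂ * Z ≤ K₂ * (z * z * Z) := Nat.mul_le_mul_left _ (Nat.le_mul_of_pos_left _ (by omega))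
    have c₃ : ((w + 3) * (z * z)) * ((K₁ + 1) * Z) = (w + 3) * (K₁ + 1) * (z * z * Z) := by ring
    have c₄ : 4 * (z * z) ≤ 4 * (z * z * Z) := Nat.mul_le_mul_left _ (Nat.le_mul_of_pos_right _ hZ1)
    rw [c₃] at b₃
    rw [add_mul, add_mul, add_mul]
    omega
  · rw [R₄.rl j (by omega), o₁]
  · rw [R₄.rl (I.C + i) (by omega), o₂]

/-- The same instance with real costs. -/
def Instance.toReal (I : Instance ℕ) : Instance ℝ where
  F := I.F
  C := I.C
  k := I.k
  U := I.U
  c x y := I.c x y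
  c_nonneg _ _ := Nat.cast_nonneg _
  c_self x := by rw [I.c_self]; simp
  c_symm x y := by rw [I.c_symm]
  c_triangle x y z := by exact_mod_cast I.c_triangle x y z

theorem Instance.cost_toReal (φ : Fin I.C → Fin I.F) : I.toReal.cost φ = (I.cost φ : ℝ) :=
  (Nat.cast_sum _ _).symm

theorem Instance.isOptAssignment_toReal {S : Finset (Fin I.F)} {φ : Fin I.C → Fin I.F} :
    I.toReal.IsOptAssignment S φ ↔ I.IsOptAssignment S φ := by
  have key : ∀ {a b : ℕ} {a' b' : ℝ}, a' = a → b' = b → (a' ≤ b' ↔ a ≤ b) := by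
    rintro a b _ _ rfl rfl
    exact Nat.cast_le
  exact and_congr Iff.rfl (forall_congr' fun ψ => forall_congr' fun _ =>
    key (I.cost_toReal φ) (I.cost_toReal ψ))

/-- The program works with natural costs and the guarantee is proved for real ones. A step with real
costs is also a step with natural costs, since both cost conditions are inequalities between casts.
-/
theorem Instance.IsLocalOpt.toReal {p q : ℕ} {x : I.State} (h : I.IsLocalOpt p q x) :
    I.toReal.IsLocalOpt p q x := by
  have key : ∀ {a b : ℕ} {a' b' : ℝ}, a' = a → b' = b → a' < b' → (q : ℝ) * a' + b' ≤ q * b' →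
      a < b ∧ (q : ℕ) * a + b ≤ q * b := by
    rintro a b _ _ rfl rfl h1 h2
    exact ⟨by exact_mod_cast h1, by exact_mod_cast h2⟩
  refine ⟨isOptAssignment_toReal.2 h.1, fun y hy => ?_⟩
  obtain ⟨h1, h2⟩ := key (I.cost_toReal y.2) (I.cost_toReal x.2) hy.2.2.1 hy.2.2.2
  exact h.2 y ⟨hy.1, isOptAssignment_toReal.1 hy.2.1, h1, h2⟩

theorem Instance.IsSearchResult.card_eq {p q : ℕ} {x : I.State} (h : I.IsSearchResult p q x) :
    #x.1 = min (8 * I.k / 3) I.F := by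
  obtain ⟨x₀, h0, h1, -⟩ := h
  rw [← h0.1]
  induction h1 with
  | refl => rfl
  | tail _ h ih => rw [h.1.card_eq, ih]

end Machine
end CapMedian

theorem theorem1 :
    ∃ (d : ℕ) (Q : MvPolynomial (Fin 2) ℕ), ∀ ε : ℝ, 0 < ε →
      ∃ p : ℕ, 2 < p ∧ p ≤ d * ⌈1 / ε⌉₊ ∧
        (∀ I : CapMedian.Instance ℝ, ∀ s : I.State,
          s.1.card = min (8 * I.k / 3) I.F →
          I.IsLocalOpt p (MvPolynomial.eval ![I.F + I.C, ⌈1 / ε⌉₊] Q) s →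
          I.WithinFactor id (3 + ε) s.2) ∧
        ∃ (P : CapMedian.Prog) (a : ℕ), ∀ I : CapMedian.Instance ℕ, I.Feasible →
          ∃ (t : ℕ) (τ : CapMedian.Config) (s : I.State),
            CapMedian.Exec P I.initial t τ ∧ t ≤ a * I.size ^ (d * ⌈1 / ε⌉₊) ∧
            I.Outputs τ s ∧
            I.IsSearchResult p (MvPolynomial.eval ![I.F + I.C, ⌈1 / ε⌉₊] Q) s ∧
            I.IsAssignment s.1 s.2 ∧ 3 * s.1.card ≤ 8 * I.k ∧
            I.WithinFactor (fun x => (x : ℝ)) (3 + ε) s.2 := by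
  -- With `e = ⌈1/ε⌉` the swap size is `p = 40 e`, and the exponent `2 p + 6 = 80 e + 6` is at most
  -- `90 e` because `e ≥ 1`. The polynomial is the `q` for which local optima were analysed.
  refine ⟨90, MvPolynomial.C 40 * MvPolynomial.X 0 * MvPolynomial.X 1 + 1, fun ε hε => ?_⟩
  set e := ⌈1 / ε⌉₊ with he
  have he1 : 1 ≤ e := Nat.one_le_iff_ne_zero.2 (Nat.ceil_pos.2 (by positivity)).ne'
  have hinv : 1 / (e : ℝ) ≤ ε := by
    rw [one_div_le (by exact_mod_cast he1) hε]
    exact Nat.le_ceil _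
  have hQ : ∀ N : ℕ, MvPolynomial.eval ![N, e]
      (MvPolynomial.C 40 * MvPolynomial.X 0 * MvPolynomial.X 1 + 1) = 40 * N * e + 1 := fun N => by
    simp
  simp only [hQ]
  have factor : ∀ (I : CapMedian.Instance ℝ) (s : I.State),
      s.1.card = min (8 * I.k / 3) I.F → I.IsLocalOpt (40 * e) (40 * (I.F + I.C) * e + 1) s →
      I.WithinFactor id (3 + ε) s.2 := by
    intro I s hs hopt O ψ hO hψ
    refine (hopt.cost_le he1 hs hO hψ).trans ?_
    exact mul_le_mul_of_nonneg_right (by linarith) (I.cost_nonneg ψ)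
  obtain ⟨a, ha⟩ := CapMedian.exec_searchProg (40 * e) (40 * e)
  refine ⟨40 * e, by omega, by omega, factor, CapMedian.searchProg (40 * e) (40 * e), a,
    fun I hI => ?_⟩
  obtain ⟨t, τ, s, h1, h2, h3, h4⟩ := ha I hI
  rw [show 40 * e * (I.F + I.C) + 1 = 40 * (I.F + I.C) * e + 1 by ring] at h4
  refine ⟨t, τ, s, h1, h2.trans (Nat.mul_le_mul_left _ (Nat.pow_le_pow_right ?_ (by omega))), h3, h4,
    ?_, ?_, ?_⟩
  · have := I.add_four_le_size
    omega
  · obtain ⟨-, -, -, h5⟩ := h4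
    exact h5.1.1
  · have := h4.card_eq
    omega
  · have h5 := h4.card_eq
    obtain ⟨-, -, -, h6⟩ := h4
    intro O ψ hO hψ
    have h7 := factor I.toReal s h5 h6.toReal O ψ hO hψ
    have key : ∀ {a b a' b' : ℝ}, a' = a → b' = b → a' ≤ (3 + ε) * b' → a ≤ (3 + ε) * b := by
      rintro a b _ _ rfl rfl h
      exact h
    exact key (I.cost_toReal s.2) (I.cost_toReal ψ) h7
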